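/- Let $n\ge 2$ and let $(M,J,\omega)$ be a compact Hermitian manifold of complex dimension $n$ with smooth boundary $\partial M$, $\bar M=M\cup\partial M$; here $J$ is integrable, $g$ denotes the $J$-invariant Riemannian metric with $\omega(X,Y)=g(JX,Y)$, and $J$, $g$ are smooth up to the boundary. Let $\chi$ be a smooth real $(1,1)$-form on $\bar M$ and write $\mathfrak g[u]=\chi+\sqrt{-1}\,\partial\bar\partial u$; $\lambda(\mathfrak g[u])\in\mathbb R^n$ denotes its eigenvalues with respect to $\omega$. Let $\Gamma\subset\mathbb R^n$ be an open symmetric convex cone with vertex at the origin, $\partial\Gamma\ne\emptyset$, containing $\Gamma_n=\{\lambda:\lambda_i>0\ \forall i\}$, and let $f$ be a smooth symmetric function on $\Gamma$ such that 1. $\partial f/\partial\lambda_i>0$ in $\Gamma$ for $1\le i\le n$, and $f$ is concave in $\Gamma$; 2. $\lim_{t\to+\infty}f(t\lambda)>\sigma$ for every $\sigma<\sup_\Gamma f$ and every $\lambda\in\Gamma$; 3. $\lim_{t\to+\infty}f(\lambda_1,\dots,\lambda_{n-1},\lambda_n+t)=\sup_\Gamma f$ for every $\lambda\in\Gamma$.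 Put $\sup_{\partial\Gamma}f=\sup_{\lambda_0\in\partial\Gamma}\limsup_{\lambda\to\lambda_0}f(\lambda)$ and $\delta_{\psi,f}=\inf_M\psi-\sup_{\partial\Gamma}f\in[-\infty,+\infty]$ (with $(+\infty)^{-1}=0$). Let $\varphi\in C^\infty(\bar M)$ (only $\varphi|_{\partial M}$ matters). Then for every $K$ there is a constant $C>0$, depending only on $K$ and on the data $(M,J,\omega)$, $\chi$, $\Gamma$, $f$, $\varphi$, with the following property. Let $\psi\in C^0(\bar M)$, $\underline u\in C^2(\bar M)$ and $u\in C^3(\bar M)$ be such that * $\delta_{\psi,f}>0$; * $\lambda(\mathfrak g[\underline u])\in\Gamma$ and $f(\lambda(\mathfrak g[\underline u]))\ge\psi$ in $\bar M$, and $\underline u=\varphi$ on $\partial M$; * $\lambda(\mathfrak g[u])\in\Gamma$ and $f(\lambda(\mathfrak g[u]))=\psi$ in $M$, and $u=\varphi$ on $\partial M$; * $(\delta_{\psi,f})^{-1}$, $|\psi|_{C^0(\bar M)}$, $|u|_{C^0(M)}$, $|\nabla u|_{C^0(\partial M)}$ and $|\underline u|_{C^2(\bar M)}$ are all at most $K$.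 Let $x_0\in\partial M$, let $\nu$ be the unit inner normal at $x_0$, $\xi_n=\frac1{\sqrt2}(\nu-\sqrt{-1}J\nu)$, and let $\xi_1,\dots,\xi_{n-1}\in T^{1,0}_{\bar M,x_0}\cap T^{\mathbb C}_{\partial M,x_0}$ satisfy $g(\xi_\alpha,\bar\xi_\beta)=\delta_{\alpha\beta}$ ($g$, $J$ and forms being extended complex linearly in each argument). Then, with $\mathfrak g=\mathfrak g[u]$, $$\mathfrak g(\xi_n,J\bar\xi_n)(x_0)\le C\Big(1+\sum_{\alpha=1}^{n-1}|\mathfrak g(\xi_\alpha,J\bar\xi_n)(x_0)|^2\Big).$$ In particular $C$ does not depend on $\sup_M|\nabla u|$. -/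

import Mathlib

open Set Filter Topology
open scoped Manifold ContDiff

noncomputable section

/-! ### Symmetric cones and symmetric functions of eigenvalues -/

/-- `Γ ⊂ ℝⁿ` is an open symmetric convex cone with vertex at the origin, containing the positive
cone, and with non-empty boundary. -/
structure IsSymmetricCone {n : ℕ} (Γ : Set (Fin n → ℝ)) : Prop where
  isOpen : IsOpen Γ
  convex : Convex ℝ Γ
  symmetric : ∀ (σ : Equiv.Perm (Fin n)) (l : Fin n → ℝ), l ∈ Γ → l ∘ σ ∈ Γ
  cone : ∀ (t : ℝ) (l : Fin n → ℝ), 0 < t → l ∈ Γ → t • l ∈ Γ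
  positive_subset : {l : Fin n → ℝ | ∀ i, 0 < l i} ⊆ Γ
  boundary_nonempty : (frontier Γ).Nonempty

/-- `sup_Γ f`, as an extended real number. -/
def supOn {n : ℕ} (f : (Fin n → ℝ) → ℝ) (Γ : Set (Fin n → ℝ)) : EReal :=
  ⨆ l ∈ Γ, (f l : EReal)

/-- `sup_{∂Γ} f`, the supremum over `l₀ ∈ ∂Γ` of `limsup f(l)` as `l → l₀` in `Γ`. -/
def supBoundary {n : ℕ} (f : (Fin n → ℝ) → ℝ) (Γ : Set (Fin n → ℝ)) : EReal :=
  ⨆ l₀ ∈ frontier Γ, limsup (fun l => (f l : EReal)) (𝓝[Γ] l₀)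

/-- `f` is a smooth symmetric function on `Γ`. -/
structure IsSmoothSymmetricOn {n : ℕ} (f : (Fin n → ℝ) → ℝ) (Γ : Set (Fin n → ℝ)) : Prop where
  smooth : ContDiffOn ℝ ∞ f Γ
  symmetric : ∀ (σ : Equiv.Perm (Fin n)), ∀ l ∈ Γ, f (l ∘ σ) = f l

/-- Ellipticity: `∂f/∂λᵢ > 0` in `Γ` for every `i`. -/
def IsEllipticOn {n : ℕ} (f : (Fin n → ℝ) → ℝ) (Γ : Set (Fin n → ℝ)) : Prop :=
  ∀ l ∈ Γ, ∀ i : Fin n, 0 < fderiv ℝ f l (Pi.single i 1)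

/-- For every `σ < sup_Γ f` and every `l ∈ Γ`, `lim_{t → +∞} f(t l) > σ`
(the limit is taken in `[-∞, +∞]`). -/
def RayCondition {n : ℕ} (f : (Fin n → ℝ) → ℝ) (Γ : Set (Fin n → ℝ)) : Prop :=
  ∀ σ : ℝ, (σ : EReal) < supOn f Γ → ∀ l ∈ Γ, ∃ L : EReal,
    Tendsto (fun t : ℝ => (f (t • l) : EReal)) atTop (𝓝 L) ∧ (σ : EReal) < L

/-- The unbounded condition: `lim_{t → +∞} f(λ₁, …, λₙ₋₁, λₙ + t) = sup_Γ f` for every `λ ∈ Γ`.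
As `f` is symmetric, the coordinate to which `t` is added does not matter. -/
def UnboundedCondition {n : ℕ} (f : (Fin n → ℝ) → ℝ) (Γ : Set (Fin n → ℝ)) : Prop :=
  ∀ l ∈ Γ, ∀ i : Fin n,
    Tendsto (fun t : ℝ => (f (l + Pi.single i t) : EReal)) atTop (𝓝 (supOn f Γ))

/-- `δ_{ψ,f} = inf_M ψ - sup_{∂Γ} f`, an extended real number (it is `+∞` when
`sup_{∂Γ} f = -∞`). -/
def nondegeneracy {M : Type*} {n : ℕ} (ψ : M → ℝ) (f : (Fin n → ℝ) → ℝ)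
    (Γ : Set (Fin n → ℝ)) : EReal :=
  (⨅ x, (ψ x : EReal)) - supBoundary f Γ

/-! ### Hermitian manifolds with boundary

The underlying real manifold has dimension `2 * n` and is modelled on the Euclidean half-space. -/

section Manifold

variable {n : ℕ} [NeZero n] {M : Type*} [TopologicalSpace M]
  [ChartedSpace (EuclideanHalfSpace (2 * n)) M]

/-- A smooth Hermitian structure `(J, ω)` on a manifold with boundary of real dimension `2 * n`:
a smooth integrable complex structure `J` on the tangent bundle (its Nijenhuis tensor
vanishes) and a smooth Riemannian metric `g` invariant under `J`. The Kähler form is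
`ω(X, Y) = g(J X, Y)`. -/
structure HermitianStructure (n : ℕ) [NeZero n] (M : Type*) [TopologicalSpace M]
    [ChartedSpace (EuclideanHalfSpace (2 * n)) M] [IsManifold (𝓡∂ (2 * n)) ∞ M] where
  metric : Bundle.ContMDiffRiemannianMetric (𝓡∂ (2 * n)) ∞ (EuclideanSpace ℝ (Fin (2 * n)))
    (fun x : M => TangentSpace (𝓡∂ (2 * n)) x)
  J : ∀ x : M, TangentSpace (𝓡∂ (2 * n)) x →L[ℝ] TangentSpace (𝓡∂ (2 * n)) x
  J_smooth : ContMDiff (𝓡∂ (2 * n))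
    ((𝓡∂ (2 * n)).prod
      𝓘(ℝ, EuclideanSpace ℝ (Fin (2 * n)) →L[ℝ] EuclideanSpace ℝ (Fin (2 * n)))) ∞
    (fun x => Bundle.TotalSpace.mk'
      (EuclideanSpace ℝ (Fin (2 * n)) →L[ℝ] EuclideanSpace ℝ (Fin (2 * n)))
      (E := fun x : M => TangentSpace (𝓡∂ (2 * n)) x →L[ℝ] TangentSpace (𝓡∂ (2 * n)) x) x (J x))
  J_J : ∀ (x : M) (v : TangentSpace (𝓡∂ (2 * n)) x), J x (J x v) = -v
  J_integrable : ∀ X Y : ∀ x : M, TangentSpace (𝓡∂ (2 * n)) x,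
    ContMDiff (𝓡∂ (2 * n)) (𝓡∂ (2 * n)).tangent ∞
      (fun x => (⟨x, X x⟩ : TangentBundle (𝓡∂ (2 * n)) M)) →
    ContMDiff (𝓡∂ (2 * n)) (𝓡∂ (2 * n)).tangent ∞
      (fun x => (⟨x, Y x⟩ : TangentBundle (𝓡∂ (2 * n)) M)) →
    ∀ x : M,
      VectorField.mlieBracket (𝓡∂ (2 * n)) X Y x
        + J x (VectorField.mlieBracket (𝓡∂ (2 * n)) (fun p => J p (X p)) Y x)
        + J x (VectorField.mlieBracket (𝓡∂ (2 * n)) X (fun p => J p (Y p)) x)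
        - VectorField.mlieBracket (𝓡∂ (2 * n)) (fun p => J p (X p)) (fun p => J p (Y p)) x = 0
  metric_J : ∀ (x : M) (v w : TangentSpace (𝓡∂ (2 * n)) x),
    metric.inner x (J x v) (J x w) = metric.inner x v w

/-- A smooth real `(1,1)`-form: a smooth skew-symmetric form invariant under `J`. -/
structure RealOneOneForm [IsManifold (𝓡∂ (2 * n)) ∞ M] (h : HermitianStructure n M) where
  form : ∀ x : M, TangentSpace (𝓡∂ (2 * n)) x →L[ℝ] TangentSpace (𝓡∂ (2 * n)) x →L[ℝ] ℝ
  form_smooth : ContMDiff (𝓡∂ (2 * n))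
    ((𝓡∂ (2 * n)).prod 𝓘(ℝ, EuclideanSpace ℝ (Fin (2 * n)) →L[ℝ]
      EuclideanSpace ℝ (Fin (2 * n)) →L[ℝ] ℝ)) ∞
    (fun x => Bundle.TotalSpace.mk'
      (EuclideanSpace ℝ (Fin (2 * n)) →L[ℝ] EuclideanSpace ℝ (Fin (2 * n)) →L[ℝ] ℝ)
      (E := fun x : M =>
        TangentSpace (𝓡∂ (2 * n)) x →L[ℝ] TangentSpace (𝓡∂ (2 * n)) x →L[ℝ] ℝ) x (form x))
  skew : ∀ (x : M) (v w : TangentSpace (𝓡∂ (2 * n)) x), form x v w = -form x w v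
  form_J : ∀ (x : M) (v w : TangentSpace (𝓡∂ (2 * n)) x),
    form x (h.J x v) (h.J x w) = form x v w

/-! ### Calculus in the preferred chart at a point -/

/-- The components of a tangent vector at `x` in the preferred chart at `x`. -/
def coordVec (x : M) :
    TangentSpace (𝓡∂ (2 * n)) x →L[ℝ] EuclideanSpace ℝ (Fin (2 * n)) :=
  mfderiv (𝓡∂ (2 * n)) 𝓘(ℝ, EuclideanSpace ℝ (Fin (2 * n))) (extChartAt (𝓡∂ (2 * n)) x) x

/-- The coordinate vector field with constant components `a` in the preferred chart at `x₀`, at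
the point with coordinates `y`. -/
def coordField (x₀ : M) (a y : EuclideanSpace ℝ (Fin (2 * n))) :
    TangentSpace (𝓡∂ (2 * n)) ((extChartAt (𝓡∂ (2 * n)) x₀).symm y) :=
  mfderivWithin 𝓘(ℝ, EuclideanSpace ℝ (Fin (2 * n))) (𝓡∂ (2 * n))
    (extChartAt (𝓡∂ (2 * n)) x₀).symm (range (𝓡∂ (2 * n))) y a

/-- The derivative at `x` of a function `F` of the coordinates of the preferred chart at `x`, in
the direction of a tangent vector `Z` at `x`. At a boundary point it is the one-sided derivative
within the half-space. -/
def coordDeriv (x : M) (F : EuclideanSpace ℝ (Fin (2 * n)) → ℝ)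
    (Z : TangentSpace (𝓡∂ (2 * n)) x) : ℝ :=
  fderivWithin ℝ F (range (𝓡∂ (2 * n))) (extChartAt (𝓡∂ (2 * n)) x x) (coordVec x Z)

/-- The exterior derivative of a `1`-form `α`, by `dα(X, Y) = X(α(Y)) - Y(α(X))` for coordinate
vector fields `X`, `Y` with constant components. -/
def extDerivOneForm (α : ∀ x : M, TangentSpace (𝓡∂ (2 * n)) x →L[ℝ] ℝ) (x : M)
    (X Y : TangentSpace (𝓡∂ (2 * n)) x) : ℝ :=
  coordDeriv x (fun y => α _ (coordField x (coordVec x Y) y)) X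
    - coordDeriv x (fun y => α _ (coordField x (coordVec x X) y)) Y

/-- The differential of a real function. -/
def differential (u : M → ℝ) (x : M) : TangentSpace (𝓡∂ (2 * n)) x →L[ℝ] ℝ :=
  mfderiv (𝓡∂ (2 * n)) 𝓘(ℝ, ℝ) u x

section Hermitian

variable [IsManifold (𝓡∂ (2 * n)) ∞ M] (h : HermitianStructure n M)

/-- `√-1 ∂∂̄ u = ½ d(-du ∘ J)`, as a real `2`-form. -/
def ddbar (u : M → ℝ) (x : M) (X Y : TangentSpace (𝓡∂ (2 * n)) x) : ℝ :=
  (1 / 2) * extDerivOneForm (fun p => -((differential u p).comp (h.J p))) x X Y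

/-- `𝔤[u] = χ + √-1 ∂∂̄ u`. -/
def gForm (χ : RealOneOneForm h) (u : M → ℝ) (x : M)
    (X Y : TangentSpace (𝓡∂ (2 * n)) x) : ℝ :=
  χ.form x X Y + ddbar h u x X Y

/-- `l = (λ₁, …, λₙ)` is a list of the eigenvalues, with multiplicity, of the real `(1,1)`-form
`Θ` with respect to `ω` at `x`. If `Θ = √-1 Θ_{ij̄} dzⁱ ∧ dz̄ʲ` these are the eigenvalues of
`(Θ_{ij̄})` with respect to `(g_{ij̄})`. They are expressed by a unitary basis
(`e₁, …, eₙ, J e₁, …, J eₙ` is orthonormal for `g`) which diagonalizes the symmetric form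
`Θ(·, J ·)` with respect to `g = ω(·, J ·)`. -/
def IsEigenvalues (x : M)
    (Θ : TangentSpace (𝓡∂ (2 * n)) x → TangentSpace (𝓡∂ (2 * n)) x → ℝ)
    (l : Fin n → ℝ) : Prop :=
  ∃ e : Fin n → TangentSpace (𝓡∂ (2 * n)) x,
    (∀ i j, h.metric.inner x (e i) (e j) = if i = j then 1 else 0) ∧
    (∀ i j, h.metric.inner x (e i) (h.J x (e j)) = 0) ∧
    ∀ i Y, Θ (e i) (h.J x Y) = l i * h.metric.inner x (e i) Y

/-- The norm of a tangent vector. -/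
def gNorm (x : M) (v : TangentSpace (𝓡∂ (2 * n)) x) : ℝ :=
  √(h.metric.inner x v v)

/-- Every cotangent vector is represented by a tangent vector through the metric. -/
theorem exists_riesz (x : M) (α : TangentSpace (𝓡∂ (2 * n)) x →L[ℝ] ℝ) :
    ∃ G : TangentSpace (𝓡∂ (2 * n)) x, ∀ X, h.metric.inner x G X = α X := by
  have fd : FiniteDimensional ℝ (TangentSpace (𝓡∂ (2 * n)) x) :=
    inferInstanceAs (FiniteDimensional ℝ (EuclideanSpace ℝ (Fin (2 * n))))
  let L : TangentSpace (𝓡∂ (2 * n)) x →ₗ[ℝ] Module.Dual ℝ (TangentSpace (𝓡∂ (2 * n)) x) :=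
    { toFun := fun G => (h.metric.inner x G : TangentSpace (𝓡∂ (2 * n)) x →ₗ[ℝ] ℝ)
      map_add' := fun a b => by ext; simp
      map_smul' := fun a b => by ext; simp }
  have hinj : Function.Injective L := by
    rw [injective_iff_map_eq_zero]
    intro v hv
    by_contra hne
    have h1 := h.metric.pos x v hne
    have h2 : h.metric.inner x v v = 0 := by
      have := LinearMap.congr_fun hv v
      simpa [L] using this
    linarith
  have hsurj := (LinearMap.injective_iff_surjective_of_finrank_eq_finrank
    (Subspace.dual_finrank_eq (K := ℝ) (V := TangentSpace (𝓡∂ (2 * n)) x)).symm).1 hinj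
  obtain ⟨G, hG⟩ := hsurj (α : TangentSpace (𝓡∂ (2 * n)) x →ₗ[ℝ] ℝ)
  exact ⟨G, fun X => by simpa [L] using LinearMap.congr_fun hG X⟩

/-- The gradient `∇u`, characterized by `g(∇u, X) = du(X)`. -/
def metricGradient (u : M → ℝ) (x : M) : TangentSpace (𝓡∂ (2 * n)) x :=
  (exists_riesz h x (differential u x)).choose

/-- The derivative at `x` of the function `g(A, B)` along `Z`, where the tangent vectors `A`, `B`
at `x` are extended to coordinate vector fields with constant components. -/
def metricDeriv (x : M) (Z A B : TangentSpace (𝓡∂ (2 * n)) x) : ℝ :=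
  coordDeriv x (fun y => h.metric.inner _ (coordField x (coordVec x A) y)
    (coordField x (coordVec x B) y)) Z

/-- The real Hessian `∇²u` of the Levi-Civita connection,
`∇²u(X, Y) = X(Y u) - (∇_X Y) u` for coordinate vector fields with constant components, where
`(∇_X Y) u = g(∇_X Y, ∇u)` is given by the Koszul formula. -/
def realHessian (u : M → ℝ) (x : M) (X Y : TangentSpace (𝓡∂ (2 * n)) x) : ℝ :=
  coordDeriv x (fun y => differential u _ (coordField x (coordVec x Y) y)) X
    - (1 / 2) * (metricDeriv h x X Y (metricGradient h u x) + metricDeriv h x Y X (metricGradient h u x)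
        - metricDeriv h x (metricGradient h u x) X Y)

/-- `|u|_{C²(M̄)} ≤ K`: the norms of `u`, `∇u` and `∇²u` are at most `K` everywhere. -/
def C2NormLE (u : M → ℝ) (K : ℝ) : Prop :=
  ∀ x : M, |u x| ≤ K ∧ gNorm h x (metricGradient h u x) ≤ K ∧
    ∀ X Y : TangentSpace (𝓡∂ (2 * n)) x, |realHessian h u x X Y| ≤ K * gNorm h x X * gNorm h x Y

end Hermitian

/-! ### Complex tangent vectors and the boundary -/

/-- The tangent space of `∂M` at a boundary point `x`: the tangent vectors whose zeroth component
vanishes in the preferred chart, which maps `M` to the half-space `{y | 0 ≤ y₀}`. -/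
def boundaryTangent (x : M) : Set (TangentSpace (𝓡∂ (2 * n)) x) :=
  {v | (coordVec x v) 0 = 0}

/-- `ν` is the unit inner normal vector of `∂M` at the boundary point `x`. -/
structure IsUnitInnerNormal [IsManifold (𝓡∂ (2 * n)) ∞ M] (h : HermitianStructure n M) (x : M)
    (ν : TangentSpace (𝓡∂ (2 * n)) x) : Prop where
  unit : h.metric.inner x ν ν = 1
  normal : ∀ v ∈ boundaryTangent x, h.metric.inner x ν v = 0
  inner : 0 < (coordVec x ν) 0

/-- A complex tangent vector `a + √-1 b`. -/
structure CTangent (x : M) where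
  re : TangentSpace (𝓡∂ (2 * n)) x
  im : TangentSpace (𝓡∂ (2 * n)) x

/-- Complex conjugation of complex tangent vectors. -/
def CTangent.conj {x : M} (ξ : CTangent (n := n) x) : CTangent (n := n) x := ⟨ξ.re, -ξ.im⟩

/-- The complex bilinear extension of a real bilinear form. -/
def complexExt {x : M} (B : TangentSpace (𝓡∂ (2 * n)) x → TangentSpace (𝓡∂ (2 * n)) x → ℝ)
    (ξ η : CTangent (n := n) x) : ℂ :=
  ⟨B ξ.re η.re - B ξ.im η.im, B ξ.re η.im + B ξ.im η.re⟩

section Hermitian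

variable [IsManifold (𝓡∂ (2 * n)) ∞ M] (h : HermitianStructure n M)

/-- The complex linear extension of `J`. -/
def complexJ {x : M} (ξ : CTangent (n := n) x) : CTangent (n := n) x :=
  ⟨h.J x ξ.re, h.J x ξ.im⟩

/-- `ξ = a + √-1 b ∈ T^{1,0}_{∂M, x}`, the intersection of `T^{1,0}_{M̄, x}` (given by
`J ξ = √-1 ξ`, that is `J a = -b` and `J b = a`) with the complexified tangent space
of `∂M`. -/
def IsBoundaryHolomorphic {x : M} (ξ : CTangent (n := n) x) : Prop :=
  h.J x ξ.re = -ξ.im ∧ h.J x ξ.im = ξ.re ∧ ξ.re ∈ boundaryTangent x ∧ ξ.im ∈ boundaryTangent x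

/-- `ξₙ = (ν - √-1 J ν) / √2`. -/
def xiNormal {x : M} (ν : TangentSpace (𝓡∂ (2 * n)) x) : CTangent (n := n) x :=
  ⟨(√2)⁻¹ • ν, -((√2)⁻¹ • h.J x ν)⟩

/-- `u` is an admissible solution of `f(λ(𝔤[u])) = ψ` in the interior of `M`, `u = φ`
on `∂M`. -/
def IsAdmissibleSolution (χ : RealOneOneForm h) (f : (Fin n → ℝ) → ℝ) (Γ : Set (Fin n → ℝ))
    (ψ φ u : M → ℝ) : Prop :=
  (∀ x ∈ (𝓡∂ (2 * n)).interior M,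
    ∃ l, IsEigenvalues h x (gForm h χ u x) l ∧ l ∈ Γ ∧ f l = ψ x) ∧
  ∀ x ∈ (𝓡∂ (2 * n)).boundary M, u x = φ x

/-- `v` is an admissible subsolution: `f(λ(𝔤[v])) ≥ ψ` and `λ(𝔤[v]) ∈ Γ` in `M̄`, `v = φ`
on `∂M`. -/
def IsAdmissibleSubsolution (χ : RealOneOneForm h) (f : (Fin n → ℝ) → ℝ) (Γ : Set (Fin n → ℝ))
    (ψ φ v : M → ℝ) : Prop :=
  (∀ x : M, ∃ l, IsEigenvalues h x (gForm h χ v x) l ∧ l ∈ Γ ∧ ψ x ≤ f l) ∧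
  ∀ x ∈ (𝓡∂ (2 * n)).boundary M, v x = φ x

end Hermitian

end Manifold

end

/-!
The double normal component is controlled in the coordinates of one chart around each boundary
point; compactness of the boundary then yields a single constant.

**Algebra.** Let `Γ_∞ ⊆ ℝⁿ⁻¹` (`sectionCone`) be the cone of those `λ'` which become a point of
`Γ` when completed by a sufficiently large eigenvalue. Suppose that the eigenvalues `λ'` of `𝔤[u]`
on the complex tangent space of the boundary are bounded and that `λ' - ε₁ (1, …, 1)` lies in
`Γ_∞`. In a frame which diagonalizes this restriction, completing the square (`arrow_lower_bound`)
bounds `𝔤[u]` from below by the diagonal form with entries `𝔤_{nn̄} - 2 ∑ |𝔤_{αn̄}|² / ε₁` and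
`λ'_α - ε₁ / 2`. If the first entry exceeded a constant `T₀` then, by the unbounded condition made
uniform (`exists_uniform_lift`), `f` would be too large on this diagonal form, hence on the
eigenvalues of `𝔤[u]` (`IsEigenframe.le_of_diagonal_le`, from Birkhoff's theorem and the concavity
of `f`); this contradicts `f (λ(𝔤[u])) = ψ`. So `𝔤_{nn̄}` is at most `T₀` plus a multiple of the
sum of the squares of the mixed components.

**Strict positivity.** It remains to find `ε₁`. By separation (`exists_isSupporting`) this means a
positive lower bound for the traces of `𝔤[u]` along complex tangent unitary frames, with the
weights `μ` of the supporting functionals of `Γ_∞`. On the boundary `u - φ` vanishes, so such a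
trace is the corresponding trace of `𝔤[φ]` plus the derivative `η` of `u - φ` in the inner
direction times the trace `Sf` of the Levi form of the boundary. The subsolution `v`, which
satisfies `f (λ(𝔤[v])) ≥ ψ` up to the boundary, gives a lower bound `ε₀` for the trace belonging
to its own inner derivative `η'`, and `η' ≤ η` because `v ≤ u`. If the trace belonging to `η` were
tiny, `Sf` would have to be definitely negative. Extend the frame to smooth complex tangent frames
of the level sets of the boundary defining coordinate `h₀`, and consider
`w = φ + (η - ε' + ℓ (y - y₀)) h₀ + A (h₀ + τ |y - y₀|²)²`.
The linear function `ℓ` cancels the first order variation of the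
trace, and the last term, thanks to `Sf < 0`, absorbs the quadratic error; so the trace of `𝔤[w]`
remains small near `y₀`. At an interior maximum of `u - w` one has `𝔤[u] ≤ 𝔤[w]`, so the diagonal
of `𝔤[w]` in a unitary frame lies in `Γ` and `f ≥ s` there, for some `s` greater than the supremum
of `f` on `∂Γ`. Being bounded, the diagonal then keeps a distance from `∂Γ` (`exists_shift_mem`),
so that its weighted trace is not small: such maxima do not exist. On the rest of the boundary of
a small half-ball around `y₀` the last term of `w` dominates. Hence `u ≤ w` near `y₀`, and the
inner derivative of `u - φ` at `y₀` is at most `η - ε'`: a contradiction. This is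
`exists_levi_lower_bound`. All constants depend on the solution only through bounds for `|u|` and,
at the boundary, for its gradient; that is why no interior gradient bound is needed. The two steps
together are `HermitianPatch.exists_double_normal_bound`.

**Comparison.** The inequality `v ≤ u` on the components of the manifold which meet the boundary
(`le_on_connectedComponent`) follows from the strong maximum principle
`HermitianPatch.sub_eq_of_isMax`, applied to `v - u`. Since `f` is merely concave and increasing,
with no uniform ellipticity, the gain from the radial barrier comes from
`exists_strict_improvement`: a perturbation which is very positive in one complex direction and
slightly negative otherwise increases `f`, because it is a convex combination with a form to which
the unbounded condition applies.

**Charts.** `ddbar_eq` and `realHessian_eq` express `√-1 ∂∂̄ u` and the Hessian in the coordinates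
of any chart. By `chartJ_integrable` the Nijenhuis tensor vanishes in coordinates, so that `𝔤[u]`
is a Hermitian form. `exists_level` turns the bound for the nondegeneracy `δ` into a lower bound
of `ψ` by a level `s` above the supremum of `f` on `∂Γ`, and `exists_hasNormalBound_near` is the
estimate near one boundary point.
-/

noncomputable section

/-! ### Unitary frames -/

section UnitaryFrames

variable {E : Type*} [NormedAddCommGroup E] [NormedSpace ℝ E]

/-- `J` is a complex structure on the vector space `E` and `g` is a `J`-invariant inner product. -/
structure IsHermitianPair (J : E →L[ℝ] E) (g : E →L[ℝ] E →L[ℝ] ℝ) : Prop where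
  J_J : ∀ a, J (J a) = -a
  symm : ∀ a b, g a b = g b a
  pos : ∀ a, a ≠ 0 → 0 < g a a
  inv : ∀ a b, g (J a) (J b) = g a b

/-- `e` is unitary for `(J, g)`: the vectors `e i` and `J (e i)` together are orthonormal. -/
def IsUnitaryFrame {k : ℕ} (J : E →L[ℝ] E) (g : E →L[ℝ] E →L[ℝ] ℝ) (e : Fin k → E) : Prop :=
  (∀ i j, g (e i) (e j) = if i = j then 1 else 0) ∧ ∀ i j, g (e i) (J (e j)) = 0

/-- A Hermitian form, encoded by its real part: a symmetric `J`-invariant bilinear form. -/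
structure IsHermitianForm (J : E →L[ℝ] E) (B : LinearMap.BilinForm ℝ E) : Prop where
  symm : ∀ a b, B a b = B b a
  inv : ∀ a b, B (J a) (J b) = B a b

/-- The squared modulus of the Hermitian product of `X` with `e`. -/
def frameWeight (J : E →L[ℝ] E) (g : E →L[ℝ] E →L[ℝ] ℝ) (X e : E) : ℝ :=
  g X e ^ 2 + g X (J e) ^ 2

/-- `l` lists the eigenvalues of the form `B` with respect to `g`, realised by the unitary
frame `e`. -/
def IsEigenframe {k : ℕ} (J : E →L[ℝ] E) (g : E →L[ℝ] E →L[ℝ] ℝ) (B : LinearMap.BilinForm ℝ E)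
    (e : Fin k → E) (l : Fin k → ℝ) : Prop :=
  IsUnitaryFrame J g e ∧ ∀ i Y, B (e i) Y = l i * g (e i) Y

variable {J : E →L[ℝ] E} {g : E →L[ℝ] E →L[ℝ] ℝ}

namespace IsHermitianPair

theorem apply_J_left (hJ : IsHermitianPair J g) (a b : E) : g (J a) b = -g a (J b) := by
  have := hJ.inv a (J b)
  rw [hJ.J_J, map_neg] at this
  linarith

theorem self_J (hJ : IsHermitianPair J g) (a : E) : g a (J a) = 0 := by
  have h1 := hJ.apply_J_left a a
  have h2 := hJ.symm (J a) a
  linarith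

theorem nonneg (hJ : IsHermitianPair J g) (a : E) : 0 ≤ g a a := by
  by_cases h : a = 0
  · simp [h]
  · exact (hJ.pos a h).le

theorem frameWeight_comm (hJ : IsHermitianPair J g) (a b : E) :
    frameWeight J g a b = frameWeight J g b a := by
  unfold frameWeight
  rw [hJ.symm b a, hJ.symm b (J a), hJ.apply_J_left]
  ring

end IsHermitianPair

theorem frameWeight_nonneg (a b : E) : 0 ≤ frameWeight J g a b := by
  unfold frameWeight; positivity

namespace IsUnitaryFrame

variable {k : ℕ} {e : Fin k → E}

/-- The real family `e, J e` attached to a unitary frame. -/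
def realFamily (J : E →L[ℝ] E) (e : Fin k → E) : Fin k ⊕ Fin k → E :=
  Sum.elim e fun i => J (e i)

theorem gram (hJ : IsHermitianPair J g) (he : IsUnitaryFrame J g e) (a b : Fin k ⊕ Fin k) :
    g (realFamily J e a) (realFamily J e b) = if a = b then 1 else 0 := by
  rcases a with a | a <;> rcases b with b | b
  · simp [realFamily, he.1]
  · simp [realFamily, he.2]
  · simp [realFamily, hJ.apply_J_left, he.2]
  · simp [realFamily, hJ.inv, he.1]

theorem coeff_eq (hJ : IsHermitianPair J g) (he : IsUnitaryFrame J g e) (c : Fin k ⊕ Fin k → ℝ)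
    (b : Fin k ⊕ Fin k) : g (∑ a, c a • realFamily J e a) (realFamily J e b) = c b := by
  rw [map_sum, sum_apply, Finset.sum_eq_single b]
  · simp [gram hJ he]
  · intro a _ hab
    simp [gram hJ he, hab]
  · simp

theorem linearIndependent (hJ : IsHermitianPair J g) (he : IsUnitaryFrame J g e) :
    LinearIndependent ℝ (realFamily J e) := by
  rw [Fintype.linearIndependent_iff]
  intro c hc b
  rw [← coeff_eq hJ he c b, hc]
  simp

/-- A unitary frame of `n` vectors in real dimension `2 n` is complete. -/
theorem expansion [FiniteDimensional ℝ E] (hJ : IsHermitianPair J g) (he : IsUnitaryFrame J g e)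
    (hk : Module.finrank ℝ E = 2 * k) (X : E) :
    X = ∑ i, (g X (e i) • e i + g X (J (e i)) • J (e i)) := by
  have hcard : Fintype.card (Fin k ⊕ Fin k) = Module.finrank ℝ E := by
    simp [hk]; ring
  have hspan := (linearIndependent hJ he).span_eq_top_of_card_eq_finrank' hcard
  have hX : X ∈ Submodule.span ℝ (Set.range (realFamily J e)) := hspan ▸ Submodule.mem_top
  obtain ⟨c, rfl⟩ := (Submodule.mem_span_range_iff_exists_fun ℝ).1 hX
  have h1 : ∀ i, g (∑ a, c a • realFamily J e a) (e i) = c (Sum.inl i) := fun i =>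
    coeff_eq hJ he c (Sum.inl i)
  have h2 : ∀ i, g (∑ a, c a • realFamily J e a) (J (e i)) = c (Sum.inr i) := fun i =>
    coeff_eq hJ he c (Sum.inr i)
  simp only [h1, h2]
  rw [Fintype.sum_sum_type, Finset.sum_add_distrib]
  rfl

theorem parseval [FiniteDimensional ℝ E] (hJ : IsHermitianPair J g) (he : IsUnitaryFrame J g e)
    (hk : Module.finrank ℝ E = 2 * k) (X : E) : g X X = ∑ i, frameWeight J g X (e i) := by
  conv_lhs => enter [2]; rw [expansion hJ he hk X]
  simp [map_sum, frameWeight, sq]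

/-- An incomplete unitary frame leaves room for a further orthogonal direction. -/
theorem exists_orthogonal [FiniteDimensional ℝ E] (J : E →L[ℝ] E) (g : E →L[ℝ] E →L[ℝ] ℝ)
    (e : Fin k → E) (hk : 2 * k < Module.finrank ℝ E) :
    ∃ X : E, X - ∑ i, (g X (e i) • e i + g X (J (e i)) • J (e i)) ≠ 0 := by
  by_contra! hcon
  have hspan : Submodule.span ℝ (Set.range (realFamily J e)) = ⊤ := by
    rw [eq_top_iff]
    intro X _
    have hX := sub_eq_zero.1 (hcon X)
    rw [hX]
    refine Submodule.sum_mem _ fun i _ => Submodule.add_mem _ ?_ ?_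
    · exact Submodule.smul_mem _ _ (Submodule.subset_span ⟨Sum.inl i, rfl⟩)
    · exact Submodule.smul_mem _ _ (Submodule.subset_span ⟨Sum.inr i, rfl⟩)
  have h1 := finrank_range_le_card (R := ℝ) (realFamily J e)
  rw [Set.finrank, hspan, finrank_top] at h1
  simp at h1
  omega

/-- The Gram–Schmidt residual of `X` is orthogonal to the frame. -/
theorem residual_orthogonal (hJ : IsHermitianPair J g) (he : IsUnitaryFrame J g e) (X : E)
    (j : Fin k) :
    g (X - ∑ i, (g X (e i) • e i + g X (J (e i)) • J (e i))) (e j) = 0 ∧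
    g (X - ∑ i, (g X (e i) • e i + g X (J (e i)) • J (e i))) (J (e j)) = 0 := by
  constructor
  · simp [map_sum, he.1, hJ.apply_J_left, he.2]
  · simp [map_sum, he.1, hJ.inv, he.2]

/-- Appending a unit vector orthogonal to a unitary frame and to its image under `J`. -/
theorem snoc (hJ : IsHermitianPair J g) (he : IsUnitaryFrame J g e) {X : E} (hX : g X X = 1)
    (h1 : ∀ j, g X (e j) = 0) (h2 : ∀ j, g X (J (e j)) = 0) :
    IsUnitaryFrame J g (Fin.snoc e X : Fin (k + 1) → E) := by
  have h1' : ∀ j, g (e j) X = 0 := fun j => by rw [hJ.symm]; exact h1 j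
  have h2' : ∀ j, g (e j) (J X) = 0 := fun j => by
    rw [hJ.symm, hJ.apply_J_left, h2, neg_zero]
  constructor
  · intro i j
    refine Fin.lastCases ?_ (fun i => ?_) i <;> refine Fin.lastCases ?_ (fun j => ?_) j
    · simp [hX]
    · simp [h1, Fin.ext_iff, (Fin.is_lt j).ne']
    · simp [h1', Fin.ext_iff, (Fin.is_lt i).ne]
    · simp [he.1]
  · intro i j
    refine Fin.lastCases ?_ (fun i => ?_) i <;> refine Fin.lastCases ?_ (fun j => ?_) j
    · simp [hJ.self_J]
    · simp [h2]
    · simp [h2']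
    · simp [he.2]

/-- Prepending a unit vector orthogonal to a unitary frame and to its image under `J`. -/
theorem cons (hJ : IsHermitianPair J g) (he : IsUnitaryFrame J g e) {X : E} (hX : g X X = 1)
    (h1 : ∀ j, g X (e j) = 0) (h2 : ∀ j, g X (J (e j)) = 0) :
    IsUnitaryFrame J g (Fin.cons X e : Fin (k + 1) → E) := by
  have h1' : ∀ j, g (e j) X = 0 := fun j => by rw [hJ.symm]; exact h1 j
  have h2' : ∀ j, g (e j) (J X) = 0 := fun j => by
    rw [hJ.symm, hJ.apply_J_left, h2, neg_zero]
  constructor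
  · intro i j
    refine Fin.cases ?_ (fun i => ?_) i <;> refine Fin.cases ?_ (fun j => ?_) j
    · simp [hX]
    · simp [h1, (Fin.succ_ne_zero j).symm]
    · simp [h1', Fin.succ_ne_zero]
    · simp [he.1]
  · intro i j
    refine Fin.cases ?_ (fun i => ?_) i <;> refine Fin.cases ?_ (fun j => ?_) j
    · simp [hJ.self_J]
    · simp [h2]
    · simp [h2']
    · simp [he.2]

theorem exists_snoc [FiniteDimensional ℝ E] (hJ : IsHermitianPair J g)
    (he : IsUnitaryFrame J g e) (hk : 2 * k < Module.finrank ℝ E) :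
    ∃ X : E, IsUnitaryFrame J g (Fin.snoc e X : Fin (k + 1) → E) := by
  obtain ⟨X, hX⟩ := exists_orthogonal J g e hk
  set W := X - ∑ i, (g X (e i) • e i + g X (J (e i)) • J (e i)) with hW
  have hpos := hJ.pos W hX
  have hs : 0 < √(g W W) := Real.sqrt_pos.2 hpos
  refine ⟨(√(g W W))⁻¹ • W, snoc hJ he ?_ (fun j => ?_) fun j => ?_⟩
  · simp only [map_smul, smul_apply, smul_eq_mul]
    field_simp
    rw [Real.sq_sqrt hpos.le]
  · simp only [map_smul, smul_apply, smul_eq_mul, mul_eq_zero]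
    right; exact (residual_orthogonal hJ he X j).1
  · simp only [map_smul, smul_apply, smul_eq_mul, mul_eq_zero]
    right; exact (residual_orthogonal hJ he X j).2

/-- Every unitary frame extends to a complete one. -/
theorem exists_extension [FiniteDimensional ℝ E] (hJ : IsHermitianPair J g) {n : ℕ}
    (hn : Module.finrank ℝ E = 2 * n) {X : E} (hX : g X X = 1) :
    ∀ k, k + 1 ≤ n → ∃ e : Fin k → E, IsUnitaryFrame J g (Fin.cons X e : Fin (k + 1) → E) := by
  intro k
  induction k with
  | zero =>
    intro _
    refine ⟨Fin.elim0, ?_⟩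
    refine cons hJ ⟨fun i => i.elim0, fun i => i.elim0⟩ hX (fun j => j.elim0) fun j => j.elim0
  | succ k ih =>
    intro hk
    obtain ⟨e, he⟩ := ih (by omega)
    obtain ⟨Y, hY⟩ := exists_snoc hJ he (by omega)
    refine ⟨Fin.snoc e Y, ?_⟩
    rwa [Fin.cons_snoc_eq_snoc_cons]

/-- The coefficient matrix between two complete unitary frames is doubly stochastic. -/
theorem doublyStochastic_weight [FiniteDimensional ℝ E] (hJ : IsHermitianPair J g)
    (he : IsUnitaryFrame J g e) {e' : Fin k → E} (he' : IsUnitaryFrame J g e')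
    (hk : Module.finrank ℝ E = 2 * k) :
    Matrix.of (fun i j => frameWeight J g (e i) (e' j)) ∈ doublyStochastic ℝ (Fin k) := by
  rw [mem_doublyStochastic_iff_sum]
  refine ⟨fun i j => frameWeight_nonneg _ _, fun i => ?_, fun j => ?_⟩
  · have := parseval hJ he' hk (e i)
    simpa [he.1] using this.symm
  · have := parseval hJ he hk (e' j)
    simp only [he'.1, if_true] at this
    simp only [Matrix.of_apply]
    rw [this]
    exact Finset.sum_congr rfl fun i _ => hJ.frameWeight_comm _ _

end IsUnitaryFrame

namespace IsEigenframe

variable {k : ℕ} {e : Fin k → E} {l : Fin k → ℝ} {B : LinearMap.BilinForm ℝ E}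

/-- Spectral decomposition of the quadratic form of a Hermitian form. -/
theorem quadratic_eq [FiniteDimensional ℝ E] (hJ : IsHermitianPair J g) (hB : IsHermitianForm J B)
    (he : IsEigenframe J g B e l) (hk : Module.finrank ℝ E = 2 * k) (X : E) :
    B X X = ∑ i, l i * frameWeight J g X (e i) := by
  have hBJ : ∀ i Y, B (J (e i)) Y = l i * g (J (e i)) Y := by
    intro i Y
    have h1 := hB.inv (J (e i)) Y
    rw [hJ.J_J] at h1
    have h2 := he.2 i (J Y)
    rw [hJ.apply_J_left, ← h1]
    simp [h2]
  have hX := he.1.expansion hJ hk X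
  calc B X X = B (∑ i, (g X (e i) • e i + g X (J (e i)) • J (e i))) X := by rw [← hX]
    _ = _ := by
      simp only [map_sum, map_add, map_smul, LinearMap.sum_apply, LinearMap.add_apply,
        LinearMap.smul_apply, smul_eq_mul, he.2, hBJ]
      refine Finset.sum_congr rfl fun i _ => ?_
      rw [hJ.symm (e i) X, hJ.symm (J (e i)) X, frameWeight]
      ring

end IsEigenframe

end UnitaryFrames

/-! ### Symmetric cones and concave functions of the eigenvalues -/

section Cones

variable {n : ℕ} {Γ : Set (Fin n → ℝ)} {f : (Fin n → ℝ) → ℝ}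

namespace IsSymmetricCone

theorem add_mem (hΓ : IsSymmetricCone Γ) {a b : Fin n → ℝ} (ha : a ∈ Γ) (hb : b ∈ Γ) :
    a + b ∈ Γ := by
  have h1 := hΓ.convex ha hb (a := 1 / 2) (b := 1 / 2) (by norm_num) (by norm_num) (by norm_num)
  have h2 := hΓ.cone 2 _ two_pos h1
  rw [smul_add, smul_smul, smul_smul] at h2
  norm_num at h2
  exact h2

theorem mem_of_le (hΓ : IsSymmetricCone Γ) {a b : Fin n → ℝ} (ha : a ∈ Γ) (hab : a ≤ b) :
    b ∈ Γ := by
  obtain ⟨ε, hε, hball⟩ := Metric.isOpen_iff.1 hΓ.isOpen a ha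
  have h1 : (fun i => a i - ε / 2) ∈ Γ := by
    apply hball
    rw [Metric.mem_ball]
    refine lt_of_le_of_lt ((dist_pi_le_iff (by positivity : (0 : ℝ) ≤ ε / 2)).2 fun i => ?_)
      (half_lt_self hε)
    rw [Real.dist_eq, show a i - ε / 2 - a i = -(ε / 2) by ring, abs_neg, abs_of_pos (half_pos hε)]
  have h2 : (fun i => b i - a i + ε / 2) ∈ Γ := hΓ.positive_subset fun i => by
    have := hab i
    linarith
  convert hΓ.add_mem h1 h2 using 1
  ext i
  simp

theorem const_mem (hΓ : IsSymmetricCone Γ) {R : ℝ} (hR : 0 < R) : (fun _ => R) ∈ Γ :=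
  hΓ.positive_subset fun _ => hR

end IsSymmetricCone

/-- The standing hypotheses on the function `f` and the cone `Γ`. -/
structure IsAdmissiblePair (f : (Fin n → ℝ) → ℝ) (Γ : Set (Fin n → ℝ)) : Prop where
  cone : IsSymmetricCone Γ
  smooth : IsSmoothSymmetricOn f Γ
  elliptic : IsEllipticOn f Γ
  concave : ConcaveOn ℝ Γ f
  unbounded : UnboundedCondition f Γ

namespace IsAdmissiblePair

theorem hasFDerivAt (h : IsAdmissiblePair f Γ) {l : Fin n → ℝ} (hl : l ∈ Γ) :
    HasFDerivAt f (fderiv ℝ f l) l :=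
  (((h.smooth.smooth l hl).contDiffAt (h.cone.isOpen.mem_nhds hl)).differentiableAt
    (by simp)).hasFDerivAt

theorem fderiv_apply (l v : Fin n → ℝ) :
    fderiv ℝ f l v = ∑ i, v i * fderiv ℝ f l (Pi.single i 1) := by
  conv_lhs => rw [pi_eq_sum_univ' v]
  simp [map_sum]

/-- `f` is nondecreasing in each eigenvalue. -/
theorem mono (h : IsAdmissiblePair f Γ) {a b : Fin n → ℝ} (ha : a ∈ Γ) (hab : a ≤ b) :
    f a ≤ f b := by
  have hb := h.cone.mem_of_le ha hab
  have hseg : ∀ t ∈ Icc (0 : ℝ) 1, a + t • (b - a) ∈ Γ := fun t ht =>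
    h.cone.mem_of_le ha fun i => by
      have h1 := hab i
      have h2 := mul_nonneg ht.1 (sub_nonneg.2 h1)
      simp only [Pi.add_apply, Pi.smul_apply, Pi.sub_apply, smul_eq_mul]
      linarith
  have hd : ∀ t ∈ Icc (0 : ℝ) 1,
      HasDerivAt (fun t : ℝ => f (a + t • (b - a))) (fderiv ℝ f (a + t • (b - a)) (b - a)) t := by
    intro t ht
    have h1 : HasDerivAt (fun t : ℝ => a + t • (b - a)) (b - a) t := by
      simpa using ((hasDerivAt_id t).smul_const (b - a)).const_add a
    exact (h.hasFDerivAt (hseg t ht)).comp_hasDerivAt t h1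
  have hmono : MonotoneOn (fun t : ℝ => f (a + t • (b - a))) (Icc 0 1) := by
    refine monotoneOn_of_deriv_nonneg (convex_Icc 0 1)
      (fun t ht => (hd t ht).continuousAt.continuousWithinAt)
      (fun t ht => (hd t (interior_subset ht)).differentiableAt.differentiableWithinAt) ?_
    intro t ht
    have ht' := interior_subset ht
    rw [(hd t ht').deriv, fderiv_apply]
    exact Finset.sum_nonneg fun i _ =>
      mul_nonneg (sub_nonneg.2 (hab i)) (h.elliptic _ (hseg t ht') i).le
  have := hmono (left_mem_Icc.2 zero_le_one) (right_mem_Icc.2 zero_le_one) zero_le_one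
  simpa using this

theorem lt_supOn [NeZero n] (h : IsAdmissiblePair f Γ) {l : Fin n → ℝ} (hl : l ∈ Γ) :
    (f l : EReal) < supOn f Γ := by
  have hpos := h.elliptic l hl 0
  have h1 : HasDerivAt (fun t : ℝ => f (l + t • Pi.single 0 1))
      (fderiv ℝ f l (Pi.single 0 1)) 0 := by
    have h2 : HasDerivAt (fun t : ℝ => l + t • (Pi.single 0 1 : Fin n → ℝ)) (Pi.single 0 1) 0 := by
      simpa using ((hasDerivAt_id (0 : ℝ)).smul_const (Pi.single 0 1 : Fin n → ℝ)).const_add l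
    have h3 := h.hasFDerivAt hl
    have h4 : HasFDerivAt f (fderiv ℝ f l) (l + (0 : ℝ) • (Pi.single 0 1 : Fin n → ℝ)) := by
      simpa using h3
    exact h4.comp_hasDerivAt 0 h2
  have h5 := (hasDerivAt_iff_tendsto_slope.1 h1).eventually (lt_mem_nhds hpos)
  have h6 := h5.filter_mono (nhdsWithin_mono (0 : ℝ) (fun t (ht : t ∈ Ioi (0 : ℝ)) => ne_of_gt ht))
  obtain ⟨t, ht, ht0⟩ := (h6.and self_mem_nhdsWithin).exists
  have ht0 : 0 < t := ht0
  rw [slope_def_field] at ht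
  have hlt : f l < f (l + t • Pi.single 0 1) := by
    simp only [sub_zero, zero_smul, add_zero] at ht
    have := (lt_div_iff₀ ht0).1 ht
    linarith
  have hmem : l + t • Pi.single 0 1 ∈ Γ := h.cone.mem_of_le hl fun i => by
    have : 0 ≤ t * (Pi.single 0 1 : Fin n → ℝ) i :=
      mul_nonneg ht0.le (by by_cases hi : i = 0 <;> simp [hi])
    simpa using this
  exact lt_of_lt_of_le (EReal.coe_lt_coe_iff.2 hlt) (
    le_iSup₂ (f := fun l _ => (f l : EReal)) _ hmem)

/-- Averaging with a doubly stochastic matrix stays in `Γ` and does not decrease `f`: by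
Birkhoff's theorem the average is a convex combination of permutations. -/
theorem mulVec_doublyStochastic (h : IsAdmissiblePair f Γ) {P : Matrix (Fin n) (Fin n) ℝ}
    (hP : P ∈ doublyStochastic ℝ (Fin n)) {l : Fin n → ℝ} (hl : l ∈ Γ) :
    P.mulVec l ∈ Γ ∧ f l ≤ f (P.mulVec l) := by
  obtain ⟨w, hw0, hw1, rfl⟩ := exists_eq_sum_perm_of_mem_doublyStochastic hP
  have heq : (∑ σ, w σ • Equiv.Perm.permMatrix ℝ σ).mulVec l = ∑ σ, w σ • (l ∘ σ) := by
    rw [Matrix.sum_mulVec]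
    refine Finset.sum_congr rfl fun σ _ => ?_
    rw [Matrix.smul_mulVec, Matrix.permMatrix_mulVec]
  rw [heq]
  have hmem : ∀ σ ∈ (Finset.univ : Finset (Equiv.Perm (Fin n))), l ∘ σ ∈ Γ := fun σ _ =>
    h.cone.symmetric σ l hl
  refine ⟨h.cone.convex.sum_mem (fun σ _ => hw0 σ) hw1 hmem, ?_⟩
  have h2 := h.concave.le_map_sum (fun σ _ => hw0 σ) hw1 hmem
  have h3 : ∑ σ, w σ • f (l ∘ σ) = f l := by
    simp_rw [h.smooth.symmetric _ l hl, ← Finset.sum_smul, hw1, one_smul]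
  linarith

/-- Bounded eigenvalues on which `f` stays above `sup_{∂Γ} f` keep a uniform distance from
`∂Γ`. -/
theorem isCompact_superlevel (h : IsAdmissiblePair f Γ) {s : ℝ}
    (hs : supBoundary f Γ < (s : EReal)) (R : ℝ) :
    IsCompact {l | l ∈ Γ ∧ (∀ i, |l i| ≤ R) ∧ s ≤ f l} := by
  set S := {l | l ∈ Γ ∧ (∀ i, |l i| ≤ R) ∧ s ≤ f l} with hS
  have hbd : Bornology.IsBounded S := by
    refine (Metric.isBounded_closedBall (x := (0 : Fin n → ℝ)) (r := max R 0)).subset ?_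
    intro l hl
    rw [mem_closedBall_zero_iff, pi_norm_le_iff_of_nonneg (le_max_right _ _)]
    exact fun i => (hl.2.1 i).trans (le_max_left _ _)
  refine Metric.isCompact_of_isClosed_isBounded ?_ hbd
  refine isClosed_of_closure_subset fun l hl => ?_
  have hne : (𝓝[S] l).NeBot := mem_closure_iff_nhdsWithin_neBot.1 hl
  have hbound : ∀ i, |l i| ≤ R := by
    have hcl : IsClosed {l : Fin n → ℝ | ∀ i, |l i| ≤ R} := by
      simp only [ofPred_forall]
      exact isClosed_iInter fun i => isClosed_le (by fun_prop) continuous_const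
    exact hcl.closure_subset_iff.2 (fun l hl => hl.2.1) hl
  by_cases hmem : l ∈ Γ
  · refine ⟨hmem, hbound, ?_⟩
    have hc : Tendsto f (𝓝[S] l) (𝓝 (f l)) :=
      (h.hasFDerivAt hmem).continuousAt.tendsto.mono_left nhdsWithin_le_nhds
    exact ge_of_tendsto hc (eventually_nhdsWithin_of_forall fun x hx => hx.2.2)
  -- near a limit point on `∂Γ` the values of `f` would drop below `s`
  · exfalso
    have hfr : l ∈ frontier Γ := by
      rw [h.cone.isOpen.frontier_eq]
      exact ⟨closure_mono (fun x hx => hx.1) hl, hmem⟩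
    have h1 : limsup (fun l => (f l : EReal)) (𝓝[Γ] l) < s :=
      lt_of_le_of_lt (le_iSup₂ (f := fun l₀ (_ : l₀ ∈ frontier Γ) =>
        limsup (fun l => (f l : EReal)) (𝓝[Γ] l₀)) l hfr) hs
    have h2 := eventually_lt_of_limsup_lt h1
    have h3 := h2.filter_mono (nhdsWithin_mono l (fun x (hx : x ∈ S) => hx.1))
    obtain ⟨x, hx1, hx2⟩ := (h3.and self_mem_nhdsWithin).exists
    exact absurd (EReal.coe_lt_coe_iff.1 hx1) (not_lt.2 hx2.2.2)

/-- Quantitative form of the compactness of the truncated superlevel sets of `f` in `Γ`. -/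
theorem exists_shift_mem (h : IsAdmissiblePair f Γ) {s : ℝ}
    (hs : supBoundary f Γ < (s : EReal)) (R : ℝ) :
    ∃ ε > 0, ∀ l ∈ Γ, (∀ i, |l i| ≤ R) → s ≤ f l → (fun i => l i - ε) ∈ Γ := by
  obtain ⟨δ, hδ, hsub⟩ := (h.isCompact_superlevel hs R).exists_cthickening_subset_open
    h.cone.isOpen (fun l hl => hl.1)
  refine ⟨δ, hδ, fun l hl hR hsl => hsub ?_⟩
  refine Metric.mem_cthickening_of_dist_le _ l _ _ ⟨hl, hR, hsl⟩ ?_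
  refine (dist_pi_le_iff hδ.le).2 fun i => ?_
  rw [Real.dist_eq, show l i - δ - l i = -δ by ring, abs_neg, abs_of_pos hδ]

end IsAdmissiblePair

end Cones

section SectionCone

variable {m : ℕ} {Γ : Set (Fin (m + 1) → ℝ)} {f : (Fin (m + 1) → ℝ) → ℝ}

/-- The cone `Γ_∞` of those `x ∈ ℝ^{n-1}` which become a point of `Γ` when completed by a
sufficiently large eigenvalue. -/
def sectionCone (Γ : Set (Fin (m + 1) → ℝ)) : Set (Fin m → ℝ) :=
  {x | ∃ R : ℝ, (Fin.cons R x : Fin (m + 1) → ℝ) ∈ Γ}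

theorem cons_le_cons {R R' : ℝ} {x y : Fin m → ℝ} (hR : R ≤ R') (hxy : x ≤ y) :
    (Fin.cons R x : Fin (m + 1) → ℝ) ≤ Fin.cons R' y := by
  intro i
  refine Fin.cases ?_ (fun i => ?_) i
  · simpa using hR
  · simpa using hxy i

theorem isOpen_sectionCone (hΓ : IsSymmetricCone Γ) : IsOpen (sectionCone Γ) := by
  have : sectionCone Γ = ⋃ R : ℝ,
      (fun x : Fin m → ℝ => (Fin.cons R x : Fin (m + 1) → ℝ)) ⁻¹' Γ := by
    ext x; simp [sectionCone]
  rw [this]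
  refine isOpen_iUnion fun R => hΓ.isOpen.preimage ?_
  refine continuous_pi fun i => ?_
  refine Fin.cases ?_ (fun i => ?_) i
  · simpa using continuous_const
  · simpa using continuous_apply i

theorem convex_sectionCone (hΓ : IsSymmetricCone Γ) : Convex ℝ (sectionCone Γ) := by
  rintro x ⟨R, hR⟩ y ⟨R', hR'⟩ a b ha hb hab
  refine ⟨a * R + b * R', ?_⟩
  convert hΓ.convex hR hR' ha hb hab using 1
  ext i
  refine Fin.cases ?_ (fun i => ?_) i <;> simp

theorem smul_mem_sectionCone (hΓ : IsSymmetricCone Γ) {t : ℝ} (ht : 0 < t) {x : Fin m → ℝ}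
    (hx : x ∈ sectionCone Γ) : t • x ∈ sectionCone Γ := by
  obtain ⟨R, hR⟩ := hx
  refine ⟨t * R, ?_⟩
  convert hΓ.cone t _ ht hR using 1
  ext i
  refine Fin.cases ?_ (fun i => ?_) i <;> simp

theorem sectionCone_mem_of_le (hΓ : IsSymmetricCone Γ) {x y : Fin m → ℝ} (hx : x ∈ sectionCone Γ)
    (hxy : x ≤ y) : y ∈ sectionCone Γ := by
  obtain ⟨R, hR⟩ := hx
  exact ⟨R, hΓ.mem_of_le hR (cons_le_cons le_rfl hxy)⟩

/-- `μ` is a normalised supporting functional of `Γ_∞` at the origin. -/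
structure IsSupporting (Γ : Set (Fin (m + 1) → ℝ)) (μ : Fin m → ℝ) : Prop where
  nonneg : ∀ i, 0 ≤ μ i
  sum_eq_one : ∑ i, μ i = 1
  le_apply : ∀ y ∈ sectionCone Γ, 0 ≤ ∑ i, μ i * y i

/-- A point outside `Γ_∞` is separated from it by a normalised supporting functional. -/
theorem exists_isSupporting (hΓ : IsSymmetricCone Γ) {x : Fin m → ℝ} (hx : x ∉ sectionCone Γ) :
    ∃ μ, IsSupporting Γ μ ∧ ∑ i, μ i * x i ≤ 0 := by
  obtain ⟨F, hF⟩ := geometric_hahn_banach_open_point (convex_sectionCone hΓ)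
    (isOpen_sectionCone hΓ) hx
  have hFsum : ∀ y : Fin m → ℝ, F y = ∑ i, y i * F (Pi.single i 1) := fun y => by
    conv_lhs => rw [pi_eq_sum_univ' y]
    simp [map_sum]
  have hle : ∀ a ∈ sectionCone Γ, F a ≤ 0 := by
    intro a ha
    by_contra! hpos
    have h1 := hF _ (smul_mem_sectionCone hΓ (t := (|F x| + 1) / F a) (by positivity) ha)
    rw [map_smul, smul_eq_mul, div_mul_cancel₀ _ hpos.ne'] at h1
    linarith [le_abs_self (F x)]
  have h1mem : (fun _ => (1 : ℝ)) ∈ sectionCone Γ := by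
    refine ⟨1, ?_⟩
    convert hΓ.const_mem one_pos using 1
    ext i
    refine Fin.cases ?_ (fun i => ?_) i <;> simp
  have hx0 : 0 ≤ F x := by
    by_contra! hneg
    have h0 := hle _ h1mem
    set y : Fin m → ℝ := fun _ => (1 : ℝ)
    have h1 := hF _ (smul_mem_sectionCone hΓ (t := -F x / (1 - F y))
      (div_pos (by linarith) (by linarith)) h1mem)
    rw [map_smul, smul_eq_mul, div_mul_eq_mul_div, div_lt_iff₀ (by linarith)] at h1
    nlinarith
  -- `Γ_∞` contains all translates of the point `(1, …, 1)` by nonnegative vectors, so the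
  -- coefficients of the functional have a sign
  have hcoef : ∀ i, F (Pi.single i 1) ≤ 0 := by
    intro i
    by_contra! hpos
    set y : Fin m → ℝ := fun _ => (1 : ℝ)
    set t := (|F y| + 1) / F (Pi.single i 1)
    have ht : 0 < t := by positivity
    have h1 : y + t • Pi.single i 1 ∈ sectionCone Γ := sectionCone_mem_of_le hΓ h1mem fun j => by
      by_cases hj : j = i
      · subst hj; simp [ht.le]
      · simp [hj]
    have h2 := hle _ h1
    rw [map_add, map_smul, smul_eq_mul, div_mul_cancel₀ _ hpos.ne'] at h2
    linarith [neg_abs_le (F y)]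
  have hsum_pos : 0 < ∑ i, -F (Pi.single i 1) := by
    refine lt_of_le_of_ne (Finset.sum_nonneg fun i _ => by linarith [hcoef i]) fun h0 => ?_
    have hz := (Finset.sum_eq_zero_iff_of_nonneg fun i _ => by linarith [hcoef i]).1 h0.symm
    have h1 := hF _ h1mem
    rw [hFsum, hFsum x] at h1
    have hz' : ∀ i, F (Pi.single i 1) = 0 := fun i => by linarith [hz i (Finset.mem_univ i)]
    simp [hz'] at h1
  set s := ∑ i, -F (Pi.single i 1)
  have hkey : ∀ y : Fin m → ℝ, ∑ i, (-F (Pi.single i 1) / s) * y i = -F y / s := by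
    intro y
    rw [hFsum y, ← Finset.sum_neg_distrib, Finset.sum_div]
    exact Finset.sum_congr rfl fun i _ => by ring
  refine ⟨fun i => -F (Pi.single i 1) / s, ⟨fun i => ?_, ?_, fun y hy => ?_⟩, ?_⟩
  · exact div_nonneg (by linarith [hcoef i]) hsum_pos.le
  · rw [← Finset.sum_div, div_self hsum_pos.ne']
  · rw [hkey]
    exact div_nonneg (by linarith [hle y hy]) hsum_pos.le
  · rw [hkey]
    exact div_nonpos_of_nonpos_of_nonneg (by linarith) hsum_pos.le

/-- The unbounded condition holds uniformly on bounded sets which keep a distance `ε` from the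
boundary of `Γ_∞`: by compactness it suffices to treat a neighbourhood of one point `x`, where a
point `y ≤ x' - ε / 2` of `Γ_∞` serves for all nearby `x'`, by monotonicity. -/
theorem IsAdmissiblePair.exists_uniform_lift (h : IsAdmissiblePair f Γ) {N : ℝ}
    (hN : (N : EReal) < supOn f Γ) (R : ℝ) {ε : ℝ} (hε : 0 < ε) :
    ∃ T : ℝ, ∀ x : Fin m → ℝ, (∀ i, |x i| ≤ R) → (fun i => x i - ε) ∈ closure (sectionCone Γ) →
      ∀ t ≥ T, (Fin.cons t (fun i => x i - ε / 2) : Fin (m + 1) → ℝ) ∈ Γ ∧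
        N < f (Fin.cons t (fun i => x i - ε / 2)) := by
  set S : Set (Fin m → ℝ) :=
    {x | (∀ i, |x i| ≤ R) ∧ (fun i => x i - ε) ∈ closure (sectionCone Γ)} with hS
  have hcomp : IsCompact S := by
    refine Metric.isCompact_of_isClosed_isBounded ?_ ?_
    · refine IsClosed.and ?_ ?_
      · simp only [ofPred_forall]
        exact isClosed_iInter fun i => isClosed_le (by fun_prop) continuous_const
      · exact isClosed_closure.preimage (by fun_prop)
    · refine (Metric.isBounded_closedBall (x := (0 : Fin m → ℝ)) (r := max R 0)).subset ?_
      intro l hl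
      rw [mem_closedBall_zero_iff, pi_norm_le_iff_of_nonneg (le_max_right _ _)]
      exact fun i => (hl.1 i).trans (le_max_left _ _)
  have key : ∃ T : ℝ, ∀ x ∈ S, ∀ t ≥ T, (Fin.cons t (fun i => x i - ε / 2) : Fin (m + 1) → ℝ) ∈ Γ ∧
        N < f (Fin.cons t (fun i => x i - ε / 2)) := by
    refine hcomp.induction_on (p := fun s => ∃ T : ℝ, ∀ x ∈ s, ∀ t ≥ T,
      (Fin.cons t (fun i => x i - ε / 2) : Fin (m + 1) → ℝ) ∈ Γ ∧
        N < f (Fin.cons t (fun i => x i - ε / 2))) ⟨0, by simp⟩ ?_ ?_ ?_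
    · rintro s t hst ⟨T, hT⟩
      exact ⟨T, fun x hx => hT x (hst hx)⟩
    · rintro s s' ⟨T, hT⟩ ⟨T', hT'⟩
      refine ⟨max T T', ?_⟩
      rintro x (hx | hx) t ht
      · exact hT x hx t ((le_max_left _ _).trans ht)
      · exact hT' x hx t ((le_max_right _ _).trans ht)
    · intro x hx
      obtain ⟨y, ⟨R₀, hy⟩, hdist⟩ := Metric.mem_closure_iff.1 hx.2 (ε / 4) (by positivity)
      have hlim := h.unbounded _ hy 0
      obtain ⟨t₀, ht₀, ht0⟩ :=
        ((hlim.eventually (lt_mem_nhds hN)).and (eventually_ge_atTop 0)).exists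
      have ht₀ : N < f (Fin.cons R₀ y + Pi.single 0 t₀) := EReal.coe_lt_coe_iff.1 ht₀
      have heq : (Fin.cons R₀ y + Pi.single 0 t₀ : Fin (m + 1) → ℝ) = Fin.cons (R₀ + t₀) y := by
        ext i
        refine Fin.cases ?_ (fun i => ?_) i <;> simp
      rw [heq] at ht₀
      have hy' : (Fin.cons (R₀ + t₀) y : Fin (m + 1) → ℝ) ∈ Γ :=
        h.cone.mem_of_le hy (cons_le_cons (by linarith) le_rfl)
      refine ⟨Metric.ball x (ε / 4) ∩ S, inter_mem (mem_nhdsWithin_of_mem_nhds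
        (Metric.ball_mem_nhds x (by positivity))) self_mem_nhdsWithin, R₀ + t₀, ?_⟩
      rintro x' ⟨hx', -⟩ t ht
      have hle : (Fin.cons (R₀ + t₀) y : Fin (m + 1) → ℝ) ≤ Fin.cons t (fun i => x' i - ε / 2) := by
        refine cons_le_cons ht fun i => ?_
        have h1 := (dist_le_pi_dist (fun i => x i - ε) y i).trans hdist.le
        have h2 := (dist_le_pi_dist x' x i).trans (Metric.mem_ball.1 hx').le
        rw [Real.dist_eq, abs_le] at h1 h2
        linarith [h1.1, h2.1]
      exact ⟨h.cone.mem_of_le hy' hle, ht₀.trans_le (h.mono hy' hle)⟩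
  obtain ⟨T, hT⟩ := key
  exact ⟨T, fun x h1 h2 => hT x ⟨h1, h2⟩⟩

end SectionCone

/-! ### Hermitian forms in unitary frames -/

section HermitianForms

variable {E : Type*} [NormedAddCommGroup E] [NormedSpace ℝ E]
  {J : E →L[ℝ] E} {g : E →L[ℝ] E →L[ℝ] ℝ} {B : LinearMap.BilinForm ℝ E}

section Comparison

variable {n : ℕ} {Γ : Set (Fin n → ℝ)} {f : (Fin n → ℝ) → ℝ} [FiniteDimensional ℝ E]

/-- Schur–Horn: the diagonal of a Hermitian form in a unitary frame lies in `Γ` if its eigenvalues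
do, and `f` of the diagonal is at least `f` of the eigenvalues. -/
theorem IsEigenframe.diagonal (hp : IsAdmissiblePair f Γ) (hJ : IsHermitianPair J g)
    (hB : IsHermitianForm J B) (hn : Module.finrank ℝ E = 2 * n) {e : Fin n → E}
    {l : Fin n → ℝ} (he : IsEigenframe J g B e l) (hl : l ∈ Γ) {e' : Fin n → E}
    (he' : IsUnitaryFrame J g e') :
    (fun i => B (e' i) (e' i)) ∈ Γ ∧ f l ≤ f fun i => B (e' i) (e' i) := by
  have h1 := hp.mulVec_doublyStochastic (he'.doublyStochastic_weight hJ he.1 hn) hl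
  have h2 : (Matrix.of fun i j => frameWeight J g (e' i) (e j)).mulVec l
      = fun i => B (e' i) (e' i) := by
    ext i
    rw [he.quadratic_eq hJ hB hn, Matrix.mulVec, dotProduct]
    exact Finset.sum_congr rfl fun j _ => by rw [Matrix.of_apply, mul_comm]
  rwa [h2] at h1

/-- A lower bound of the quadratic form which is diagonal in some unitary frame bounds `f` of the
eigenvalues from below. -/
theorem IsEigenframe.le_of_diagonal_le (hp : IsAdmissiblePair f Γ) (hJ : IsHermitianPair J g)
    (hn : Module.finrank ℝ E = 2 * n) {e : Fin n → E}
    {l : Fin n → ℝ} (he : IsEigenframe J g B e l) {e' : Fin n → E}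
    (he' : IsUnitaryFrame J g e') {d : Fin n → ℝ} (hd : d ∈ Γ)
    (hle : ∀ X, ∑ i, d i * frameWeight J g X (e' i) ≤ B X X) :
    l ∈ Γ ∧ f d ≤ f l := by
  have h1 := hp.mulVec_doublyStochastic (he.1.doublyStochastic_weight hJ he' hn) hd
  have h2 : (Matrix.of fun i j => frameWeight J g (e i) (e' j)).mulVec d ≤ l := by
    intro i
    rw [Matrix.mulVec, dotProduct]
    have h3 := hle (e i)
    rw [he.2 i, he.1.1 i i, if_pos rfl, mul_one] at h3
    refine le_trans (le_of_eq ?_) h3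
    exact Finset.sum_congr rfl fun j _ => by rw [Matrix.of_apply, mul_comm]
  exact ⟨hp.cone.mem_of_le h1.1 h2, h1.2.trans (hp.mono h1.1 h2)⟩

end Comparison

/-- The complex linear combination `∑ zⱼ eⱼ`, the imaginary unit acting as `J`. -/
def complexCombination {m : ℕ} (J : E →L[ℝ] E) (e : Fin m → E) (z : Fin m → ℂ) : E :=
  ∑ j, ((z j).re • e j + (z j).im • J (e j))

/-- The rows of `Z` are orthonormal for the standard Hermitian product of `ℂᵐ`. -/
def HasOrthonormalRows {m : ℕ} (Z : Fin m → Fin m → ℂ) : Prop :=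
  ∀ a b, ∑ j, Z a j * (starRingEnd ℂ) (Z b j) = if a = b then 1 else 0

theorem J_complexCombination (hJ : IsHermitianPair J g) {m : ℕ} (e : Fin m → E) (z : Fin m → ℂ) :
    J (complexCombination J e z) = complexCombination J e fun j => Complex.I * z j := by
  simp only [complexCombination, map_sum, map_add, map_smul, hJ.J_J]
  refine Finset.sum_congr rfl fun j _ => ?_
  simp
  abel

theorem inner_complexCombination (hJ : IsHermitianPair J g) {m : ℕ} {e : Fin m → E}
    (he : IsUnitaryFrame J g e) (z w : Fin m → ℂ) :
    g (complexCombination J e z) (complexCombination J e w)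
      = (∑ j, z j * (starRingEnd ℂ) (w j)).re := by
  simp only [complexCombination, map_sum, map_add, map_smul, sum_apply, add_apply, smul_apply,
    smul_eq_mul, he.1, he.2, hJ.inv, hJ.apply_J_left]
  simp [Finset.sum_add_distrib, mul_comm]

theorem IsUnitaryFrame.complexCombination (hJ : IsHermitianPair J g) {m : ℕ} {e : Fin m → E}
    (he : IsUnitaryFrame J g e) {Z : Fin m → Fin m → ℂ} (hZ : HasOrthonormalRows Z) :
    IsUnitaryFrame J g fun a => complexCombination J e (Z a) := by
  constructor
  · intro a b
    rw [inner_complexCombination hJ he, hZ]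
    split_ifs <;> simp
  · intro a b
    rw [J_complexCombination hJ, inner_complexCombination hJ he]
    have : ∀ j, Z a j * (starRingEnd ℂ) (Complex.I * Z b j)
        = -Complex.I * (Z a j * (starRingEnd ℂ) (Z b j)) := fun j => by
      rw [map_mul, Complex.conj_I]; ring
    rw [Finset.sum_congr rfl fun j _ => this j, ← Finset.mul_sum, hZ]
    split_ifs <;> simp

theorem complexCombination_orthogonal {m : ℕ} {e : Fin m → E} {X : E}
    (h1 : ∀ j, g X (e j) = 0) (h2 : ∀ j, g X (J (e j)) = 0) (z : Fin m → ℂ) :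
    g X (complexCombination J e z) = 0 := by
  simp [complexCombination, map_sum, h1, h2]

/-- The complex linear combinations of the tail of a unitary frame complete its head to a unitary
frame. -/
theorem IsUnitaryFrame.cons_complexCombination (hJ : IsHermitianPair J g) {m : ℕ}
    {e : Fin (m + 1) → E} (he : IsUnitaryFrame J g e) {Z : Fin m → Fin m → ℂ}
    (hZ : HasOrthonormalRows Z) :
    IsUnitaryFrame J g (Fin.cons (e 0)
      (fun a => _root_.complexCombination J (fun j => e (Fin.succ j)) (Z a)) :
        Fin (m + 1) → E) := by
  have htail : IsUnitaryFrame J g fun j : Fin m => e (Fin.succ j) :=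
    ⟨fun i j => by simpa using he.1 i.succ j.succ, fun i j => he.2 _ _⟩
  have h1 : ∀ j : Fin m, g (e 0) (e j.succ) = 0 := fun j => by
    simpa [(Fin.succ_ne_zero j).symm] using he.1 0 j.succ
  refine (htail.complexCombination hJ hZ).cons hJ
    (by simpa using he.1 0 0) (fun a => ?_) fun a => ?_
  · exact complexCombination_orthogonal h1 (fun j => he.2 _ _) _
  · rw [J_complexCombination hJ]
    exact complexCombination_orthogonal h1 (fun j => he.2 _ _) _

theorem apply_complexCombination (hJ : IsHermitianPair J g) (hB : IsHermitianForm J B) {m : ℕ}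
    (e : Fin m → E) (z w : Fin m → ℂ) :
    B (complexCombination J e z) (complexCombination J e w)
      = (∑ k, (starRingEnd ℂ) (w k) *
          ∑ j, (⟨B (e j) (e k), B (e j) (J (e k))⟩ : ℂ) * z j).re := by
  have hJB : ∀ a b, B (J a) b = -B a (J b) := fun a b => by
    have := hB.inv a (J b)
    rw [hJ.J_J, map_neg] at this
    linarith
  simp only [complexCombination, map_sum, map_add, map_smul, LinearMap.sum_apply,
    LinearMap.add_apply, LinearMap.smul_apply, smul_eq_mul, hB.inv, hJB, Complex.re_sum,
    Finset.mul_sum]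
  refine Finset.sum_congr rfl fun k _ => ?_
  rw [← Finset.sum_add_distrib]
  refine Finset.sum_congr rfl fun j _ => ?_
  simp only [Complex.mul_re, Complex.conj_re, Complex.conj_im, Complex.mul_im]
  ring

/-- Spectral theorem for the restriction of a Hermitian form to the complex span of a frame. -/
theorem exists_diagonalization (hJ : IsHermitianPair J g) (hB : IsHermitianForm J B) {m : ℕ}
    (e : Fin m → E) :
    ∃ (Z : Fin m → Fin m → ℂ) (l : Fin m → ℝ), HasOrthonormalRows Z ∧
      (∀ a b, B (complexCombination J e (Z a)) (complexCombination J e (Z b))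
        = if a = b then l a else 0) ∧
      ∀ a b, B (complexCombination J e (Z a)) (J (complexCombination J e (Z b))) = 0 := by
  have hJB : ∀ a b, B (J a) b = -B a (J b) := fun a b => by
    have := hB.inv a (J b)
    rw [hJ.J_J, map_neg] at this
    linarith
  set A : Matrix (Fin m) (Fin m) ℂ :=
    Matrix.of fun k j => (⟨B (e j) (e k), B (e j) (J (e k))⟩ : ℂ) with hAdef
  have hA : A.IsHermitian := by
    ext k j
    simp only [hAdef, Matrix.conjTranspose_apply, Matrix.of_apply]
    apply Complex.ext
    · simp [hB.symm (e k) (e j)]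
    · simp only [RCLike.star_def, Complex.conj_im]
      rw [hB.symm (e k), hJB]; ring
  set b := hA.eigenvectorBasis
  have horth : ∀ i j, ∑ k, (b i) k * (starRingEnd ℂ) ((b j) k) = if i = j then 1 else 0 := by
    intro i j
    have := orthonormal_iff_ite.1 b.orthonormal j i
    rw [PiLp.inner_apply] at this
    simp only [RCLike.inner_apply] at this
    rw [this]
    simp [eq_comm]
  have heig : ∀ i k, ∑ j, A k j * (b i) j = (hA.eigenvalues i : ℂ) * (b i) k := by
    intro i k
    have := congrFun (hA.mulVec_eigenvectorBasis i) k
    simpa [Matrix.mulVec, dotProduct] using this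
  have hval : ∀ (i j : Fin m) (c : ℂ),
      B (complexCombination J e (b i)) (complexCombination J e fun k => c * (b j) k)
        = ((starRingEnd ℂ) c * ((hA.eigenvalues i : ℂ) * if i = j then 1 else 0)).re := by
    intro i j c
    rw [apply_complexCombination hJ hB]
    congr 1
    have : ∀ k, ∑ j, (⟨B (e j) (e k), B (e j) (J (e k))⟩ : ℂ) * (b i) j
        = (hA.eigenvalues i : ℂ) * (b i) k := fun k => heig i k
    simp_rw [this, ← horth, Finset.mul_sum]
    refine Finset.sum_congr rfl fun k _ => ?_
    rw [map_mul]; ring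
  refine ⟨fun a j => (b a) j, hA.eigenvalues, horth, fun i j => ?_, fun i j => ?_⟩
  · have := hval i j 1
    simp only [one_mul, map_one] at this
    rw [this]
    split_ifs <;> simp
  · rw [J_complexCombination hJ]
    have := hval i j Complex.I
    rw [this]
    split_ifs <;> simp

/-- Completing the square: a Hermitian form which is diagonal on the complement of `e 0` is bounded
below by a diagonal form, at the cost of `ε` in the diagonal entries on the complement and of the
mixed entries, divided by `ε`, in the remaining one. -/
theorem arrow_lower_bound [FiniteDimensional ℝ E] (hJ : IsHermitianPair J g)
    (hB : IsHermitianForm J B) {m : ℕ} (hm : Module.finrank ℝ E = 2 * (m + 1)) {ν : E}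
    {T : Fin m → E} (he : IsUnitaryFrame J g (Fin.cons ν T : Fin (m + 1) → E)) {l : Fin m → ℝ}
    (h1 : ∀ a b, B (T a) (T b) = if a = b then l a else 0)
    (h2 : ∀ a b, B (T a) (J (T b)) = 0) {ε : ℝ} (hε : 0 < ε) (X : E) :
    ∑ i, (Fin.cons (B ν ν - (∑ a, (B ν (T a) ^ 2 + B ν (J (T a)) ^ 2)) / ε)
      (fun a => l a - ε) : Fin (m + 1) → ℝ) i
        * frameWeight J g X ((Fin.cons ν T : Fin (m + 1) → E) i) ≤ B X X := by
  have hJB : ∀ a b, B (J a) b = -B a (J b) := fun a b => by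
    have := hB.inv a (J b)
    rw [hJ.J_J, map_neg] at this
    linarith
  have hJν : B ν (J ν) = 0 := by
    have h1 := hJB ν ν
    rw [hB.symm] at h1
    linarith
  have hX := he.expansion hJ hm X
  rw [Fin.sum_univ_succ] at hX
  simp only [Fin.cons_zero, Fin.cons_succ] at hX
  set p := g X ν
  set p' := g X (J ν)
  set q : Fin m → ℝ := fun a => g X (T a) with hq
  set q' : Fin m → ℝ := fun a => g X (J (T a)) with hq'
  set Y := ∑ a, (q a • T a + q' a • J (T a)) with hY
  have hXY : X = p • ν + p' • J ν + Y := hX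
  have hTν : ∀ a, B (T a) ν = B ν (T a) := fun a => hB.symm _ _
  have hνY : B ν Y = ∑ a, (q a * B ν (T a) + q' a * B ν (J (T a))) := by
    simp [hY, map_sum]
  have hJνY : B (J ν) Y = ∑ a, (q' a * B ν (T a) - q a * B ν (J (T a))) := by
    simp only [hY, map_sum, map_add, map_smul, smul_eq_mul, hJB, hJ.J_J, map_neg]
    rw [← Finset.sum_neg_distrib]
    refine Finset.sum_congr rfl fun a _ => by ring
  have hYY : B Y Y = ∑ a, l a * (q a ^ 2 + q' a ^ 2) := by
    simp only [hY, map_sum, map_add, map_smul, LinearMap.sum_apply, LinearMap.add_apply,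
      LinearMap.smul_apply, smul_eq_mul, hB.inv, hJB, h1, h2]
    simp only [mul_ite, mul_zero, neg_zero, add_zero, zero_add, Finset.sum_ite_eq',
      Finset.mem_univ, if_true]
    refine Finset.sum_congr rfl fun a _ => by ring
  have hBXX : B X X = B ν ν * (p ^ 2 + p' ^ 2) + 2 * (p * B ν Y + p' * B (J ν) Y) + B Y Y := by
    rw [hXY]
    simp only [map_add, map_smul, LinearMap.add_apply, LinearMap.smul_apply, smul_eq_mul, hB.inv,
      hJν, hJB ν ν, hB.symm Y ν, hB.symm Y (J ν)]
    ring
  rw [Fin.sum_univ_succ]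
  simp only [Fin.cons_zero, Fin.cons_succ, frameWeight]
  rw [hBXX, hνY, hJνY, hYY, Finset.mul_sum, Finset.mul_sum, ← Finset.sum_add_distrib,
    Finset.mul_sum]
  have hkey : ∀ a, (l a - ε) * (q a ^ 2 + q' a ^ 2)
      - (B ν (T a) ^ 2 + B ν (J (T a)) ^ 2) / ε * (p ^ 2 + p' ^ 2) ≤
      2 * (p * (q a * B ν (T a) + q' a * B ν (J (T a))) +
        p' * (q' a * B ν (T a) - q a * B ν (J (T a)))) + l a * (q a ^ 2 + q' a ^ 2) := by
    intro a
    set s := B ν (T a)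
    set t := B ν (J (T a))
    have h3 : 0 ≤ ((ε * q a + s * p - t * p') ^ 2 + (ε * q' a + s * p' + t * p) ^ 2) / ε := by
      positivity
    have h4 : ((ε * q a + s * p - t * p') ^ 2 + (ε * q' a + s * p' + t * p) ^ 2) / ε
        = ε * (q a ^ 2 + q' a ^ 2) + (s ^ 2 + t ^ 2) / ε * (p ^ 2 + p' ^ 2)
          + 2 * (p * (q a * s + q' a * t) + p' * (q' a * s - q a * t)) := by
      field_simp
      ring
    rw [h4] at h3
    linarith
  have hsum := Finset.sum_le_sum fun a (_ : a ∈ Finset.univ) => hkey a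
  rw [Finset.sum_sub_distrib, Finset.sum_add_distrib, ← Finset.sum_mul, ← Finset.sum_div] at hsum
  simp only [hq, hq'] at hsum ⊢
  linarith

end HermitianForms

/-! ### Calculus up to the boundary of a half-space -/

section HalfSpaceCalculus

variable {E : Type*} [NormedAddCommGroup E] [NormedSpace ℝ E]
  {F : Type*} [NormedAddCommGroup F] [NormedSpace ℝ F]

/-- The closed half-space `{h₀ ≥ 0}`. -/
def halfSpace (h₀ : E →L[ℝ] ℝ) : Set E := {y | 0 ≤ h₀ y}

/-- The second derivative `D²u(y)(a, b)` within `S`, the derivative in the direction `a` of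
`Du(·) b`. -/
def secondDerivWithin (S : Set E) (u : E → ℝ) (y : E) : E →L[ℝ] E →L[ℝ] ℝ :=
  fderivWithin ℝ (fderivWithin ℝ u S) S y

variable {h₀ : E →L[ℝ] ℝ}

theorem convex_halfSpace : Convex ℝ (halfSpace h₀) := by
  intro x hx y hy a b ha hb _
  simp only [halfSpace, mem_ofPred_eq, map_add, map_smul, smul_eq_mul] at *
  positivity

theorem isClosed_halfSpace : IsClosed (halfSpace h₀) :=
  isClosed_le continuous_const h₀.continuous

theorem mem_interior_halfSpace {y : E} (hy : 0 < h₀ y) : y ∈ interior (halfSpace h₀) := by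
  rw [mem_interior]
  exact ⟨{y | 0 < h₀ y}, fun z (hz : 0 < h₀ z) => show 0 ≤ h₀ z from hz.le, isOpen_lt
    continuous_const h₀.continuous, hy⟩

theorem interior_halfSpace_nonempty (hne : ∃ v, h₀ v = 1) : (interior (halfSpace h₀)).Nonempty := by
  obtain ⟨v, hv⟩ := hne
  exact ⟨v, mem_interior_halfSpace (by rw [hv]; exact one_pos)⟩

theorem uniqueDiffOn_halfSpace (hne : ∃ v, h₀ v = 1) : UniqueDiffOn ℝ (halfSpace h₀) :=
  uniqueDiffOn_convex convex_halfSpace (interior_halfSpace_nonempty hne)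

theorem subset_closure_interior_halfSpace (hne : ∃ v, h₀ v = 1) :
    halfSpace h₀ ⊆ closure (interior (halfSpace h₀)) := by
  rw [convex_halfSpace.closure_interior_eq_closure_of_nonempty_interior
    (interior_halfSpace_nonempty hne)]
  exact subset_closure

variable {U : Set E}

theorem ContDiffOn.contDiffWithinAt_halfSpace {k : ℕ∞ω} (hU : ∀ y ∈ U, U ∈ 𝓝[halfSpace h₀] y)
    {u : E → F} (hu : ContDiffOn ℝ k u U) {y : E} (hy : y ∈ U) :
    ContDiffWithinAt ℝ k u (halfSpace h₀) y :=
  (hu y hy).mono_of_mem_nhdsWithin (hU y hy)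

theorem ContDiffOn.fderivWithin_halfSpace (hne : ∃ v, h₀ v = 1) (hsub : U ⊆ halfSpace h₀)
    (hU : ∀ y ∈ U, U ∈ 𝓝[halfSpace h₀] y) {j k : ℕ∞ω} (hjk : j + 1 ≤ k)
    {u : E → F} (hu : ContDiffOn ℝ k u U) :
    ContDiffOn ℝ j (fderivWithin ℝ u (halfSpace h₀)) U := fun _ hy =>
  ((hu.contDiffWithinAt_halfSpace hU hy).fderivWithin_right (uniqueDiffOn_halfSpace hne) hjk
    (hsub hy)).mono hsub

theorem secondDerivWithin_symm (hne : ∃ v, h₀ v = 1) (hsub : U ⊆ halfSpace h₀)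
    (hU : ∀ y ∈ U, U ∈ 𝓝[halfSpace h₀] y) {u : E → ℝ} (hu : ContDiffOn ℝ 2 u U) {y : E}
    (hy : y ∈ U) (a b : E) :
    secondDerivWithin (halfSpace h₀) u y a b = secondDerivWithin (halfSpace h₀) u y b a :=
  (hu.contDiffWithinAt_halfSpace hU hy).isSymmSndFDerivWithinAt (by simp)
    (uniqueDiffOn_halfSpace hne) (subset_closure_interior_halfSpace hne (hsub hy)) (hsub hy) a b

theorem hasFDerivWithinAt_fderivWithin (hne : ∃ v, h₀ v = 1) (hsub : U ⊆ halfSpace h₀)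
    (hU : ∀ y ∈ U, U ∈ 𝓝[halfSpace h₀] y) {u : E → ℝ} (hu : ContDiffOn ℝ 2 u U) {y : E}
    (hy : y ∈ U) :
    HasFDerivWithinAt (fderivWithin ℝ u (halfSpace h₀)) (secondDerivWithin (halfSpace h₀) u y)
      (halfSpace h₀) y :=
  (((hu.contDiffWithinAt_halfSpace hU hy).fderivWithin_right (m := 1)
    (uniqueDiffOn_halfSpace hne) (by norm_num) (hsub hy)).differentiableWithinAt
      (by simp)).hasFDerivWithinAt

theorem fderivWithin_add_of_smooth (hne : ∃ v, h₀ v = 1) (hsub : U ⊆ halfSpace h₀)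
    (hU : ∀ y ∈ U, U ∈ 𝓝[halfSpace h₀] y) {u w : E → ℝ} (hu : ContDiffOn ℝ 2 u U)
    (hw : ContDiffOn ℝ 2 w U) {y : E} (hy : y ∈ U) :
    fderivWithin ℝ (fun y => u y + w y) (halfSpace h₀) y
      = fderivWithin ℝ u (halfSpace h₀) y + fderivWithin ℝ w (halfSpace h₀) y :=
  fderivWithin_fun_add (uniqueDiffOn_halfSpace hne y (hsub hy))
    ((hu.contDiffWithinAt_halfSpace hU hy).differentiableWithinAt (by simp))
    ((hw.contDiffWithinAt_halfSpace hU hy).differentiableWithinAt (by simp))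

theorem secondDerivWithin_add (hne : ∃ v, h₀ v = 1) (hsub : U ⊆ halfSpace h₀)
    (hU : ∀ y ∈ U, U ∈ 𝓝[halfSpace h₀] y) {u w : E → ℝ} (hu : ContDiffOn ℝ 2 u U)
    (hw : ContDiffOn ℝ 2 w U) {y : E} (hy : y ∈ U) :
    secondDerivWithin (halfSpace h₀) (fun y => u y + w y) y
      = secondDerivWithin (halfSpace h₀) u y + secondDerivWithin (halfSpace h₀) w y := by
  have h1 : HasFDerivWithinAt (fderivWithin ℝ (fun y => u y + w y) (halfSpace h₀))
      (secondDerivWithin (halfSpace h₀) u y + secondDerivWithin (halfSpace h₀) w y)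
      (halfSpace h₀) y := by
    refine ((hasFDerivWithinAt_fderivWithin hne hsub hU hu hy).add
      (hasFDerivWithinAt_fderivWithin hne hsub hU hw hy)).congr_of_eventuallyEq ?_ ?_
    · filter_upwards [hU y hy] with z hz
      exact fderivWithin_add_of_smooth hne hsub hU hu hw hz
    · exact fderivWithin_add_of_smooth hne hsub hU hu hw hy
  exact h1.fderivWithin (uniqueDiffOn_halfSpace hne y (hsub hy))

theorem fderivWithin_neg_of_smooth (hne : ∃ v, h₀ v = 1) (hsub : U ⊆ halfSpace h₀)
    {u : E → ℝ} {y : E} (hy : y ∈ U) :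
    fderivWithin ℝ (fun y => -u y) (halfSpace h₀) y = -fderivWithin ℝ u (halfSpace h₀) y :=
  fderivWithin_fun_neg (uniqueDiffOn_halfSpace hne y (hsub hy))

theorem secondDerivWithin_neg (hne : ∃ v, h₀ v = 1) (hsub : U ⊆ halfSpace h₀)
    {u : E → ℝ} {y : E} (hy : y ∈ U) :
    secondDerivWithin (halfSpace h₀) (fun y => -u y) y
      = -secondDerivWithin (halfSpace h₀) u y := by
  unfold secondDerivWithin
  rw [← fderivWithin_fun_neg (uniqueDiffOn_halfSpace hne y (hsub hy))]
  refine fderivWithin_congr (fun z hz => ?_) ?_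
  · exact fderivWithin_fun_neg (uniqueDiffOn_halfSpace hne z hz)
  · exact fderivWithin_fun_neg (uniqueDiffOn_halfSpace hne y (hsub hy))

/-- First and second order conditions at an interior local maximum. -/
theorem IsLocalMax.fderivWithin_conditions (hne : ∃ v, h₀ v = 1) (hsub : U ⊆ halfSpace h₀)
    (hU : ∀ y ∈ U, U ∈ 𝓝[halfSpace h₀] y) {u : E → ℝ} (hu : ContDiffOn ℝ 2 u U) {y : E}
    (hy : y ∈ U) (hpos : 0 < h₀ y) (hmax : IsLocalMax u y) :
    fderivWithin ℝ u (halfSpace h₀) y = 0 ∧ ∀ a, secondDerivWithin (halfSpace h₀) u y a a ≤ 0 := by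
  have hSn : ∀ᶠ z in 𝓝 y, 0 < h₀ z := (isOpen_lt continuous_const h₀.continuous).mem_nhds hpos
  have hnhds : ∀ z, 0 < h₀ z → halfSpace h₀ ∈ 𝓝 z := fun z hz =>
    mem_interior_iff_mem_nhds.1 (mem_interior_halfSpace hz)
  have hUn : U ∈ 𝓝 y := by
    have := hU y hy
    rwa [nhdsWithin_eq_nhds.2 (hnhds y hpos)] at this
  have hfd : ∀ z, 0 < h₀ z → fderivWithin ℝ u (halfSpace h₀) z = fderiv ℝ u z := fun z hz =>
    fderivWithin_of_mem_nhds (hnhds z hz)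
  have hd1 : ∀ᶠ z in 𝓝 y, HasFDerivAt u (fderivWithin ℝ u (halfSpace h₀) z) z := by
    filter_upwards [hSn, eventually_mem_nhds_iff.2 hUn] with z hz hzU
    rw [hfd z hz]
    exact (((hu z (mem_of_mem_nhds hzU)).contDiffAt hzU).differentiableAt (by simp)).hasFDerivAt
  have hd2 : HasFDerivAt (fderivWithin ℝ u (halfSpace h₀))
      (secondDerivWithin (halfSpace h₀) u y) y :=
    (hasFDerivWithinAt_fderivWithin hne hsub hU hu hy).hasFDerivAt (hnhds y hpos)
  have hzero : fderivWithin ℝ u (halfSpace h₀) y = 0 := hmax.hasFDerivAt_eq_zero hd1.self_of_nhds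
  refine ⟨hzero, fun a => ?_⟩
  by_contra! hcon
  set γ : ℝ → E := fun t => y + t • a with hγ
  have hγ0 : γ 0 = y := by simp [hγ]
  have hγc : Continuous γ := by fun_prop
  have hγd : ∀ t, HasDerivAt γ a t := fun t =>
    (show HasDerivAt (fun t : ℝ => t • a) a t by
      simpa using (hasDerivAt_id t).smul_const a).const_add y
  have hγt : Tendsto γ (𝓝 0) (𝓝 y) := by simpa [hγ0] using hγc.tendsto 0
  have hder : (deriv fun t => u (γ t)) =ᶠ[𝓝 0]
      fun t => fderivWithin ℝ u (halfSpace h₀) (γ t) a := by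
    filter_upwards [hγt.eventually hd1] with t ht
    exact (ht.comp_hasDerivAt t (hγd t)).deriv
  have hderder : deriv (deriv fun t => u (γ t)) 0 = secondDerivWithin (halfSpace h₀) u y a a := by
    rw [hder.deriv_eq]
    have h1 : HasFDerivAt (fderivWithin ℝ u (halfSpace h₀))
        (secondDerivWithin (halfSpace h₀) u y) (γ 0) := by rw [hγ0]; exact hd2
    have h2 := h1.comp_hasDerivAt 0 (hγd 0)
    exact (h2.clm_apply (hasDerivAt_const (0 : ℝ) a)).deriv.trans (by simp)
  have hlmax : IsLocalMax (fun t => u (γ t)) 0 := by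
    have := hγt.eventually hmax
    simpa [IsLocalMax, IsMaxFilter, hγ0] using this
  have hlmin : IsLocalMin (fun t => u (γ t)) 0 := by
    refine isLocalMin_of_deriv_deriv_pos (by rw [hderder]; exact hcon) hlmax.deriv_eq_zero ?_
    have h1 : HasFDerivAt u (fderivWithin ℝ u (halfSpace h₀) (γ 0)) (γ 0) := by
      rw [hγ0]; exact hd1.self_of_nhds
    exact (h1.comp_hasDerivAt 0 (hγd 0)).continuousAt
  have hconst : (fun t => u (γ t)) =ᶠ[𝓝 0] fun _ => u (γ 0) := by
    filter_upwards [hlmax, hlmin] with t h1 h2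
    exact le_antisymm h1 h2
  have h3 : (deriv fun t => u (γ t)) =ᶠ[𝓝 0] fun _ => 0 := by
    filter_upwards [hconst.eventuallyEq_nhds] with t ht
    rw [ht.deriv_eq]; simp
  rw [h3.deriv_eq] at hderder
  simp at hderder
  linarith

/-- A function vanishing along a line inside `S` has vanishing derivative within `S` along it. -/
theorem HasFDerivWithinAt.apply_eq_zero_of_line {S : Set E} {G : E → F} {G' : E →L[ℝ] F} {y T : E}
    (hG : HasFDerivWithinAt G G' S y)
    (hline : ∀ᶠ t : ℝ in 𝓝 0, y + t • T ∈ S ∧ G (y + t • T) = 0) : G' T = 0 := by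
  set s : Set ℝ := {t | y + t • T ∈ S ∧ G (y + t • T) = 0} with hs
  have hγ : HasDerivWithinAt (fun t : ℝ => y + t • T) T s 0 := by
    simpa using (((hasDerivAt_id (0 : ℝ)).smul_const T).const_add y).hasDerivWithinAt
  have hG' : HasFDerivWithinAt G G' S (y + (0 : ℝ) • T) := by simpa using hG
  have h1 := (hG'.comp_hasDerivWithinAt 0 hγ fun t ht => ht.1).hasDerivAt hline
  have h2 : (G ∘ fun t : ℝ => y + t • T) =ᶠ[𝓝 0] fun _ => 0 := by
    filter_upwards [hline] with t ht using ht.2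
  exact h1.unique ((hasDerivAt_const (0 : ℝ) (0 : F)).congr_of_eventuallyEq h2)

/-- First and second derivatives at a boundary point of a function vanishing on the boundary. -/
theorem boundary_derivatives (hne : ∃ v, h₀ v = 1) (hsub : U ⊆ halfSpace h₀)
    (hU : ∀ y ∈ U, U ∈ 𝓝[halfSpace h₀] y) {u : E → ℝ} (hu : ContDiffOn ℝ 2 u U)
    (hzero : ∀ y ∈ U, h₀ y = 0 → u y = 0) {y : E} (hy : y ∈ U) (hy0 : h₀ y = 0) {a : E}
    (ha : h₀ a = 0) :
    fderivWithin ℝ u (halfSpace h₀) y a = 0 ∧ secondDerivWithin (halfSpace h₀) u y a a = 0 := by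
  have hline : ∀ z ∈ U, h₀ z = 0 → ∀ᶠ t : ℝ in 𝓝 0, z + t • a ∈ U ∧ h₀ (z + t • a) = 0 := by
    intro z hz hz0
    have h1 : Tendsto (fun t : ℝ => z + t • a) (𝓝 0) (𝓝[halfSpace h₀] z) := by
      refine tendsto_nhdsWithin_iff.2 ⟨?_, Eventually.of_forall fun t => ?_⟩
      · have : Continuous fun t : ℝ => z + t • a := by fun_prop
        simpa using this.tendsto 0
      · simp [halfSpace, ha, hz0]
    filter_upwards [h1 (hU z hz)] with t ht
    exact ⟨ht, by simp [ha, hz0]⟩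
  have hfirst : ∀ z ∈ U, h₀ z = 0 → fderivWithin ℝ u (halfSpace h₀) z a = 0 := by
    intro z hz hz0
    refine ((hu.contDiffWithinAt_halfSpace hU hz).differentiableWithinAt
      (by simp)).hasFDerivWithinAt.apply_eq_zero_of_line ?_
    filter_upwards [hline z hz hz0] with t ht
    exact ⟨hsub ht.1, hzero _ ht.1 ht.2⟩
  refine ⟨hfirst y hy hy0, ?_⟩
  have h2 : HasFDerivWithinAt (fun z => fderivWithin ℝ u (halfSpace h₀) z a)
      ((ContinuousLinearMap.apply ℝ ℝ a).comp (secondDerivWithin (halfSpace h₀) u y))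
      (halfSpace h₀) y :=
    (ContinuousLinearMap.apply ℝ ℝ a).hasFDerivAt.comp_hasFDerivWithinAt y
      (hasFDerivWithinAt_fderivWithin hne hsub hU hu hy)
  have h3 := h2.apply_eq_zero_of_line (T := a) (by
    filter_upwards [hline y hy hy0] with t ht
    exact ⟨hsub ht.1, hfirst _ ht.1 ht.2⟩)
  simpa using h3

/-- Taylor's formula of order one with a uniform quadratic error on a compact convex set. -/
theorem exists_uniform_taylor {K : Set E} (hK : IsCompact K) (hconv : Convex ℝ K)
    (hint : (interior K).Nonempty) {G : E → ℝ} (hG : ContDiffOn ℝ 2 G K) :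
    ∃ C : ℝ, 0 ≤ C ∧ ∀ x ∈ K, ∃ L : E →L[ℝ] ℝ, ‖L‖ ≤ C ∧
      ∀ y ∈ K, |G y - G x - L (y - x)| ≤ C * ‖y - x‖ ^ 2 := by
  have huniq := uniqueDiffOn_convex hconv hint
  have hG1 : ContDiffOn ℝ 1 (fderivWithin ℝ G K) K := hG.fderivWithin huniq (by norm_num)
  have hG2 : ContinuousOn (fderivWithin ℝ (fderivWithin ℝ G K) K) K :=
    hG1.continuousOn_fderivWithin huniq le_rfl
  obtain ⟨C₁, hC₁⟩ := hK.exists_bound_of_continuousOn hG1.continuousOn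
  obtain ⟨C₂, hC₂⟩ := hK.exists_bound_of_continuousOn (E := E →L[ℝ] E →L[ℝ] ℝ) hG2
  refine ⟨max (max C₁ C₂) 0, le_max_right _ _, fun x hx => ⟨fderivWithin ℝ G K x,
    (hC₁ x hx).trans ((le_max_left _ _).trans (le_max_left _ _)), fun y hy => ?_⟩⟩
  set C := max (max C₁ C₂) 0
  have hC0 : 0 ≤ C := le_max_right _ _
  have hlip : ∀ z ∈ K, ‖fderivWithin ℝ G K z - fderivWithin ℝ G K x‖ ≤ C * ‖z - x‖ := fun z hz =>
    hconv.norm_image_sub_le_of_norm_fderivWithin_le (𝕜 := ℝ)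
      (hG1.differentiableOn (by simp))
      (fun w hw => (hC₂ w hw).trans ((le_max_right C₁ C₂).trans (le_max_left _ 0))) hx hz
  have hseg : segment ℝ x y ⊆ K := hconv.segment_subset hx hy
  have h1 := (convex_segment x y).norm_image_sub_le_of_norm_hasFDerivWithin_le' (𝕜 := ℝ)
    (f := G) (f' := fun z => fderivWithin ℝ G K z) (φ := fderivWithin ℝ G K x) (C := C * ‖y - x‖)
    (fun z hz => ((hG.differentiableOn (by simp)) z (hseg hz)).hasFDerivWithinAt.mono hseg)
    (fun z hz => (hlip z (hseg hz)).trans (mul_le_mul_of_nonneg_left ?_ hC0))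
    (left_mem_segment ℝ x y) (right_mem_segment ℝ x y)
  · rw [Real.norm_eq_abs] at h1
    calc _ ≤ C * ‖y - x‖ * ‖y - x‖ := h1
      _ = _ := by ring
  · obtain ⟨a, b, ha, hb, hab, rfl⟩ := hz
    have : a • x + b • y - x = b • (y - x) := by
      rw [show a = 1 - b by linarith, sub_smul, smul_sub, one_smul]; abel
    rw [this, norm_smul, Real.norm_of_nonneg hb]
    exact mul_le_of_le_one_left (norm_nonneg _) (by linarith)

end HalfSpaceCalculus

/-! ### Hermitian structures in a coordinate patch -/

section Patch

variable {E : Type*} [NormedAddCommGroup E] [InnerProductSpace ℝ E]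

/-- A Hermitian structure in a coordinate patch `U`, relatively open in the half-space `{h₀ ≥ 0}`:
the almost complex structure `J`, the metric `g` and a background form `χ`, all as functions of the
coordinates. Integrability of `J` and the symmetries of `χ` are not part of the structure; they
enter through the assumption that `𝔤[u]` is a Hermitian form. -/
structure HermitianPatch (E : Type*) [NormedAddCommGroup E] [InnerProductSpace ℝ E] where
  h₀ : E →L[ℝ] ℝ
  exists_eq_one : ∃ v, h₀ v = 1
  U : Set E
  subset : U ⊆ halfSpace h₀
  mem_nhdsWithin : ∀ y ∈ U, U ∈ 𝓝[halfSpace h₀] y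
  J : E → E →L[ℝ] E
  g : E → E →L[ℝ] E →L[ℝ] ℝ
  χ : E → E →L[ℝ] E →L[ℝ] ℝ
  J_smooth : ContDiffOn ℝ ∞ J U
  g_smooth : ContDiffOn ℝ ∞ g U
  χ_smooth : ContDiffOn ℝ ∞ χ U
  pair : ∀ y ∈ U, IsHermitianPair (J y) (g y)

namespace HermitianPatch

variable (P : HermitianPatch E)

/-- The half-space containing the patch. -/
abbrev S : Set E := halfSpace P.h₀

/-- The derivative of the complex structure. -/
def DJ (y : E) : E →L[ℝ] E →L[ℝ] E := fderivWithin ℝ P.J P.S y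

/-- The coordinate expression of `√-1 ∂∂̄ u = ½ d(-du ∘ J)`. -/
def ddc (u : E → ℝ) (y a b : E) : ℝ :=
  1 / 2 * (secondDerivWithin P.S u y b (P.J y a) - secondDerivWithin P.S u y a (P.J y b)
    + fderivWithin ℝ u P.S y (P.DJ y b a - P.DJ y a b))

/-- The bilinear form `(a, b) ↦ 𝔤[u](a, J b)`, whose Hermitian eigenvalues are `λ(𝔤[u])`. -/
def form (u : E → ℝ) (y : E) : LinearMap.BilinForm ℝ E :=
  LinearMap.mk₂ ℝ (fun a b => P.χ y a (P.J y b) + P.ddc u y a (P.J y b))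
    (fun a a' b => by simp only [ddc, map_add, add_apply, map_sub]; ring)
    (fun c a b => by
      simp only [ddc, map_smul, smul_apply, map_sub, smul_eq_mul]; ring)
    (fun a b b' => by simp only [ddc, map_add, add_apply, map_sub]; ring)
    (fun c a b => by
      simp only [ddc, map_smul, smul_apply, map_sub, smul_eq_mul]; ring)

/-- The first order coefficient of the operator `u ↦ √-1 ∂∂̄ u (a, J a)`. -/
def drift (y a : E) : E := (1 / 2 : ℝ) • (P.DJ y (P.J y a) a - P.DJ y a (P.J y a))

/-- The value `√-1 ∂∂̄ u (a, J a)` of the complex Hessian, as a second order operator. -/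
def leviOp (u : E → ℝ) (y a : E) : ℝ :=
  1 / 2 * (secondDerivWithin P.S u y a a + secondDerivWithin P.S u y (P.J y a) (P.J y a))
    + fderivWithin ℝ u P.S y (P.drift y a)

variable {P}

theorem form_apply (u : E → ℝ) (y a b : E) :
    P.form u y a b = P.χ y a (P.J y b) + P.ddc u y a (P.J y b) := rfl

theorem form_self (u : E → ℝ) {y : E} (hy : y ∈ P.U) (a : E) :
    P.form u y a a = P.χ y a (P.J y a) + P.leviOp u y a := by
  rw [form_apply, ddc, leviOp, drift, (P.pair y hy).J_J]
  simp only [map_neg, map_smul, map_sub, smul_eq_mul]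
  ring

theorem leviOp_add {u w : E → ℝ} (hu : ContDiffOn ℝ 2 u P.U) (hw : ContDiffOn ℝ 2 w P.U) {y : E}
    (hy : y ∈ P.U) (a : E) :
    P.leviOp (fun y => u y + w y) y a = P.leviOp u y a + P.leviOp w y a := by
  unfold leviOp
  rw [secondDerivWithin_add P.exists_eq_one P.subset P.mem_nhdsWithin hu hw hy,
    fderivWithin_add_of_smooth P.exists_eq_one P.subset P.mem_nhdsWithin hu hw hy]
  simp only [add_apply]
  ring

theorem leviOp_neg {u : E → ℝ} {y : E} (hy : y ∈ P.U) (a : E) :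
    P.leviOp (fun y => -u y) y a = -P.leviOp u y a := by
  unfold leviOp
  rw [secondDerivWithin_neg P.exists_eq_one P.subset hy,
    fderivWithin_neg_of_smooth P.exists_eq_one P.subset hy]
  simp only [neg_apply]
  ring

theorem leviOp_sub {u w : E → ℝ} (hu : ContDiffOn ℝ 2 u P.U) (hw : ContDiffOn ℝ 2 w P.U) {y : E}
    (hy : y ∈ P.U) (a : E) :
    P.leviOp (fun y => u y - w y) y a = P.leviOp u y a - P.leviOp w y a := by
  have h1 := leviOp_add hu hw.neg hy a
  have h2 := leviOp_neg (u := w) hy a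
  simp only [sub_eq_add_neg]
  rw [← h2]
  exact h1

/-- At an interior maximum of `u - w` the form `𝔤[u]` lies below `𝔤[w]`. -/
theorem form_le_of_isLocalMax {u w : E → ℝ} (hu : ContDiffOn ℝ 2 u P.U)
    (hw : ContDiffOn ℝ 2 w P.U) {y : E} (hy : y ∈ P.U) (hpos : 0 < P.h₀ y)
    (hmax : IsLocalMax (fun y => u y - w y) y) (a : E) :
    P.form u y a a ≤ P.form w y a a := by
  rw [form_self u hy, form_self w hy]
  obtain ⟨h1, h2⟩ := hmax.fderivWithin_conditions P.exists_eq_one P.subset P.mem_nhdsWithin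
    (hu.sub hw) hy hpos
  have h3 := leviOp_sub hu hw hy a
  rw [leviOp, h1] at h3
  have h4 := h2 a
  have h5 := h2 (P.J y a)
  simp only [zero_apply] at h3
  linarith

/-- At a boundary point, along the complex tangent space of the boundary, `√-1 ∂∂̄ u` of a function
vanishing on the boundary is its normal derivative times the Levi form of the boundary. -/
theorem leviOp_of_boundary_zero {u : E → ℝ} (hu : ContDiffOn ℝ 2 u P.U)
    (hzero : ∀ y ∈ P.U, P.h₀ y = 0 → u y = 0) {y : E} (hy : y ∈ P.U) (hy0 : P.h₀ y = 0) {v : E}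
    (hv : P.h₀ v = 1) {a : E} (ha : P.h₀ a = 0) (hJa : P.h₀ (P.J y a) = 0) :
    P.leviOp u y a = fderivWithin ℝ u P.S y v * P.h₀ (P.drift y a) := by
  have h1 := fun {a} (ha : P.h₀ a = 0) =>
    boundary_derivatives P.exists_eq_one P.subset P.mem_nhdsWithin hu hzero hy hy0 ha
  rw [leviOp, (h1 ha).2, (h1 hJa).2]
  have h2 : fderivWithin ℝ u P.S y (P.drift y a - P.h₀ (P.drift y a) • v) = 0 :=
    (h1 (by simp [hv])).1
  rw [map_sub, map_smul, smul_eq_mul] at h2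
  linarith

variable (P) in
theorem DJ_smooth : ContDiffOn ℝ ∞ P.DJ P.U :=
  P.J_smooth.fderivWithin_halfSpace P.exists_eq_one P.subset P.mem_nhdsWithin (by simp)

theorem _root_.ContinuousLinearMap.isInvertible_of_pos [FiniteDimensional ℝ E]
    {b : E →L[ℝ] E →L[ℝ] ℝ} (hb : ∀ a, a ≠ 0 → 0 < b a a) :
    ∃ e : E ≃L[ℝ] (E →L[ℝ] ℝ), (e : E →L[ℝ] (E →L[ℝ] ℝ)) = b := by
  have hinj : Function.Injective (b : E →ₗ[ℝ] (E →L[ℝ] ℝ)) := by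
    rw [injective_iff_map_eq_zero]
    intro a ha
    by_contra hne
    have h1 := hb a hne
    have h2 : b a = 0 := ha
    rw [h2] at h1
    simp at h1
  have hdim : Module.finrank ℝ E = Module.finrank ℝ (E →L[ℝ] ℝ) := by
    rw [← LinearEquiv.finrank_eq (LinearMap.toContinuousLinearMap (𝕜 := ℝ) (E := E) (F' := ℝ))]
    exact (Subspace.dual_finrank_eq (K := ℝ) (V := E)).symm
  refine ⟨(LinearEquiv.ofInjectiveOfFinrankEq _ hinj hdim).toContinuousLinearEquiv, ?_⟩
  ext a c
  rfl

/-- Near each point of the patch there is a smooth unitary frame whose first vector is normal to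
the hypersurfaces `h₀ = const`; the remaining ones span their complex tangent spaces. -/
theorem exists_smooth_frame [FiniteDimensional ℝ E] {m : ℕ}
    (hm : Module.finrank ℝ E = 2 * (m + 1)) {yc : E} (hyc : yc ∈ P.U) :
    ∃ r > 0, Metric.closedBall yc r ∩ P.S ⊆ P.U ∧ ∃ e : Fin (m + 1) → E → E,
      (∀ i, ContDiffOn ℝ ∞ (e i) (Metric.closedBall yc r ∩ P.S)) ∧
      ∀ y ∈ Metric.closedBall yc r ∩ P.S, IsUnitaryFrame (P.J y) (P.g y) (fun i => e i y) ∧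
        0 < P.h₀ (e 0 y) ∧ P.h₀ (P.J y (e 0 y)) = 0 ∧
        ∀ i : Fin m, P.h₀ (e i.succ y) = 0 ∧ P.h₀ (P.J y (e i.succ y)) = 0 := by
  -- the normal field, the gradient of `h₀`
  set N : E → E := fun y => (P.g y).inverse P.h₀ with hN
  have hgN : ∀ y ∈ P.U, ∀ a, P.g y (N y) a = P.h₀ a := by
    intro y hy a
    obtain ⟨e, he⟩ := ContinuousLinearMap.isInvertible_of_pos (P.pair y hy).pos
    simp only [hN, ← he, ContinuousLinearMap.inverse_equiv]
    simp
  have hNsm : ContDiffOn ℝ ∞ N P.U := by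
    intro y hy
    obtain ⟨e, he⟩ := ContinuousLinearMap.isInvertible_of_pos (P.pair y hy).pos
    have h1 : ContDiffAt ℝ ∞ ContinuousLinearMap.inverse (P.g y) := he ▸ contDiffAt_map_inverse e
    exact (h1.comp_contDiffWithinAt y (P.g_smooth y hy)).clm_apply contDiffWithinAt_const
  have hNpos : ∀ y ∈ P.U, 0 < P.g y (N y) (N y) := by
    intro y hy
    refine (P.pair y hy).pos _ fun h0 => ?_
    obtain ⟨v, hv⟩ := P.exists_eq_one
    have := hgN y hy v
    rw [h0, hv] at this
    simp at this
  -- Gram–Schmidt, one vector at a time: a constant vector `X` which is transversal to the frame at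
  -- `yc` remains so nearby
  have key : ∀ k ≤ m, ∃ W ⊆ P.U, W ∈ 𝓝[P.S] yc ∧ ∃ e : Fin (k + 1) → E → E,
      (∀ i, ContDiffOn ℝ ∞ (e i) W) ∧ (∀ y ∈ W, IsUnitaryFrame (P.J y) (P.g y) fun i => e i y) ∧
        ∀ y ∈ W, e 0 y = (√(P.g y (N y) (N y)))⁻¹ • N y := by
    intro k
    induction k with
    | zero =>
      intro _
      refine ⟨P.U, le_rfl, P.mem_nhdsWithin yc hyc,
        fun _ y => (√(P.g y (N y) (N y)))⁻¹ • N y, fun _ => ?_, fun y hy => ?_, fun y _ => rfl⟩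
      · have h1 : ContDiffOn ℝ ∞ (fun y => P.g y (N y) (N y)) P.U :=
          (P.g_smooth.clm_apply hNsm).clm_apply hNsm
        exact ((h1.sqrt fun y hy => (hNpos y hy).ne').inv fun y hy =>
          (Real.sqrt_pos.2 (hNpos y hy)).ne').smul hNsm
      · have hs := Real.sqrt_pos.2 (hNpos y hy)
        constructor
        · intro i j
          rw [if_pos (Fin.ext (by omega))]
          simp only [map_smul, smul_apply, smul_eq_mul]
          field_simp
          rw [Real.sq_sqrt (hNpos y hy).le]
        · intro i j
          simp only [map_smul, smul_apply, smul_eq_mul, (P.pair y hy).self_J, mul_zero]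
    | succ k ih =>
      intro hk
      obtain ⟨W, hWU, hW, e, hesm, heu, he0⟩ := ih (by omega)
      have hycW : yc ∈ W := mem_of_mem_nhdsWithin (P.subset hyc) hW
      obtain ⟨X, hX⟩ := IsUnitaryFrame.exists_orthogonal (P.J yc) (P.g yc) (fun i => e i yc)
        (by omega)
      set R : E → E := fun y => X - ∑ i, (P.g y X (e i y) • e i y
        + P.g y X (P.J y (e i y)) • P.J y (e i y)) with hR
      have hJW := P.J_smooth.mono hWU
      have hgW := P.g_smooth.mono hWU
      have hRsm : ContDiffOn ℝ ∞ R W := by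
        refine contDiffOn_const.sub (ContDiffOn.sum fun i _ => ?_)
        have h1 := hJW.clm_apply (hesm i)
        have h2 := hgW.clm_apply (contDiffOn_const (c := X))
        exact ((h2.clm_apply (hesm i)).smul (hesm i)).add ((h2.clm_apply h1).smul h1)
      have hRR : ContDiffOn ℝ ∞ (fun y => P.g y (R y) (R y)) W :=
        (hgW.clm_apply hRsm).clm_apply hRsm
      have hRpos : 0 < P.g yc (R yc) (R yc) := (P.pair yc hyc).pos _ hX
      have hev : ∀ᶠ y in 𝓝[P.S] yc, 0 < P.g y (R y) (R y) :=
        ((hRR.continuousOn yc hycW).mono_of_mem_nhdsWithin hW).eventually (lt_mem_nhds hRpos)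
      refine ⟨{y ∈ W | 0 < P.g y (R y) (R y)}, fun y hy => hWU hy.1, inter_mem hW hev,
        Fin.snoc e fun y => (√(P.g y (R y) (R y)))⁻¹ • R y, fun i => ?_, fun y hy => ?_,
        fun y hy => ?_⟩
      · refine Fin.lastCases ?_ (fun i => ?_) i
        · rw [Fin.snoc_last]
          have h1 := hRR.mono fun y (hy : y ∈ {y ∈ W | 0 < P.g y (R y) (R y)}) => hy.1
          exact ((h1.sqrt fun y hy => hy.2.ne').inv fun y hy =>
            (Real.sqrt_pos.2 hy.2).ne').smul (hRsm.mono fun y hy => hy.1)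
        · rw [Fin.snoc_castSucc]
          exact (hesm i).mono fun y hy => hy.1
      · have hp := P.pair y (hWU hy.1)
        have hs := Real.sqrt_pos.2 hy.2
        have h1 := (heu y hy.1).snoc hp (X := (√(P.g y (R y) (R y)))⁻¹ • R y) (by
            simp only [map_smul, smul_apply, smul_eq_mul]
            field_simp
            rw [Real.sq_sqrt hy.2.le])
          (fun j => by
            simp only [map_smul, smul_apply, smul_eq_mul, mul_eq_zero]
            right; exact ((heu y hy.1).residual_orthogonal hp X j).1)
          (fun j => by
            simp only [map_smul, smul_apply, smul_eq_mul, mul_eq_zero]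
            right; exact ((heu y hy.1).residual_orthogonal hp X j).2)
        convert h1 using 1
        ext i
        refine Fin.lastCases ?_ (fun i => ?_) i <;> simp
      · have h0 : (0 : Fin (k + 1 + 1)) = Fin.castSucc 0 := rfl
        rw [h0, Fin.snoc_castSucc]
        exact he0 y hy.1
  obtain ⟨W, hWU, hW, e, hesm, heu, he0⟩ := key m le_rfl
  obtain ⟨r, hr, hrW⟩ := Metric.mem_nhdsWithin_iff.1 hW
  have hsub : Metric.closedBall yc (r / 2) ∩ P.S ⊆ W := fun y hy =>
    hrW ⟨Metric.closedBall_subset_ball (half_lt_self hr) hy.1, hy.2⟩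
  refine ⟨r / 2, half_pos hr, hsub.trans hWU, e, fun i => (hesm i).mono hsub, fun y hy => ?_⟩
  have hyW := hsub hy
  have hyU := hWU hyW
  have hs := Real.sqrt_pos.2 (hNpos y hyU)
  have hg0 : ∀ a, P.g y (e 0 y) a = (√(P.g y (N y) (N y)))⁻¹ * P.h₀ a := fun a => by
    rw [he0 y hyW, map_smul, smul_apply, hgN y hyU a, smul_eq_mul]
  have hzero : ∀ a, P.g y (e 0 y) a = 0 → P.h₀ a = 0 := fun a ha => by
    rw [hg0, mul_eq_zero] at ha
    exact ha.resolve_left (inv_ne_zero hs.ne')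
  refine ⟨heu y hyW, ?_, hzero _ ((heu y hyW).2 0 0), fun i => ⟨hzero _ ?_, hzero _ ?_⟩⟩
  · have h1 := (heu y hyW).1 0 0
    rw [if_pos rfl, hg0] at h1
    by_contra! hle
    nlinarith [inv_pos.2 hs]
  · simpa [(Fin.succ_ne_zero i).symm] using (heu y hyW).1 0 i.succ
  · exact (heu y hyW).2 0 i.succ

end HermitianPatch

end Patch

/-! ### Local bounds and the boundary barrier -/

section LocalBarrier

variable {E : Type*} [NormedAddCommGroup E] [InnerProductSpace ℝ E]

namespace HermitianPatch

variable {P : HermitianPatch E}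

/-- Uniform bounds for the geometry over a compact part of the patch. -/
structure Bounds (P : HermitianPatch E) (A : Set E) (c : ℝ) : Prop where
  one_le : 1 ≤ c
  sq_norm_le : ∀ y ∈ A, ∀ a, ‖a‖ ^ 2 ≤ c * P.g y a a
  J_le : ∀ y ∈ A, ‖P.J y‖ ≤ c
  g_le : ∀ y ∈ A, ‖P.g y‖ ≤ c
  χ_le : ∀ y ∈ A, ‖P.χ y‖ ≤ c
  DJ_le : ∀ y ∈ A, ‖P.DJ y‖ ≤ c
  Dg_le : ∀ y ∈ A, ∀ a b d, |fderivWithin ℝ P.g P.S y a b d| ≤ c * ‖a‖ * ‖b‖ * ‖d‖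

set_option maxSynthPendingDepth 3 in
theorem exists_bounds [FiniteDimensional ℝ E] (P : HermitianPatch E) {A : Set E} (hA : IsCompact A)
    (hAU : A ⊆ P.U) : ∃ c, P.Bounds A c := by
  obtain ⟨c₁, h1⟩ := hA.exists_bound_of_continuousOn (E := E →L[ℝ] E)
    (P.J_smooth.continuousOn.mono hAU)
  obtain ⟨c₂, h2⟩ := hA.exists_bound_of_continuousOn (E := E →L[ℝ] E →L[ℝ] ℝ)
    (P.g_smooth.continuousOn.mono hAU)
  obtain ⟨c₃, h3⟩ := hA.exists_bound_of_continuousOn (E := E →L[ℝ] E →L[ℝ] ℝ)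
    (P.χ_smooth.continuousOn.mono hAU)
  obtain ⟨c₄, h4⟩ := hA.exists_bound_of_continuousOn (E := E →L[ℝ] E →L[ℝ] E)
    (P.DJ_smooth.continuousOn.mono hAU)
  obtain ⟨c₅, h5⟩ := hA.exists_bound_of_continuousOn (E := E →L[ℝ] E →L[ℝ] E →L[ℝ] ℝ)
    ((P.g_smooth.fderivWithin_halfSpace P.exists_eq_one P.subset P.mem_nhdsWithin
      (j := ∞) (by simp)).continuousOn.mono hAU)
  obtain ⟨c₆, h6⟩ : ∃ c₆, ∀ p ∈ A ×ˢ Metric.sphere (0 : E) 1, ‖(P.g p.1 p.2 p.2)⁻¹‖ ≤ c₆ := by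
    refine (hA.prod (isCompact_sphere 0 1)).exists_bound_of_continuousOn ?_
    have hg : ContinuousOn (fun p : E × E => P.g p.1) (A ×ˢ Metric.sphere (0 : E) 1) :=
      (P.g_smooth.continuousOn.mono hAU).comp continuousOn_fst fun p hp => hp.1
    refine ((hg.clm_apply continuousOn_snd).clm_apply continuousOn_snd).inv₀ fun p hp => ?_
    refine ((P.pair p.1 (hAU hp.1)).pos p.2 fun h0 => ?_).ne'
    have := hp.2
    rw [h0] at this
    simp at this
  refine ⟨1 + |c₁| + |c₂| + |c₃| + |c₄| + |c₅| + |c₆|, ⟨?_, fun y hy a => ?_, fun y hy => ?_,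
    fun y hy => ?_, fun y hy => ?_, fun y hy => ?_, fun y hy => ?_⟩⟩
  · linarith [abs_nonneg c₁, abs_nonneg c₂, abs_nonneg c₃, abs_nonneg c₄, abs_nonneg c₅,
      abs_nonneg c₆]
  · by_cases ha : a = 0
    · simp [ha]
    · have hn : 0 < ‖a‖ := norm_pos_iff.2 ha
      have hb := h6 (y, ‖a‖⁻¹ • a) ⟨hy, by simp [norm_smul, hn.ne']⟩
      have hpos := (P.pair y (hAU hy)).pos a ha
      simp only [map_smul, smul_apply, smul_eq_mul] at hb
      rw [Real.norm_of_nonneg (by positivity)] at hb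
      have heq : (‖a‖⁻¹ * (‖a‖⁻¹ * P.g y a a))⁻¹ = ‖a‖ ^ 2 / P.g y a a := by
        field_simp
      rw [heq, div_le_iff₀ hpos] at hb
      refine hb.trans (mul_le_mul_of_nonneg_right ?_ hpos.le)
      linarith [abs_nonneg c₁, abs_nonneg c₂, abs_nonneg c₃, abs_nonneg c₄, abs_nonneg c₅,
        le_abs_self c₆]
  · linarith [h1 y hy, le_abs_self c₁, abs_nonneg c₂, abs_nonneg c₃, abs_nonneg c₄,
      abs_nonneg c₅, abs_nonneg c₆]
  · linarith [h2 y hy, abs_nonneg c₁, le_abs_self c₂, abs_nonneg c₃, abs_nonneg c₄,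
      abs_nonneg c₅, abs_nonneg c₆]
  · linarith [h3 y hy, abs_nonneg c₁, abs_nonneg c₂, le_abs_self c₃, abs_nonneg c₄,
      abs_nonneg c₅, abs_nonneg c₆]
  · linarith [h4 y hy, abs_nonneg c₁, abs_nonneg c₂, abs_nonneg c₃, le_abs_self c₄,
      abs_nonneg c₅, abs_nonneg c₆]
  · intro a b d
    have h7 := ((fderivWithin ℝ P.g P.S y a b).le_opNorm d).trans (mul_le_mul_of_nonneg_right
      (((fderivWithin ℝ P.g P.S y a).le_opNorm b).trans (mul_le_mul_of_nonneg_right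
        ((fderivWithin ℝ P.g P.S y).le_of_opNorm_le (h5 y hy) a) (norm_nonneg b))) (norm_nonneg d))
    refine h7.trans ?_
    gcongr
    linarith [abs_nonneg c₁, abs_nonneg c₂, abs_nonneg c₃, abs_nonneg c₄,
      le_abs_self c₅, abs_nonneg c₆]

namespace Bounds

variable {A : Set E} {c : ℝ} {y : E}

theorem norm_unit_le (hc : P.Bounds A c) (hy : y ∈ A) {a : E} (ha : P.g y a a = 1) : ‖a‖ ≤ c := by
  have h1 := hc.sq_norm_le y hy a
  rw [ha, mul_one] at h1
  nlinarith [hc.one_le, norm_nonneg a]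

theorem norm_J_le (hc : P.Bounds A c) (hy : y ∈ A) (a : E) : ‖P.J y a‖ ≤ c * ‖a‖ :=
  (P.J y).le_of_opNorm_le (hc.J_le y hy) a

theorem norm_drift_le (hc : P.Bounds A c) (hy : y ∈ A) (a : E) :
    ‖P.drift y a‖ ≤ c ^ 2 * ‖a‖ ^ 2 := by
  have hc0 : 0 ≤ c := zero_le_one.trans hc.one_le
  have hD : ∀ b d, ‖P.DJ y b d‖ ≤ c * ‖b‖ * ‖d‖ := fun b d =>
    ((P.DJ y b).le_opNorm d).trans (mul_le_mul_of_nonneg_right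
      ((P.DJ y).le_of_opNorm_le (hc.DJ_le y hy) b) (norm_nonneg d))
  have hJ := hc.norm_J_le hy a
  have h1 : ‖P.DJ y (P.J y a) a‖ ≤ c ^ 2 * ‖a‖ ^ 2 := by
    refine (hD _ _).trans ?_
    calc c * ‖P.J y a‖ * ‖a‖ ≤ c * (c * ‖a‖) * ‖a‖ := by gcongr
      _ = _ := by ring
  have h2 : ‖P.DJ y a (P.J y a)‖ ≤ c ^ 2 * ‖a‖ ^ 2 := by
    refine (hD _ _).trans ?_
    calc c * ‖a‖ * ‖P.J y a‖ ≤ c * ‖a‖ * (c * ‖a‖) := by gcongr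
      _ = _ := by ring
  unfold drift
  rw [norm_smul, Real.norm_of_nonneg (by norm_num)]
  have h3 := norm_sub_le (P.DJ y (P.J y a) a) (P.DJ y a (P.J y a))
  linarith

theorem abs_bilin_le {b : E →L[ℝ] E →L[ℝ] ℝ} {c : ℝ} (hb : ‖b‖ ≤ c) (a d : E) :
    |b a d| ≤ c * ‖a‖ * ‖d‖ :=
  ((b a).le_opNorm d).trans (mul_le_mul_of_nonneg_right (b.le_of_opNorm_le hb a) (norm_nonneg d))

/-- A bound for the complex Hessian of a function from bounds of its two derivatives. -/
theorem abs_leviOp_le (hc : P.Bounds A c) (hy : y ∈ A) {u : E → ℝ} {c' : ℝ}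
    (h1 : ‖fderivWithin ℝ u P.S y‖ ≤ c') (h2 : ‖secondDerivWithin P.S u y‖ ≤ c') (a : E) :
    |P.leviOp u y a| ≤ c' * (1 + 2 * c ^ 2) * ‖a‖ ^ 2 := by
  have hc' : 0 ≤ c' := (norm_nonneg _).trans h1
  have h3 := abs_bilin_le h2 a a
  have h4 := abs_bilin_le h2 (P.J y a) (P.J y a)
  have h5 : c' * ‖P.J y a‖ * ‖P.J y a‖ ≤ c' * c ^ 2 * ‖a‖ ^ 2 := by
    have := hc.norm_J_le hy a
    have hc0 : 0 ≤ c := zero_le_one.trans hc.one_le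
    calc c' * ‖P.J y a‖ * ‖P.J y a‖ ≤ c' * (c * ‖a‖) * (c * ‖a‖) := by gcongr
      _ = _ := by ring
  have h6 : |fderivWithin ℝ u P.S y (P.drift y a)| ≤ c' * (c ^ 2 * ‖a‖ ^ 2) :=
    ((fderivWithin ℝ u P.S y).le_of_opNorm_le h1 _).trans
      (mul_le_mul_of_nonneg_left (hc.norm_drift_le hy a) hc')
  unfold leviOp
  have h7 := h4.trans h5
  rw [abs_le] at *
  have h8 : 0 ≤ c' * c ^ 2 * ‖a‖ ^ 2 := by positivity
  have h9 : 0 ≤ c' * ‖a‖ ^ 2 := by positivity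
  constructor <;> nlinarith [h3.1, h3.2, h7.1, h7.2, h6.1, h6.2]

end Bounds

theorem exists_derivative_bounds (P : HermitianPatch E) {A : Set E} (hA : IsCompact A)
    (hAU : A ⊆ P.U) {u : E → ℝ} (hu : ContDiffOn ℝ 2 u P.U) :
    ∃ c, 0 ≤ c ∧ ∀ y ∈ A, |u y| ≤ c ∧ ‖fderivWithin ℝ u P.S y‖ ≤ c ∧
      ‖secondDerivWithin P.S u y‖ ≤ c := by
  have hu1 := hu.fderivWithin_halfSpace P.exists_eq_one P.subset P.mem_nhdsWithin
    (j := 1) (by norm_num)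
  have hu2 := hu1.fderivWithin_halfSpace P.exists_eq_one P.subset P.mem_nhdsWithin
    (j := 0) (by norm_num)
  obtain ⟨c₁, h1⟩ := hA.exists_bound_of_continuousOn (hu.continuousOn.mono hAU)
  obtain ⟨c₂, h2⟩ := hA.exists_bound_of_continuousOn (E := E →L[ℝ] ℝ) (hu1.continuousOn.mono hAU)
  obtain ⟨c₃, h3⟩ := hA.exists_bound_of_continuousOn (E := E →L[ℝ] E →L[ℝ] ℝ)
    (hu2.continuousOn.mono hAU)
  refine ⟨|c₁| + |c₂| + |c₃|, by positivity, fun y hy => ⟨?_, ?_, ?_⟩⟩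
  · have := h1 y hy
    rw [Real.norm_eq_abs] at this
    linarith [le_abs_self c₁, abs_nonneg c₂, abs_nonneg c₃]
  · linarith [h2 y hy, abs_nonneg c₁, le_abs_self c₂, abs_nonneg c₃]
  · have := h3 y hy
    unfold secondDerivWithin
    linarith [abs_nonneg c₁, abs_nonneg c₂, le_abs_self c₃]

/-- The barrier `(κ + ℓ(y - y₀)) h₀ + A (h₀ + τ |y - y₀|²)²` at a boundary point `y₀`. -/
def barrier (P : HermitianPatch E) (y₀ : E) (κ A τ : ℝ) (ℓ : E →L[ℝ] ℝ) (y : E) : ℝ :=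
  (κ + ℓ (y - y₀)) * P.h₀ y + A * (P.h₀ y + τ * ‖y - y₀‖ ^ 2) ^ 2

theorem contDiff_barrier (P : HermitianPatch E) (y₀ : E) (κ A τ : ℝ) (ℓ : E →L[ℝ] ℝ) :
    ContDiff ℝ ∞ (P.barrier y₀ κ A τ ℓ) := by
  have h1 : ContDiff ℝ ∞ fun y : E => ‖y - y₀‖ ^ 2 := (contDiff_id.sub contDiff_const).norm_sq ℝ
  unfold barrier
  fun_prop

theorem hasFDerivAt_barrier (P : HermitianPatch E) (y₀ : E) (κ A τ : ℝ) (ℓ : E →L[ℝ] ℝ) (y : E) :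
    HasFDerivAt (P.barrier y₀ κ A τ ℓ)
      ((κ + ℓ (y - y₀)) • P.h₀ + P.h₀ y • ℓ
        + (2 * A * (P.h₀ y + τ * ‖y - y₀‖ ^ 2)) • (P.h₀ + (2 * τ) • innerSL ℝ (y - y₀))) y := by
  have h0 : HasFDerivAt (fun y => y - y₀) (ContinuousLinearMap.id ℝ E) y :=
    (hasFDerivAt_id y).sub_const y₀
  have h1 : HasFDerivAt (fun y => ‖y - y₀‖ ^ 2) (2 • (innerSL ℝ (y - y₀))) y := by
    simpa using h0.norm_sq
  have h2 : HasFDerivAt (fun y => ℓ (y - y₀)) ℓ y := by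
    have := ℓ.hasFDerivAt.comp y h0
    rwa [ContinuousLinearMap.comp_id] at this
  have h3 := ((h2.const_add κ).mul P.h₀.hasFDerivAt).add
    (((P.h₀.hasFDerivAt.add (h1.const_mul τ)).pow 2).const_mul A)
  refine h3.congr_fderiv ?_
  ext a
  simp
  ring

theorem hasFDerivAt_fderiv_barrier (P : HermitianPatch E) (y₀ : E) (κ A τ : ℝ) (ℓ : E →L[ℝ] ℝ)
    (y a : E) :
    HasFDerivAt (fun y => (κ + ℓ (y - y₀)) * P.h₀ a + P.h₀ y * ℓ a
        + (2 * A * (P.h₀ y + τ * ‖y - y₀‖ ^ 2)) * (P.h₀ a + (2 * τ) * inner ℝ (y - y₀) a))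
      (P.h₀ a • ℓ + ℓ a • P.h₀
        + ((2 * A * (P.h₀ y + τ * ‖y - y₀‖ ^ 2)) * (2 * τ)) • innerSL ℝ a
        + (2 * A * (P.h₀ a + (2 * τ) * inner ℝ (y - y₀) a)) •
          (P.h₀ + (2 * τ) • innerSL ℝ (y - y₀))) y := by
  have h0 : HasFDerivAt (fun y => y - y₀) (ContinuousLinearMap.id ℝ E) y :=
    (hasFDerivAt_id y).sub_const y₀
  have h1 : HasFDerivAt (fun y => ‖y - y₀‖ ^ 2) (2 • (innerSL ℝ (y - y₀))) y := by
    simpa using h0.norm_sq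
  have h2 : HasFDerivAt (fun y => ℓ (y - y₀)) ℓ y := by
    have := ℓ.hasFDerivAt.comp y h0
    rwa [ContinuousLinearMap.comp_id] at this
  have h4 : HasFDerivAt (fun y => inner ℝ (y - y₀) a) (innerSL ℝ a) y := by
    have h5 := (innerSL ℝ a).hasFDerivAt.comp y h0
    refine (h5.congr_fderiv (by ext; simp)).congr_of_eventuallyEq (Eventually.of_forall fun z => ?_)
    simp [real_inner_comm]
  have h3 := (((h2.const_add κ).mul_const (P.h₀ a)).add (P.h₀.hasFDerivAt.mul_const (ℓ a))).add
    (((P.h₀.hasFDerivAt.add (h1.const_mul τ)).const_mul (2 * A)).mul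
      ((h4.const_mul (2 * τ)).const_add (P.h₀ a)))
  refine h3.congr_fderiv ?_
  ext b
  simp
  ring

theorem leviOp_barrier (P : HermitianPatch E) (y₀ : E) (κ A τ : ℝ) (ℓ : E →L[ℝ] ℝ) {y : E}
    (hy : y ∈ P.U) (a : E) :
    P.leviOp (P.barrier y₀ κ A τ ℓ) y a
      = (κ + ℓ (y - y₀)) * P.h₀ (P.drift y a) + P.h₀ y * ℓ (P.drift y a)
        + (ℓ a * P.h₀ a + ℓ (P.J y a) * P.h₀ (P.J y a))
        + A * (2 * (P.h₀ y + τ * ‖y - y₀‖ ^ 2) * (P.h₀ (P.drift y a)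
            + 2 * τ * inner ℝ (y - y₀) (P.drift y a) + τ * (‖a‖ ^ 2 + ‖P.J y a‖ ^ 2))
          + (P.h₀ a + 2 * τ * inner ℝ (y - y₀) a) ^ 2
          + (P.h₀ (P.J y a) + 2 * τ * inner ℝ (y - y₀) (P.J y a)) ^ 2) := by
  have huniq := uniqueDiffOn_halfSpace P.exists_eq_one
  have hD : ∀ z ∈ P.S, fderivWithin ℝ (P.barrier y₀ κ A τ ℓ) P.S z = _ := fun z hz =>
    (P.hasFDerivAt_barrier y₀ κ A τ ℓ z).hasFDerivWithinAt.fderivWithin (huniq z hz)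
  have hD2 : ∀ b, secondDerivWithin P.S (P.barrier y₀ κ A τ ℓ) y b b
      = 2 * (P.h₀ b * ℓ b) + 2 * A * (P.h₀ y + τ * ‖y - y₀‖ ^ 2) * (2 * τ) * ‖b‖ ^ 2
        + 2 * A * (P.h₀ b + 2 * τ * inner ℝ (y - y₀) b) ^ 2 := by
    intro b
    have h1 := hasFDerivWithinAt_fderivWithin P.exists_eq_one P.subset P.mem_nhdsWithin
      (((P.contDiff_barrier y₀ κ A τ ℓ).of_le ENat.LEInfty.out).contDiffOn
        (s := P.U)) hy
    have h2 := (ContinuousLinearMap.apply ℝ ℝ b).hasFDerivAt.comp_hasFDerivWithinAt y h1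
    have h3 := (P.hasFDerivAt_fderiv_barrier y₀ κ A τ ℓ y b).hasFDerivWithinAt (s := P.S)
    have heq : ∀ z ∈ P.S, ((ContinuousLinearMap.apply ℝ ℝ b) ∘
        fderivWithin ℝ (P.barrier y₀ κ A τ ℓ) (halfSpace P.h₀)) z = _ := fun z hz => by
      simp only [Function.comp_apply]
      rw [hD z hz]
    have h4 := h3.congr (f₁ := (ContinuousLinearMap.apply ℝ ℝ b) ∘
      fderivWithin ℝ (P.barrier y₀ κ A τ ℓ) (halfSpace P.h₀)) (fun z hz => by
        rw [heq z hz]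
        simp only [ContinuousLinearMap.apply_apply, add_apply, smul_apply, innerSL_apply_apply,
          smul_eq_mul]) (by
        rw [heq y (P.subset hy)]
        simp only [ContinuousLinearMap.apply_apply, add_apply, smul_apply, innerSL_apply_apply,
          smul_eq_mul])
    have h5 := (huniq y (P.subset hy)).eq h2 h4
    have h6 := DFunLike.congr_fun h5 b
    simp only [ContinuousLinearMap.comp_apply, ContinuousLinearMap.apply_apply, add_apply,
      smul_apply, innerSL_apply_apply, smul_eq_mul, real_inner_self_eq_norm_sq] at h6
    rw [h6]
    ring
  rw [leviOp, hD2, hD2, hD y (P.subset hy)]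
  simp only [add_apply, smul_apply, innerSL_apply_apply, smul_eq_mul]
  ring

end HermitianPatch

end LocalBarrier

/-! ### Weighted traces along complex tangent frames -/

section LeviSum

variable {E : Type*} [NormedAddCommGroup E] [InnerProductSpace ℝ E] {m : ℕ}

namespace HermitianPatch

/-- A smooth unitary frame on `A` whose first vector is normal to the hypersurfaces `h₀ = const` and
whose remaining vectors span their complex tangent spaces. -/
structure IsAdaptedFrame (P : HermitianPatch E) (A : Set E) (e : Fin (m + 1) → E → E) : Prop where
  subset : A ⊆ P.U
  smooth : ∀ i, ContDiffOn ℝ ∞ (e i) A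
  unitary : ∀ y ∈ A, IsUnitaryFrame (P.J y) (P.g y) fun i => e i y
  normal_pos : ∀ y ∈ A, 0 < P.h₀ (e 0 y)
  normal_J : ∀ y ∈ A, P.h₀ (P.J y (e 0 y)) = 0
  tangent : ∀ y ∈ A, ∀ i : Fin m, P.h₀ (e i.succ y) = 0
  tangent_J : ∀ y ∈ A, ∀ i : Fin m, P.h₀ (P.J y (e i.succ y)) = 0

/-- The complex tangent frame obtained from an adapted frame by the constant matrix `Z`. -/
def tangentFrame (P : HermitianPatch E) (e : Fin (m + 1) → E → E) (Z : Fin m → Fin m → ℂ) (y : E)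
    (a : Fin m) : E :=
  complexCombination (P.J y) (fun j => e j.succ y) (Z a)

/-- The trace of `𝔤[φ + κ h₀]` along the complex tangent frame of the hypersurfaces `h₀ = const`,
with weights `μ`. -/
def leviSum (P : HermitianPatch E) (e : Fin (m + 1) → E → E) (φ : E → ℝ) (Z : Fin m → Fin m → ℂ)
    (μ : Fin m → ℝ) (κ : ℝ) (y : E) : ℝ :=
  ∑ a, μ a * (P.χ y (P.tangentFrame e Z y a) (P.J y (P.tangentFrame e Z y a))
    + P.leviOp φ y (P.tangentFrame e Z y a)
    + κ * P.h₀ (P.drift y (P.tangentFrame e Z y a)))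

variable {P : HermitianPatch E} {A : Set E} {e : Fin (m + 1) → E → E}

theorem contDiffOn_leviSum {φ : E → ℝ} (hφ : ContDiffOn ℝ ∞ φ P.U) (he : P.IsAdaptedFrame A e) :
    ContDiffOn ℝ ∞ (fun p : E × (Fin m → Fin m → ℂ) × (Fin m → ℝ) × ℝ =>
      P.leviSum e φ p.2.1 p.2.2.1 p.2.2.2 p.1) (A ×ˢ univ) := by
  have hfst : ContDiffOn ℝ ∞ (fun p : E × (Fin m → Fin m → ℂ) × (Fin m → ℝ) × ℝ => p.1)
      (A ×ˢ univ) := contDiffOn_fst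
  have hmaps : MapsTo (fun p : E × (Fin m → Fin m → ℂ) × (Fin m → ℝ) × ℝ => p.1)
      (A ×ˢ univ) A := fun p hp => hp.1
  have hmapsU : MapsTo (fun p : E × (Fin m → Fin m → ℂ) × (Fin m → ℝ) × ℝ => p.1)
      (A ×ˢ univ) P.U := fun p hp => he.subset hp.1
  have hJ := P.J_smooth.comp hfst hmapsU
  have hχ := P.χ_smooth.comp hfst hmapsU
  have hDJ := P.DJ_smooth.comp hfst hmapsU
  have hφ1' := hφ.fderivWithin_halfSpace P.exists_eq_one P.subset P.mem_nhdsWithin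
    (j := ∞) (by simp)
  have hφ2' := hφ1'.fderivWithin_halfSpace P.exists_eq_one P.subset P.mem_nhdsWithin
    (j := ∞) (by simp)
  have hφ1 := hφ1'.comp hfst hmapsU
  have hφ2 := hφ2'.comp hfst hmapsU
  have hZ : ∀ a j, ContDiffOn ℝ ∞ (fun p : E × (Fin m → Fin m → ℂ) × (Fin m → ℝ) × ℝ => p.2.1 a j)
      (A ×ˢ univ) := fun a j => by
    have : ContDiff ℝ ∞ (fun p : E × (Fin m → Fin m → ℂ) × (Fin m → ℝ) × ℝ => p.2.1 a j) := by
      fun_prop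
    exact this.contDiffOn
  have hT : ∀ a, ContDiffOn ℝ ∞ (fun p : E × (Fin m → Fin m → ℂ) × (Fin m → ℝ) × ℝ =>
      P.tangentFrame e p.2.1 p.1 a) (A ×ˢ univ) := by
    intro a
    unfold tangentFrame complexCombination
    refine ContDiffOn.sum fun j _ => ?_
    have h1 := (he.smooth j.succ).comp hfst hmaps
    exact (((Complex.reCLM.contDiff).comp_contDiffOn (hZ a j)).smul h1).add
      (((Complex.imCLM.contDiff).comp_contDiffOn (hZ a j)).smul (hJ.clm_apply h1))
  have hμ : ∀ a, ContDiffOn ℝ ∞ (fun p : E × (Fin m → Fin m → ℂ) × (Fin m → ℝ) × ℝ => p.2.2.1 a)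
      (A ×ˢ univ) := fun a => by
    have : ContDiff ℝ ∞ (fun p : E × (Fin m → Fin m → ℂ) × (Fin m → ℝ) × ℝ => p.2.2.1 a) := by
      fun_prop
    exact this.contDiffOn
  have hκ : ContDiffOn ℝ ∞ (fun p : E × (Fin m → Fin m → ℂ) × (Fin m → ℝ) × ℝ => p.2.2.2)
      (A ×ˢ univ) := by
    have : ContDiff ℝ ∞ (fun p : E × (Fin m → Fin m → ℂ) × (Fin m → ℝ) × ℝ => p.2.2.2) := by
      fun_prop
    exact this.contDiffOn
  refine ContDiffOn.sum fun a _ => (hμ a).mul ?_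
  have hJT := hJ.clm_apply (hT a)
  have hV : ContDiffOn ℝ ∞ (fun p : E × (Fin m → Fin m → ℂ) × (Fin m → ℝ) × ℝ =>
      P.drift p.1 (P.tangentFrame e p.2.1 p.1 a)) (A ×ˢ univ) :=
    contDiffOn_const.smul (((hDJ.clm_apply hJT).clm_apply (hT a)).sub
      ((hDJ.clm_apply (hT a)).clm_apply hJT))
  refine (((hχ.clm_apply (hT a)).clm_apply hJT).add ?_).add
    (hκ.mul (P.h₀.contDiff.comp_contDiffOn hV))
  exact (contDiffOn_const.mul (((hφ2.clm_apply (hT a)).clm_apply (hT a)).add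
    ((hφ2.clm_apply hJT).clm_apply hJT))).add (hφ1.clm_apply hV)

theorem _root_.HasOrthonormalRows.norm_le {Z : Fin m → Fin m → ℂ} (hZ : HasOrthonormalRows Z)
    (a j : Fin m) : ‖Z a j‖ ≤ 1 := by
  have h1 := hZ a a
  rw [if_pos rfl] at h1
  have h2 : ∑ j, ‖Z a j‖ ^ 2 = 1 := by
    have h3 : ((∑ j, ‖Z a j‖ ^ 2 : ℝ) : ℂ) = 1 := by
      rw [← h1]
      push_cast
      exact Finset.sum_congr rfl fun j _ => (Complex.mul_conj' _).symm
    exact_mod_cast h3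
  have h4 : ‖Z a j‖ ^ 2 ≤ 1 := by
    rw [← h2]
    exact Finset.single_le_sum (f := fun j => ‖Z a j‖ ^ 2) (fun i _ => sq_nonneg _)
      (Finset.mem_univ j)
  nlinarith [norm_nonneg (Z a j)]

theorem _root_.IsSupporting.le_one {Γ : Set (Fin (m + 1) → ℝ)} {μ : Fin m → ℝ}
    (hμ : IsSupporting Γ μ) (a : Fin m) : μ a ≤ 1 := by
  rw [← hμ.sum_eq_one]
  exact Finset.single_le_sum (fun i _ => hμ.nonneg i) (Finset.mem_univ a)

/-- The weighted traces along complex tangent frames have first order Taylor expansions with a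
quadratic error which is uniform in the base point and in the frame. -/
theorem exists_leviSum_taylor [FiniteDimensional ℝ E] {φ : E → ℝ} (hφ : ContDiffOn ℝ ∞ φ P.U)
    {yc : E} {r : ℝ} (hr : 0 < r) (hyc : P.h₀ yc = 0)
    (he : P.IsAdaptedFrame (Metric.closedBall yc r ∩ P.S) e) (Γ : Set (Fin (m + 1) → ℝ)) (K : ℝ) :
    ∃ C, 0 ≤ C ∧ ∀ y₀ ∈ Metric.closedBall yc r ∩ P.S, ∀ Z, HasOrthonormalRows Z →
      ∀ μ, IsSupporting Γ μ → ∀ κ, |κ| ≤ K → ∃ ℓ : E →L[ℝ] ℝ, ‖ℓ‖ ≤ C ∧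
        ∀ y ∈ Metric.closedBall yc r ∩ P.S,
          |P.leviSum e φ Z μ κ y - P.leviSum e φ Z μ κ y₀ - ℓ (y - y₀)| ≤ C * ‖y - y₀‖ ^ 2 := by
  set A := Metric.closedBall yc r ∩ P.S with hA
  set B : Set ((Fin m → Fin m → ℂ) × (Fin m → ℝ) × ℝ) := Metric.closedBall 0 (|K| + 1) with hB
  have hAc : IsCompact A := (isCompact_closedBall yc r).inter_right isClosed_halfSpace
  have hAint : (interior A).Nonempty := by
    obtain ⟨v, hv⟩ := P.exists_eq_one
    set s : ℝ := r / (2 * (‖v‖ + 1)) with hs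
    have hs0 : 0 < s := by positivity
    refine ⟨yc + s • v, ?_⟩
    rw [hA, interior_inter]
    refine ⟨Metric.ball_subset_interior_closedBall ?_, mem_interior_halfSpace ?_⟩
    · rw [Metric.mem_ball, dist_eq_norm, add_sub_cancel_left, norm_smul, Real.norm_of_nonneg hs0.le,
        hs, div_mul_eq_mul_div, div_lt_iff₀ (by positivity)]
      nlinarith [norm_nonneg v]
    · rw [map_add, hyc, map_smul, hv, smul_eq_mul, mul_one, zero_add]
      exact hs0
  have hBint : (interior B).Nonempty :=
    ⟨0, Metric.ball_subset_interior_closedBall (Metric.mem_ball_self (by positivity))⟩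
  obtain ⟨C, hC0, hC⟩ := exists_uniform_taylor (hAc.prod (isCompact_closedBall 0 (|K| + 1)))
    (((convex_closedBall yc r).inter convex_halfSpace).prod (convex_closedBall 0 (|K| + 1)))
    (by rw [interior_prod_eq]; exact hAint.prod hBint)
    (((contDiffOn_leviSum hφ he).mono (prod_mono le_rfl (subset_univ _))).of_le ENat.LEInfty.out)
  refine ⟨C, hC0, fun y₀ hy₀ Z hZ μ hμ κ hκ => ?_⟩
  have hp : ((Z, μ, κ) : (Fin m → Fin m → ℂ) × (Fin m → ℝ) × ℝ) ∈ B := by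
    have hK1 : (1 : ℝ) ≤ |K| + 1 := by linarith [abs_nonneg K]
    rw [hB, mem_closedBall_zero_iff, Prod.norm_def, Prod.norm_def]
    refine max_le ?_ (max_le ?_ ?_)
    · refine (pi_norm_le_iff_of_nonneg (by positivity)).2 fun a =>
        (pi_norm_le_iff_of_nonneg (by positivity)).2 fun j => (hZ.norm_le a j).trans hK1
    · refine (pi_norm_le_iff_of_nonneg (by positivity)).2 fun a => ?_
      rw [Real.norm_of_nonneg (hμ.nonneg a)]
      exact (hμ.le_one a).trans hK1
    · rw [Real.norm_eq_abs]
      show |κ| ≤ _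
      linarith [le_abs_self K]
  obtain ⟨L, hL, hLy⟩ := hC (y₀, Z, μ, κ) ⟨hy₀, hp⟩
  refine ⟨L.comp (ContinuousLinearMap.inl ℝ E _), ?_, fun y hy => ?_⟩
  · refine (L.opNorm_comp_le _).trans ?_
    refine (mul_le_mul hL (ContinuousLinearMap.norm_inl_le_one ℝ E _)
      (ContinuousLinearMap.opNorm_nonneg _) hC0).trans ?_
    rw [mul_one]
  · have h1 := hLy (y, Z, μ, κ) ⟨hy, hp⟩
    have h2 : ((y, Z, μ, κ) : E × (Fin m → Fin m → ℂ) × (Fin m → ℝ) × ℝ) - (y₀, Z, μ, κ)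
        = (y - y₀, 0) := by simp
    rw [h2] at h1
    simpa [Prod.norm_def] using h1

/-- The coefficient of `κ` in the weighted trace: the weighted trace of the Levi form. -/
theorem leviSum_eq_add (φ : E → ℝ) (Z : Fin m → Fin m → ℂ) (μ : Fin m → ℝ) (κ : ℝ) (y : E) :
    P.leviSum e φ Z μ κ y = P.leviSum e φ Z μ 0 y
      + κ * ∑ a, μ a * P.h₀ (P.drift y (P.tangentFrame e Z y a)) := by
  simp only [leviSum, zero_mul, add_zero]
  rw [Finset.mul_sum, ← Finset.sum_add_distrib]
  exact Finset.sum_congr rfl fun a _ => by ring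

theorem IsAdaptedFrame.tangentFrame_unitary (he : P.IsAdaptedFrame A e) {Z : Fin m → Fin m → ℂ}
    (hZ : HasOrthonormalRows Z) {y : E} (hy : y ∈ A) :
    IsUnitaryFrame (P.J y) (P.g y)
      (Fin.cons (e 0 y) (P.tangentFrame e Z y) : Fin (m + 1) → E) :=
  (he.unitary y hy).cons_complexCombination (P.pair y (he.subset hy)) hZ

theorem IsAdaptedFrame.h₀_tangentFrame (he : P.IsAdaptedFrame A e) (Z : Fin m → Fin m → ℂ) {y : E}
    (hy : y ∈ A) (a : Fin m) : P.h₀ (P.tangentFrame e Z y a) = 0 := by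
  simp [tangentFrame, complexCombination, map_sum, he.tangent y hy, he.tangent_J y hy]

theorem IsAdaptedFrame.h₀_J_tangentFrame (he : P.IsAdaptedFrame A e) (Z : Fin m → Fin m → ℂ) {y : E}
    (hy : y ∈ A) (a : Fin m) : P.h₀ (P.J y (P.tangentFrame e Z y a)) = 0 := by
  rw [tangentFrame, J_complexCombination (P.pair y (he.subset hy))]
  simp [complexCombination, map_sum, he.tangent y hy, he.tangent_J y hy]

/-- On the boundary the weighted trace of `𝔤[u]` along complex tangent directions is determined by
the boundary values and the normal derivative of `u`. -/
theorem sum_form_eq_leviSum {φ u : E → ℝ} (hφ : ContDiffOn ℝ ∞ φ P.U) (hu : ContDiffOn ℝ 2 u P.U)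
    (hbd : ∀ y ∈ P.U, P.h₀ y = 0 → u y = φ y) (he : P.IsAdaptedFrame A e)
    (Z : Fin m → Fin m → ℂ) (μ : Fin m → ℝ) {y : E} (hy : y ∈ A) (hy0 : P.h₀ y = 0) {v : E}
    (hv : P.h₀ v = 1) :
    ∑ a, μ a * P.form u y (P.tangentFrame e Z y a) (P.tangentFrame e Z y a)
      = P.leviSum e φ Z μ (fderivWithin ℝ (fun y => u y - φ y) P.S y v) y := by
  have hφ2 : ContDiffOn ℝ 2 φ P.U := hφ.of_le ENat.LEInfty.out
  refine Finset.sum_congr rfl fun a _ => ?_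
  rw [form_self u (he.subset hy)]
  have h1 := leviOp_of_boundary_zero (hu.sub hφ2) (fun z hz hz0 => sub_eq_zero.2 (hbd z hz hz0))
    (he.subset hy) hy0 hv (he.h₀_tangentFrame Z hy a) (he.h₀_J_tangentFrame Z hy a)
  rw [← h1]
  have h2 := leviOp_sub hu hφ2 (he.subset hy) (P.tangentFrame e Z y a)
  rw [h2]
  ring

end HermitianPatch

end LeviSum

/-! ### The complex Hessian of the barrier -/

section BarrierEstimate

/-- The choice of constants in the barrier: the linear term `ℓ` cancels the first order variation
of the weighted trace, and the negative Levi form absorbs all quadratic errors. -/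
theorem barrier_arithmetic {a C δ t h S S₀ G G₀ L ℓz τ c₁ c₂ A Lc : ℝ} (ha : 0 < a) (hC : 0 ≤ C)
    (ht : 0 ≤ t) (htδ : t ≤ δ) (hh : 0 ≤ h) (hS₀ : S₀ ≤ -a)
    (hS : |S - S₀| ≤ 4 * C * t) (hδ : 4 * C * δ ≤ a / 2) (hG : G ≤ G₀ + L + C * t ^ 2)
    (hL : |L| ≤ C * t) (hℓ : ℓz = -L / S₀) (hτ : 0 ≤ τ) (hτ₂ : τ * c₂ ≤ a / 4)
    (hτ₁ : 8 * τ * c₁ ^ 2 ≤ a / 4) (hA : 0 ≤ A) (hA₁ : C + C * (4 * C) / a ≤ A * (a * τ / 4))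
    (hA₂ : Lc * c₁ ≤ A * (a / 2)) :
    G + ℓz * S + h * (Lc * c₁)
      + A * (2 * (h + τ * t ^ 2) * (S + τ * c₂) + 8 * τ ^ 2 * c₁ ^ 2 * t ^ 2) ≤ G₀ := by
  have hS₀ne : S₀ ≠ 0 := by linarith
  have h1 : ℓz * S = -L + ℓz * (S - S₀) := by
    rw [mul_sub, hℓ, div_mul_cancel₀ _ hS₀ne]; ring
  have h2 : |ℓz| ≤ C * t / a := by
    rw [hℓ, abs_div, abs_neg]
    have : a ≤ |S₀| := by rw [abs_of_nonpos (by linarith)]; linarith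
    exact div_le_div₀ (by positivity) hL ha this
  have h3 : ℓz * (S - S₀) ≤ C * (4 * C) / a * t ^ 2 := by
    calc ℓz * (S - S₀) ≤ |ℓz * (S - S₀)| := le_abs_self _
      _ = |ℓz| * |S - S₀| := abs_mul _ _
      _ ≤ (C * t / a) * (4 * C * t) := mul_le_mul h2 hS (abs_nonneg _) (by positivity)
      _ = _ := by ring
  have h4 : S + τ * c₂ ≤ -(a / 4) := by
    have := (abs_le.1 hS).2
    have h5 : 4 * C * t ≤ a / 2 := (mul_le_mul_of_nonneg_left htδ (by positivity)).trans hδ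
    linarith
  have hd : 0 ≤ h + τ * t ^ 2 := by positivity
  have h5 : 2 * (h + τ * t ^ 2) * (S + τ * c₂) ≤ -(a / 2) * (h + τ * t ^ 2) := by
    nlinarith
  have h6 : 8 * τ ^ 2 * c₁ ^ 2 * t ^ 2 ≤ a * τ / 4 * t ^ 2 := by
    have : 8 * τ ^ 2 * c₁ ^ 2 ≤ a * τ / 4 := by nlinarith
    exact mul_le_mul_of_nonneg_right this (sq_nonneg t)
  have h7 : A * (2 * (h + τ * t ^ 2) * (S + τ * c₂) + 8 * τ ^ 2 * c₁ ^ 2 * t ^ 2)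
      ≤ A * (-(a / 2) * h - a * τ / 4 * t ^ 2) := by
    refine mul_le_mul_of_nonneg_left ?_ hA
    nlinarith
  have h8 := mul_le_mul_of_nonneg_right hA₁ (sq_nonneg t)
  have h9 := mul_le_mul_of_nonneg_left hA₂ hh
  nlinarith

variable {E : Type*} [NormedAddCommGroup E] [InnerProductSpace ℝ E] {m : ℕ}

namespace HermitianPatch

variable {P : HermitianPatch E}

/-- `u` is a `C²` function for which `𝔤[u]` is of type `(1,1)` and, at interior points, has
eigenvalues in `Γ` with `f ≥ s`. -/
structure IsSupersolvable (P : HermitianPatch E) (f : (Fin (m + 1) → ℝ) → ℝ)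
    (Γ : Set (Fin (m + 1) → ℝ)) (s : ℝ) (u : E → ℝ) : Prop where
  smooth : ContDiffOn ℝ 2 u P.U
  hermitian : ∀ y ∈ P.U, IsHermitianForm (P.J y) (P.form u y)
  eigen : ∀ y ∈ P.U, 0 < P.h₀ y → ∃ e l, IsEigenframe (P.J y) (P.g y) (P.form u y) e l ∧
    l ∈ Γ ∧ s ≤ f l

/-- Contribution of the barrier to the trace along a complex tangent vector of the hypersurfaces
`h₀ = const`. -/
theorem leviOp_barrier_tangent_le {y₀ y T : E} {κ A τ c₁ Lc : ℝ} {ℓ : E →L[ℝ] ℝ} (hy : y ∈ P.U)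
    (hT : P.h₀ T = 0) (hJT : P.h₀ (P.J y T) = 0) (hT₁ : ‖T‖ ≤ c₁) (hJT₁ : ‖P.J y T‖ ≤ c₁)
    (hV : ‖P.drift y T‖ ≤ c₁) (hA : 0 ≤ A) (hτ : 0 ≤ τ) (hz : ‖y - y₀‖ ≤ 1) (hℓ : ‖ℓ‖ ≤ Lc) :
    P.leviOp (P.barrier y₀ κ A τ ℓ) y T ≤ κ * P.h₀ (P.drift y T)
      + ℓ (y - y₀) * P.h₀ (P.drift y T) + P.h₀ y * (Lc * c₁)
      + A * (2 * (P.h₀ y + τ * ‖y - y₀‖ ^ 2) * (P.h₀ (P.drift y T) + τ * (2 * c₁ + 2 * c₁ ^ 2))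
        + 8 * τ ^ 2 * c₁ ^ 2 * ‖y - y₀‖ ^ 2) := by
  have hh : 0 ≤ P.h₀ y := P.subset hy
  have hc₁ : 0 ≤ c₁ := (norm_nonneg _).trans hT₁
  have hin : ∀ X : E, ‖X‖ ≤ c₁ → |inner ℝ (y - y₀) X| ≤ c₁ * ‖y - y₀‖ := fun X hX =>
    (abs_real_inner_le_norm _ _).trans (by rw [mul_comm]; gcongr)
  have h1 : ℓ (P.drift y T) ≤ Lc * c₁ :=
    (le_abs_self _).trans ((ℓ.le_of_opNorm_le hℓ _).trans
      (mul_le_mul_of_nonneg_left hV ((norm_nonneg _).trans hℓ)))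
  have h2 := mul_le_mul_of_nonneg_left h1 hh
  have h3 : inner ℝ (y - y₀) (P.drift y T) ≤ c₁ := by
    have := (le_abs_self _).trans (hin _ hV)
    nlinarith
  have hsq : ∀ X : E, ‖X‖ ≤ c₁ →
      (2 * τ * inner ℝ (y - y₀) X) ^ 2 ≤ 4 * τ ^ 2 * c₁ ^ 2 * ‖y - y₀‖ ^ 2 := by
    intro X hX
    have := sq_le_sq' (abs_le.1 (hin X hX)).1 (abs_le.1 (hin X hX)).2
    calc (2 * τ * inner ℝ (y - y₀) X) ^ 2 = 4 * τ ^ 2 * (inner ℝ (y - y₀) X) ^ 2 := by ring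
      _ ≤ 4 * τ ^ 2 * (c₁ * ‖y - y₀‖) ^ 2 := by gcongr
      _ = _ := by ring
  have h4 := hsq _ hT₁
  have h5 := hsq _ hJT₁
  have h6 : ‖T‖ ^ 2 + ‖P.J y T‖ ^ 2 ≤ 2 * c₁ ^ 2 := by
    have h7 : ‖T‖ ^ 2 ≤ c₁ ^ 2 := by gcongr
    have h8 : ‖P.J y T‖ ^ 2 ≤ c₁ ^ 2 := by gcongr
    linarith
  have h7 : P.h₀ (P.drift y T) + 2 * τ * inner ℝ (y - y₀) (P.drift y T)
      + τ * (‖T‖ ^ 2 + ‖P.J y T‖ ^ 2) ≤ P.h₀ (P.drift y T) + τ * (2 * c₁ + 2 * c₁ ^ 2) := by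
    nlinarith [mul_le_mul_of_nonneg_left h3 hτ, mul_le_mul_of_nonneg_left h6 hτ]
  have hd : 0 ≤ 2 * (P.h₀ y + τ * ‖y - y₀‖ ^ 2) := by positivity
  have h8 := mul_le_mul_of_nonneg_left h7 hd
  rw [leviOp_barrier P y₀ κ A τ ℓ hy, hT, hJT]
  have h9 := mul_le_mul_of_nonneg_left (add_le_add (add_le_add h8 h4) h5) hA
  simp only [zero_add, mul_zero, add_zero]
  nlinarith

/-- A crude bound of the complex Hessian of the barrier. -/
theorem abs_leviOp_barrier_le {y₀ y X : E} {κ A τ c₁ Lc K : ℝ} {ℓ : E →L[ℝ] ℝ} (hy : y ∈ P.U)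
    (hX : ‖X‖ ≤ c₁) (hJX : ‖P.J y X‖ ≤ c₁) (hV : ‖P.drift y X‖ ≤ c₁) (hA : 0 ≤ A) (hτ : 0 ≤ τ)
    (hτ1 : τ ≤ 1) (hz : ‖y - y₀‖ ≤ 1) (hℓ : ‖ℓ‖ ≤ Lc) (hκ : |κ| ≤ K) (hy0 : P.h₀ y₀ = 0) :
    |P.leviOp (P.barrier y₀ κ A τ ℓ) y X| ≤ (K + Lc) * (‖P.h₀‖ * c₁) + ‖P.h₀‖ * (Lc * c₁)
      + 2 * (Lc * c₁ * (‖P.h₀‖ * c₁))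
      + A * (2 * (‖P.h₀‖ + 1) * (‖P.h₀‖ * c₁ + 2 * c₁ + 2 * c₁ ^ 2)
        + 2 * (‖P.h₀‖ * c₁ + 2 * c₁) ^ 2) := by
  have hc₁ : 0 ≤ c₁ := (norm_nonneg _).trans hX
  have hLc : 0 ≤ Lc := (norm_nonneg _).trans hℓ
  have hK : 0 ≤ K := (abs_nonneg _).trans hκ
  have hn : 0 ≤ ‖P.h₀‖ := norm_nonneg _
  have hh : ∀ Y : E, ‖Y‖ ≤ c₁ → |P.h₀ Y| ≤ ‖P.h₀‖ * c₁ := fun Y hY =>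
    (P.h₀.le_opNorm Y).trans (by gcongr)
  have hl : ∀ Y : E, ‖Y‖ ≤ c₁ → |ℓ Y| ≤ Lc * c₁ := fun Y hY =>
    (ℓ.le_opNorm Y).trans (by gcongr)
  have hin : ∀ Y : E, ‖Y‖ ≤ c₁ → |2 * τ * inner ℝ (y - y₀) Y| ≤ 2 * c₁ := fun Y hY => by
    rw [abs_mul, abs_of_nonneg (by positivity : 0 ≤ 2 * τ)]
    have h1 : |inner ℝ (y - y₀) Y| ≤ 1 * c₁ :=
      (abs_real_inner_le_norm _ _).trans (by gcongr)
    calc 2 * τ * |inner ℝ (y - y₀) Y| ≤ 2 * 1 * (1 * c₁) := by gcongr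
      _ = _ := by ring
  have hh0 : |P.h₀ y| ≤ ‖P.h₀‖ := by
    have : P.h₀ y = P.h₀ (y - y₀) := by rw [map_sub, hy0, sub_zero]
    rw [this]
    exact (P.h₀.le_opNorm _).trans (mul_le_of_le_one_right hn hz)
  have hlz : |ℓ (y - y₀)| ≤ Lc :=
    (ℓ.le_of_opNorm_le hℓ _).trans (mul_le_of_le_one_right hLc hz)
  have h1 : |(κ + ℓ (y - y₀)) * P.h₀ (P.drift y X)| ≤ (K + Lc) * (‖P.h₀‖ * c₁) := by
    rw [abs_mul]
    exact mul_le_mul ((abs_add_le _ _).trans (add_le_add hκ hlz)) (hh _ hV) (abs_nonneg _)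
      (by positivity)
  have h2 : |P.h₀ y * ℓ (P.drift y X)| ≤ ‖P.h₀‖ * (Lc * c₁) := by
    rw [abs_mul]
    exact mul_le_mul hh0 (hl _ hV) (abs_nonneg _) hn
  have h3 : ∀ Y : E, ‖Y‖ ≤ c₁ → |ℓ Y * P.h₀ Y| ≤ Lc * c₁ * (‖P.h₀‖ * c₁) := fun Y hY => by
    rw [abs_mul]
    exact mul_le_mul (hl _ hY) (hh _ hY) (abs_nonneg _) (by positivity)
  have hsq : ∀ Y : E, ‖Y‖ ≤ c₁ → (P.h₀ Y + 2 * τ * inner ℝ (y - y₀) Y) ^ 2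
      ≤ (‖P.h₀‖ * c₁ + 2 * c₁) ^ 2 := fun Y hY => by
    have := (abs_add_le _ _).trans (add_le_add (hh Y hY) (hin Y hY))
    exact sq_le_sq' (abs_le.1 this).1 (abs_le.1 this).2
  have hN : ‖y - y₀‖ ^ 2 ≤ 1 := pow_le_one₀ (norm_nonneg _) hz
  have h4 : |2 * (P.h₀ y + τ * ‖y - y₀‖ ^ 2)| ≤ 2 * (‖P.h₀‖ + 1) := by
    rw [abs_mul, abs_two]
    refine mul_le_mul_of_nonneg_left ((abs_add_le _ _).trans (add_le_add hh0 ?_)) zero_le_two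
    rw [abs_of_nonneg (by positivity)]
    exact mul_le_one₀ hτ1 (by positivity) hN
  have h5 : |P.h₀ (P.drift y X) + 2 * τ * inner ℝ (y - y₀) (P.drift y X)
      + τ * (‖X‖ ^ 2 + ‖P.J y X‖ ^ 2)| ≤ ‖P.h₀‖ * c₁ + 2 * c₁ + 2 * c₁ ^ 2 := by
    refine (abs_add_le _ _).trans (add_le_add ((abs_add_le _ _).trans
      (add_le_add (hh _ hV) (hin _ hV))) ?_)
    rw [abs_of_nonneg (by positivity)]
    calc τ * (‖X‖ ^ 2 + ‖P.J y X‖ ^ 2) ≤ 1 * (c₁ ^ 2 + c₁ ^ 2) := by gcongr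
      _ = _ := by ring
  have h6 : |2 * (P.h₀ y + τ * ‖y - y₀‖ ^ 2) * (P.h₀ (P.drift y X)
      + 2 * τ * inner ℝ (y - y₀) (P.drift y X) + τ * (‖X‖ ^ 2 + ‖P.J y X‖ ^ 2))|
      ≤ 2 * (‖P.h₀‖ + 1) * (‖P.h₀‖ * c₁ + 2 * c₁ + 2 * c₁ ^ 2) := by
    rw [abs_mul]
    exact mul_le_mul h4 h5 (abs_nonneg _) (by positivity)
  have h7 : |2 * (P.h₀ y + τ * ‖y - y₀‖ ^ 2) * (P.h₀ (P.drift y X)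
      + 2 * τ * inner ℝ (y - y₀) (P.drift y X) + τ * (‖X‖ ^ 2 + ‖P.J y X‖ ^ 2))
      + (P.h₀ X + 2 * τ * inner ℝ (y - y₀) X) ^ 2
      + (P.h₀ (P.J y X) + 2 * τ * inner ℝ (y - y₀) (P.J y X)) ^ 2|
      ≤ 2 * (‖P.h₀‖ + 1) * (‖P.h₀‖ * c₁ + 2 * c₁ + 2 * c₁ ^ 2)
        + 2 * (‖P.h₀‖ * c₁ + 2 * c₁) ^ 2 := by
    rw [abs_le] at h6 ⊢
    have h8 := hsq X hX
    have h9 := hsq _ hJX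
    constructor <;> nlinarith [sq_nonneg (P.h₀ X + 2 * τ * inner ℝ (y - y₀) X),
      sq_nonneg (P.h₀ (P.J y X) + 2 * τ * inner ℝ (y - y₀) (P.J y X)), h6.1, h6.2]
  rw [leviOp_barrier P y₀ κ A τ ℓ hy]
  refine (abs_add_le _ _).trans (add_le_add ((abs_add_le _ _).trans (add_le_add
    ((abs_add_le _ _).trans (add_le_add h1 h2)) ?_)) ?_)
  · have := (abs_add_le _ _).trans (add_le_add (h3 _ hX) (h3 _ hJX))
    linarith
  · rw [abs_mul, abs_of_nonneg hA]
    exact mul_le_mul_of_nonneg_left h7 hA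

end HermitianPatch

end BarrierEstimate

/-! ### Strict positivity along the complex tangent space -/

section LeviLowerBound

variable {E : Type*} [NormedAddCommGroup E] [InnerProductSpace ℝ E] {m : ℕ}
  {Γ : Set (Fin (m + 1) → ℝ)} {f : (Fin (m + 1) → ℝ) → ℝ}

/-- Averaging with weights of total mass one. -/
theorem sum_weighted_affine {μ : Fin m → ℝ} (hμ : ∑ b, μ b = 1) (G S : Fin m → ℝ)
    (z x A d t q : ℝ) :
    ∑ b, μ b * (G b + z * S b + x + A * (2 * d * (S b + t) + q))
      = ∑ b, μ b * G b + z * ∑ b, μ b * S b + x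
        + A * (2 * d * (∑ b, μ b * S b + t) + q) := by
  have h1 : ∀ b, μ b * (G b + z * S b + x + A * (2 * d * (S b + t) + q))
      = μ b * G b + (z + A * (2 * d)) * (μ b * S b) + μ b * (x + A * (2 * d * t + q)) :=
    fun b => by ring
  simp_rw [h1, Finset.sum_add_distrib, ← Finset.mul_sum, ← Finset.sum_mul, hμ]
  ring

theorem abs_sub_le_of_taylor {C t G G₀ S S₀ L₀ L₁ : ℝ} (hC : 0 ≤ C) (ht : 0 ≤ t) (ht1 : t ≤ 1)
    (h0 : |G - G₀ - L₀| ≤ C * t ^ 2) (h1 : |G + 1 * S - (G₀ + 1 * S₀) - L₁| ≤ C * t ^ 2)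
    (h2 : |L₀| ≤ C * t) (h3 : |L₁| ≤ C * t) : |S - S₀| ≤ 4 * C * t := by
  have h4 : C * t ^ 2 ≤ C * t := mul_le_mul_of_nonneg_left (by nlinarith) hC
  rw [abs_le] at *
  constructor <;> linarith [h0.1, h0.2, h1.1, h1.2, h2.1, h2.2, h3.1, h3.2]

/-- The choice of the radius `δ` and of the constants `τ` and `A` of the barrier. -/
theorem exists_barrier_constants {a C c₁ r D : ℝ} (ha : 0 < a) (hC : 0 ≤ C) (hc₁ : 1 ≤ c₁)
    (hr : 0 < r) (hD : 0 ≤ D) :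
    ∃ δ τ A : ℝ, 0 < δ ∧ δ ≤ 1 ∧ δ ≤ r / 2 ∧ 4 * C * δ ≤ a / 2 ∧ 0 < τ ∧ τ ≤ 1 ∧
      τ * (2 * c₁ + 2 * c₁ ^ 2) ≤ a / 4 ∧ 8 * τ * c₁ ^ 2 ≤ a / 4 ∧ 0 ≤ A ∧
      C + C * (4 * C) / a ≤ A * (a * τ / 4) ∧ C / a * c₁ ≤ A * (a / 2) ∧
      D ≤ A * (τ ^ 2 * δ ^ 4) := by
  obtain ⟨δ, hδ0, hδ1, hδr, hδC⟩ :
      ∃ δ : ℝ, 0 < δ ∧ δ ≤ 1 ∧ δ ≤ r / 2 ∧ 4 * C * δ ≤ a / 2 := by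
    refine ⟨min (min 1 (r / 2)) (a / (8 * (C + 1))), by positivity,
      (min_le_left _ _).trans (min_le_left _ _), (min_le_left _ _).trans (min_le_right _ _), ?_⟩
    have h1 : min (min 1 (r / 2)) (a / (8 * (C + 1))) ≤ a / (8 * (C + 1)) := min_le_right _ _
    have h2 : 0 < min (min 1 (r / 2)) (a / (8 * (C + 1))) := by positivity
    rw [le_div_iff₀ (by positivity)] at h1
    linarith
  obtain ⟨τ, hτ0, hτ1, hτ₂, hτ₁⟩ : ∃ τ : ℝ, 0 < τ ∧ τ ≤ 1 ∧
      τ * (2 * c₁ + 2 * c₁ ^ 2) ≤ a / 4 ∧ 8 * τ * c₁ ^ 2 ≤ a / 4 := by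
    refine ⟨min 1 (min (a / (4 * (2 * c₁ + 2 * c₁ ^ 2))) (a / (32 * c₁ ^ 2))), by positivity,
      min_le_left _ _, ?_, ?_⟩
    · have h1 : min 1 (min (a / (4 * (2 * c₁ + 2 * c₁ ^ 2))) (a / (32 * c₁ ^ 2)))
          ≤ a / (4 * (2 * c₁ + 2 * c₁ ^ 2)) := (min_le_right _ _).trans (min_le_left _ _)
      rw [le_div_iff₀ (by positivity)] at h1
      linarith
    · have h1 : min 1 (min (a / (4 * (2 * c₁ + 2 * c₁ ^ 2))) (a / (32 * c₁ ^ 2)))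
          ≤ a / (32 * c₁ ^ 2) := (min_le_right _ _).trans (min_le_right _ _)
      rw [le_div_iff₀ (by positivity)] at h1
      linarith
  have h1 : 0 ≤ (C + C * (4 * C) / a) / (a * τ / 4) := by positivity
  have h2 : 0 ≤ C / a * c₁ / (a / 2) := by positivity
  have h3 : 0 ≤ D / (τ ^ 2 * δ ^ 4) := by positivity
  refine ⟨δ, τ, (C + C * (4 * C) / a) / (a * τ / 4) + C / a * c₁ / (a / 2)
    + D / (τ ^ 2 * δ ^ 4), hδ0, hδ1, hδr, hδC, hτ0, hτ1, hτ₂, hτ₁, by positivity, ?_, ?_, ?_⟩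
  · rw [← div_le_iff₀ (by positivity)]; linarith
  · rw [← div_le_iff₀ (by positivity)]; linarith
  · rw [← div_le_iff₀ (by positivity)]; linarith

/-- The weak maximum principle on a half ball, in the absence of positive interior maxima. -/
theorem nonpos_of_not_isLocalMax [FiniteDimensional ℝ E] {h₀ : E →L[ℝ] ℝ} {F : E → ℝ} {y₀ : E}
    {δ : ℝ}
    (hF : ContinuousOn F (Metric.closedBall y₀ δ ∩ halfSpace h₀))
    (hside : ∀ y ∈ Metric.closedBall y₀ δ ∩ halfSpace h₀, ‖y - y₀‖ = δ → F y ≤ 0)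
    (hflat : ∀ y ∈ Metric.closedBall y₀ δ ∩ halfSpace h₀, h₀ y = 0 → F y ≤ 0)
    (hmax : ∀ y ∈ Metric.closedBall y₀ δ ∩ halfSpace h₀, 0 < h₀ y → ¬ IsLocalMax F y) :
    ∀ y ∈ Metric.closedBall y₀ δ ∩ halfSpace h₀, F y ≤ 0 := by
  by_contra! hex
  obtain ⟨y₁, hy₁, hlt⟩ := hex
  obtain ⟨p, hpΩ, hpmax⟩ := ((isCompact_closedBall y₀ δ).inter_right
    isClosed_halfSpace).exists_isMaxOn ⟨y₁, hy₁⟩ hF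
  have hppos : 0 < F p := hlt.trans_le (hpmax hy₁)
  have hp0 : 0 < h₀ p := lt_of_le_of_ne hpΩ.2 fun h0 =>
    absurd (hflat p hpΩ h0.symm) (not_le.2 hppos)
  have hpδ : ‖p - y₀‖ < δ := lt_of_le_of_ne (by rw [← dist_eq_norm]; exact hpΩ.1) fun h0 =>
    absurd (hside p hpΩ h0) (not_le.2 hppos)
  refine hmax p hpΩ hp0 (hpmax.isLocalMax (inter_mem ?_ ?_))
  · exact mem_of_superset (Metric.isOpen_ball.mem_nhds (by rwa [Metric.mem_ball, dist_eq_norm]))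
      Metric.ball_subset_closedBall
  · exact mem_interior_iff_mem_nhds.1 (mem_interior_halfSpace hp0)

namespace HermitianPatch

variable {P : HermitianPatch E}

/-- If the weighted trace of `𝔤[w]` along complex tangent directions is less than the distance `ε`
which bounded eigenvalues with `f ≥ s` keep from `∂Γ`, then `u - w` has no interior maximum. -/
theorem not_isLocalMax_sub [FiniteDimensional ℝ E] (hm : Module.finrank ℝ E = 2 * (m + 1))
    (hp : IsAdmissiblePair f Γ)
    {s R ε : ℝ} (hε : ∀ l ∈ Γ, (∀ i, |l i| ≤ R) → s ≤ f l → (fun i => l i - ε) ∈ Γ)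
    {A : Set E} {e : Fin (m + 1) → E → E} (he : P.IsAdaptedFrame A e) {u w : E → ℝ}
    (hu : P.IsSupersolvable f Γ s u) (hw : ContDiffOn ℝ 2 w P.U) {y : E} (hy : y ∈ A)
    (hpos : 0 < P.h₀ y) {Z : Fin m → Fin m → ℂ} (hZ : HasOrthonormalRows Z) {μ : Fin m → ℝ}
    (hμ : IsSupporting Γ μ) (hR : ∀ X, P.g y X X = 1 → |P.form w y X X| ≤ R)
    (hlt : ∑ a, μ a * P.form w y (P.tangentFrame e Z y a) (P.tangentFrame e Z y a) < ε) :
    ¬ IsLocalMax (fun z => u z - w z) y := by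
  intro hmax
  have hyU := he.subset hy
  obtain ⟨e', l, hel, hl, hsl⟩ := hu.eigen y hyU hpos
  have hF := he.tangentFrame_unitary hZ hy
  set F : Fin (m + 1) → E := Fin.cons (e 0 y) (P.tangentFrame e Z y) with hFdef
  obtain ⟨h1, h2⟩ := hel.diagonal hp (P.pair y hyU) (hu.hermitian y hyU) hm hl hF
  have hle : (fun i => P.form u y (F i) (F i)) ≤ fun i => P.form w y (F i) (F i) := fun i =>
    form_le_of_isLocalMax hu.smooth hw hyU hpos hmax (F i)
  have h3 := hp.cone.mem_of_le h1 hle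
  have h4 := hε _ h3 (fun i => hR _ (by simpa using hF.1 i i))
    ((hsl.trans h2).trans (hp.mono h1 hle))
  have h5 : (fun a => P.form w y (P.tangentFrame e Z y a) (P.tangentFrame e Z y a) - ε)
      ∈ sectionCone Γ := by
    refine ⟨P.form w y (e 0 y) (e 0 y) - ε, ?_⟩
    convert h4 using 1
    ext i
    refine Fin.cases ?_ (fun i => ?_) i <;> simp [hFdef]
  have h6 := hμ.le_apply _ h5
  simp only [mul_sub, Finset.sum_sub_distrib, ← Finset.sum_mul, hμ.sum_eq_one, one_mul] at h6
  linarith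

/-- A function touching the barrier from below at the boundary point `y₀` has normal derivative
at most the slope `κ` of the barrier. -/
theorem fderivWithin_le_of_le_barrier {F : E → ℝ} {y₀ v : E} {κ A τ : ℝ} {ℓ : E →L[ℝ] ℝ}
    (hF : DifferentiableWithinAt ℝ F P.S y₀) (hy₀ : P.h₀ y₀ = 0) (hv : P.h₀ v = 1)
    (hmax : IsLocalMaxOn (fun y => F y - P.barrier y₀ κ A τ ℓ y) P.S y₀) :
    fderivWithin ℝ F P.S y₀ v ≤ κ := by
  have hder : HasFDerivWithinAt (fun y => F y - P.barrier y₀ κ A τ ℓ y)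
      (fderivWithin ℝ F P.S y₀ - _) P.S y₀ :=
    hF.hasFDerivWithinAt.sub (P.hasFDerivAt_barrier y₀ κ A τ ℓ y₀).hasFDerivWithinAt
  have hcone : v ∈ posTangentConeAt P.S y₀ := by
    refine mem_posTangentConeAt_of_segment_subset (convex_halfSpace.segment_subset hy₀.ge ?_)
    show 0 ≤ P.h₀ (y₀ + v)
    rw [map_add, hy₀, hv]
    norm_num
  have hnp := hmax.hasFDerivWithinAt_nonpos hder hcone
  have hval : ((κ + ℓ (y₀ - y₀)) • P.h₀ + P.h₀ y₀ • ℓ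
        + (2 * A * (P.h₀ y₀ + τ * ‖y₀ - y₀‖ ^ 2)) • (P.h₀ + (2 * τ) • innerSL ℝ (y₀ - y₀))) v
      = κ := by
    simp [hy₀, hv]
  rw [sub_apply, hval] at hnp
  linarith

set_option maxHeartbeats 1000000 in
/-- Quantitative strict positivity of `𝔤[u]` along the complex tangent space of the boundary: the
weighted traces supporting `Γ_∞` have a positive lower bound as soon as they have one for
the boundary form belonging to a smaller normal derivative. -/
theorem exists_levi_lower_bound [FiniteDimensional ℝ E] (hm : Module.finrank ℝ E = 2 * (m + 1))
    (hp : IsAdmissiblePair f Γ) {s : ℝ} (hs : supBoundary f Γ < (s : EReal)) {φ : E → ℝ}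
    (hφ : ContDiffOn ℝ ∞ φ P.U) {yc : E} {r : ℝ} (hr : 0 < r) (hyc : P.h₀ yc = 0)
    {e : Fin (m + 1) → E → E} (he : P.IsAdaptedFrame (Metric.closedBall yc r ∩ P.S) e) {v : E}
    (hv : P.h₀ v = 1) {K ε₀ : ℝ} (hK : 0 ≤ K) (hε₀ : 0 < ε₀) :
    ∃ ε₁ > 0, ∀ y₀ ∈ Metric.closedBall yc (r / 2), P.h₀ y₀ = 0 → ∀ u : E → ℝ,
      P.IsSupersolvable f Γ s u → (∀ y ∈ P.U, |u y| ≤ K) → (∀ y ∈ P.U, P.h₀ y = 0 → u y = φ y) →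
      |fderivWithin ℝ (fun y => u y - φ y) P.S y₀ v| ≤ K →
      ∀ η', |η'| ≤ K → η' ≤ fderivWithin ℝ (fun y => u y - φ y) P.S y₀ v →
      ∀ Z, HasOrthonormalRows Z → ∀ μ, IsSupporting Γ μ → ε₀ ≤ P.leviSum e φ Z μ η' y₀ →
        ε₁ < P.leviSum e φ Z μ (fderivWithin ℝ (fun y => u y - φ y) P.S y₀ v) y₀ := by
  set Ω₀ := Metric.closedBall yc r ∩ P.S with hΩ₀
  have hφ2 : ContDiffOn ℝ 2 φ P.U := hφ.of_le ENat.LEInfty.out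
  have hΩc : IsCompact Ω₀ := (isCompact_closedBall yc r).inter_right isClosed_halfSpace
  obtain ⟨c, hc⟩ := P.exists_bounds hΩc he.subset
  obtain ⟨cφ, hcφ0, hcφ⟩ := P.exists_derivative_bounds hΩc he.subset hφ2
  obtain ⟨C, hC0, hC⟩ := exists_leviSum_taylor hφ hr hyc he Γ (K + 1)
  have hc1 := hc.one_le
  -- bounds for unit vectors and the drift
  obtain ⟨c₁, hc₁⟩ : ∃ c₁, c₁ = c ^ 4 := ⟨_, rfl⟩
  have hc₁1 : 1 ≤ c₁ := hc₁ ▸ one_le_pow₀ hc1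
  have hX : ∀ y ∈ Ω₀, ∀ X, P.g y X X = 1 → ‖X‖ ≤ c₁ ∧ ‖P.J y X‖ ≤ c₁ ∧ ‖P.drift y X‖ ≤ c₁ := by
    intro y hy X hX
    have h1 := hc.norm_unit_le hy hX
    have h2 := hc.norm_J_le hy X
    have h3 := hc.norm_drift_le hy X
    rw [hc₁]
    refine ⟨h1.trans (le_self_pow₀ hc1 (by norm_num)), ?_, ?_⟩
    · calc ‖P.J y X‖ ≤ c * c := h2.trans (by gcongr)
        _ = c ^ 2 := by ring
        _ ≤ c ^ 4 := pow_le_pow_right₀ hc1 (by norm_num)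
    · calc ‖P.drift y X‖ ≤ c ^ 2 * c ^ 2 := h3.trans (by gcongr)
        _ = c ^ 4 := by ring
  obtain ⟨H, hH⟩ : ∃ H, H = ‖P.h₀‖ := ⟨_, rfl⟩
  have hH0 : 0 ≤ H := hH ▸ norm_nonneg _
  have hh₀ : ∀ z, |P.h₀ z| ≤ H * ‖z‖ := fun z => hH ▸ P.h₀.le_opNorm z
  -- `a` bounds the negativity of the weighted Levi form from below: raising the normal derivative
  -- from `η'` to `η`, by at most `2 * K`, decreases the trace by `ε₀ / 2` at least
  obtain ⟨a, ha⟩ : ∃ a, a = ε₀ / (4 * (K + 1)) := ⟨_, rfl⟩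
  have ha0 : 0 < a := by rw [ha]; positivity
  have hLc0 : 0 ≤ C / a := by positivity
  obtain ⟨δ, τ, A, hδ0, hδ1, hδr, hδC, hτ0, hτ1, hτ₂, hτ₁, hA0, hAA₁, hAA₂, hAA₃⟩ :=
    exists_barrier_constants (D := cφ + K + (K + 1 + C / a) * H) ha0 hC0 hc₁1 hr (by positivity)
  obtain ⟨Lc, hLc⟩ : ∃ Lc, Lc = C / a := ⟨_, rfl⟩
  rw [← hLc] at hLc0 hAA₂ hAA₃
  obtain ⟨R, hR⟩ : ∃ R, R = (c * c₁ * c₁ + cφ * (1 + 2 * c ^ 2) * c₁ ^ 2) + ((K + 1 + Lc) * (H * c₁)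
      + H * (Lc * c₁) + 2 * (Lc * c₁ * (H * c₁))
      + A * (2 * (H + 1) * (H * c₁ + 2 * c₁ + 2 * c₁ ^ 2) + 2 * (H * c₁ + 2 * c₁) ^ 2)) := ⟨_, rfl⟩
  obtain ⟨ε₂, hε₂, hshift⟩ := hp.exists_shift_mem hs R
  obtain ⟨ε', hε'0, hε'1, hε'H⟩ : ∃ ε' : ℝ, 0 < ε' ∧ ε' ≤ 1 ∧ ε' * (H * c₁) ≤ ε₂ / 4 := by
    refine ⟨min 1 (ε₂ / (4 * (H * c₁ + 1))), by positivity, min_le_left _ _, ?_⟩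
    have h0 : 0 < min 1 (ε₂ / (4 * (H * c₁ + 1))) := by positivity
    have h1 : min 1 (ε₂ / (4 * (H * c₁ + 1))) ≤ ε₂ / (4 * (H * c₁ + 1)) := min_le_right _ _
    rw [le_div_iff₀ (by positivity)] at h1
    linarith
  refine ⟨min (ε₂ / 2) (ε₀ / 2), by positivity, ?_⟩
  intro y₀ hy₀ hy₀0 u hu huK hbd hηK η' hη'K hη'η Z hZ μ hμ hε₀le
  set η := fderivWithin ℝ (fun y => u y - φ y) P.S y₀ v with hη
  by_contra! hcon
  have hcon₂ := hcon.trans (min_le_left _ _)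
  have hcon₀ := hcon.trans (min_le_right _ _)
  have hy₀S : y₀ ∈ P.S := hy₀0.ge
  have hball : ∀ y, ‖y - y₀‖ ≤ δ → y ∈ Metric.closedBall yc r := fun y hy => by
    rw [Metric.mem_closedBall] at hy₀ ⊢
    calc dist y yc ≤ dist y y₀ + dist y₀ yc := dist_triangle _ _ _
      _ ≤ r / 2 + r / 2 := add_le_add ((dist_eq_norm y y₀ ▸ hy).trans hδr) hy₀
      _ = r := by ring
  have hy₀Ω : y₀ ∈ Ω₀ := ⟨hball y₀ (by simpa using hδ0.le), hy₀S⟩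
  set T := fun y => P.tangentFrame e Z y with hT
  have hTunit : ∀ y ∈ Ω₀, ∀ b, P.g y (T y b) (T y b) = 1 := fun y hy b => by
    simpa using (he.tangentFrame_unitary hZ hy).1 b.succ b.succ
  set Sf : E → ℝ := fun y => ∑ b, μ b * P.h₀ (P.drift y (T y b)) with hSf
  have hSfG : ∀ κ y, P.leviSum e φ Z μ κ y = P.leviSum e φ Z μ 0 y + κ * Sf y := fun κ y =>
    leviSum_eq_add φ Z μ κ y
  have hSf0 : |Sf y₀| ≤ H * c₁ := by
    calc |Sf y₀| ≤ ∑ b, |μ b * P.h₀ (P.drift y₀ (T y₀ b))| := Finset.abs_sum_le_sum_abs _ _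
      _ ≤ ∑ b, μ b * (H * c₁) := by
          refine Finset.sum_le_sum fun b _ => ?_
          rw [abs_mul, abs_of_nonneg (hμ.nonneg b)]
          refine mul_le_mul_of_nonneg_left ((hh₀ _).trans ?_) (hμ.nonneg b)
          exact mul_le_mul_of_nonneg_left (hX y₀ hy₀Ω _ (hTunit y₀ hy₀Ω b)).2.2 hH0
      _ = H * c₁ := by rw [← Finset.sum_mul, hμ.sum_eq_one, one_mul]
  -- the Levi form is negative in the weighted direction
  have hS₀ : Sf y₀ ≤ -a := by
    by_contra! hgt
    have h1 := hSfG η y₀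
    have h2 := hSfG η' y₀
    have h3 : (η - η') * Sf y₀ ≤ -(ε₀ / 2) := by nlinarith
    have h4 : η - η' ≤ 2 * K := by linarith [(abs_le.1 hηK).2, (abs_le.1 hη'K).1]
    have h5 : -(ε₀ / 2) < (η - η') * (-a) := by
      have : 2 * K * a < ε₀ / 2 := by
        rw [ha, ← mul_div_assoc, div_lt_iff₀ (by positivity)]
        nlinarith
      nlinarith
    nlinarith [mul_le_mul_of_nonneg_left hgt.le (sub_nonneg.2 hη'η)]
  -- the slope of the barrier is slightly less than the normal derivative of `u - φ`; a comparison
  -- `u - φ ≤` barrier is therefore absurd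
  set κ := η - ε' with hκ
  have hκK : |κ| ≤ K + 1 := by
    rw [abs_le] at hηK ⊢
    constructor <;> linarith [hηK.1, hηK.2]
  obtain ⟨L, hLn, hL⟩ := hC y₀ hy₀Ω Z hZ μ hμ κ hκK
  obtain ⟨L₀, hL₀n, hL₀⟩ := hC y₀ hy₀Ω Z hZ μ hμ 0 (by rw [abs_zero]; linarith)
  obtain ⟨L₁, hL₁n, hL₁⟩ := hC y₀ hy₀Ω Z hZ μ hμ 1 (by rw [abs_one]; linarith)
  -- `ℓ · Sf` cancels the first order term `L` of the weighted trace at `y₀`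
  set ℓ : E →L[ℝ] ℝ := (-(Sf y₀)⁻¹) • L with hℓ
  have hℓn : ‖ℓ‖ ≤ Lc := by
    rw [hℓ, norm_smul, norm_neg, norm_inv, Real.norm_eq_abs, abs_of_nonpos (by linarith), hLc,
      div_eq_inv_mul]
    refine mul_le_mul ?_ hLn (norm_nonneg _) (by positivity)
    exact inv_anti₀ ha0 (by linarith)
  set w : E → ℝ := fun y => φ y + P.barrier y₀ κ A τ ℓ y with hw
  have hbar2 : ContDiffOn ℝ 2 (P.barrier y₀ κ A τ ℓ) P.U :=
    ((P.contDiff_barrier y₀ κ A τ ℓ).of_le ENat.LEInfty.out).contDiffOn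
  have hw2 : ContDiffOn ℝ 2 w P.U := hφ2.add hbar2
  have hwform : ∀ y ∈ Ω₀, ∀ X, P.form w y X X = P.χ y X (P.J y X) + P.leviOp φ y X
      + P.leviOp (P.barrier y₀ κ A τ ℓ) y X := fun y hy X => by
    rw [form_self w (he.subset hy), leviOp_add hφ2 hbar2 (he.subset hy)]; ring
  set Ω := Metric.closedBall y₀ δ ∩ P.S with hΩ
  have hΩsub : Ω ⊆ Ω₀ := fun y hy => ⟨hball y (by rw [← dist_eq_norm]; exact hy.1), hy.2⟩
  have hΩn : ∀ y ∈ Ω, ‖y - y₀‖ ≤ δ := fun y hy => by rw [← dist_eq_norm]; exact hy.1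
  -- boundedness of the diagonal entries of the form of the barrier
  have hwR : ∀ y ∈ Ω, ∀ X, P.g y X X = 1 → |P.form w y X X| ≤ R := by
    intro y hy X hX1
    have hyΩ := hΩsub hy
    obtain ⟨h1, h2, h3⟩ := hX y hyΩ X hX1
    rw [hwform y hyΩ, hR]
    refine (abs_add_le _ _).trans (add_le_add ((abs_add_le _ _).trans (add_le_add ?_ ?_)) ?_)
    · refine (Bounds.abs_bilin_le (hc.χ_le y hyΩ) _ _).trans ?_
      gcongr
    · refine (hc.abs_leviOp_le hyΩ (hcφ y hyΩ).2.1 (hcφ y hyΩ).2.2 X).trans ?_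
      gcongr
    · rw [hH]
      exact abs_leviOp_barrier_le (he.subset hyΩ) h1 h2 h3 hA0 hτ0.le hτ1
        ((hΩn y hy).trans hδ1) hℓn hκK hy₀0
  -- the weighted trace of the form of the barrier is small
  have hΛ : ∀ y ∈ Ω, ∑ b, μ b * P.form w y (T y b) (T y b) < ε₂ := by
    intro y hy
    have hyΩ := hΩsub hy
    have ht := hΩn y hy
    have hn : 0 ≤ ‖y - y₀‖ := norm_nonneg _
    have hb : ∀ b, P.form w y (T y b) (T y b) ≤ (P.χ y (T y b) (P.J y (T y b))
        + P.leviOp φ y (T y b) + κ * P.h₀ (P.drift y (T y b)))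
        + ℓ (y - y₀) * P.h₀ (P.drift y (T y b)) + P.h₀ y * (Lc * c₁)
        + A * (2 * (P.h₀ y + τ * ‖y - y₀‖ ^ 2)
            * (P.h₀ (P.drift y (T y b)) + τ * (2 * c₁ + 2 * c₁ ^ 2))
          + 8 * τ ^ 2 * c₁ ^ 2 * ‖y - y₀‖ ^ 2) := by
      intro b
      obtain ⟨h1, h2, h3⟩ := hX y hyΩ _ (hTunit y hyΩ b)
      have h4 := leviOp_barrier_tangent_le (y₀ := y₀) (κ := κ) (he.subset hyΩ)
        (he.h₀_tangentFrame Z hyΩ b) (he.h₀_J_tangentFrame Z hyΩ b) h1 h2 h3 hA0 hτ0.le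
        (ht.trans hδ1) hℓn
      rw [hwform y hyΩ]
      linarith only [h4]
    have hsum : ∑ b, μ b * P.form w y (T y b) (T y b) ≤ P.leviSum e φ Z μ κ y
        + ℓ (y - y₀) * Sf y + P.h₀ y * (Lc * c₁)
        + A * (2 * (P.h₀ y + τ * ‖y - y₀‖ ^ 2) * (Sf y + τ * (2 * c₁ + 2 * c₁ ^ 2))
          + 8 * τ ^ 2 * c₁ ^ 2 * ‖y - y₀‖ ^ 2) := by
      refine (Finset.sum_le_sum fun b _ =>
        mul_le_mul_of_nonneg_left (hb b) (hμ.nonneg b)).trans (le_of_eq ?_)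
      exact sum_weighted_affine hμ.sum_eq_one _ _ _ _ _ _ _ _
    have hS : |Sf y - Sf y₀| ≤ 4 * C * ‖y - y₀‖ := by
      have h0 := hL₀ y hyΩ
      have h1 := hL₁ y hyΩ
      rw [hSfG 1 y, hSfG 1 y₀] at h1
      have h2 : |L₀ (y - y₀)| ≤ C * ‖y - y₀‖ := L₀.le_of_opNorm_le hL₀n _
      have h3 : |L₁ (y - y₀)| ≤ C * ‖y - y₀‖ := L₁.le_of_opNorm_le hL₁n _
      exact abs_sub_le_of_taylor hC0 hn (ht.trans hδ1) h0 h1 h2 h3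
    have hG : P.leviSum e φ Z μ κ y ≤ P.leviSum e φ Z μ κ y₀ + L (y - y₀) + C * ‖y - y₀‖ ^ 2 := by
      linarith only [(abs_le.1 (hL y hyΩ)).2]
    have hfin := barrier_arithmetic ha0 hC0 hn ht (show 0 ≤ P.h₀ y from hy.2) hS₀ hS hδC hG
      (L.le_of_opNorm_le hLn _) (show ℓ (y - y₀) = -L (y - y₀) / Sf y₀ by
        rw [hℓ, smul_apply, smul_eq_mul]; ring) hτ0.le hτ₂ hτ₁ hA0 hAA₁ hAA₂
    have hG₀ : P.leviSum e φ Z μ κ y₀ ≤ ε₂ / 2 + ε₂ / 4 := by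
      rw [hSfG κ y₀, hκ, sub_mul]
      have h1 := hSfG η y₀
      have h2 : -(ε' * Sf y₀) ≤ ε' * (H * c₁) := by
        rw [← mul_neg]
        exact mul_le_mul_of_nonneg_left (by linarith [(abs_le.1 hSf0).1]) hε'0.le
      linarith
    linarith
  -- comparison on the boundary of the small half ball
  have hhΩ : ∀ y ∈ Ω, P.h₀ y ≤ H := fun y hy => by
    have h1 : P.h₀ y = P.h₀ (y - y₀) := by rw [map_sub, hy₀0, sub_zero]
    rw [h1]
    exact (le_abs_self _).trans ((hh₀ _).trans
      (mul_le_of_le_one_right hH0 ((hΩn y hy).trans hδ1)))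
  have hside : ∀ y ∈ Ω, ‖y - y₀‖ = δ → u y ≤ w y := by
    intro y hy hyδ
    have h1 := (abs_le.1 (huK y (he.subset (hΩsub hy)))).2
    have h2 := (abs_le.1 (hcφ y (hΩsub hy)).1).1
    have hh0 : 0 ≤ P.h₀ y := hy.2
    have hlz : |ℓ (y - y₀)| ≤ Lc := (ℓ.le_of_opNorm_le hℓn _).trans
      (mul_le_of_le_one_right hLc0 ((hΩn y hy).trans hδ1))
    have h3 : -((K + 1 + Lc) * H) ≤ (κ + ℓ (y - y₀)) * P.h₀ y := by
      have h4 : |(κ + ℓ (y - y₀)) * P.h₀ y| ≤ (K + 1 + Lc) * H := by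
        rw [abs_mul, abs_of_nonneg hh0]
        exact mul_le_mul ((abs_add_le _ _).trans (add_le_add hκK hlz)) (hhΩ y hy) hh0
          (by positivity)
      exact (abs_le.1 h4).1
    have h4 : τ ^ 2 * δ ^ 4 ≤ (P.h₀ y + τ * ‖y - y₀‖ ^ 2) ^ 2 := by
      rw [hyδ]
      calc τ ^ 2 * δ ^ 4 = (τ * δ ^ 2) ^ 2 := by ring
        _ ≤ _ := by gcongr; linarith
    have h5 := mul_le_mul_of_nonneg_left h4 hA0
    simp only [hw, barrier]
    linarith
  have hflat : ∀ y ∈ Ω, P.h₀ y = 0 → u y ≤ w y := by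
    intro y hy hy0
    rw [hbd y (he.subset (hΩsub hy)) hy0]
    simp only [hw, barrier, hy0, mul_zero, zero_add]
    have : 0 ≤ A * (τ * ‖y - y₀‖ ^ 2) ^ 2 := by positivity
    linarith
  have hcomp : ∀ y ∈ Ω, u y - w y ≤ 0 := nonpos_of_not_isLocalMax
    ((hu.smooth.sub hw2).continuousOn.mono (hΩsub.trans he.subset))
    (fun y hy hyδ => sub_nonpos.2 (hside y hy hyδ)) (fun y hy hy0 => sub_nonpos.2 (hflat y hy hy0))
    fun y hy hy0 => not_isLocalMax_sub hm hp hshift he hu hw2 (hΩsub hy) hy0 hZ hμ (hwR y hy)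
      (hΛ y hy)
  -- the normal derivatives at `y₀` contradict the comparison
  have hy₀Ω' : y₀ ∈ Ω := ⟨Metric.mem_closedBall_self hδ0.le, hy₀S⟩
  have hw₀ : w y₀ = u y₀ := by
    rw [hbd y₀ (he.subset hy₀Ω) hy₀0]
    simp [hw, barrier, hy₀0]
  have hmaxOn : IsLocalMaxOn (fun y => (u y - φ y) - P.barrier y₀ κ A τ ℓ y) P.S y₀ := by
    have hmem : Ω ∈ 𝓝[P.S] y₀ := by
      rw [hΩ, inter_comm]
      exact inter_mem self_mem_nhdsWithin
        (mem_nhdsWithin_of_mem_nhds (Metric.closedBall_mem_nhds y₀ hδ0))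
    filter_upwards [hmem] with y hy
    have h1 := hcomp y hy
    have h2 : u y₀ - φ y₀ - P.barrier y₀ κ A τ ℓ y₀ = 0 := by
      simp only [hw] at hw₀
      linarith
    simp only [hw] at h1
    rw [h2]
    linarith
  have hdiff := ((hu.smooth.sub hφ2).contDiffWithinAt_halfSpace P.mem_nhdsWithin
    (he.subset hy₀Ω)).differentiableWithinAt (by simp)
  have hle : η ≤ κ := fderivWithin_le_of_le_barrier hdiff hy₀0 hv hmaxOn
  linarith

end HermitianPatch

end LeviLowerBound

/-! ### Strict comparison of eigenvalues -/

section StrictComparison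

variable {E : Type*} [NormedAddCommGroup E] [NormedSpace ℝ E] {m : ℕ}
  {Γ : Set (Fin (m + 1) → ℝ)} {f : (Fin (m + 1) → ℝ) → ℝ} {J : E →L[ℝ] E}
  {g : E →L[ℝ] E →L[ℝ] ℝ} {B : LinearMap.BilinForm ℝ E}

/-- A unit vector can be completed to a unitary frame which diagonalizes a Hermitian form on the
complement of that vector. -/
theorem exists_frame_diagonalizing_complement [FiniteDimensional ℝ E] (hJ : IsHermitianPair J g)
    (hB : IsHermitianForm J B) (hm : Module.finrank ℝ E = 2 * (m + 1)) {X : E} (hX : g X X = 1) :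
    ∃ (T : Fin m → E) (l : Fin m → ℝ), IsUnitaryFrame J g (Fin.cons X T : Fin (m + 1) → E) ∧
      (∀ a b, B (T a) (T b) = if a = b then l a else 0) ∧ ∀ a b, B (T a) (J (T b)) = 0 := by
  obtain ⟨e, he⟩ := IsUnitaryFrame.exists_extension hJ hm hX m le_rfl
  obtain ⟨Z, l, hZ, h1, h2⟩ := exists_diagonalization hJ hB e
  exact ⟨_, l, by simpa using he.cons_complexCombination hJ hZ, h1, h2⟩

/-- Polarization: a bound for a symmetric form on unit vectors bounds its entries. -/
theorem abs_le_of_orthogonal (hJ : IsHermitianPair J g) (hB : IsHermitianForm J B) {R : ℝ}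
    (hR : ∀ X, g X X = 1 → |B X X| ≤ R) {X Y : E} (hX : g X X = 1) (hY : g Y Y = 1)
    (hXY : g X Y = 0) : |B X Y| ≤ 2 * R := by
  have h2 : (√2)⁻¹ * (√2)⁻¹ = (1 / 2 : ℝ) := by
    rw [← mul_inv, Real.mul_self_sqrt (by norm_num)]; norm_num
  have h1 : g ((√2)⁻¹ • (X + Y)) ((√2)⁻¹ • (X + Y)) = 1 := by
    simp only [map_smul, map_add, smul_apply, add_apply, smul_eq_mul, hX, hY, hXY, hJ.symm Y X]
    linear_combination 2 * h2
  have h3 := hR _ h1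
  have h4 : B ((√2)⁻¹ • (X + Y)) ((√2)⁻¹ • (X + Y)) = (B X X + B Y Y) / 2 + B X Y := by
    simp only [map_smul, map_add, LinearMap.smul_apply, LinearMap.add_apply, smul_eq_mul,
      hB.symm Y X]
    linear_combination (B X X + B Y Y + 2 * B X Y) * h2
  rw [h4] at h3
  have h5 := hR X hX
  have h6 := hR Y hY
  rw [abs_le] at *
  constructor <;> linarith [h3.1, h3.2, h5.1, h5.2, h6.1, h6.2]

/-- Strict monotonicity under a perturbation which is very positive in one complex direction `X`
and slightly negative otherwise. The perturbed form is a convex combination of `B` and of a form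
whose eigenvalue in the direction of `X` is so large that the unbounded condition applies. -/
theorem exists_strict_improvement [FiniteDimensional ℝ E] (hm : Module.finrank ℝ E = 2 * (m + 1))
    (hp : IsAdmissiblePair f Γ) {s : ℝ}
    (hs : supBoundary f Γ < (s : EReal)) {R : ℝ} (hR : 0 < R) :
    ∃ κ₀ > 0, ∃ t₀ > 0, ∀ (J : E →L[ℝ] E) (g : E →L[ℝ] E →L[ℝ] ℝ) (B B' : LinearMap.BilinForm ℝ E)
      (e e' : Fin (m + 1) → E) (l l' : Fin (m + 1) → ℝ) (X : E) (κ t : ℝ), IsHermitianPair J g →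
      IsHermitianForm J B → IsEigenframe J g B e l → IsEigenframe J g B' e' l' → l ∈ Γ → s ≤ f l →
      (∀ X, g X X = 1 → |B X X| ≤ R) → g X X = 1 → κ₀ ≤ κ → 0 < t → t ≤ t₀ →
      (∀ a, B a a + t * (κ * frameWeight J g a X - g a a) ≤ B' a a) → f l < f l' := by
  obtain ⟨ε, hε, hshift⟩ := hp.exists_shift_mem hs R
  obtain ⟨T₀, hT₀⟩ := hp.exists_uniform_lift (hp.lt_supOn (hp.cone.const_mem hR)) R hε
  obtain ⟨t₁, ht₁⟩ : ∃ t₁, t₁ = ε / 4 := ⟨_, rfl⟩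
  have ht₁0 : 0 < t₁ := by rw [ht₁]; positivity
  set Q : ℝ := T₀ + R + (m * (8 * R ^ 2)) / t₁ with hQ
  refine ⟨1 + |Q| / t₁, by positivity, t₁, ht₁0, ?_⟩
  intro J g B B' e e' l l' X κ t hJ hB he he' hl hsl hRB hX hκ ht htt₁ hle
  obtain ⟨T, lam, hF, h1, h2⟩ := exists_frame_diagonalizing_complement hJ hB hm hX
  set F : Fin (m + 1) → E := Fin.cons X T with hFdef
  have hTT : ∀ a, g (T a) (T a) = 1 := fun a => by simpa [hFdef] using hF.1 a.succ a.succ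
  have hXT : ∀ a, g X (T a) = 0 := fun a => by
    simpa [hFdef, (Fin.succ_ne_zero a).symm] using hF.1 0 a.succ
  have hXJT : ∀ a, g X (J (T a)) = 0 := fun a => by simpa [hFdef] using hF.2 0 a.succ
  -- the diagonal of `B` in the new frame stays away from the boundary of the cone
  obtain ⟨hd, hfd⟩ := he.diagonal hp hJ hB hm hl hF
  have hd' := hshift _ hd (fun i => hRB _ (by simpa using hF.1 i i)) (hsl.trans hfd)
  have hlam : ∀ a, B (T a) (T a) = lam a := fun a => by rw [h1, if_pos rfl]
  have hsec : (fun a => lam a - ε) ∈ sectionCone Γ := by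
    refine ⟨B X X - ε, ?_⟩
    convert hd' using 1
    ext i
    refine Fin.cases ?_ (fun i => ?_) i <;> simp [hFdef, hlam]
  have hlamR : ∀ a, |lam a| ≤ R := fun a => hlam a ▸ hRB _ (hTT a)
  -- the coefficient in the direction of `X` exceeds the threshold
  set q₀ := ∑ a, (B X (T a) ^ 2 + B X (J (T a)) ^ 2) with hq₀
  have hq₀le : q₀ ≤ m * (8 * R ^ 2) := by
    calc q₀ ≤ ∑ _a : Fin m, 8 * R ^ 2 := by
          refine Finset.sum_le_sum fun a _ => ?_
          have h3 := sq_le_sq' (abs_le.1 (abs_le_of_orthogonal hJ hB hRB hX (hTT a) (hXT a))).1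
            (abs_le.1 (abs_le_of_orthogonal hJ hB hRB hX (hTT a) (hXT a))).2
          have h4 := abs_le_of_orthogonal hJ hB hRB hX (by rw [hJ.inv]; exact hTT a) (hXJT a)
          have h5 := sq_le_sq' (abs_le.1 h4).1 (abs_le.1 h4).2
          linarith
      _ = m * (8 * R ^ 2) := by simp
  have htop : T₀ ≤ B X X - q₀ / t₁ + t₁ * (κ - 1) := by
    have h3 : |Q| ≤ t₁ * (κ - 1) := by
      rw [← div_le_iff₀' ht₁0]; linarith
    have h4 := (abs_le.1 (hRB X hX)).1
    have h5 : q₀ / t₁ ≤ (m * (8 * R ^ 2)) / t₁ := by gcongr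
    linarith [le_abs_self Q]
  obtain ⟨hD, hND⟩ := hT₀ lam hlamR (subset_closure hsec) _ htop
  set D : Fin (m + 1) → ℝ := Fin.cons (B X X - q₀ / t₁ + t₁ * (κ - 1)) fun a => lam a - ε / 2
    with hDdef
  have hBD : ∀ a, ∑ i, D i * frameWeight J g a (F i)
      ≤ B a a + t₁ * (κ * frameWeight J g a X - g a a) := by
    intro a
    have h3 := arrow_lower_bound hJ hB hm hF h1 h2 ht₁0 a
    have h4 := hF.parseval hJ hm a
    rw [Fin.sum_univ_succ] at h3 h4 ⊢
    simp only [hDdef, hFdef, Fin.cons_zero, Fin.cons_succ] at h3 h4 ⊢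
    have h5 : ∑ i, (lam i - ε / 2) * frameWeight J g a (T i)
        = ∑ i, (lam i - t₁) * frameWeight J g a (T i) - t₁ * ∑ i, frameWeight J g a (T i) := by
      rw [Finset.mul_sum, ← Finset.sum_sub_distrib]
      refine Finset.sum_congr rfl fun i _ => ?_
      rw [ht₁]; ring
    rw [h5]
    linear_combination h3 + t₁ * h4
  -- the lower bound for `B'` is the convex combination with weight `θ = t / t₁` of `B` and of the
  -- form with eigenvalues `D`, and `f D` exceeds the value `f (R, …, R) ≥ f l`
  have hfl : f l ≤ f fun _ => R := hp.mono hl fun i => by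
    have h3 := he.2 i (e i)
    rw [he.1.1, if_pos rfl, mul_one] at h3
    rw [← h3]
    exact (abs_le.1 (hRB _ (by simpa using he.1.1 i i))).2
  set θ := t / t₁ with hθ
  have hθ0 : 0 < θ := by positivity
  have hθ1 : θ ≤ 1 := (div_le_one ht₁0).2 htt₁
  have ht : t = θ * t₁ := by rw [hθ, div_mul_cancel₀ _ ht₁0.ne']
  obtain ⟨hW, hfW⟩ := hp.mulVec_doublyStochastic (he'.1.doublyStochastic_weight hJ he.1 hm) hl
  obtain ⟨hW', hfW'⟩ := hp.mulVec_doublyStochastic (he'.1.doublyStochastic_weight hJ hF hm) hD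
  have hz := hp.cone.convex hW hW' (sub_nonneg.2 hθ1) hθ0.le (by ring)
  have hfz := hp.concave.2 hW hW' (sub_nonneg.2 hθ1) hθ0.le (by ring)
  have hzl : (1 - θ) • (Matrix.of fun i j => frameWeight J g (e' i) (e j)).mulVec l
      + θ • (Matrix.of fun i j => frameWeight J g (e' i) (F j)).mulVec D ≤ l' := by
    intro i
    have h3 := hle (e' i)
    rw [he'.2 i, he'.1.1, if_pos rfl, mul_one] at h3
    have h4 := hBD (e' i)
    have h5 := he.quadratic_eq hJ hB hm (e' i)
    have h6 := mul_le_mul_of_nonneg_left h4 hθ0.le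
    simp only [Pi.add_apply, Pi.smul_apply, smul_eq_mul, Matrix.mulVec, dotProduct,
      Matrix.of_apply]
    simp only [mul_comm (frameWeight J g _ _)]
    rw [← h5]
    rw [ht] at h3
    rw [he'.1.1, if_pos rfl] at h6
    linarith
  have hmono := hp.mono hz hzl
  simp only [smul_eq_mul] at hfz
  nlinarith [mul_le_mul_of_nonneg_left hfW (sub_nonneg.2 hθ1),
    mul_lt_mul_of_pos_left (hND.trans_le hfW') hθ0, mul_le_mul_of_nonneg_left hfl hθ0.le]

end StrictComparison

/-! ### The strong maximum principle -/

section StrongMaximum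

variable {E : Type*} [NormedAddCommGroup E] [InnerProductSpace ℝ E]

/-- If a nonpositive function vanishes at the centre of a ball without vanishing near the centre,
some closed ball touches its zero set from outside at exactly one point. -/
theorem exists_touching_ball [FiniteDimensional ℝ E] {F : E → ℝ} {x₀ z : E} {ρ : ℝ}
    (hF : ContinuousOn F (Metric.ball x₀ ρ)) (h0 : F x₀ = 0)
    (hle : ∀ y ∈ Metric.ball x₀ ρ, F y ≤ 0) (hz : z ∈ Metric.ball x₀ (ρ / 2)) (hFz : F z ≠ 0) :
    ∃ q p, p ≠ q ∧ Metric.closedBall q ‖p - q‖ ⊆ Metric.ball x₀ ρ ∧ F p = 0 ∧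
      ∀ y ∈ Metric.closedBall q ‖p - q‖, y ≠ p → F y < 0 := by
  have hzd : dist z x₀ < ρ / 2 := hz
  have hsub : Metric.closedBall z (dist z x₀) ⊆ Metric.ball x₀ ρ := fun y hy => by
    rw [Metric.mem_ball]
    calc dist y x₀ ≤ dist y z + dist z x₀ := dist_triangle _ _ _
      _ ≤ dist z x₀ + dist z x₀ := by gcongr; exact hy
      _ < ρ := by linarith
  have hx₀ : x₀ ∈ Metric.closedBall z (dist z x₀) := by
    rw [Metric.mem_closedBall, dist_comm]
  have hcomp : IsCompact (Metric.closedBall z (dist z x₀) ∩ F ⁻¹' {0}) :=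
    (isCompact_closedBall z _).of_isClosed_subset
      ((hF.mono hsub).preimage_isClosed_of_isClosed Metric.isClosed_closedBall isClosed_singleton)
      inter_subset_left
  obtain ⟨p, ⟨hpz, hp0⟩, hpmin⟩ := hcomp.exists_isMinOn ⟨x₀, hx₀, h0⟩
    (f := fun y => ‖y - z‖) (by fun_prop)
  have hp0 : F p = 0 := hp0
  have hpz' : p ≠ z := fun h => hFz (h ▸ hp0)
  have hpq : p - (z + (1 / 2 : ℝ) • (p - z)) = (1 / 2 : ℝ) • (p - z) := by module
  have hkey : ∀ y ∈ Metric.closedBall (z + (1 / 2 : ℝ) • (p - z))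
      ‖p - (z + (1 / 2 : ℝ) • (p - z))‖,
      ‖y - z‖ ^ 2 ≤ inner ℝ (y - z) (p - z) := by
    intro y hy
    rw [hpq, Metric.mem_closedBall, dist_eq_norm] at hy
    have h1 : ‖(y - z) - (1 / 2 : ℝ) • (p - z)‖ ^ 2 ≤ ‖(1 / 2 : ℝ) • (p - z)‖ ^ 2 := by
      refine pow_le_pow_left₀ (norm_nonneg _) ?_ 2
      rwa [sub_sub]
    rw [norm_sub_sq_real, inner_smul_right] at h1
    linarith
  have hin : ∀ y ∈ Metric.closedBall (z + (1 / 2 : ℝ) • (p - z))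
      ‖p - (z + (1 / 2 : ℝ) • (p - z))‖, ‖y - z‖ ≤ ‖p - z‖ := by
    intro y hy
    have h1 := hkey y hy
    have h2 := real_inner_le_norm (y - z) (p - z)
    by_contra! h3
    nlinarith [norm_nonneg (y - z), norm_nonneg (p - z)]
  have hin' : Metric.closedBall (z + (1 / 2 : ℝ) • (p - z))
      ‖p - (z + (1 / 2 : ℝ) • (p - z))‖ ⊆ Metric.closedBall z (dist z x₀) := fun y hy => by
    rw [Metric.mem_closedBall, dist_eq_norm] at hpz ⊢
    exact (hin y hy).trans hpz
  -- the midpoint of `z` and a nearest zero `p` is the centre of the touching ball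
  refine ⟨z + (1 / 2 : ℝ) • (p - z), p, fun h => hpz' ?_, hin'.trans hsub, hp0, fun y hy hyp => ?_⟩
  · rw [← sub_eq_zero, hpq] at h
    exact sub_eq_zero.1 ((smul_eq_zero.1 h).resolve_left (by norm_num))
  · refine lt_of_le_of_ne (hle y (hsub (hin' hy))) fun hy0 => hyp ?_
    have h1 : ‖p - z‖ ≤ ‖y - z‖ := hpmin ⟨hin' hy, hy0⟩
    have h2 := hkey y hy
    have h3 : ‖(y - z) - (p - z)‖ ^ 2 ≤ 0 := by
      rw [norm_sub_sq_real]
      nlinarith [norm_nonneg (y - z), norm_nonneg (p - z)]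
    have h4 : (y - z) - (p - z) = 0 := norm_eq_zero.1 (by nlinarith [norm_nonneg (y - z - (p - z))])
    simpa [sub_eq_zero] using h4

/-- The radial barrier of the strong maximum principle. -/
def radialBarrier (q : E) (α η : ℝ) (y : E) : ℝ := η * Real.exp (-α * ‖y - q‖ ^ 2)

theorem contDiff_radialBarrier (q : E) (α η : ℝ) : ContDiff ℝ ∞ (radialBarrier q α η) := by
  have h1 : ContDiff ℝ ∞ fun y : E => ‖y - q‖ ^ 2 := (contDiff_id.sub contDiff_const).norm_sq ℝ
  unfold radialBarrier
  fun_prop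

theorem hasFDerivAt_radialBarrier (q : E) (α η : ℝ) (y : E) :
    HasFDerivAt (radialBarrier q α η)
      ((-(2 * α) * radialBarrier q α η y) • innerSL ℝ (y - q)) y := by
  have h0 : HasFDerivAt (fun y => y - q) (ContinuousLinearMap.id ℝ E) y :=
    (hasFDerivAt_id y).sub_const q
  have h1 : HasFDerivAt (fun y => ‖y - q‖ ^ 2) (2 • (innerSL ℝ (y - q))) y := by
    simpa using h0.norm_sq
  refine ((h1.const_mul (-α)).exp.const_mul η).congr_fderiv ?_
  ext a
  simp [radialBarrier]
  ring

namespace HermitianPatch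

variable {P : HermitianPatch E}

theorem leviOp_radialBarrier (P : HermitianPatch E) (q : E) (α η : ℝ) {y : E} (hy : y ∈ P.U)
    (a : E) :
    P.leviOp (radialBarrier q α η) y a = α * radialBarrier q α η y *
      (2 * α * (inner ℝ (y - q) a ^ 2 + inner ℝ (y - q) (P.J y a) ^ 2)
        - (‖a‖ ^ 2 + ‖P.J y a‖ ^ 2) - 2 * inner ℝ (y - q) (P.drift y a)) := by
  have huniq := uniqueDiffOn_halfSpace P.exists_eq_one
  have hD : ∀ z ∈ P.S, fderivWithin ℝ (radialBarrier q α η) P.S z = _ := fun z hz =>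
    (hasFDerivAt_radialBarrier q α η z).hasFDerivWithinAt.fderivWithin (huniq z hz)
  have hD2 : ∀ b, secondDerivWithin P.S (radialBarrier q α η) y b b
      = radialBarrier q α η y * (4 * α ^ 2 * inner ℝ (y - q) b ^ 2 - 2 * α * ‖b‖ ^ 2) := by
    intro b
    have h1 := hasFDerivWithinAt_fderivWithin P.exists_eq_one P.subset P.mem_nhdsWithin
      (((contDiff_radialBarrier q α η).of_le ENat.LEInfty.out).contDiffOn
        (s := P.U)) hy
    have h2 := (ContinuousLinearMap.apply ℝ ℝ b).hasFDerivAt.comp_hasFDerivWithinAt y h1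
    have h0 : HasFDerivAt (fun y => y - q) (ContinuousLinearMap.id ℝ E) y :=
      (hasFDerivAt_id y).sub_const q
    have hi : HasFDerivAt (fun y => inner ℝ (y - q) b) (innerSL ℝ b) y := by
      have h5 := (innerSL ℝ b).hasFDerivAt.comp y h0
      refine (h5.congr_fderiv (by ext; simp)).congr_of_eventuallyEq
        (Eventually.of_forall fun z => ?_)
      simp [real_inner_comm]
    have h3 := (((hasFDerivAt_radialBarrier q α η y).const_mul (-(2 * α))).mul
      hi).hasFDerivWithinAt (s := P.S)
    have heq : ∀ z ∈ P.S, ((ContinuousLinearMap.apply ℝ ℝ b) ∘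
        fderivWithin ℝ (radialBarrier q α η) (halfSpace P.h₀)) z
          = -(2 * α) * radialBarrier q α η z * inner ℝ (z - q) b := fun z hz => by
      simp only [Function.comp_apply, ContinuousLinearMap.apply_apply]
      rw [hD z hz]
      simp only [smul_apply, innerSL_apply_apply, smul_eq_mul]
    have h4 := h3.congr heq (heq y (P.subset hy))
    have h5 := (huniq y (P.subset hy)).eq h2 h4
    have h6 := DFunLike.congr_fun h5 b
    simp only [ContinuousLinearMap.comp_apply, ContinuousLinearMap.apply_apply, add_apply,
      smul_apply, innerSL_apply_apply, smul_eq_mul, real_inner_self_eq_norm_sq] at h6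
    rw [h6]
    ring
  rw [leviOp, hD2, hD2, hD y (P.subset hy)]
  simp only [smul_apply, innerSL_apply_apply, smul_eq_mul]
  ring

/-- Diagonal bound for `𝔤[u]` from bounds of the derivatives of `u`. -/
theorem Bounds.abs_form_le {A : Set E} {c c' : ℝ} (hc : P.Bounds A c) (hAU : A ⊆ P.U) {y : E}
    (hy : y ∈ A) {u : E → ℝ} (h1 : ‖fderivWithin ℝ u P.S y‖ ≤ c')
    (h2 : ‖secondDerivWithin P.S u y‖ ≤ c') {X : E} (hX : P.g y X X = 1) :
    |P.form u y X X| ≤ c * c * (c * c) + c' * (1 + 2 * c ^ 2) * c ^ 2 := by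
  have hc0 : 0 ≤ c := zero_le_one.trans hc.one_le
  have hc' : 0 ≤ c' := (norm_nonneg _).trans h1
  have hn := hc.norm_unit_le hy hX
  rw [form_self u (hAU hy)]
  refine (abs_add_le _ _).trans (add_le_add ?_ ?_)
  · refine (abs_bilin_le (hc.χ_le y hy) _ _).trans ?_
    have := hc.norm_J_le hy X
    calc c * ‖X‖ * ‖P.J y X‖ ≤ c * c * (c * ‖X‖) := by gcongr
      _ ≤ c * c * (c * c) := by gcongr
  · refine (hc.abs_leviOp_le hy h1 h2 X).trans ?_
    gcongr

/-- The complex Hessian of the radial barrier is very positive in the direction dual to the radial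
one and only slightly negative otherwise. -/
theorem le_leviOp_radialBarrier [FiniteDimensional ℝ E] {A : Set E} {c : ℝ} (hc : P.Bounds A c)
    (hAU : A ⊆ P.U) {y q : E} (hy : y ∈ A) {r₁ r₂ α η κ₀ C₂ : ℝ} (hr₁ : 0 < r₁)
    (h1 : r₁ ≤ ‖y - q‖) (h2 : ‖y - q‖ ≤ r₂) (hα : 0 < α) (hη : 0 < η)
    (hC₂ : C₂ = (1 + c ^ 2 + 2 * r₂ * c ^ 2) * c) (hκ₀ : κ₀ ≤ 2 * α * (r₁ ^ 2 / c) / C₂) :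
    ∃ X, P.g y X X = 1 ∧ ∃ κ ≥ κ₀, ∀ a,
      α * radialBarrier q α η y * C₂ * (κ * frameWeight (P.J y) (P.g y) a X - P.g y a a)
        ≤ P.leviOp (radialBarrier q α η) y a := by
  have hJ := P.pair y (hAU hy)
  have hc0 : 0 < c := zero_lt_one.trans_le hc.one_le
  have hr₂ : 0 < r₂ := hr₁.trans_le (h1.trans h2)
  have hC₂0 : 0 < C₂ := by rw [hC₂]; positivity
  simp only [P.leviOp_radialBarrier q α η (hAU hy)]
  obtain ⟨x, hx⟩ : ∃ x, x = y - q := ⟨_, rfl⟩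
  rw [← hx] at h1 h2 ⊢
  obtain ⟨Φ, hΦ⟩ := ContinuousLinearMap.isInvertible_of_pos hJ.pos
  obtain ⟨G, hG⟩ : ∃ G, ∀ a, P.g y G a = inner ℝ x a := by
    refine ⟨Φ.symm (innerSL ℝ x), fun a => ?_⟩
    rw [← hΦ]
    simp
  have hGG : r₁ ^ 2 / c ≤ P.g y G G := by
    have h3 := hJ.nonneg (x - c • G)
    have h4 : P.g y x x ≤ c * ‖x‖ * ‖x‖ :=
      (le_abs_self _).trans (Bounds.abs_bilin_le (hc.g_le y hy) _ _)
    have h6 := hG x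
    rw [real_inner_self_eq_norm_sq] at h6
    simp only [map_sub, map_smul, sub_apply, smul_apply, smul_eq_mul, hJ.symm x G, h6] at h3
    rw [div_le_iff₀ hc0]
    have h7 : r₁ ^ 2 ≤ ‖x‖ ^ 2 := by gcongr
    have h8 : 0 ≤ c * (P.g y G G * c - ‖x‖ ^ 2) := by linarith
    linarith [nonneg_of_mul_nonneg_right h8 hc0]
  have hG0 : 0 < P.g y G G := lt_of_lt_of_le (by positivity) hGG
  have hs : (√(P.g y G G))⁻¹ * (√(P.g y G G))⁻¹ = (P.g y G G)⁻¹ := by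
    rw [← mul_inv, Real.mul_self_sqrt hG0.le]
  refine ⟨(√(P.g y G G))⁻¹ • G, ?_, 2 * α * P.g y G G / C₂, ?_, fun a => ?_⟩
  · simp only [map_smul, smul_apply, smul_eq_mul]
    rw [← mul_assoc, hs, inv_mul_cancel₀ hG0.ne']
  · refine hκ₀.trans ?_
    gcongr
  · have hw : frameWeight (P.J y) (P.g y) a ((√(P.g y G G))⁻¹ • G)
        = (P.g y G G)⁻¹ * (inner ℝ x a ^ 2 + inner ℝ x (P.J y a) ^ 2) := by
      have h3 := hJ.apply_J_left a G
      rw [hJ.symm (P.J y a) G, hG] at h3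
      rw [frameWeight, ← hs]
      simp only [map_smul, smul_eq_mul, hJ.symm a G, hG]
      rw [show P.g y a (P.J y G) = -inner ℝ x (P.J y a) by linarith]
      ring
    have hn := hc.sq_norm_le y hy a
    have hJn := hc.norm_J_le hy a
    have hd := (abs_le.1 (abs_real_inner_le_norm x (P.drift y a))).2
    have hd2 : ‖x‖ * ‖P.drift y a‖ ≤ r₂ * (c ^ 2 * ‖a‖ ^ 2) := by
      gcongr
      exact hc.norm_drift_le hy a
    have hJ2 : ‖P.J y a‖ ^ 2 ≤ c ^ 2 * ‖a‖ ^ 2 := by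
      rw [← mul_pow]; gcongr
    have hb : 0 < radialBarrier q α η y := by unfold radialBarrier; positivity
    have hkey : (‖a‖ ^ 2 + ‖P.J y a‖ ^ 2) + 2 * inner ℝ x (P.drift y a) ≤ C₂ * P.g y a a := by
      have h3 := mul_le_mul_of_nonneg_left hn
        (show 0 ≤ 1 + c ^ 2 + 2 * r₂ * c ^ 2 by positivity)
      rw [hC₂]
      linarith
    rw [hw, mul_assoc (α * _)]
    refine mul_le_mul_of_nonneg_left ?_ (by positivity)
    have h4 : C₂ * (2 * α * P.g y G G / C₂ * ((P.g y G G)⁻¹ * (inner ℝ x a ^ 2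
        + inner ℝ x (P.J y a) ^ 2)) - P.g y a a)
        = 2 * α * (inner ℝ x a ^ 2 + inner ℝ x (P.J y a) ^ 2) - C₂ * P.g y a a := by
      field_simp
    rw [h4]
    linarith

/-- The strong maximum principle for the difference of a subsolution `v` and a solution `u`. -/
theorem sub_eq_of_isMax [FiniteDimensional ℝ E] {m : ℕ} {Γ : Set (Fin (m + 1) → ℝ)}
    {f : (Fin (m + 1) → ℝ) → ℝ} (hm : Module.finrank ℝ E = 2 * (m + 1))
    (hp : IsAdmissiblePair f Γ) {s : ℝ} (hs : supBoundary f Γ < (s : EReal)) {u v : E → ℝ}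
    (hu : ContDiffOn ℝ 2 u P.U) (hv : ContDiffOn ℝ 2 v P.U)
    (hvB : ∀ y ∈ P.U, IsHermitianForm (P.J y) (P.form v y))
    (hcmp : ∀ y ∈ P.U, 0 < P.h₀ y → ∃ e l e' l', IsEigenframe (P.J y) (P.g y) (P.form v y) e l ∧
      IsEigenframe (P.J y) (P.g y) (P.form u y) e' l' ∧ l ∈ Γ ∧ s ≤ f l ∧ f l' ≤ f l)
    {x₀ : E} {ρ M : ℝ} (hρU : Metric.ball x₀ ρ ⊆ P.U) (hpos : ∀ y ∈ Metric.ball x₀ ρ, 0 < P.h₀ y)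
    (hmax : ∀ y ∈ Metric.ball x₀ ρ, v y - u y ≤ M) (hx₀ : v x₀ - u x₀ = M) :
    ∀ y ∈ Metric.ball x₀ (ρ / 2), v y - u y = M := by
  by_contra! hex
  obtain ⟨z, hz, hzM⟩ := hex
  have hFc : ContinuousOn (fun y => v y - u y - M) P.U :=
    (hv.continuousOn.sub hu.continuousOn).sub continuousOn_const
  obtain ⟨q, p, hpq, hsub, hp0, hlt⟩ := exists_touching_ball (F := fun y => v y - u y - M)
    (hFc.mono hρU) (by linarith) (fun y hy => by linarith [hmax y hy]) hz (sub_ne_zero.2 hzM)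
  obtain ⟨ρ', hρ'⟩ : ∃ ρ', ρ' = ‖p - q‖ := ⟨_, rfl⟩
  have hρ'0 : 0 < ρ' := hρ' ▸ norm_pos_iff.2 (sub_ne_zero.2 hpq)
  have hpball : p ∈ Metric.ball x₀ ρ := hsub (by rw [Metric.mem_closedBall, dist_eq_norm])
  rw [← hρ'] at hsub hlt
  obtain ⟨δ, hδ0, hδρ, hδsub⟩ : ∃ δ > 0, δ ≤ ρ' / 2 ∧
      Metric.closedBall p δ ⊆ Metric.ball x₀ ρ := by
    obtain ⟨δ, hδ, hsub⟩ := Metric.nhds_basis_closedBall.mem_iff.1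
      (Metric.isOpen_ball.mem_nhds hpball)
    exact ⟨min δ (ρ' / 2), by positivity, min_le_right _ _,
      (Metric.closedBall_subset_closedBall (min_le_left _ _)).trans hsub⟩
  have hNU : Metric.closedBall p δ ⊆ P.U := hδsub.trans hρU
  have hNc := isCompact_closedBall p δ
  obtain ⟨c, hc⟩ := P.exists_bounds hNc hNU
  obtain ⟨c', hc'0, hc'⟩ := P.exists_derivative_bounds hNc hNU hv
  have hc0 : 0 < c := zero_lt_one.trans_le hc.one_le
  obtain ⟨κ₀, hκ₀, t₀, ht₀, himp⟩ := exists_strict_improvement hm hp hs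
    (show 0 < c * c * (c * c) + c' * (1 + 2 * c ^ 2) * c ^ 2 by positivity)
  obtain ⟨C₂, hC₂⟩ : ∃ C₂, C₂ = (1 + c ^ 2 + 2 * (3 / 2 * ρ') * c ^ 2) * c := ⟨_, rfl⟩
  have hC₂0 : 0 < C₂ := by rw [hC₂]; positivity
  obtain ⟨α, hα0, hα⟩ : ∃ α > 0, κ₀ ≤ 2 * α * ((ρ' / 2) ^ 2 / c) / C₂ := by
    refine ⟨κ₀ * C₂ / (2 * ((ρ' / 2) ^ 2 / c)), by positivity, le_of_eq ?_⟩
    field_simp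
  -- on the part of the small sphere inside the touching ball the difference is negative
  obtain ⟨c₀, hc₀, hside⟩ : ∃ c₀ > 0, ∀ y ∈ Metric.sphere p δ ∩ Metric.closedBall q ρ',
      v y - u y - M ≤ -c₀ := by
    have hK : IsCompact (Metric.sphere p δ ∩ Metric.closedBall q ρ') :=
      (isCompact_sphere p δ).inter_right Metric.isClosed_closedBall
    rcases (Metric.sphere p δ ∩ Metric.closedBall q ρ').eq_empty_or_nonempty with h0 | hne
    · exact ⟨1, one_pos, fun y hy => by rw [h0] at hy; exact hy.elim⟩
    · obtain ⟨y₁, hy₁, hy₁max⟩ := hK.exists_isMaxOn hne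
        (hFc.mono fun y hy => hNU (Metric.sphere_subset_closedBall hy.1))
      have h1 := hlt y₁ hy₁.2 (Metric.ne_of_mem_sphere hy₁.1 hδ0.ne')
      exact ⟨-(v y₁ - u y₁ - M), by linarith, fun y hy => by
        rw [neg_neg]; exact hy₁max hy⟩
  obtain ⟨η, hη0, hηc, hηt⟩ : ∃ η > 0, η < c₀ ∧ α * η * C₂ ≤ t₀ := by
    refine ⟨min (c₀ / 2) (t₀ / (α * C₂)), by positivity,
      (min_le_left _ _).trans_lt (by linarith), ?_⟩
    have h1 : min (c₀ / 2) (t₀ / (α * C₂)) ≤ t₀ / (α * C₂) := min_le_right _ _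
    rw [le_div_iff₀ (by positivity)] at h1
    linarith
  have hbpos : ∀ y, 0 < radialBarrier q α η y := fun y => by unfold radialBarrier; positivity
  have hble : ∀ y, radialBarrier q α η y ≤ η := fun y => by
    unfold radialBarrier
    refine mul_le_of_le_one_right hη0.le (Real.exp_le_one_iff.2 ?_)
    have : 0 ≤ α * ‖y - q‖ ^ 2 := by positivity
    linarith
  set w : E → ℝ := fun y => v y + radialBarrier q α η y with hw
  have hb2 : ContDiffOn ℝ 2 (radialBarrier q α η) P.U :=
    ((contDiff_radialBarrier q α η).of_le ENat.LEInfty.out).contDiffOn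
  -- on the small sphere around `p`, the function `w - u` stays below its value at `p`: outside the
  -- touching ball since the barrier is smaller there, inside it since `η < c₀`
  obtain ⟨p', hp', hp'max⟩ := hNc.exists_isMaxOn ⟨p, Metric.mem_closedBall_self hδ0.le⟩
    ((hFc.add hb2.continuousOn).mono hNU)
  have hge : radialBarrier q α η p ≤ v p' - u p' - M + radialBarrier q α η p' := by
    have := hp'max (Metric.mem_closedBall_self hδ0.le)
    simp only [mem_ofPred_eq, Pi.add_apply] at this
    linarith
  have hp'int : dist p' p < δ := by
    refine lt_of_le_of_ne hp' fun h0 => ?_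
    by_cases hin : p' ∈ Metric.closedBall q ρ'
    · linarith [hside p' ⟨h0, hin⟩, hble p', hbpos p]
    · rw [Metric.mem_closedBall, dist_eq_norm, not_le, hρ'] at hin
      have h1 : radialBarrier q α η p' < radialBarrier q α η p := by
        unfold radialBarrier
        refine mul_lt_mul_of_pos_left (Real.exp_lt_exp.2 ?_) hη0
        have h2 : ‖p - q‖ ^ 2 < ‖p' - q‖ ^ 2 := by gcongr
        nlinarith
      linarith [hmax p' (hδsub hp')]
  have hlocal : IsLocalMax (fun y => w y - u y) p' := by
    have h1 : Metric.closedBall p δ ∈ 𝓝 p' :=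
      mem_of_superset (Metric.isOpen_ball.mem_nhds hp'int) Metric.ball_subset_closedBall
    filter_upwards [h1] with y hy
    have := hp'max hy
    simp only [mem_ofPred_eq, Pi.add_apply] at this
    simp only [hw]
    linarith
  have hp'U := hNU hp'
  obtain ⟨e, l, e', l', he, he', hl, hsl, hle⟩ := hcmp p' hp'U (hpos p' (hδsub hp'))
  have hnorm : ‖p' - p‖ ≤ ρ' / 2 := by
    rw [← dist_eq_norm]; linarith
  have hr1 : ρ' / 2 ≤ ‖p' - q‖ := by
    have h1 := norm_sub_norm_le (p - q) (p - p')
    rw [sub_sub_sub_cancel_left, ← hρ', norm_sub_rev p p'] at h1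
    linarith
  have hr2 : ‖p' - q‖ ≤ 3 / 2 * ρ' := by
    have h1 := norm_add_le (p' - p) (p - q)
    rw [sub_add_sub_cancel, ← hρ'] at h1
    linarith
  -- at the interior maximum `𝔤[w] ≤ 𝔤[u]`, whereas `𝔤[w]` strictly improves on `𝔤[v]`
  obtain ⟨X, hX, κ, hκ, hlevi⟩ := le_leviOp_radialBarrier hc hNU hp' (by positivity) hr1 hr2 hα0 hη0
    hC₂ hα
  have hcon := himp (P.J p') (P.g p') (P.form v p') (P.form u p') e e' l l' X κ
    (α * radialBarrier q α η p' * C₂) (P.pair p' hp'U) (hvB p' hp'U) he he' hl hsl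
    (fun X hX => hc.abs_form_le hNU hp' (hc' p' hp').2.1 (hc' p' hp').2.2 hX) hX hκ
    (by have := hbpos p'; positivity)
    (le_trans (by have := hble p'; gcongr) hηt) fun a => by
      have h1 := form_le_of_isLocalMax (hv.add hb2) hu hp'U (hpos p' (hδsub hp')) hlocal a
      rw [form_self _ hp'U, leviOp_add hv hb2 hp'U] at h1
      rw [form_self v hp'U]
      linarith [hlevi a]
  linarith

end HermitianPatch

end StrongMaximum

/-! ### Boundary values of the eigenvalues -/

section BoundaryEstimate

variable {E : Type*} [NormedAddCommGroup E] [InnerProductSpace ℝ E] {m : ℕ}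
  {Γ : Set (Fin (m + 1) → ℝ)} {f : (Fin (m + 1) → ℝ) → ℝ}

/-- The mixed entries of a Hermitian form in two unitary frames with the same first vector are
comparable. -/
theorem sum_sq_mixed_le [FiniteDimensional ℝ E] {J : E →L[ℝ] E} {g : E →L[ℝ] E →L[ℝ] ℝ}
    {B : LinearMap.BilinForm ℝ E} (hJ : IsHermitianPair J g)
    (hm : Module.finrank ℝ E = 2 * (m + 1)) {ν : E} {T T' : Fin m → E}
    (hT : IsUnitaryFrame J g (Fin.cons ν T : Fin (m + 1) → E))
    (hT' : IsUnitaryFrame J g (Fin.cons ν T' : Fin (m + 1) → E)) :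
    ∑ a, (B ν (T a) ^ 2 + B ν (J (T a)) ^ 2)
      ≤ 2 * m * ∑ a, (B ν (T' a) ^ 2 + B ν (J (T' a)) ^ 2) := by
  have hkey : ∀ X, g X X = 1 → g X ν = 0 → g X (J ν) = 0 →
      B ν X ^ 2 ≤ ∑ a, (B ν (T' a) ^ 2 + B ν (J (T' a)) ^ 2) := by
    intro X hX h1 h2
    have hexp := hT'.expansion hJ hm X
    have hpar := hT'.parseval hJ hm X
    rw [Fin.sum_univ_succ] at hexp hpar
    simp only [Fin.cons_zero, Fin.cons_succ, frameWeight, h1, h2, zero_smul, zero_add, hX, ne_eq,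
      OfNat.ofNat_ne_zero, not_false_eq_true, zero_pow] at hexp hpar
    have hcs := Finset.sum_mul_sq_le_sq_mul_sq (Finset.univ : Finset (Fin m ⊕ Fin m))
      (Sum.elim (fun a => g X (T' a)) fun a => g X (J (T' a)))
      (Sum.elim (fun a => B ν (T' a)) fun a => B ν (J (T' a)))
    simp only [Fintype.sum_sum_type, Sum.elim_inl, Sum.elim_inr, ← Finset.sum_add_distrib,
      ← hpar, one_mul] at hcs
    refine le_trans (le_of_eq ?_) hcs
    conv_lhs => rw [hexp]
    simp only [map_sum, map_add, map_smul, smul_eq_mul]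
  have hTT : ∀ a, g (T a) (T a) = 1 := fun a => by simpa using hT.1 a.succ a.succ
  have hTν : ∀ a, g (T a) ν = 0 := fun a => by simpa using hT.1 a.succ 0
  have hTJν : ∀ a, g (T a) (J ν) = 0 := fun a => by simpa using hT.2 a.succ 0
  calc ∑ a, (B ν (T a) ^ 2 + B ν (J (T a)) ^ 2)
      ≤ ∑ _a : Fin m, 2 * ∑ a, (B ν (T' a) ^ 2 + B ν (J (T' a)) ^ 2) := by
        refine Finset.sum_le_sum fun a _ => ?_
        have h1 := hkey (T a) (hTT a) (hTν a) (hTJν a)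
        have h2 := hkey (J (T a)) (by rw [hJ.inv, hTT])
          (by rw [hJ.apply_J_left, hTJν, neg_zero]) (by rw [hJ.inv, hTν])
        linarith
    _ = _ := by simp; ring

namespace HermitianPatch

variable {P : HermitianPatch E}

theorem continuousOn_form {X : Type*} [TopologicalSpace X] {Q : Set X} {u : E → ℝ}
    (hu : ContDiffOn ℝ 2 u P.U) {y a b : X → E} (hy : ContinuousOn y Q) (hyU : MapsTo y Q P.U)
    (ha : ContinuousOn a Q) (hb : ContinuousOn b Q) :
    ContinuousOn (fun p => P.form u (y p) (a p) (b p)) Q := by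
  have hu1 := hu.fderivWithin_halfSpace P.exists_eq_one P.subset P.mem_nhdsWithin
    (j := 1) (by norm_num)
  have hu2 := hu1.fderivWithin_halfSpace P.exists_eq_one P.subset P.mem_nhdsWithin
    (j := 0) (by norm_num)
  have h1 := hu1.continuousOn.comp hy hyU
  have h2 := hu2.continuousOn.comp hy hyU
  have hJ := P.J_smooth.continuousOn.comp hy hyU
  have hχ := P.χ_smooth.continuousOn.comp hy hyU
  have hDJ := P.DJ_smooth.continuousOn.comp hy hyU
  have hJb := hJ.clm_apply hb
  simp only [form_apply, ddc]
  refine ((hχ.clm_apply ha).clm_apply hJb).add (continuousOn_const.mul ?_)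
  exact (((h2.clm_apply hJb).clm_apply (hJ.clm_apply ha)).sub
    ((h2.clm_apply ha).clm_apply (hJ.clm_apply hJb))).add
    (h1.clm_apply (((hDJ.clm_apply hJb).clm_apply ha).sub ((hDJ.clm_apply ha).clm_apply hJb)))

/-- Eigenvalues and eigenframes pass to the limit at boundary points. The limit of the eigenvalues
stays in `Γ` because the truncated superlevel set of `f` is compact. -/
theorem exists_boundary_eigenframe [FiniteDimensional ℝ E] (hp : IsAdmissiblePair f Γ) {s N : ℝ}
    (hs : supBoundary f Γ < (s : EReal)) {u : E → ℝ} (hu : ContDiffOn ℝ 2 u P.U) {yc : E} {r : ℝ}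
    (hsub : Metric.closedBall yc r ∩ P.S ⊆ P.U)
    (heig : ∀ y ∈ Metric.closedBall yc r ∩ P.S, 0 < P.h₀ y → ∃ e l,
      IsEigenframe (P.J y) (P.g y) (P.form u y) e l ∧ l ∈ Γ ∧ s ≤ f l ∧ f l ≤ N)
    {y₀ : E} (hy₀ : y₀ ∈ Metric.ball yc r) (hy₀S : y₀ ∈ P.S) :
    ∃ e l, IsEigenframe (P.J y₀) (P.g y₀) (P.form u y₀) e l ∧ l ∈ Γ ∧ f l ≤ N := by
  set Ω₀ := Metric.closedBall yc r ∩ P.S with hΩ₀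
  have hΩc : IsCompact Ω₀ := (isCompact_closedBall yc r).inter_right isClosed_halfSpace
  obtain ⟨c, hc⟩ := P.exists_bounds hΩc hsub
  obtain ⟨c', -, hc'⟩ := P.exists_derivative_bounds hΩc hsub hu
  have hL := hp.isCompact_superlevel hs (c * c * (c * c) + c' * (1 + 2 * c ^ 2) * c ^ 2)
  set L := {l | l ∈ Γ ∧ (∀ i, |l i| ≤ c * c * (c * c) + c' * (1 + 2 * c ^ 2) * c ^ 2) ∧ s ≤ f l}
    with hLdef
  have hcl : y₀ ∈ closure (Ω₀ ∩ {y | 0 < P.h₀ y}) := by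
    obtain ⟨v, hv⟩ := P.exists_eq_one
    have h1 : Tendsto (fun t : ℝ => y₀ + t • v) (𝓝[>] 0) (𝓝 y₀) := by
      have h2 : Continuous fun t : ℝ => y₀ + t • v := by fun_prop
      have h3 := h2.tendsto 0
      rw [zero_smul, add_zero] at h3
      exact h3.mono_left nhdsWithin_le_nhds
    refine mem_closure_of_tendsto h1 ?_
    filter_upwards [h1.eventually (Metric.isOpen_ball.mem_nhds hy₀), self_mem_nhdsWithin]
      with t ht ht0
    have h2 : 0 < P.h₀ (y₀ + t • v) := by
      rw [map_add, map_smul, hv, smul_eq_mul, mul_one]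
      exact add_pos_of_nonneg_of_pos hy₀S ht0
    exact ⟨⟨Metric.ball_subset_closedBall ht, show 0 ≤ P.h₀ _ from h2.le⟩, h2⟩
  obtain ⟨ys, hys, hlim⟩ := mem_closure_iff_seq_limit.1 hcl
  choose es ls hel hl hsl hN using fun k => heig (ys k) (hys k).1 (hys k).2
  set Q : Set (E × (Fin (m + 1) → E) × (Fin (m + 1) → ℝ)) :=
    Ω₀ ×ˢ Metric.closedBall 0 c ×ˢ L with hQ
  have hQc : IsCompact Q := hΩc.prod ((isCompact_closedBall 0 c).prod hL)
  have hmem : ∀ k, (ys k, es k, ls k) ∈ Q := by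
    intro k
    have hunit : ∀ i, P.g (ys k) (es k i) (es k i) = 1 := fun i => by
      simpa using (hel k).1.1 i i
    refine ⟨(hys k).1, ?_, hl k, fun i => ?_, hsl k⟩
    · rw [mem_closedBall_zero_iff, pi_norm_le_iff_of_nonneg (zero_le_one.trans hc.one_le)]
      exact fun i => hc.norm_unit_le (hys k).1 (hunit i)
    · have h1 := (hel k).2 i (es k i)
      rw [hunit, mul_one] at h1
      show |ls k i| ≤ _
      rw [← h1]
      exact hc.abs_form_le hsub (hys k).1 (hc' _ (hys k).1).2.1 (hc' _ (hys k).1).2.2 (hunit i)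
  obtain ⟨⟨y, e, l⟩, hpQ, θ, hθ, hθlim⟩ := hQc.tendsto_subseq hmem
  have hpass : ∀ F : E × (Fin (m + 1) → E) × (Fin (m + 1) → ℝ) → ℝ, ContinuousOn F Q →
      ∀ c : ℝ, (∀ k, F (ys k, es k, ls k) ≤ c) → F (y, e, l) ≤ c := by
    intro F hF c hFc
    have h1 : Tendsto (fun k => F (ys (θ k), es (θ k), ls (θ k))) atTop (𝓝 (F (y, e, l))) :=
      (hF _ hpQ).tendsto.comp (tendsto_nhdsWithin_iff.2
        ⟨hθlim, Eventually.of_forall fun k => hmem (θ k)⟩)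
    exact le_of_tendsto h1 (Eventually.of_forall fun k => hFc (θ k))
  have hpass' : ∀ F : E × (Fin (m + 1) → E) × (Fin (m + 1) → ℝ) → ℝ, ContinuousOn F Q →
      ∀ c : ℝ, (∀ k, F (ys k, es k, ls k) = c) → F (y, e, l) = c := by
    intro F hF c hFc
    refine le_antisymm (hpass F hF c fun k => (hFc k).le) ?_
    have := hpass _ hF.neg (-c) fun k => by simp [hFc k]
    simpa using this
  have hyy : y = y₀ := by
    have h1 := (continuous_fst.tendsto (y, e, l)).comp hθlim
    exact tendsto_nhds_unique h1 (hlim.comp hθ.tendsto_atTop)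
  have hcy : ContinuousOn (fun p : E × (Fin (m + 1) → E) × (Fin (m + 1) → ℝ) => p.1) Q := by
    fun_prop
  have hce : ∀ i, ContinuousOn (fun p : E × (Fin (m + 1) → E) × (Fin (m + 1) → ℝ) => p.2.1 i) Q :=
    fun i => by fun_prop
  have hcl' : ∀ i, ContinuousOn (fun p : E × (Fin (m + 1) → E) × (Fin (m + 1) → ℝ) => p.2.2 i) Q :=
    fun i => by fun_prop
  have hmapsU : MapsTo (fun p : E × (Fin (m + 1) → E) × (Fin (m + 1) → ℝ) => p.1) Q P.U :=
    fun p hp => hsub hp.1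
  have hg := P.g_smooth.continuousOn.comp hcy hmapsU
  have hJ := P.J_smooth.continuousOn.comp hcy hmapsU
  have hfc : ContinuousOn (fun p : E × (Fin (m + 1) → E) × (Fin (m + 1) → ℝ) => f p.2.2) Q :=
    hp.smooth.smooth.continuousOn.comp (by fun_prop) fun p hp => hp.2.2.1
  subst hyy
  refine ⟨e, l, ⟨⟨fun i j => ?_, fun i j => ?_⟩, fun i Y => ?_⟩, hpQ.2.2.1, ?_⟩
  · exact hpass' _ ((hg.clm_apply (hce i)).clm_apply (hce j)) _ fun k => (hel k).1.1 i j
  · exact hpass' _ ((hg.clm_apply (hce i)).clm_apply (hJ.clm_apply (hce j))) _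
      fun k => (hel k).1.2 i j
  · have h1 := hpass' _ ((continuousOn_form hu hcy hmapsU (hce i) (continuousOn_const (c := Y))).sub
      ((hcl' i).mul ((hg.clm_apply (hce i)).clm_apply (continuousOn_const (c := Y))))) 0
      fun k => by
        simp only [Pi.sub_apply, Pi.mul_apply]
        exact sub_eq_zero.2 ((hel k).2 i Y)
    exact sub_eq_zero.1 h1
  · exact hpass _ hfc N hN

theorem IsAdaptedFrame.eq_normal [FiniteDimensional ℝ E] {A : Set E} {e : Fin (m + 1) → E → E}
    (hm : Module.finrank ℝ E = 2 * (m + 1)) (he : P.IsAdaptedFrame A e) {y : E} (hy : y ∈ A) {ν : E}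
    (h1 : P.g y ν ν = 1) (h2 : ∀ a, P.h₀ a = 0 → P.g y ν a = 0) (h3 : 0 < P.h₀ ν) :
    ν = e 0 y := by
  have hexp := (he.unitary y hy).expansion (P.pair y (he.subset hy)) hm ν
  rw [Fin.sum_univ_succ] at hexp
  simp only [h2 _ (he.tangent y hy _), h2 _ (he.tangent_J y hy _), h2 _ (he.normal_J y hy),
    zero_smul, add_zero, Finset.sum_const_zero] at hexp
  have h4 := (he.unitary y hy).1 0 0
  rw [if_pos rfl] at h4
  have h5 : P.g y ν (e 0 y) ^ 2 = 1 := by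
    rw [hexp] at h1
    simp only [map_smul, smul_apply, smul_eq_mul, h4] at h1
    linarith
  have h6 : 0 < P.g y ν (e 0 y) := by
    rw [hexp, map_smul, smul_eq_mul] at h3
    exact pos_of_mul_pos_left h3 (he.normal_pos y hy).le
  rw [hexp, show P.g y ν (e 0 y) = 1 by nlinarith, one_smul]

/-- The `C²` bound `|v|, |∇v|, |∇²v| ≤ K` at one point, in terms of the coordinates. -/
def C2BoundAt (P : HermitianPatch E) (v : E → ℝ) (K : ℝ) (y : E) : Prop :=
  ∃ G, (∀ X, P.g y G X = fderivWithin ℝ v P.S y X) ∧ √(P.g y G G) ≤ K ∧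
    ∀ a b, |secondDerivWithin P.S v y a b - 1 / 2 * (fderivWithin ℝ P.g P.S y a b G
      + fderivWithin ℝ P.g P.S y b a G - fderivWithin ℝ P.g P.S y G a b)|
        ≤ K * √(P.g y a a) * √(P.g y b b)

theorem Bounds.sqrt_le {A : Set E} {c : ℝ} (hc : P.Bounds A c) {y : E} (hy : y ∈ A) (a : E) :
    √(P.g y a a) ≤ c * ‖a‖ := by
  have hc0 : 0 ≤ c := zero_le_one.trans hc.one_le
  refine Real.sqrt_le_iff.2 ⟨by positivity, (le_abs_self _).trans
    ((Bounds.abs_bilin_le (hc.g_le y hy)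
    a a).trans ?_)⟩
  have h1 := hc.one_le
  have h2 : c * ‖a‖ * ‖a‖ ≤ c * c * (‖a‖ * ‖a‖) := by
    rw [mul_assoc]; exact mul_le_mul_of_nonneg_right (by nlinarith) (by positivity)
  linarith

theorem C2BoundAt.norm_le {A : Set E} {c K : ℝ} (hK : 0 ≤ K) (hc : P.Bounds A c)
    {y : E} (hy : y ∈ A) {v : E → ℝ} (hv : P.C2BoundAt v K y) :
    ‖fderivWithin ℝ v P.S y‖ ≤ 3 * K * c ^ 2 ∧ ‖secondDerivWithin P.S v y‖ ≤ 3 * K * c ^ 2 := by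
  obtain ⟨G, hG, hGK, hH⟩ := hv
  have hc0 : 0 ≤ c := zero_le_one.trans hc.one_le
  have hGn : ‖G‖ ≤ c * K := by
    have h1 := hc.sq_norm_le y hy G
    have h2 : P.g y G G ≤ K ^ 2 := (Real.sqrt_le_left hK).1 hGK
    have h3 : ‖G‖ ^ 2 ≤ (c * K) ^ 2 := by
      calc ‖G‖ ^ 2 ≤ c * K ^ 2 := h1.trans (by gcongr)
        _ ≤ c ^ 2 * K ^ 2 := by
            refine mul_le_mul_of_nonneg_right ?_ (by positivity)
            nlinarith [hc.one_le]
        _ = _ := by ring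
    exact le_of_sq_le_sq h3 (by positivity)
  refine ⟨ContinuousLinearMap.opNorm_le_bound _ (by positivity) fun X => ?_,
    ContinuousLinearMap.opNorm_le_bound₂ _ (by positivity) fun a b => ?_⟩
  · rw [← hG, Real.norm_eq_abs]
    calc |P.g y G X| ≤ c * ‖G‖ * ‖X‖ := Bounds.abs_bilin_le (hc.g_le y hy) _ _
      _ ≤ c * (c * K) * ‖X‖ := by gcongr
      _ ≤ 3 * K * c ^ 2 * ‖X‖ := by nlinarith [show 0 ≤ K * c ^ 2 * ‖X‖ by positivity]
  · rw [Real.norm_eq_abs]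
    have hD : ∀ a b d, |fderivWithin ℝ P.g P.S y a b d| ≤ c * ‖a‖ * ‖b‖ * ‖d‖ := hc.Dg_le y hy
    have h0 : K * √(P.g y a a) * √(P.g y b b) ≤ K * c ^ 2 * (‖a‖ * ‖b‖) := by
      calc K * √(P.g y a a) * √(P.g y b b) ≤ K * (c * ‖a‖) * (c * ‖b‖) := by
            gcongr
            · exact hc.sqrt_le hy a
            · exact hc.sqrt_le hy b
        _ = _ := by ring
    have h1 := (hH a b).trans h0
    have h5 : ∀ x : ℝ, 0 ≤ x → x * ‖G‖ ≤ x * (c * K) := fun x hx =>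
      mul_le_mul_of_nonneg_left hGn hx
    have h6 := h5 (c * ‖a‖ * ‖b‖) (by positivity)
    have h2 := hD a b G
    have h3 := hD b a G
    have h4 := hD G a b
    have h7 : 0 ≤ K * c ^ 2 * (‖a‖ * ‖b‖) := by positivity
    rw [abs_le] at *
    constructor <;> nlinarith [h1.1, h1.2, h2.1, h2.2, h3.1, h3.2, h4.1, h4.2]

end HermitianPatch

end BoundaryEstimate

/-! ### The double normal component in a patch -/

section DoubleNormalEstimate

variable {E : Type*} [NormedAddCommGroup E] [InnerProductSpace ℝ E] {m : ℕ}
  {Γ : Set (Fin (m + 1) → ℝ)} {f : (Fin (m + 1) → ℝ) → ℝ}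

namespace HermitianPatch

variable {P : HermitianPatch E}

/-- A solution `u` and a subsolution `v ≤ u` in a coordinate patch, with common boundary values `φ`
and with the bounds by `K` which enter the estimate of the double normal derivative. -/
structure IsBoundedPair (P : HermitianPatch E) (f : (Fin (m + 1) → ℝ) → ℝ)
    (Γ : Set (Fin (m + 1) → ℝ)) (s : ℝ) (φ : E → ℝ) (K : ℝ) (u v : E → ℝ) : Prop where
  u_smooth : ContDiffOn ℝ 2 u P.U
  v_smooth : ContDiffOn ℝ 2 v P.U
  u_hermitian : ∀ y ∈ P.U, IsHermitianForm (P.J y) (P.form u y)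
  v_hermitian : ∀ y ∈ P.U, IsHermitianForm (P.J y) (P.form v y)
  v_eigen : ∀ y ∈ P.U, ∃ e l, IsEigenframe (P.J y) (P.g y) (P.form v y) e l ∧ l ∈ Γ ∧ s ≤ f l
  comparison : ∀ y ∈ P.U, 0 < P.h₀ y → ∃ e l e' l',
    IsEigenframe (P.J y) (P.g y) (P.form v y) e l ∧
    IsEigenframe (P.J y) (P.g y) (P.form u y) e' l' ∧ l ∈ Γ ∧ l' ∈ Γ ∧ s ≤ f l' ∧ f l' ≤ f l
  u_boundary : ∀ y ∈ P.U, P.h₀ y = 0 → u y = φ y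
  v_boundary : ∀ y ∈ P.U, P.h₀ y = 0 → v y = φ y
  le : ∀ y ∈ P.U, v y ≤ u y
  u_bound : ∀ y ∈ P.U, |u y| ≤ K
  u_gradient : ∀ y ∈ P.U, P.h₀ y = 0 → ∀ a, |fderivWithin ℝ u P.S y a| ≤ K * √(P.g y a a)
  v_C2 : ∀ y ∈ P.U, P.C2BoundAt v K y

namespace IsBoundedPair

variable {s K : ℝ} {φ u v : E → ℝ}

theorem isSupersolvable (h : P.IsBoundedPair f Γ s φ K u v) : P.IsSupersolvable f Γ s u where
  smooth := h.u_smooth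
  hermitian := h.u_hermitian
  eigen y hy hpos := by
    obtain ⟨_, _, e', l', -, h1, -, h2, h3, -⟩ := h.comparison y hy hpos
    exact ⟨e', l', h1, h2, h3⟩

/-- At the boundary, the inner derivative of the subsolution is at most that of the solution. -/
theorem fderivWithin_le (h : P.IsBoundedPair f Γ s φ K u v) (hφ : ContDiffOn ℝ 2 φ P.U) {y : E}
    (hy : y ∈ P.U) (hy0 : P.h₀ y = 0) {w : E} (hw : P.h₀ w = 1) :
    fderivWithin ℝ (fun y => v y - φ y) P.S y w ≤ fderivWithin ℝ (fun y => u y - φ y) P.S y w := by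
  have hd : ∀ {z : E → ℝ}, ContDiffOn ℝ 2 z P.U → HasFDerivWithinAt (fun y => z y - φ y)
      (fderivWithin ℝ (fun y => z y - φ y) P.S y) P.S y := fun hz =>
    (((hz.sub hφ).contDiffWithinAt_halfSpace P.mem_nhdsWithin hy).differentiableWithinAt
      (by simp)).hasFDerivWithinAt
  have hmax : IsLocalMaxOn (fun y => (v y - φ y) - (u y - φ y)) P.S y := by
    filter_upwards [P.mem_nhdsWithin y hy] with z hz
    rw [h.u_boundary y hy hy0, h.v_boundary y hy hy0]
    linarith [h.le z hz]
  have hcone : w ∈ posTangentConeAt P.S y := by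
    refine mem_posTangentConeAt_of_segment_subset (convex_halfSpace.segment_subset hy0.ge ?_)
    show 0 ≤ P.h₀ (y + w)
    rw [map_add, hy0, hw]
    norm_num
  have := hmax.hasFDerivWithinAt_nonpos ((hd h.v_smooth).sub (hd h.u_smooth)) hcone
  rw [sub_apply] at this
  linarith

end IsBoundedPair

/-- Along complex tangent directions of the boundary, `𝔤[u]` is `𝔤[φ]` plus the Levi form times the
normal derivative of `u - φ`. -/
theorem form_tangent_eq {φ u : E → ℝ} (hφ : ContDiffOn ℝ 2 φ P.U) (hu : ContDiffOn ℝ 2 u P.U)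
    (hbd : ∀ y ∈ P.U, P.h₀ y = 0 → u y = φ y) {y : E} (hy : y ∈ P.U) (hy0 : P.h₀ y = 0) {w : E}
    (hw : P.h₀ w = 1) {T : E} (hT : P.h₀ T = 0) (hJT : P.h₀ (P.J y T) = 0) :
    P.form u y T T = P.form φ y T T
      + fderivWithin ℝ (fun y => u y - φ y) P.S y w * P.h₀ (P.drift y T) := by
  rw [form_self u hy, form_self φ hy, ← leviOp_of_boundary_zero (hu.sub hφ)
    (fun z hz hz0 => sub_eq_zero.2 (hbd z hz hz0)) hy hy0 hw hT hJT, leviOp_sub hu hφ hy]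
  ring

/-- The estimate of the double normal component of `𝔤[u]` near a boundary point of a patch. -/
theorem exists_double_normal_bound [FiniteDimensional ℝ E] (hm : Module.finrank ℝ E = 2 * (m + 1))
    (hp : IsAdmissiblePair f Γ) {s : ℝ} (hs : supBoundary f Γ < (s : EReal)) {φ : E → ℝ}
    (hφ : ContDiffOn ℝ ∞ φ P.U) {yc : E} (hyc : yc ∈ P.U) (hyc0 : P.h₀ yc = 0) {K : ℝ}
    (hK : 0 ≤ K) :
    ∃ r > 0, ∃ C > 0, ∀ y₀ ∈ Metric.closedBall yc r, y₀ ∈ P.U → P.h₀ y₀ = 0 → ∀ u v : E → ℝ,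
      P.IsBoundedPair f Γ s φ K u v → ∀ ν, P.g y₀ ν ν = 1 → (∀ a, P.h₀ a = 0 → P.g y₀ ν a = 0) →
      0 < P.h₀ ν → ∀ T' : Fin m → E, IsUnitaryFrame (P.J y₀) (P.g y₀) T' →
      (∀ a, P.h₀ (T' a) = 0 ∧ P.h₀ (P.J y₀ (T' a)) = 0) →
      P.form u y₀ ν ν
        ≤ C * (1 + ∑ a, (P.form u y₀ ν (T' a) ^ 2 + P.form u y₀ ν (P.J y₀ (T' a)) ^ 2)) := by
  obtain ⟨r, hr, hsub, e, hesm, heu⟩ := P.exists_smooth_frame hm hyc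
  have he : P.IsAdaptedFrame (Metric.closedBall yc r ∩ P.S) e :=
    ⟨hsub, hesm, fun y hy => (heu y hy).1, fun y hy => (heu y hy).2.1,
      fun y hy => (heu y hy).2.2.1, fun y hy i => ((heu y hy).2.2.2 i).1,
      fun y hy i => ((heu y hy).2.2.2 i).2⟩
  have hφ2 : ContDiffOn ℝ 2 φ P.U := hφ.of_le ENat.LEInfty.out
  have hΩc : IsCompact (Metric.closedBall yc r ∩ P.S) :=
    (isCompact_closedBall yc r).inter_right isClosed_halfSpace
  obtain ⟨c, hc⟩ := P.exists_bounds hΩc hsub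
  obtain ⟨cφ, hcφ0, hcφ⟩ := P.exists_derivative_bounds hΩc hsub hφ2
  obtain ⟨w, hw⟩ := P.exists_eq_one
  have hc0 : 0 < c := zero_lt_one.trans_le hc.one_le
  -- bounds for the normal derivatives, for `𝔤[v]` and for the tangential part of `𝔤[u]`
  obtain ⟨K₁, hK₁⟩ : ∃ K₁, K₁ = K + 3 * K * c ^ 2 * ‖w‖ + K * (c * ‖w‖) + cφ * ‖w‖ := ⟨_, rfl⟩
  have hK₁0 : 0 ≤ K₁ := by rw [hK₁]; positivity
  obtain ⟨R₁, hR₁⟩ : ∃ R₁, R₁ = c * c * (c * c) + 3 * K * c ^ 2 * (1 + 2 * c ^ 2) * c ^ 2 :=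
    ⟨_, rfl⟩
  have hR₁0 : 0 < R₁ := by rw [hR₁]; positivity
  obtain ⟨R₂, hR₂⟩ : ∃ R₂, R₂ = c * c * (c * c) + cφ * (1 + 2 * c ^ 2) * c ^ 2
    + K₁ * (‖P.h₀‖ * (c ^ 2 * c ^ 2)) := ⟨_, rfl⟩
  obtain ⟨ε₀, hε₀, hshift⟩ := hp.exists_shift_mem hs R₁
  obtain ⟨ε₁, hε₁, hlevi⟩ := exists_levi_lower_bound hm hp hs hφ hr hyc0 he hw hK₁0 hε₀
  obtain ⟨T₀, hT₀⟩ := hp.exists_uniform_lift (hp.lt_supOn (hp.cone.const_mem hR₁0)) R₂ hε₁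
  refine ⟨r / 2, by positivity, |T₀| + 2 * m / (ε₁ / 2) + 1, by positivity, ?_⟩
  intro y₀ hy₀ hy₀U hy₀0 u v huv ν hν1 hν2 hν3 T' hT' hT'0
  have hy₀S : y₀ ∈ P.S := hy₀0.ge
  have hy₀Ω : y₀ ∈ Metric.closedBall yc r ∩ P.S :=
    ⟨Metric.closedBall_subset_closedBall (by linarith) hy₀, hy₀S⟩
  have hJ := P.pair y₀ hy₀U
  have hνe := he.eq_normal hm hy₀Ω hν1 hν2 hν3
  have hsubder : ∀ {z : E → ℝ}, ContDiffOn ℝ 2 z P.U →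
      fderivWithin ℝ (fun y => z y - φ y) P.S y₀ w
        = fderivWithin ℝ z P.S y₀ w - fderivWithin ℝ φ P.S y₀ w := fun hz => by
    have hd : ∀ {z : E → ℝ}, ContDiffOn ℝ 2 z P.U → DifferentiableWithinAt ℝ z P.S y₀ := fun hz =>
      (hz.contDiffWithinAt_halfSpace P.mem_nhdsWithin hy₀U).differentiableWithinAt (by simp)
    rw [fderivWithin_fun_sub (uniqueDiffOn_halfSpace P.exists_eq_one y₀ hy₀S) (hd hz) (hd hφ2)]
    rfl
  have hφw : |fderivWithin ℝ φ P.S y₀ w| ≤ cφ * ‖w‖ :=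
    ContinuousLinearMap.le_of_opNorm_le _ (hcφ y₀ hy₀Ω).2.1 w
  have hvn := fun {y} (hy : y ∈ Metric.closedBall yc r ∩ P.S) =>
    (huv.v_C2 y (hsub hy)).norm_le hK hc hy
  have hη : |fderivWithin ℝ (fun y => u y - φ y) P.S y₀ w| ≤ K₁ := by
    rw [hsubder huv.u_smooth, hK₁]
    have h1 := (huv.u_gradient y₀ hy₀U hy₀0 w).trans
      (mul_le_mul_of_nonneg_left (hc.sqrt_le hy₀Ω w) hK)
    have h2 : 0 ≤ 3 * K * c ^ 2 * ‖w‖ := by positivity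
    exact (abs_sub _ _).trans (by linarith)
  have hη' : |fderivWithin ℝ (fun y => v y - φ y) P.S y₀ w| ≤ K₁ := by
    rw [hsubder huv.v_smooth, hK₁]
    have h1 : |fderivWithin ℝ v P.S y₀ w| ≤ 3 * K * c ^ 2 * ‖w‖ :=
      ContinuousLinearMap.le_of_opNorm_le _ (hvn hy₀Ω).1 w
    have h2 : 0 ≤ K * (c * ‖w‖) := by positivity
    exact (abs_sub _ _).trans (by linarith)
  have hvR : ∀ y ∈ Metric.closedBall yc r ∩ P.S, ∀ X, P.g y X X = 1 → |P.form v y X X| ≤ R₁ :=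
    fun y hy X hX => hR₁ ▸ hc.abs_form_le hsub hy (hvn hy).1 (hvn hy).2 hX
  -- strict positivity of the weighted traces of `𝔤[u]`
  have hpos : ∀ Z, HasOrthonormalRows Z → ∀ μ, IsSupporting Γ μ →
      ε₁ < ∑ a, μ a * P.form u y₀ (P.tangentFrame e Z y₀ a) (P.tangentFrame e Z y₀ a) := by
    intro Z hZ μ hμ
    rw [sum_form_eq_leviSum hφ huv.u_smooth huv.u_boundary he Z μ hy₀Ω hy₀0 hw]
    refine hlevi y₀ hy₀ hy₀0 u huv.isSupersolvable (fun y hy => (huv.u_bound y hy).trans ?_)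
      huv.u_boundary hη _ hη' (huv.fderivWithin_le hφ2 hy₀U hy₀0 hw) Z hZ μ hμ ?_
    · have h1 : 0 ≤ 3 * K * c ^ 2 * ‖w‖ + K * (c * ‖w‖) + cφ * ‖w‖ := by positivity
      rw [hK₁]; linarith
    · rw [← sum_form_eq_leviSum hφ huv.v_smooth huv.v_boundary he Z μ hy₀Ω hy₀0 hw]
      obtain ⟨e', l, hel, hl, hsl⟩ := huv.v_eigen y₀ hy₀U
      have hF := he.tangentFrame_unitary hZ hy₀Ω
      obtain ⟨hd, hfd⟩ := hel.diagonal hp hJ (huv.v_hermitian y₀ hy₀U) hm hl hF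
      have hd' := hshift _ hd (fun i => hvR y₀ hy₀Ω _ (by simpa using hF.1 i i)) (hsl.trans hfd)
      have hsec : (fun a => P.form v y₀ (P.tangentFrame e Z y₀ a) (P.tangentFrame e Z y₀ a) - ε₀)
          ∈ sectionCone Γ := by
        refine ⟨P.form v y₀ (e 0 y₀) (e 0 y₀) - ε₀, ?_⟩
        convert hd' using 1
        ext i
        refine Fin.cases ?_ (fun i => ?_) i <;> simp
      have h6 := hμ.le_apply _ hsec
      simp only [mul_sub, Finset.sum_sub_distrib, ← Finset.sum_mul, hμ.sum_eq_one, one_mul] at h6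
      linarith
  -- a complex tangent frame diagonalizing `𝔤[u]`
  have hB := huv.u_hermitian y₀ hy₀U
  obtain ⟨Z, lam, hZ, h1, h2⟩ := exists_diagonalization hJ hB fun j : Fin m => e j.succ y₀
  change ∀ a b, P.form u y₀ (P.tangentFrame e Z y₀ a) (P.tangentFrame e Z y₀ b) = _ at h1
  change ∀ a b, P.form u y₀ (P.tangentFrame e Z y₀ a) (P.J y₀ (P.tangentFrame e Z y₀ b)) = 0 at h2
  have hF := he.tangentFrame_unitary hZ hy₀Ω
  rw [← hνe] at hF
  have hlam : ∀ a, P.form u y₀ (P.tangentFrame e Z y₀ a) (P.tangentFrame e Z y₀ a) = lam a :=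
    fun a => by rw [h1, if_pos rfl]
  -- a point outside `Γ_∞` would have a supporting functional with a nonpositive value there
  have hsec : (fun a => lam a - ε₁) ∈ sectionCone Γ := by
    by_contra hnot
    obtain ⟨μ, hμ, hle⟩ := exists_isSupporting hp.cone hnot
    have h3 := hpos Z hZ μ hμ
    simp only [hlam] at h3
    simp only [mul_sub, Finset.sum_sub_distrib, ← Finset.sum_mul, hμ.sum_eq_one, one_mul] at hle
    linarith
  have hlamR : ∀ a, |lam a| ≤ R₂ := by
    intro a
    have hunit : P.g y₀ (P.tangentFrame e Z y₀ a) (P.tangentFrame e Z y₀ a) = 1 := by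
      simpa using hF.1 a.succ a.succ
    rw [← hlam, form_tangent_eq hφ2 huv.u_smooth huv.u_boundary hy₀U hy₀0 hw
      (he.h₀_tangentFrame Z hy₀Ω a) (he.h₀_J_tangentFrame Z hy₀Ω a), hR₂]
    refine (abs_add_le _ _).trans (add_le_add
      (hc.abs_form_le hsub hy₀Ω (hcφ y₀ hy₀Ω).2.1 (hcφ y₀ hy₀Ω).2.2 hunit) ?_)
    rw [abs_mul]
    refine mul_le_mul hη ((P.h₀.le_opNorm _).trans (mul_le_mul_of_nonneg_left
      ((hc.norm_drift_le hy₀Ω _).trans ?_) (norm_nonneg _))) (abs_nonneg _) hK₁0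
    have h3 := hc.norm_unit_le hy₀Ω hunit
    gcongr
  -- the eigenvalues of `𝔤[u]` at `y₀`, with `f` bounded above by means of the subsolution
  obtain ⟨e', l, hel, hl, hlN⟩ := exists_boundary_eigenframe (N := f fun _ => R₁) hp hs
    huv.u_smooth hsub (fun y hy hypos => by
      obtain ⟨e₁, l₁, e₂, l₂, he₁, he₂, hl₁, hl₂, hsl, hle⟩ := huv.comparison y (hsub hy) hypos
      refine ⟨e₂, l₂, he₂, hl₂, hsl, hle.trans (hp.mono hl₁ fun i => ?_)⟩
      have h3 := he₁.2 i (e₁ i)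
      rw [he₁.1.1, if_pos rfl, mul_one] at h3
      rw [← h3]
      exact (abs_le.1 (hvR y hy _ (by simpa using he₁.1.1 i i))).2)
    (y₀ := y₀) (Metric.closedBall_subset_ball (by linarith) hy₀) hy₀S
  -- the double normal component is below the threshold
  set q := ∑ a, (P.form u y₀ ν (P.tangentFrame e Z y₀ a) ^ 2
    + P.form u y₀ ν (P.J y₀ (P.tangentFrame e Z y₀ a)) ^ 2) with hq
  have hthr : P.form u y₀ ν ν ≤ T₀ + q / (ε₁ / 2) := by
    by_contra! hgt
    obtain ⟨hD, hND⟩ := hT₀ lam hlamR (subset_closure hsec) (P.form u y₀ ν ν - q / (ε₁ / 2))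
      (by linarith)
    have h3 := hel.le_of_diagonal_le hp hJ hm hF hD fun X =>
      arrow_lower_bound hJ hB hm hF h1 h2 (half_pos hε₁) X
    linarith [h3.2]
  have hF' : IsUnitaryFrame (P.J y₀) (P.g y₀) (Fin.cons ν T' : Fin (m + 1) → E) :=
    hT'.cons hJ hν1 (fun a => hν2 _ (hT'0 a).1) fun a => hν2 _ (hT'0 a).2
  have hq' := sum_sq_mixed_le (B := P.form u y₀) hJ hm hF hF'
  set q' := ∑ a, (P.form u y₀ ν (T' a) ^ 2 + P.form u y₀ ν (P.J y₀ (T' a)) ^ 2) with hq'def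
  have hq'0 : 0 ≤ q' := Finset.sum_nonneg fun a _ => by positivity
  have h4 : q / (ε₁ / 2) ≤ 2 * m / (ε₁ / 2) * q' := by
    rw [div_mul_eq_mul_div]
    gcongr
  have h5 : 0 ≤ 2 * (m : ℝ) / (ε₁ / 2) := by positivity
  nlinarith [le_abs_self T₀, mul_nonneg (abs_nonneg T₀) hq'0]

end HermitianPatch

end DoubleNormalEstimate

/-! ### Forms under a change of coordinates -/

section ChangeOfCoordinates

variable {E : Type*} [NormedAddCommGroup E] [NormedSpace ℝ E] {h₀ : E →L[ℝ] ℝ}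

/-- Derivative of the components of a one-form pulled back by a change of coordinates `τ`. -/
theorem fderivWithin_pullback_oneForm (hne : ∃ v, h₀ v = 1) {τ : E → E} {A : E → E →L[ℝ] ℝ} {y : E}
    (hy : y ∈ halfSpace h₀) (hτ : ContDiffWithinAt ℝ 2 τ (halfSpace h₀) y)
    (hmaps : ∀ᶠ z in 𝓝[halfSpace h₀] y, τ z ∈ halfSpace h₀)
    (hA : DifferentiableWithinAt ℝ A (halfSpace h₀) (τ y)) (a b : E) :
    fderivWithin ℝ (fun z => A (τ z) (fderivWithin ℝ τ (halfSpace h₀) z b)) (halfSpace h₀) y a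
      = fderivWithin ℝ A (halfSpace h₀) (τ y) (fderivWithin ℝ τ (halfSpace h₀) y a)
          (fderivWithin ℝ τ (halfSpace h₀) y b)
        + A (τ y) (fderivWithin ℝ (fderivWithin ℝ τ (halfSpace h₀)) (halfSpace h₀) y a b) := by
  have huniq := uniqueDiffOn_halfSpace hne
  have h1 := (hτ.differentiableWithinAt (by simp)).hasFDerivWithinAt
  have h2 := ((hτ.fderivWithin_right (m := 1) huniq (by norm_num) hy).differentiableWithinAt
    (by simp)).hasFDerivWithinAt
  have h3 : HasFDerivWithinAt (fun z => A (τ z)) _ (halfSpace h₀) y :=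
    hA.hasFDerivWithinAt.comp_of_tendsto y h1
      (tendsto_nhdsWithin_iff.2 ⟨h1.continuousWithinAt.tendsto, hmaps⟩)
  have h4 := (ContinuousLinearMap.apply ℝ E b).hasFDerivAt.comp_hasFDerivWithinAt y h2
  have h5 := h3.clm_apply h4
  rw [show (fun z => A (τ z) (fderivWithin ℝ τ (halfSpace h₀) z b)) = fun z => (A (τ z))
    ((⇑(ContinuousLinearMap.apply ℝ E b) ∘ fderivWithin ℝ τ (halfSpace h₀)) z) from rfl,
    h5.fderivWithin (huniq y hy)]
  simp [add_comm]

set_option maxSynthPendingDepth 3 in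
/-- Derivative of the components of a bilinear form pulled back by a change of coordinates `τ`. -/
theorem fderivWithin_pullback_bilin (hne : ∃ v, h₀ v = 1) {τ : E → E} {G : E → E →L[ℝ] E →L[ℝ] ℝ}
    {y : E} (hy : y ∈ halfSpace h₀) (hτ : ContDiffWithinAt ℝ 2 τ (halfSpace h₀) y)
    (hmaps : ∀ᶠ z in 𝓝[halfSpace h₀] y, τ z ∈ halfSpace h₀)
    (hG : DifferentiableWithinAt ℝ G (halfSpace h₀) (τ y)) (a b d : E) :
    fderivWithin ℝ (fun z => G (τ z) (fderivWithin ℝ τ (halfSpace h₀) z b)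
        (fderivWithin ℝ τ (halfSpace h₀) z d)) (halfSpace h₀) y a
      = fderivWithin ℝ G (halfSpace h₀) (τ y) (fderivWithin ℝ τ (halfSpace h₀) y a)
          (fderivWithin ℝ τ (halfSpace h₀) y b) (fderivWithin ℝ τ (halfSpace h₀) y d)
        + G (τ y) (fderivWithin ℝ (fderivWithin ℝ τ (halfSpace h₀)) (halfSpace h₀) y a b)
          (fderivWithin ℝ τ (halfSpace h₀) y d)
        + G (τ y) (fderivWithin ℝ τ (halfSpace h₀) y b)
          (fderivWithin ℝ (fderivWithin ℝ τ (halfSpace h₀)) (halfSpace h₀) y a d) := by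
  have huniq := uniqueDiffOn_halfSpace hne
  have h1 := (hτ.differentiableWithinAt (by simp)).hasFDerivWithinAt
  have h2 := ((hτ.fderivWithin_right (m := 1) huniq (by norm_num) hy).differentiableWithinAt
    (by simp)).hasFDerivWithinAt
  have h3 : HasFDerivWithinAt (fun z => G (τ z)) _ (halfSpace h₀) y :=
    hG.hasFDerivWithinAt.comp_of_tendsto y h1
      (tendsto_nhdsWithin_iff.2 ⟨h1.continuousWithinAt.tendsto, hmaps⟩)
  have h4 := fun b => (ContinuousLinearMap.apply ℝ E b).hasFDerivAt.comp_hasFDerivWithinAt y h2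
  have h5 := (h3.clm_apply (h4 b)).clm_apply (h4 d)
  rw [show (fun z => G (τ z) (fderivWithin ℝ τ (halfSpace h₀) z b)
      (fderivWithin ℝ τ (halfSpace h₀) z d)) = fun z => (G (τ z))
    ((⇑(ContinuousLinearMap.apply ℝ E b) ∘ fderivWithin ℝ τ (halfSpace h₀)) z)
    ((⇑(ContinuousLinearMap.apply ℝ E d) ∘ fderivWithin ℝ τ (halfSpace h₀)) z) from rfl,
    h5.fderivWithin (huniq y hy)]
  simp [add_comm, add_assoc, add_left_comm]

theorem fderivWithin_fderivWithin_symm (hne : ∃ v, h₀ v = 1) {τ : E → E} {y : E}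
    (hy : y ∈ halfSpace h₀) (hτ : ContDiffWithinAt ℝ 2 τ (halfSpace h₀) y) (a b : E) :
    fderivWithin ℝ (fderivWithin ℝ τ (halfSpace h₀)) (halfSpace h₀) y a b
      = fderivWithin ℝ (fderivWithin ℝ τ (halfSpace h₀)) (halfSpace h₀) y b a :=
  hτ.isSymmSndFDerivWithinAt (by simp) (uniqueDiffOn_halfSpace hne)
    (subset_closure_interior_halfSpace hne hy) hy a b

end ChangeOfCoordinates

/-! ### Components of tangent vectors in a chart -/

section ChartComponents

/-- The space of coordinates of a real manifold of dimension `2 * n`. -/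
abbrev Coord (n : ℕ) : Type := EuclideanSpace ℝ (Fin (2 * n))

variable {n : ℕ} [NeZero n] {M : Type*} [TopologicalSpace M]
  [ChartedSpace (EuclideanHalfSpace (2 * n)) M] [IsManifold (𝓡∂ (2 * n)) ∞ M]

/-- The components of tangent vectors at `p` in the chart around `c`. -/
def toChart (c p : M) :
    TangentSpace (𝓡∂ (2 * n)) p →L[ℝ] Coord n :=
  tangentCoordChange (𝓡∂ (2 * n)) p c p

/-- The tangent vector at `p` with given components in the chart around `c`. -/
def fromChart (c p : M) :
    Coord n →L[ℝ] TangentSpace (𝓡∂ (2 * n)) p :=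
  tangentCoordChange (𝓡∂ (2 * n)) c p p

theorem toChart_fromChart {c p : M} (hp : p ∈ (extChartAt (𝓡∂ (2 * n)) c).source)
    (a : Coord n) : toChart c p (fromChart c p a) = a := by
  have h1 := tangentCoordChange_comp (I := 𝓡∂ (2 * n)) (w := c) (x := p) (y := c) (z := p) (v := a)
    ⟨⟨hp, mem_extChartAt_source p⟩, hp⟩
  exact h1.trans (tangentCoordChange_self hp)

theorem fromChart_toChart {c p : M} (hp : p ∈ (extChartAt (𝓡∂ (2 * n)) c).source)
    (v : TangentSpace (𝓡∂ (2 * n)) p) : fromChart c p (toChart c p v) = v := by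
  have h1 := tangentCoordChange_comp (I := 𝓡∂ (2 * n)) (w := p) (x := c) (y := p) (z := p) (v := v)
    ⟨⟨mem_extChartAt_source p, hp⟩, mem_extChartAt_source p⟩
  exact h1.trans (tangentCoordChange_self (mem_extChartAt_source p))

/-- Components in two charts are related by the derivative of the change of coordinates. -/
theorem toChart_fromChart_of_ne {c x p : M} (hp : p ∈ (extChartAt (𝓡∂ (2 * n)) c).source)
    (hpx : p ∈ (extChartAt (𝓡∂ (2 * n)) x).source) (a : Coord n) :
    toChart c p (fromChart x p a)
      = fderivWithin ℝ (extChartAt (𝓡∂ (2 * n)) c ∘ (extChartAt (𝓡∂ (2 * n)) x).symm)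
          (range (𝓡∂ (2 * n))) (extChartAt (𝓡∂ (2 * n)) x p) a :=
  tangentCoordChange_comp (I := 𝓡∂ (2 * n)) (w := x) (x := p) (y := c) (z := p) (v := a)
    ⟨⟨hpx, mem_extChartAt_source p⟩, hp⟩

theorem coordVec_eq (x : M) (v : TangentSpace (𝓡∂ (2 * n)) x) : coordVec x v = v := by
  unfold coordVec
  rw [mfderiv_extChartAt_self]
  rfl

theorem toChart_self (x : M) (v : TangentSpace (𝓡∂ (2 * n)) x) : toChart x x v = v :=
  tangentCoordChange_self (mem_extChartAt_source x)

theorem fromChart_eq_mfderivWithin {c p : M} (hp : p ∈ (extChartAt (𝓡∂ (2 * n)) c).source) :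
    fromChart c p = mfderivWithin 𝓘(ℝ, Coord n) (𝓡∂ (2 * n))
      (extChartAt (𝓡∂ (2 * n)) c).symm (range (𝓡∂ (2 * n))) (extChartAt (𝓡∂ (2 * n)) c p) := by
  have hp' : p ∈ (chartAt (EuclideanHalfSpace (2 * n)) c).source := by
    rwa [← extChartAt_source (𝓡∂ (2 * n))]
  rw [← TangentBundle.symmL_trivializationAt hp',
    TangentBundle.symmL_trivializationAt_eq_core hp']
  rfl

theorem coordField_eq {c : M} {y : Coord n}
    (hy : y ∈ (extChartAt (𝓡∂ (2 * n)) c).target) (a : Coord n) :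
    coordField c a y = fromChart c ((extChartAt (𝓡∂ (2 * n)) c).symm y) a := by
  have h1 : ∀ z, z = y →
      (mfderivWithin 𝓘(ℝ, Coord n) (𝓡∂ (2 * n))
        (extChartAt (𝓡∂ (2 * n)) c).symm (range (𝓡∂ (2 * n))) y a : Coord n)
      = (mfderivWithin 𝓘(ℝ, Coord n) (𝓡∂ (2 * n))
        (extChartAt (𝓡∂ (2 * n)) c).symm (range (𝓡∂ (2 * n))) z a :) := by
    rintro z rfl; rfl
  rw [fromChart_eq_mfderivWithin ((extChartAt (𝓡∂ (2 * n)) c).map_target hy)]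
  exact h1 _ ((extChartAt (𝓡∂ (2 * n)) c).right_inv hy)

/-- The differential in the coordinates of a chart. -/
theorem differential_fromChart {c p : M} (hp : p ∈ (extChartAt (𝓡∂ (2 * n)) c).source)
    {u : M → ℝ} (hu : MDifferentiableAt (𝓡∂ (2 * n)) 𝓘(ℝ, ℝ) u p)
    (a : Coord n) :
    differential u p (fromChart c p a)
      = fderivWithin ℝ (u ∘ (extChartAt (𝓡∂ (2 * n)) c).symm) (range (𝓡∂ (2 * n)))
          (extChartAt (𝓡∂ (2 * n)) c p) a := by
  have hy := (extChartAt (𝓡∂ (2 * n)) c).map_source hp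
  have h1 := mfderiv_comp_mfderivWithin_of_eq hu (mdifferentiableWithinAt_extChartAt_symm hy)
    (UniqueDiffWithinAt.uniqueMDiffWithinAt
      ((𝓡∂ (2 * n)).uniqueDiffOn _ (extChartAt_target_subset_range c hy)))
    ((extChartAt (𝓡∂ (2 * n)) c).left_inv hp)
  rw [fromChart_eq_mfderivWithin hp, ← mfderivWithin_eq_fderivWithin, h1]
  rfl

end ChartComponents

/-! ### The Hermitian structure in a chart -/

section ChartPatch

variable {n : ℕ} [NeZero n] {M : Type*} [TopologicalSpace M]
  [ChartedSpace (EuclideanHalfSpace (2 * n)) M]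

/-- The zeroth coordinate, which defines the half-space. -/
def zerothCoord (n : ℕ) [NeZero n] : Coord n →L[ℝ] ℝ := EuclideanSpace.proj 0

theorem range_eq_halfSpace : range (𝓡∂ (2 * n)) = halfSpace (zerothCoord n) := by
  rw [range_modelWithCornersEuclideanHalfSpace]
  rfl

theorem exists_zerothCoord_eq_one : ∃ v, zerothCoord n v = 1 :=
  ⟨EuclideanSpace.single 0 1, by simp [zerothCoord]⟩

theorem extChartAt_target_mem_nhdsWithin_halfSpace (c : M) {y : Coord n}
    (hy : y ∈ (extChartAt (𝓡∂ (2 * n)) c).target) :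
    (extChartAt (𝓡∂ (2 * n)) c).target ∈ 𝓝[halfSpace (zerothCoord n)] y := by
  rw [← range_eq_halfSpace]
  exact extChartAt_target_mem_nhdsWithin_of_mem hy

theorem extChartAt_target_subset_halfSpace (c : M) :
    (extChartAt (𝓡∂ (2 * n)) c).target ⊆ halfSpace (zerothCoord n) := by
  rw [← range_eq_halfSpace]
  exact extChartAt_target_subset_range c

variable [IsManifold (𝓡∂ (2 * n)) ∞ M]

theorem contMDiffOn_fromChart (c : M) (a : Coord n) :
    ContMDiffOn (𝓡∂ (2 * n)) (𝓡∂ (2 * n)).tangent ∞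
      (fun p => (⟨p, fromChart c p a⟩ : TangentBundle (𝓡∂ (2 * n)) M))
      (extChartAt (𝓡∂ (2 * n)) c).source := by
  have h1 := (Bundle.Trivialization.contMDiffOn_section_baseSet_iff (IB := 𝓡∂ (2 * n)) (n := ∞)
    (s := fun p => fromChart c p a)
    (trivializationAt (Coord n) (TangentSpace (𝓡∂ (2 * n)) (M := M)) c)).2
  rw [TangentBundle.trivializationAt_baseSet, ← extChartAt_source (𝓡∂ (2 * n))] at h1
  refine h1 ((contMDiffOn_const (c := a)).congr fun p hp => ?_)
  exact toChart_fromChart hp a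

theorem contMDiffOn_toChart (c : M) {X : ∀ p : M, TangentSpace (𝓡∂ (2 * n)) p}
    (hX : ContMDiffOn (𝓡∂ (2 * n)) (𝓡∂ (2 * n)).tangent ∞
      (fun p => (⟨p, X p⟩ : TangentBundle (𝓡∂ (2 * n)) M)) (extChartAt (𝓡∂ (2 * n)) c).source) :
    ContMDiffOn (𝓡∂ (2 * n)) 𝓘(ℝ, Coord n) ∞ (fun p => toChart c p (X p))
      (extChartAt (𝓡∂ (2 * n)) c).source := by
  have h1 := (Bundle.Trivialization.contMDiffOn_section_baseSet_iff (IB := 𝓡∂ (2 * n)) (n := ∞)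
    (s := X)
    (trivializationAt (Coord n) (TangentSpace (𝓡∂ (2 * n)) (M := M)) c)).1
  rw [TangentBundle.trivializationAt_baseSet, ← extChartAt_source (𝓡∂ (2 * n))] at h1
  exact (h1 hX).congr fun p hp => rfl

/-- A smooth function on the domain of a chart is smooth in the coordinates. -/
theorem ContMDiffOn.contDiffOn_extChartAt_symm {F : Type*} [NormedAddCommGroup F] [NormedSpace ℝ F]
    {c : M} {k : ℕ∞ω} [ENat.LEInfty k] {u : M → F}
    (hu : ContMDiffOn (𝓡∂ (2 * n)) 𝓘(ℝ, F) k u (extChartAt (𝓡∂ (2 * n)) c).source) :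
    ContDiffOn ℝ k (u ∘ (extChartAt (𝓡∂ (2 * n)) c).symm) (extChartAt (𝓡∂ (2 * n)) c).target := by
  rw [← contMDiffOn_iff_contDiffOn]
  exact hu.comp ((contMDiffOn_extChartAt_symm (n := ∞) c).of_le ENat.LEInfty.out)
    fun y hy => (extChartAt (𝓡∂ (2 * n)) c).map_target hy

variable (h : HermitianStructure n M)

/-- The matrix of the complex structure in the chart around `c`. -/
def chartJ (c : M) (y : Coord n) : Coord n →L[ℝ] Coord n :=
  (toChart c ((extChartAt (𝓡∂ (2 * n)) c).symm y)).comp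
    ((h.J _).comp (fromChart c ((extChartAt (𝓡∂ (2 * n)) c).symm y)))

/-- The components of a `1`-form in the chart around `c`. -/
def chartOneForm (c : M) (α : ∀ x : M, TangentSpace (𝓡∂ (2 * n)) x →L[ℝ] ℝ) (y : Coord n) :
    Coord n →L[ℝ] ℝ :=
  (α _).comp (fromChart c ((extChartAt (𝓡∂ (2 * n)) c).symm y))

/-- The components of a field of bilinear forms in the chart around `c`. -/
def chartBilin (c : M)
    (β : ∀ x : M, TangentSpace (𝓡∂ (2 * n)) x →L[ℝ] TangentSpace (𝓡∂ (2 * n)) x →L[ℝ] ℝ)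
    (y : Coord n) : Coord n →L[ℝ] Coord n →L[ℝ] ℝ :=
  ContinuousLinearMap.bilinearComp
    (show Coord n →L[ℝ] Coord n →L[ℝ] ℝ from β ((extChartAt (𝓡∂ (2 * n)) c).symm y))
    (show Coord n →L[ℝ] Coord n from fromChart c ((extChartAt (𝓡∂ (2 * n)) c).symm y))
    (show Coord n →L[ℝ] Coord n from fromChart c ((extChartAt (𝓡∂ (2 * n)) c).symm y))

theorem chartBilin_apply (c : M)
    (β : ∀ x : M, TangentSpace (𝓡∂ (2 * n)) x →L[ℝ] TangentSpace (𝓡∂ (2 * n)) x →L[ℝ] ℝ)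
    (y a b : Coord n) : chartBilin c β y a b
      = β ((extChartAt (𝓡∂ (2 * n)) c).symm y) (fromChart c _ a) (fromChart c _ b) := rfl

theorem contDiffOn_chartJ (c : M) :
    ContDiffOn ℝ ∞ (chartJ h c) (extChartAt (𝓡∂ (2 * n)) c).target := by
  rw [contDiffOn_clm_apply]
  intro a
  exact ContMDiffOn.contDiffOn_extChartAt_symm (k := ∞) (u := fun p => toChart c p
    (h.J p (fromChart c p a)))
    (contMDiffOn_toChart c (ContMDiffOn.clm_bundle_apply (b := fun p => p) h.J_smooth.contMDiffOn
      (contMDiffOn_fromChart c a)))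

theorem contDiffOn_chartBilin (c : M)
    {β : ∀ x : M, TangentSpace (𝓡∂ (2 * n)) x →L[ℝ] TangentSpace (𝓡∂ (2 * n)) x →L[ℝ] ℝ}
    (hβ : ContMDiff (𝓡∂ (2 * n)) ((𝓡∂ (2 * n)).prod 𝓘(ℝ, Coord n →L[ℝ] Coord n →L[ℝ] ℝ)) ∞
      (fun x => Bundle.TotalSpace.mk' (Coord n →L[ℝ] Coord n →L[ℝ] ℝ)
      (E := fun x : M =>
        TangentSpace (𝓡∂ (2 * n)) x →L[ℝ] TangentSpace (𝓡∂ (2 * n)) x →L[ℝ] ℝ) x (β x))) :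
    ContDiffOn ℝ ∞ (chartBilin c β) (extChartAt (𝓡∂ (2 * n)) c).target := by
  rw [contDiffOn_clm_apply]
  intro a
  rw [contDiffOn_clm_apply]
  intro b
  have h1 := ContMDiffOn.clm_bundle_apply₂ (F₃ := ℝ) (E₃ := Bundle.Trivial M ℝ) (b := fun p => p)
    hβ.contMDiffOn (contMDiffOn_fromChart c a) (contMDiffOn_fromChart c b)
  refine ContMDiffOn.contDiffOn_extChartAt_symm (k := ∞) (u := fun p => β p (fromChart c p a)
    (fromChart c p b)) ?_
  intro x hx
  have h2 := h1 x hx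
  simp only [Bundle.contMDiffWithinAt_totalSpace] at h2
  exact h2.2

theorem isHermitianPair_chart {c : M} {y : Coord n}
    (hy : y ∈ (extChartAt (𝓡∂ (2 * n)) c).target) :
    IsHermitianPair (chartJ h c y) (chartBilin c h.metric.inner y) := by
  have hp := (extChartAt (𝓡∂ (2 * n)) c).map_target hy
  refine ⟨fun a => ?_, fun a b => ?_, fun a ha => ?_, fun a b => ?_⟩
  · simp only [chartJ, ContinuousLinearMap.comp_apply]
    rw [fromChart_toChart hp, h.J_J, map_neg, toChart_fromChart hp]
  · rw [chartBilin_apply, chartBilin_apply, h.metric.symm]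
  · rw [chartBilin_apply]
    refine h.metric.pos _ _ fun h0 => ha ?_
    rw [← toChart_fromChart hp a]
    exact (congrArg _ h0).trans (map_zero _)
  · simp only [chartJ, chartBilin_apply, ContinuousLinearMap.comp_apply]
    rw [fromChart_toChart hp, fromChart_toChart hp, h.metric_J]

/-- The Hermitian structure in the coordinates of the chart around `c`. -/
def chartPatch (χ : RealOneOneForm h) (c : M) : HermitianPatch (Coord n) where
  h₀ := zerothCoord n
  exists_eq_one := exists_zerothCoord_eq_one
  U := (extChartAt (𝓡∂ (2 * n)) c).target
  subset := extChartAt_target_subset_halfSpace c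
  mem_nhdsWithin _ hy := extChartAt_target_mem_nhdsWithin_halfSpace c hy
  J := chartJ h c
  g := chartBilin c h.metric.inner
  χ := chartBilin c χ.form
  J_smooth := contDiffOn_chartJ h c
  g_smooth := contDiffOn_chartBilin c h.metric.contMDiff
  χ_smooth := contDiffOn_chartBilin c χ.form_smooth
  pair _ hy := isHermitianPair_chart h hy

end ChartPatch

/-! ### Invariance of the complex Hessian -/

section ChartTransfer

variable {n : ℕ} [NeZero n] {M : Type*} [TopologicalSpace M]
  [ChartedSpace (EuclideanHalfSpace (2 * n)) M]

/-- The change of coordinates from the preferred chart at `x` to the chart around `c`. -/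
def coordChange (c x : M) : Coord n → Coord n :=
  extChartAt (𝓡∂ (2 * n)) c ∘ (extChartAt (𝓡∂ (2 * n)) x).symm

theorem coordChange_self {c x : M} :
    coordChange c x (extChartAt (𝓡∂ (2 * n)) x x) = extChartAt (𝓡∂ (2 * n)) c x := by
  rw [coordChange, Function.comp_apply, extChartAt_to_inv]

theorem extChartAt_mem_halfSpace (c x : M) :
    extChartAt (𝓡∂ (2 * n)) c x ∈ halfSpace (zerothCoord n) := by
  rw [← range_eq_halfSpace]
  exact mem_range_self _

/-- Points near `x` lie in the domain of both charts. -/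
theorem eventually_mem_charts {c x : M} (hx : x ∈ (extChartAt (𝓡∂ (2 * n)) c).source) :
    ∀ᶠ z in 𝓝[halfSpace (zerothCoord n)] (extChartAt (𝓡∂ (2 * n)) x x),
      z ∈ (extChartAt (𝓡∂ (2 * n)) x).target ∧
      (extChartAt (𝓡∂ (2 * n)) x).symm z ∈ (extChartAt (𝓡∂ (2 * n)) c).source := by
  have h1 := extChartAt_target_mem_nhdsWithin_halfSpace x (mem_extChartAt_target (I := 𝓡∂ (2 * n))
    x)
  have h2 := (continuousAt_extChartAt_symm (I := 𝓡∂ (2 * n)) x).preimage_mem_nhds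
    (t := (extChartAt (𝓡∂ (2 * n)) c).source) (by
      rw [extChartAt_to_inv]
      exact (isOpen_extChartAt_source c).mem_nhds hx)
  filter_upwards [h1, mem_nhdsWithin_of_mem_nhds h2] with z hz1 hz2 using ⟨hz1, hz2⟩

variable [IsManifold (𝓡∂ (2 * n)) ∞ M]

theorem contDiffWithinAt_coordChange {c x : M} (hx : x ∈ (extChartAt (𝓡∂ (2 * n)) c).source) :
    ContDiffWithinAt ℝ 2 (coordChange c x) (halfSpace (zerothCoord n))
      (extChartAt (𝓡∂ (2 * n)) x x) := by
  rw [← range_eq_halfSpace]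
  refine (contDiffWithinAt_ext_coord_change (n := ∞) c x ?_).of_le ENat.LEInfty.out
  rw [PartialEquiv.trans_source, PartialEquiv.symm_source]
  refine ⟨mem_extChartAt_target x, ?_⟩
  rwa [mem_preimage, extChartAt_to_inv]

theorem toChart_eq_fderivWithin {c x : M} (hx : x ∈ (extChartAt (𝓡∂ (2 * n)) c).source)
    (v : TangentSpace (𝓡∂ (2 * n)) x) :
    toChart c x v = fderivWithin ℝ (coordChange c x) (halfSpace (zerothCoord n))
      (extChartAt (𝓡∂ (2 * n)) x x) (coordVec x v) := by
  have h1 := toChart_fromChart_of_ne hx (mem_extChartAt_source (I := 𝓡∂ (2 * n)) x) (toChart x x v)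
  rw [fromChart_toChart (mem_extChartAt_source x), toChart_self, range_eq_halfSpace] at h1
  rw [h1, coordVec_eq]
  rfl

/-- The coordinate fields of the preferred chart at `x`, in the chart around `c`. -/
theorem coordField_eq_fromChart {c x : M} {z : Coord n}
    (hz : z ∈ (extChartAt (𝓡∂ (2 * n)) x).target)
    (hz' : (extChartAt (𝓡∂ (2 * n)) x).symm z ∈ (extChartAt (𝓡∂ (2 * n)) c).source)
    (b : Coord n) :
    coordField x b z = fromChart c ((extChartAt (𝓡∂ (2 * n)) x).symm z)
      (fderivWithin ℝ (coordChange c x) (halfSpace (zerothCoord n)) z b) := by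
  have h1 := toChart_fromChart_of_ne hz' ((extChartAt (𝓡∂ (2 * n)) x).map_target hz) b
  rw [(extChartAt (𝓡∂ (2 * n)) x).right_inv hz, range_eq_halfSpace] at h1
  rw [coordField_eq hz, coordChange, ← h1, fromChart_toChart hz']

/-- A `1`-form evaluated on a coordinate field of the preferred chart at `x`, in terms of the
chart around `c`. -/
theorem oneForm_coordField {c x : M} (α : ∀ x : M, TangentSpace (𝓡∂ (2 * n)) x →L[ℝ] ℝ)
    {z : Coord n} (hz : z ∈ (extChartAt (𝓡∂ (2 * n)) x).target)
    (hz' : (extChartAt (𝓡∂ (2 * n)) x).symm z ∈ (extChartAt (𝓡∂ (2 * n)) c).source)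
    (b : Coord n) :
    α _ (coordField x b z) = chartOneForm c α (coordChange c x z)
      (fderivWithin ℝ (coordChange c x) (halfSpace (zerothCoord n)) z b) := by
  rw [coordField_eq_fromChart hz hz']
  have h1 : ∀ p, p = (extChartAt (𝓡∂ (2 * n)) x).symm z → ∀ w : Coord n,
      α _ (fromChart c ((extChartAt (𝓡∂ (2 * n)) x).symm z) w) = α p (fromChart c p w) := by
    rintro p rfl w; rfl
  exact h1 _ ((extChartAt (𝓡∂ (2 * n)) c).left_inv hz') _

theorem bilin_coordField {c x : M}
    (β : ∀ x : M, TangentSpace (𝓡∂ (2 * n)) x →L[ℝ] TangentSpace (𝓡∂ (2 * n)) x →L[ℝ] ℝ)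
    {z : Coord n} (hz : z ∈ (extChartAt (𝓡∂ (2 * n)) x).target)
    (hz' : (extChartAt (𝓡∂ (2 * n)) x).symm z ∈ (extChartAt (𝓡∂ (2 * n)) c).source)
    (b d : Coord n) :
    β _ (coordField x b z) (coordField x d z) = chartBilin c β (coordChange c x z)
      (fderivWithin ℝ (coordChange c x) (halfSpace (zerothCoord n)) z b)
      (fderivWithin ℝ (coordChange c x) (halfSpace (zerothCoord n)) z d) := by
  rw [coordField_eq_fromChart hz hz', coordField_eq_fromChart hz hz']
  have h1 : ∀ p, p = (extChartAt (𝓡∂ (2 * n)) x).symm z → ∀ w w' : Coord n,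
      β _ (fromChart c ((extChartAt (𝓡∂ (2 * n)) x).symm z) w)
        (fromChart c ((extChartAt (𝓡∂ (2 * n)) x).symm z) w')
      = β p (fromChart c p w) (fromChart c p w') := by
    rintro p rfl w w'; rfl
  exact h1 _ ((extChartAt (𝓡∂ (2 * n)) c).left_inv hz') _ _

theorem coordDeriv_oneForm {c x : M} (hx : x ∈ (extChartAt (𝓡∂ (2 * n)) c).source)
    (α : ∀ x : M, TangentSpace (𝓡∂ (2 * n)) x →L[ℝ] ℝ)
    (hα : DifferentiableWithinAt ℝ (chartOneForm c α) (halfSpace (zerothCoord n))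
      (extChartAt (𝓡∂ (2 * n)) c x)) (X Y : TangentSpace (𝓡∂ (2 * n)) x) :
    coordDeriv x (fun y => α _ (coordField x (coordVec x Y) y)) X
      = fderivWithin ℝ (chartOneForm c α) (halfSpace (zerothCoord n))
          (extChartAt (𝓡∂ (2 * n)) c x) (toChart c x X) (toChart c x Y)
        + chartOneForm c α (extChartAt (𝓡∂ (2 * n)) c x)
          (fderivWithin ℝ (fderivWithin ℝ (coordChange c x) (halfSpace (zerothCoord n)))
            (halfSpace (zerothCoord n)) (extChartAt (𝓡∂ (2 * n)) x x)
            (coordVec x X) (coordVec x Y)) := by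
  have hev := eventually_mem_charts hx
  have hself := coordChange_self (n := n) (c := c) (x := x)
  have h1 := fderivWithin_pullback_oneForm exists_zerothCoord_eq_one
    (extChartAt_mem_halfSpace x x) (contDiffWithinAt_coordChange hx)
    (Eventually.of_forall fun z => extChartAt_mem_halfSpace c ((extChartAt (𝓡∂ (2 * n)) x).symm z))
      (hself ▸ hα)
    (coordVec x X) (coordVec x Y)
  rw [hself, ← toChart_eq_fderivWithin hx, ← toChart_eq_fderivWithin hx] at h1
  rw [← h1, coordDeriv, range_eq_halfSpace]
  refine DFunLike.congr_fun (Filter.EventuallyEq.fderivWithin_eq_of_mem ?_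
    (extChartAt_mem_halfSpace (n := n) x x)) _
  filter_upwards [hev] with z hz using oneForm_coordField α hz.1 hz.2 _

theorem coordDeriv_bilin {c x : M} (hx : x ∈ (extChartAt (𝓡∂ (2 * n)) c).source)
    (β : ∀ x : M, TangentSpace (𝓡∂ (2 * n)) x →L[ℝ] TangentSpace (𝓡∂ (2 * n)) x →L[ℝ] ℝ)
    (hβ : DifferentiableWithinAt ℝ (chartBilin c β) (halfSpace (zerothCoord n))
      (extChartAt (𝓡∂ (2 * n)) c x)) (X Y Z : TangentSpace (𝓡∂ (2 * n)) x) :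
    coordDeriv x (fun y => β _ (coordField x (coordVec x Y) y) (coordField x (coordVec x Z) y)) X
      = fderivWithin ℝ (chartBilin c β) (halfSpace (zerothCoord n))
          (extChartAt (𝓡∂ (2 * n)) c x) (toChart c x X) (toChart c x Y) (toChart c x Z)
        + chartBilin c β (extChartAt (𝓡∂ (2 * n)) c x)
          (fderivWithin ℝ (fderivWithin ℝ (coordChange c x) (halfSpace (zerothCoord n)))
            (halfSpace (zerothCoord n)) (extChartAt (𝓡∂ (2 * n)) x x)
            (coordVec x X) (coordVec x Y)) (toChart c x Z)
        + chartBilin c β (extChartAt (𝓡∂ (2 * n)) c x) (toChart c x Y)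
          (fderivWithin ℝ (fderivWithin ℝ (coordChange c x) (halfSpace (zerothCoord n)))
            (halfSpace (zerothCoord n)) (extChartAt (𝓡∂ (2 * n)) x x)
            (coordVec x X) (coordVec x Z)) := by
  have hev := eventually_mem_charts hx
  have hself := coordChange_self (n := n) (c := c) (x := x)
  have h1 := fderivWithin_pullback_bilin exists_zerothCoord_eq_one
    (extChartAt_mem_halfSpace x x) (contDiffWithinAt_coordChange hx)
    (Eventually.of_forall fun z => extChartAt_mem_halfSpace c ((extChartAt (𝓡∂ (2 * n)) x).symm z))
      (hself ▸ hβ)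
    (coordVec x X) (coordVec x Y) (coordVec x Z)
  rw [hself, ← toChart_eq_fderivWithin hx, ← toChart_eq_fderivWithin hx,
    ← toChart_eq_fderivWithin hx] at h1
  rw [← h1, coordDeriv, range_eq_halfSpace]
  refine DFunLike.congr_fun (Filter.EventuallyEq.fderivWithin_eq_of_mem ?_
    (extChartAt_mem_halfSpace (n := n) x x)) _
  filter_upwards [hev] with z hz using bilin_coordField β hz.1 hz.2 _ _

variable (h : HermitianStructure n M)

theorem toChart_J {c x : M} (hx : x ∈ (extChartAt (𝓡∂ (2 * n)) c).source)
    (V : TangentSpace (𝓡∂ (2 * n)) x) :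
    toChart c x (h.J x V) = chartJ h c (extChartAt (𝓡∂ (2 * n)) c x) (toChart c x V) := by
  have h1 : ∀ p, p = x → ∀ w : Coord n,
      (toChart c p (h.J p (fromChart c p w)) : Coord n) = toChart c x
        (h.J x (fromChart c x w)) := by
    rintro p rfl w; rfl
  have h2 := h1 _ ((extChartAt (𝓡∂ (2 * n)) c).left_inv hx) (toChart c x V)
  rw [fromChart_toChart hx] at h2
  exact h2.symm

theorem chartBilin_toChart {c x : M} (hx : x ∈ (extChartAt (𝓡∂ (2 * n)) c).source)
    (β : ∀ x : M, TangentSpace (𝓡∂ (2 * n)) x →L[ℝ] TangentSpace (𝓡∂ (2 * n)) x →L[ℝ] ℝ)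
    (V W : TangentSpace (𝓡∂ (2 * n)) x) :
    chartBilin c β (extChartAt (𝓡∂ (2 * n)) c x) (toChart c x V) (toChart c x W) = β x V W := by
  have h1 : ∀ p, p = x → ∀ w w' : Coord n,
      β p (fromChart c p w) (fromChart c p w') = β x (fromChart c x w) (fromChart c x w') := by
    rintro p rfl w w'; rfl
  have h2 := h1 _ ((extChartAt (𝓡∂ (2 * n)) c).left_inv hx) (toChart c x V) (toChart c x W)
  rw [fromChart_toChart hx, fromChart_toChart hx] at h2
  exact h2

theorem chartOneForm_toChart {c x : M} (hx : x ∈ (extChartAt (𝓡∂ (2 * n)) c).source)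
    (α : ∀ x : M, TangentSpace (𝓡∂ (2 * n)) x →L[ℝ] ℝ)
    (V : TangentSpace (𝓡∂ (2 * n)) x) :
    chartOneForm c α (extChartAt (𝓡∂ (2 * n)) c x) (toChart c x V) = α x V := by
  have h1 : ∀ p, p = x → ∀ w : Coord n,
      α p (fromChart c p w) = α x (fromChart c x w) := by
    rintro p rfl w; rfl
  have h2 := h1 _ ((extChartAt (𝓡∂ (2 * n)) c).left_inv hx) (toChart c x V)
  rw [fromChart_toChart hx] at h2
  exact h2

/-- A function in the coordinates of the chart around `c`. -/
abbrev inChart (c : M) (u : M → ℝ) : Coord n → ℝ := u ∘ (extChartAt (𝓡∂ (2 * n)) c).symm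

theorem contDiffOn_inChart (c : M) {k : ℕ∞ω} [ENat.LEInfty k] {u : M → ℝ}
    (hu : ContMDiff (𝓡∂ (2 * n)) 𝓘(ℝ, ℝ) k u) :
    ContDiffOn ℝ k (inChart c u) (extChartAt (𝓡∂ (2 * n)) c).target :=
  hu.contMDiffOn.contDiffOn_extChartAt_symm

theorem chartOneForm_differential {c : M} {u : M → ℝ} (hu : MDifferentiable (𝓡∂ (2 * n)) 𝓘(ℝ, ℝ) u)
    {y : Coord n} (hy : y ∈ (extChartAt (𝓡∂ (2 * n)) c).target) :
    chartOneForm c (fun p => differential u p) y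
      = fderivWithin ℝ (inChart c u) (halfSpace (zerothCoord n)) y := by
  ext a
  have h1 := differential_fromChart ((extChartAt (𝓡∂ (2 * n)) c).map_target hy) (hu _) a
  rw [(extChartAt (𝓡∂ (2 * n)) c).right_inv hy, range_eq_halfSpace] at h1
  exact h1

theorem chartOneForm_differential_J {c : M} {u : M → ℝ}
    (hu : MDifferentiable (𝓡∂ (2 * n)) 𝓘(ℝ, ℝ) u)
    {y : Coord n} (hy : y ∈ (extChartAt (𝓡∂ (2 * n)) c).target) :
    chartOneForm c (fun p => -((differential u p).comp (h.J p))) y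
      = -(fderivWithin ℝ (inChart c u) (halfSpace (zerothCoord n)) y).comp (chartJ h c y) := by
  ext a
  rw [← chartOneForm_differential hu hy]
  simp only [chartOneForm, chartJ, ContinuousLinearMap.comp_apply, neg_apply]
  rw [fromChart_toChart ((extChartAt (𝓡∂ (2 * n)) c).map_target hy)]

variable (χ : RealOneOneForm h)

/-- The operator `√-1 ∂∂̄` is independent of the chart in which it is computed: the second
derivative of the change of coordinates is symmetric and drops out of the exterior derivative. -/
theorem ddbar_eq {c x : M} (hx : x ∈ (extChartAt (𝓡∂ (2 * n)) c).source) {u : M → ℝ}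
    (hu : ContMDiff (𝓡∂ (2 * n)) 𝓘(ℝ, ℝ) 2 u) (X Y : TangentSpace (𝓡∂ (2 * n)) x) :
    ddbar h u x X Y = (chartPatch h χ c).ddc (inChart c u) (extChartAt (𝓡∂ (2 * n)) c x)
      (toChart c x X) (toChart c x Y) := by
  have hy := (extChartAt (𝓡∂ (2 * n)) c).map_source hx
  set y := extChartAt (𝓡∂ (2 * n)) c x with hydef
  have hud := hu.mdifferentiable (by simp)
  have huniq := uniqueDiffOn_halfSpace (exists_zerothCoord_eq_one (n := n)) y
    (extChartAt_target_subset_halfSpace c hy)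
  have h1 := hasFDerivWithinAt_fderivWithin exists_zerothCoord_eq_one
    (extChartAt_target_subset_halfSpace c)
    (fun y hy => extChartAt_target_mem_nhdsWithin_halfSpace c hy) (contDiffOn_inChart c hu) hy
  have h2 : HasFDerivWithinAt (chartJ h c) ((chartPatch h χ c).DJ y)
      (halfSpace (zerothCoord n)) y :=
    (((contDiffOn_chartJ h c).contDiffWithinAt_halfSpace
      (fun y hy => extChartAt_target_mem_nhdsWithin_halfSpace c hy) hy).differentiableWithinAt
        (by simp)).hasFDerivWithinAt
  have h3 := (h1.clm_comp h2).neg.congr_of_eventuallyEq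
    (f₁ := chartOneForm c (fun p => -((differential u p).comp (h.J p))))
    (by filter_upwards [extChartAt_target_mem_nhdsWithin_halfSpace c hy] with z hz using
          chartOneForm_differential_J h hud hz) (chartOneForm_differential_J h hud hy)
  have hc := coordDeriv_oneForm hx _ h3.differentiableWithinAt
  have hsymm := fderivWithin_fderivWithin_symm exists_zerothCoord_eq_one
    (extChartAt_mem_halfSpace x x) (contDiffWithinAt_coordChange hx) (coordVec x X) (coordVec x Y)
  rw [ddbar, extDerivOneForm, hc, hc, hsymm, HermitianPatch.ddc, ← hydef, h3.fderivWithin huniq]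
  have e1 : (chartPatch h χ c).J y = chartJ h c y := rfl
  have e2 : (chartPatch h χ c).S = halfSpace (zerothCoord n) := rfl
  rw [e1, e2]
  simp
  ring

theorem gForm_J_eq {c x : M} (hx : x ∈ (extChartAt (𝓡∂ (2 * n)) c).source) {u : M → ℝ}
    (hu : ContMDiff (𝓡∂ (2 * n)) 𝓘(ℝ, ℝ) 2 u) (X Y : TangentSpace (𝓡∂ (2 * n)) x) :
    gForm h χ u x X (h.J x Y) = (chartPatch h χ c).form (inChart c u)
      (extChartAt (𝓡∂ (2 * n)) c x) (toChart c x X) (toChart c x Y) := by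
  rw [gForm, ddbar_eq h χ hx hu, toChart_J h hx, HermitianPatch.form_apply,
    ← chartBilin_toChart hx χ.form, toChart_J h hx]
  rfl

end ChartTransfer

/-! ### The Hessian in a chart -/

section HessianTransfer

variable {n : ℕ} [NeZero n] {M : Type*} [TopologicalSpace M]
  [ChartedSpace (EuclideanHalfSpace (2 * n)) M] [IsManifold (𝓡∂ (2 * n)) ∞ M]
  (h : HermitianStructure n M) (χ : RealOneOneForm h)

theorem inner_metricGradient (u : M → ℝ) (x : M) (X : TangentSpace (𝓡∂ (2 * n)) x) :
    h.metric.inner x (metricGradient h u x) X = differential u x X :=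
  (exists_riesz h x (differential u x)).choose_spec X

theorem differential_eq {c x : M} (hx : x ∈ (extChartAt (𝓡∂ (2 * n)) c).source) {u : M → ℝ}
    (hu : MDifferentiable (𝓡∂ (2 * n)) 𝓘(ℝ, ℝ) u) (X : TangentSpace (𝓡∂ (2 * n)) x) :
    differential u x X = fderivWithin ℝ (inChart c u) (halfSpace (zerothCoord n))
      (extChartAt (𝓡∂ (2 * n)) c x) (toChart c x X) := by
  rw [← chartOneForm_differential hu ((extChartAt (𝓡∂ (2 * n)) c).map_source hx),
    chartOneForm_toChart hx]

/-- The Hessian of the Levi-Civita connection in the coordinates of any chart. The second derivative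
`D` of the change of coordinates cancels between the Hessian and the Christoffel symbols. -/
theorem realHessian_eq {c x : M} (hx : x ∈ (extChartAt (𝓡∂ (2 * n)) c).source) {u : M → ℝ}
    (hu : ContMDiff (𝓡∂ (2 * n)) 𝓘(ℝ, ℝ) 2 u) (X Y : TangentSpace (𝓡∂ (2 * n)) x) :
    realHessian h u x X Y
      = secondDerivWithin (halfSpace (zerothCoord n)) (inChart c u) (extChartAt (𝓡∂ (2 * n)) c x)
          (toChart c x X) (toChart c x Y)
        - 1 / 2 * (fderivWithin ℝ (chartBilin c h.metric.inner) (halfSpace (zerothCoord n))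
            (extChartAt (𝓡∂ (2 * n)) c x) (toChart c x X) (toChart c x Y)
            (toChart c x (metricGradient h u x))
          + fderivWithin ℝ (chartBilin c h.metric.inner) (halfSpace (zerothCoord n))
            (extChartAt (𝓡∂ (2 * n)) c x) (toChart c x Y) (toChart c x X)
            (toChart c x (metricGradient h u x))
          - fderivWithin ℝ (chartBilin c h.metric.inner) (halfSpace (zerothCoord n))
            (extChartAt (𝓡∂ (2 * n)) c x) (toChart c x (metricGradient h u x))
            (toChart c x X) (toChart c x Y)) := by
  have hy := (extChartAt (𝓡∂ (2 * n)) c).map_source hx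
  have hud := hu.mdifferentiable (by simp)
  have huniq := uniqueDiffOn_halfSpace (exists_zerothCoord_eq_one (n := n)) _
    (extChartAt_target_subset_halfSpace c hy)
  have h1 := (hasFDerivWithinAt_fderivWithin exists_zerothCoord_eq_one
    (extChartAt_target_subset_halfSpace c)
    (fun y hy => extChartAt_target_mem_nhdsWithin_halfSpace c hy)
    (contDiffOn_inChart c hu) hy).congr_of_eventuallyEq
    (f₁ := chartOneForm c (fun p => differential u p))
    (by filter_upwards [extChartAt_target_mem_nhdsWithin_halfSpace c hy] with z hz using
          chartOneForm_differential hud hz) (chartOneForm_differential hud hy)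
  have hg := ((contDiffOn_chartBilin c h.metric.contMDiff).contDiffWithinAt_halfSpace
      (fun y hy => extChartAt_target_mem_nhdsWithin_halfSpace c hy) hy).differentiableWithinAt
        (by simp)
  have hc := coordDeriv_oneForm hx _ h1.differentiableWithinAt
  have hd := coordDeriv_bilin hx _ hg
  have hsymm := fun X Y : TangentSpace (𝓡∂ (2 * n)) x =>
    fderivWithin_fderivWithin_symm exists_zerothCoord_eq_one
    (extChartAt_mem_halfSpace x x) (contDiffWithinAt_coordChange hx) (coordVec x X) (coordVec x Y)
  have hgs := (isHermitianPair_chart h hy).symm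
  have hG : ∀ b : Coord n, chartOneForm c (fun p => differential u p)
      (extChartAt (𝓡∂ (2 * n)) c x) b = chartBilin c h.metric.inner (extChartAt (𝓡∂ (2 * n)) c x)
      b (toChart c x (metricGradient h u x)) := by
    intro b
    rw [hgs, ← toChart_fromChart hx b, chartOneForm_toChart hx, chartBilin_toChart hx,
      inner_metricGradient]
  rw [realHessian, metricDeriv, metricDeriv, metricDeriv, hc, hd, hd, hd, h1.fderivWithin huniq,
    hsymm Y X, hsymm (metricGradient h u x) X, hsymm (metricGradient h u x) Y, hG]
  generalize fderivWithin ℝ (fderivWithin ℝ (coordChange c x) (halfSpace (zerothCoord n)))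
    (halfSpace (zerothCoord n)) (extChartAt (𝓡∂ (2 * n)) x x) = D
  linear_combination (-1 / 2) * hgs (toChart c x Y)
    (D (coordVec x X) (coordVec x (metricGradient h u x)))

theorem c2BoundAt_of_C2NormLE (c : M) {v : M → ℝ} {K : ℝ}
    (hv : ContMDiff (𝓡∂ (2 * n)) 𝓘(ℝ, ℝ) 2 v) (hK : C2NormLE h v K) {y : Coord n}
    (hy : y ∈ (extChartAt (𝓡∂ (2 * n)) c).target) :
    (chartPatch h χ c).C2BoundAt (inChart c v) K y := by
  have hx := (extChartAt (𝓡∂ (2 * n)) c).map_target hy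
  have hxy := (extChartAt (𝓡∂ (2 * n)) c).right_inv hy
  obtain ⟨p, hp⟩ : ∃ p, p = (extChartAt (𝓡∂ (2 * n)) c).symm y := ⟨_, rfl⟩
  rw [← hp] at hx hxy
  subst hxy
  obtain ⟨-, h2, h3⟩ := hK p
  have hg := fun a b : TangentSpace (𝓡∂ (2 * n)) p => chartBilin_toChart hx h.metric.inner a b
  refine ⟨toChart c p (metricGradient h v p), fun a => ?_, ?_, fun a b => ?_⟩
  · have h4 := hg (metricGradient h v p) (fromChart c p a)
    rw [inner_metricGradient, differential_eq hx (hv.mdifferentiable (by simp)),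
      toChart_fromChart hx] at h4
    exact h4
  · have h4 := hg (metricGradient h v p) (metricGradient h v p)
    rw [gNorm, ← h4] at h2
    exact h2
  · have h4 := h3 (fromChart c p a) (fromChart c p b)
    rw [realHessian_eq h hx hv, gNorm, gNorm, ← hg, ← hg, toChart_fromChart hx,
      toChart_fromChart hx] at h4
    exact h4

end HessianTransfer

/-! ### Integrability in coordinates -/

section Integrability

variable {n : ℕ} [NeZero n] {M : Type*} [TopologicalSpace M]
  [ChartedSpace (EuclideanHalfSpace (2 * n)) M] [IsManifold (𝓡∂ (2 * n)) ∞ M]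

/-- A vector field with constant components near `x` in the preferred chart at `x` extends to the
whole manifold. -/
theorem exists_smooth_extension [T2Space M] (x : M) (a : Coord n) :
    ∃ X : ∀ p : M, TangentSpace (𝓡∂ (2 * n)) p,
      ContMDiff (𝓡∂ (2 * n)) (𝓡∂ (2 * n)).tangent ∞
        (fun p => (⟨p, X p⟩ : TangentBundle (𝓡∂ (2 * n)) M)) ∧
      ∀ᶠ p in 𝓝 x, X p = fromChart x p a := by
  let ρ : SmoothBumpFunction (𝓡∂ (2 * n)) x := Classical.arbitrary _
  refine ⟨fun p => ρ p • fromChart x p a, ?_, ?_⟩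
  · exact ContMDiffOn.smul_section_of_tsupport (ψ := ρ) (s := fun p => fromChart x p a)
      ρ.contMDiff.contMDiffOn (isOpen_extChartAt_source x) ρ.tsupport_subset_extChartAt_source
      (contMDiffOn_fromChart x a)
  · filter_upwards [ρ.eventuallyEq_one] with p hp
    rw [hp, Pi.one_apply, one_smul]

/-- The components of a vector field in the chart around `x`. -/
theorem mpullbackWithin_extChartAt_symm (x : M) (V : ∀ p : M, TangentSpace (𝓡∂ (2 * n)) p)
    {y : Coord n} (hy : y ∈ (extChartAt (𝓡∂ (2 * n)) x).target) :
    VectorField.mpullbackWithin 𝓘(ℝ, Coord n) (𝓡∂ (2 * n)) (extChartAt (𝓡∂ (2 * n)) x).symm V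
      (range (𝓡∂ (2 * n))) y = toChart x _ (V ((extChartAt (𝓡∂ (2 * n)) x).symm y)) := by
  have hp := (extChartAt (𝓡∂ (2 * n)) x).map_target hy
  have h1 := fromChart_eq_mfderivWithin hp
  rw [(extChartAt (𝓡∂ (2 * n)) x).right_inv hy] at h1
  have h2 : (mfderivWithin 𝓘(ℝ, Coord n) (𝓡∂ (2 * n)) (extChartAt (𝓡∂ (2 * n)) x).symm
      (range (𝓡∂ (2 * n))) y).inverse = toChart x ((extChartAt (𝓡∂ (2 * n)) x).symm y) := by
    refine ContinuousLinearMap.inverse_eq ?_ ?_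
    · exact ContinuousLinearMap.ext fun v =>
        (DFunLike.congr_fun h1 (toChart x _ v)).symm.trans (fromChart_toChart hp v)
    · exact ContinuousLinearMap.ext fun v =>
        (congrArg (toChart x _) (DFunLike.congr_fun h1 v)).symm.trans (toChart_fromChart hp v)
  exact DFunLike.congr_fun h2 _

/-- The Lie bracket in the coordinates of the preferred chart. -/
theorem mlieBracket_eq (x : M) {V W : ∀ p : M, TangentSpace (𝓡∂ (2 * n)) p} {V' W' : Coord n → Coord
    n}
    (hV : ∀ᶠ p in 𝓝 x, toChart x p (V p) = V' (extChartAt (𝓡∂ (2 * n)) x p))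
    (hW : ∀ᶠ p in 𝓝 x, toChart x p (W p) = W' (extChartAt (𝓡∂ (2 * n)) x p)) :
    toChart x x (VectorField.mlieBracket (𝓡∂ (2 * n)) V W x)
      = fderivWithin ℝ W' (halfSpace (zerothCoord n)) (extChartAt (𝓡∂ (2 * n)) x x)
          (V' (extChartAt (𝓡∂ (2 * n)) x x))
        - fderivWithin ℝ V' (halfSpace (zerothCoord n)) (extChartAt (𝓡∂ (2 * n)) x x)
          (W' (extChartAt (𝓡∂ (2 * n)) x x)) := by
  have key : ∀ {V : ∀ p : M, TangentSpace (𝓡∂ (2 * n)) p} {V' : Coord n → Coord n},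
      (∀ᶠ p in 𝓝 x, toChart x p (V p) = V' (extChartAt (𝓡∂ (2 * n)) x p)) →
      VectorField.mpullbackWithin 𝓘(ℝ, Coord n) (𝓡∂ (2 * n)) (extChartAt (𝓡∂ (2 * n)) x).symm V
        (range (𝓡∂ (2 * n))) =ᶠ[𝓝[halfSpace (zerothCoord n)] (extChartAt (𝓡∂ (2 * n)) x x)] V' := by
    intro V V' hV
    have h1 := (continuousAt_extChartAt_symm (I := 𝓡∂ (2 * n)) x).tendsto
    rw [extChartAt_to_inv] at h1
    filter_upwards [mem_nhdsWithin_of_mem_nhds (h1.eventually hV),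
      extChartAt_target_mem_nhdsWithin_halfSpace x (mem_extChartAt_target x)] with z hz hz'
    rw [mpullbackWithin_extChartAt_symm x V hz', hz, (extChartAt (𝓡∂ (2 * n)) x).right_inv hz']
  have h2 : ∀ v : Coord n, (mfderiv (𝓡∂ (2 * n)) 𝓘(ℝ, Coord n)
      (extChartAt (𝓡∂ (2 * n)) x) x).inverse v = v := by
    intro v
    rw [mfderiv_extChartAt_self]
    have h4 := DFunLike.congr_fun (ContinuousLinearMap.inverse_id (R := ℝ) (M := Coord n)) v
    exact h4
  have h3 := (key hV).lieBracketWithin_vectorField_eq_of_mem (𝕜 := ℝ) (key hW)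
    (extChartAt_mem_halfSpace x x)
  rw [toChart_self]
  refine (h2 _).trans (Eq.trans ?_ h3)
  rw [preimage_univ, univ_inter, ← range_eq_halfSpace]

variable (h : HermitianStructure n M)

/-- The Nijenhuis tensor vanishes in coordinates. -/
theorem chartJ_integrable [T2Space M] (x : M) (a b : Coord n) :
    chartJ h x (extChartAt (𝓡∂ (2 * n)) x x)
      (fderivWithin ℝ (chartJ h x) (halfSpace (zerothCoord n)) (extChartAt (𝓡∂ (2 * n)) x x) a b
        - fderivWithin ℝ (chartJ h x) (halfSpace (zerothCoord n)) (extChartAt (𝓡∂ (2 * n)) x x) b a)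
      = fderivWithin ℝ (chartJ h x) (halfSpace (zerothCoord n)) (extChartAt (𝓡∂ (2 * n)) x x)
          (chartJ h x (extChartAt (𝓡∂ (2 * n)) x x) a) b
        - fderivWithin ℝ (chartJ h x) (halfSpace (zerothCoord n)) (extChartAt (𝓡∂ (2 * n)) x x)
          (chartJ h x (extChartAt (𝓡∂ (2 * n)) x x) b) a := by
  obtain ⟨X, hX, hXa⟩ := exists_smooth_extension x a
  obtain ⟨Y, hY, hYb⟩ := exists_smooth_extension x b
  have h0 := congrArg (toChart x x) (h.J_integrable X Y hX hY x)
  have hsrc := extChartAt_source_mem_nhds (I := 𝓡∂ (2 * n)) x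
  have e1 : ∀ {X : ∀ p : M, TangentSpace (𝓡∂ (2 * n)) p} {a : Coord n},
      (∀ᶠ p in 𝓝 x, X p = fromChart x p a) →
      ∀ᶠ p in 𝓝 x, toChart x p (X p) = (fun _ => a) (extChartAt (𝓡∂ (2 * n)) x p) := by
    intro X a hX
    filter_upwards [hX, hsrc] with p hp hp'
    rw [hp, toChart_fromChart hp']
  have e2 : ∀ {X : ∀ p : M, TangentSpace (𝓡∂ (2 * n)) p} {a : Coord n},
      (∀ᶠ p in 𝓝 x, X p = fromChart x p a) →
      ∀ᶠ p in 𝓝 x, toChart x p (h.J p (X p))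
        = (fun y => chartJ h x y a) (extChartAt (𝓡∂ (2 * n)) x p) := by
    intro X a hX
    filter_upwards [hX, hsrc] with p hp hp'
    rw [hp, toChart_J h hp', toChart_fromChart hp']
  have hx := mem_extChartAt_source (I := 𝓡∂ (2 * n)) x
  have hy := mem_extChartAt_target (I := 𝓡∂ (2 * n)) x
  have hd : ∀ a c : Coord n, fderivWithin ℝ (fun y => chartJ h x y a) (halfSpace (zerothCoord n))
      (extChartAt (𝓡∂ (2 * n)) x x) c = fderivWithin ℝ (chartJ h x) (halfSpace (zerothCoord n))
        (extChartAt (𝓡∂ (2 * n)) x x) c a := by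
    intro a c
    have h1 := (((contDiffOn_chartJ h x).contDiffWithinAt_halfSpace
      (fun y hy => extChartAt_target_mem_nhdsWithin_halfSpace x hy) hy).differentiableWithinAt
        (by simp)).hasFDerivWithinAt
    have h2 := (ContinuousLinearMap.apply ℝ (Coord n) a).hasFDerivAt.comp_hasFDerivWithinAt _ h1
    exact DFunLike.congr_fun (h2.fderivWithin (uniqueDiffOn_halfSpace exists_zerothCoord_eq_one _
      (extChartAt_mem_halfSpace x x))) c
  simp only [map_add, map_sub, map_zero, toChart_J h hx] at h0
  rw [mlieBracket_eq x (V' := fun _ => a) (W' := fun _ => b) (e1 hXa) (e1 hYb), mlieBracket_eq x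
    (V' := fun y => chartJ h x y a) (W' := fun _ => b) (e2 hXa) (e1 hYb),
    mlieBracket_eq x (V' := fun _ => a) (W' := fun y => chartJ h x y b) (e1 hXa) (e2 hYb),
      mlieBracket_eq x (V' := fun y => chartJ h x y a) (W' := fun y => chartJ h x y b)
      (e2 hXa) (e2 hYb)] at h0
  simp only [hd, fderivWithin_const_apply, zero_apply, sub_zero, zero_sub, zero_add, map_neg] at h0
  rw [map_sub]
  rw [sub_eq_zero] at h0
  rw [← h0]
  abel

end Integrability

/-! ### Eigenvalues and the boundary in a chart -/

section HermitianTransfer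

namespace HermitianPatch

variable {E : Type*} [NormedAddCommGroup E] [InnerProductSpace ℝ E] {P : HermitianPatch E}

theorem DJ_J {y : E} (hy : y ∈ P.U) (a b : E) : P.DJ y a (P.J y b) = -P.J y (P.DJ y a b) := by
  have h1 := ((P.J_smooth.contDiffWithinAt_halfSpace P.mem_nhdsWithin hy).differentiableWithinAt
    (by simp)).hasFDerivWithinAt
  have h2 := (ContinuousLinearMap.apply ℝ E b).hasFDerivAt.comp_hasFDerivWithinAt y h1
  have h3 := h1.clm_apply h2
  have h4 : HasFDerivWithinAt (fun z => (P.J z) ((⇑(ContinuousLinearMap.apply ℝ E b) ∘ P.J) z))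
      (0 : E →L[ℝ] E) P.S y := by
    refine (hasFDerivWithinAt_const (-b) y P.S).congr_of_eventuallyEq ?_ ((P.pair y hy).J_J b)
    filter_upwards [P.mem_nhdsWithin y hy] with z hz using (P.pair z hz).J_J b
  have h5 := DFunLike.congr_fun
    ((uniqueDiffOn_halfSpace P.exists_eq_one y (P.subset hy)).eq h3 h4) a
  simp only [ContinuousLinearMap.comp_apply, add_apply, ContinuousLinearMap.flip_apply,
    Function.comp_apply, ContinuousLinearMap.apply_apply, zero_apply] at h5
  rw [eq_neg_iff_add_eq_zero, add_comm]
  exact h5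

/-- If the Nijenhuis tensor vanishes, `√-1 ∂∂̄ u` is `J`-invariant. -/
theorem ddc_J {u : E → ℝ} (hu : ContDiffOn ℝ 2 u P.U) {y : E} (hy : y ∈ P.U)
    (hN : ∀ a b, P.J y (P.DJ y a b - P.DJ y b a) = P.DJ y (P.J y a) b - P.DJ y (P.J y b) a)
    (a b : E) : P.ddc u y (P.J y a) (P.J y b) = P.ddc u y a b := by
  have h1 : P.DJ y (P.J y b) (P.J y a) - P.DJ y (P.J y a) (P.J y b) = P.DJ y b a - P.DJ y a b := by
    rw [DJ_J hy, DJ_J hy]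
    have h2 := congrArg (P.J y) (hN a b)
    rw [(P.pair y hy).J_J, map_sub] at h2
    rw [neg_sub_neg, ← h2, neg_sub]
  have h3 := secondDerivWithin_symm P.exists_eq_one P.subset P.mem_nhdsWithin hu hy
  rw [ddc, ddc, h1, (P.pair y hy).J_J, (P.pair y hy).J_J, map_neg, map_neg,
    h3 (P.J y b) a, h3 (P.J y a) b]
  ring

theorem isHermitianForm_form {u : E → ℝ} {y : E} (hy : y ∈ P.U)
    (hχ : ∀ a b, P.χ y a b = -P.χ y b a) (hχJ : ∀ a b, P.χ y (P.J y a) (P.J y b) = P.χ y a b)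
    (hd : ∀ a b, P.ddc u y (P.J y a) (P.J y b) = P.ddc u y a b) :
    IsHermitianForm (P.J y) (P.form u y) := by
  have hJ := (P.pair y hy).J_J
  have hskew : ∀ a b, P.ddc u y a b = -P.ddc u y b a := fun a b => by
    rw [ddc, ddc, ← neg_sub (P.DJ y b a), map_neg]
    ring
  have hT : ∀ a b, P.χ y a b + P.ddc u y a b = -P.form u y a (P.J y b) := fun a b => by
    have e : P.J y (-(P.J y b)) = b := by rw [map_neg, hJ, neg_neg]
    have h0 := P.form_apply u y a (-(P.J y b))
    rw [e, map_neg] at h0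
    exact h0.symm
  have h1 : ∀ a b, P.form u y (P.J y a) b = -P.form u y a (P.J y b) := fun a b => by
    rw [← hT, form_apply, hχJ, hd]
  have h2 : ∀ a b, P.form u y (P.J y a) b = P.form u y b (P.J y a) := fun a b => by
    have h3 := hT b a
    rw [h1, ← hT, hχ, hskew]
    linarith
  refine ⟨fun a b => ?_, fun a b => ?_⟩
  · have h3 := h2 (-(P.J y a)) b
    rwa [map_neg, hJ, neg_neg] at h3
  · rw [h1, hJ, map_neg, neg_neg]

end HermitianPatch

variable {n : ℕ} [NeZero n] {M : Type*} [TopologicalSpace M]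
  [ChartedSpace (EuclideanHalfSpace (2 * n)) M] [IsManifold (𝓡∂ (2 * n)) ∞ M]

section

variable [T2Space M] (h : HermitianStructure n M)

theorem ddbar_J (χ : RealOneOneForm h) {u : M → ℝ} (hu : ContMDiff (𝓡∂ (2 * n)) 𝓘(ℝ, ℝ) 2 u) (x : M)
    (X Y : TangentSpace (𝓡∂ (2 * n)) x) :
    ddbar h u x (h.J x X) (h.J x Y) = ddbar h u x X Y := by
  have hx := mem_extChartAt_source (I := 𝓡∂ (2 * n)) x
  rw [ddbar_eq h χ hx hu, ddbar_eq h χ hx hu, toChart_J h hx, toChart_J h hx]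
  exact HermitianPatch.ddc_J (P := chartPatch h χ x) (contDiffOn_inChart x hu)
    (mem_extChartAt_target x) (chartJ_integrable h x) _ _

theorem isHermitianForm_chart (χ : RealOneOneForm h) {u : M → ℝ} (hu : ContMDiff (𝓡∂ (2 * n))
    𝓘(ℝ, ℝ) 2 u) (c : M)
    {y : Coord n} (hy : y ∈ (extChartAt (𝓡∂ (2 * n)) c).target) :
    IsHermitianForm ((chartPatch h χ c).J y) ((chartPatch h χ c).form (inChart c u) y) := by
  have hx := (extChartAt (𝓡∂ (2 * n)) c).map_target hy
  have hxy := (extChartAt (𝓡∂ (2 * n)) c).right_inv hy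
  refine HermitianPatch.isHermitianForm_form (P := chartPatch h χ c) hy
    (fun a b => χ.skew _ _ _) (fun a b => ?_) (fun a b => ?_)
  · have h1 := χ.form_J _ (fromChart c ((extChartAt (𝓡∂ (2 * n)) c).symm y) a) (fromChart c _ b)
    have h2 := fun V W => chartBilin_toChart hx χ.form V W
    rw [← h2, ← h2, toChart_J h hx, toChart_J h hx, toChart_fromChart hx, toChart_fromChart hx,
      hxy] at h1
    exact h1
  · have h1 := ddbar_J h χ hu _ (fromChart c ((extChartAt (𝓡∂ (2 * n)) c).symm y) a)
      (fromChart c _ b)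
    rw [ddbar_eq h χ hx hu, ddbar_eq h χ hx hu, toChart_J h hx, toChart_J h hx,
      toChart_fromChart hx, toChart_fromChart hx, hxy] at h1
    exact h1

end

section

variable (h : HermitianStructure n M) (χ : RealOneOneForm h)

theorem isUnitaryFrame_toChart {c x : M} (hx : x ∈ (extChartAt (𝓡∂ (2 * n)) c).source) {k : ℕ}
    {e : Fin k → TangentSpace (𝓡∂ (2 * n)) x}
    (h1 : ∀ i j, h.metric.inner x (e i) (e j) = if i = j then 1 else 0)
    (h2 : ∀ i j, h.metric.inner x (e i) (h.J x (e j)) = 0) :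
    IsUnitaryFrame (chartJ h c (extChartAt (𝓡∂ (2 * n)) c x))
      (chartBilin c h.metric.inner (extChartAt (𝓡∂ (2 * n)) c x)) fun i => toChart c x (e i) := by
  refine ⟨fun i j => ?_, fun i j => ?_⟩
  · rw [chartBilin_toChart hx, h1]
  · rw [← toChart_J h hx, chartBilin_toChart hx, h2]

theorem IsEigenvalues.isEigenframe {c x : M} (hx : x ∈ (extChartAt (𝓡∂ (2 * n)) c).source)
    {u : M → ℝ} (hu : ContMDiff (𝓡∂ (2 * n)) 𝓘(ℝ, ℝ) 2 u) {l : Fin n → ℝ}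
    (hl : IsEigenvalues h x (gForm h χ u x) l) :
    ∃ e, IsEigenframe ((chartPatch h χ c).J (extChartAt (𝓡∂ (2 * n)) c x))
      ((chartPatch h χ c).g (extChartAt (𝓡∂ (2 * n)) c x))
      ((chartPatch h χ c).form (inChart c u) (extChartAt (𝓡∂ (2 * n)) c x)) e l := by
  obtain ⟨e, h1, h2, h3⟩ := hl
  refine ⟨fun i => toChart c x (e i), isUnitaryFrame_toChart h hx h1 h2, fun i a => ?_⟩
  have h4 := h3 i (fromChart c x a)
  rw [gForm_J_eq h χ hx hu, ← chartBilin_toChart hx h.metric.inner, toChart_fromChart hx] at h4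
  exact h4

end

section Boundary

/-- Boundary points are those with vanishing zeroth coordinate, in any chart. -/
theorem mem_boundary_iff {c x : M} (hx : x ∈ (extChartAt (𝓡∂ (2 * n)) c).source) :
    x ∈ (𝓡∂ (2 * n)).boundary M ↔ zerothCoord n (extChartAt (𝓡∂ (2 * n)) c x) = 0 := by
  have hs : x ∈ (chartAt (EuclideanHalfSpace (2 * n)) c).source := by
    rwa [← extChartAt_source (𝓡∂ (2 * n))]
  have h1 := (𝓡∂ (2 * n)).isInteriorPoint_iff_of_mem_atlas (n := ∞) (by simp)
    (chart_mem_atlas (EuclideanHalfSpace (2 * n)) c) hs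
  have h2 : extChartAt (𝓡∂ (2 * n)) c x ∈ interior (extChartAt (𝓡∂ (2 * n)) c).target
      ↔ 0 < zerothCoord n (extChartAt (𝓡∂ (2 * n)) c x) := by
    have h3 := interior_range_modelWithCornersEuclideanHalfSpace (2 * n)
    constructor
    · intro h4
      have h5 := OpenPartialHomeomorph.interior_extend_target_subset_interior_range _ h4
      rw [h3] at h5
      exact h5
    · intro h4
      refine OpenPartialHomeomorph.mem_interior_extend_target _
        ((chartAt (EuclideanHalfSpace (2 * n)) c).map_source hs) ?_
      rw [h3]
      exact h4
  rw [← (𝓡∂ (2 * n)).compl_interior, mem_compl_iff]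
  refine (not_congr (h1.trans h2)).trans ?_
  rw [not_lt]
  exact ⟨fun h4 => le_antisymm h4 (extChartAt_mem_halfSpace c x), fun h4 => h4.le⟩

theorem mem_interior_of_pos {c x : M} (hx : x ∈ (extChartAt (𝓡∂ (2 * n)) c).source)
    (hpos : 0 < zerothCoord n (extChartAt (𝓡∂ (2 * n)) c x)) :
    x ∈ (𝓡∂ (2 * n)).interior M := by
  rw [← (𝓡∂ (2 * n)).compl_boundary, mem_compl_iff, mem_boundary_iff hx]
  exact hpos.ne'

theorem zerothCoord_coordChange_nonneg {c c' x : M} (hx : x ∈ (extChartAt (𝓡∂ (2 * n)) c).source)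
    (hx' : x ∈ (extChartAt (𝓡∂ (2 * n)) c').source) (hb : x ∈ (𝓡∂ (2 * n)).boundary M)
    {a : Coord n} (ha : 0 ≤ zerothCoord n a) :
    0 ≤ zerothCoord n (toChart c x (fromChart c' x a)) := by
  have h0 := (mem_boundary_iff hx).1 hb
  have h0' := (mem_boundary_iff hx').1 hb
  rw [toChart_fromChart_of_ne hx hx', range_eq_halfSpace]
  have hτ : ContDiffWithinAt ℝ ∞ (extChartAt (𝓡∂ (2 * n)) c ∘ (extChartAt (𝓡∂ (2 * n)) c').symm)
      (halfSpace (zerothCoord n)) (extChartAt (𝓡∂ (2 * n)) c' x) := by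
    rw [← range_eq_halfSpace]
    refine contDiffWithinAt_ext_coord_change (n := ∞) c c' ?_
    rw [PartialEquiv.trans_source, PartialEquiv.symm_source]
    refine ⟨(extChartAt (𝓡∂ (2 * n)) c').map_source hx', ?_⟩
    rwa [mem_preimage, (extChartAt (𝓡∂ (2 * n)) c').left_inv hx']
  have h1 := (zerothCoord n).hasFDerivAt.comp_hasFDerivWithinAt _
    (hτ.differentiableWithinAt (by simp)).hasFDerivWithinAt
  refine IsLocalMinOn.hasFDerivWithinAt_nonneg (f' := (zerothCoord n).comp (fderivWithin ℝ
    (extChartAt (𝓡∂ (2 * n)) c ∘ (extChartAt (𝓡∂ (2 * n)) c').symm) (halfSpace (zerothCoord n))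
    (extChartAt (𝓡∂ (2 * n)) c' x))) (IsMinOn.localize fun z _ => ?_) h1
    (mem_posTangentConeAt_of_segment_subset (convex_halfSpace.segment_subset
      (extChartAt_mem_halfSpace c' x) ?_))
  · simp only [mem_ofPred_eq, Function.comp_apply, (extChartAt (𝓡∂ (2 * n)) c').left_inv hx', h0]
    exact extChartAt_mem_halfSpace c _
  · show 0 ≤ zerothCoord n (_ + a)
    rw [map_add, h0', zero_add]
    exact ha

/-- Vectors at a boundary point pointing into the manifold are the same in all charts. -/
theorem zerothCoord_toChart_nonneg_iff {c x : M} (hx : x ∈ (extChartAt (𝓡∂ (2 * n)) c).source)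
    (hb : x ∈ (𝓡∂ (2 * n)).boundary M) (V : TangentSpace (𝓡∂ (2 * n)) x) :
    0 ≤ zerothCoord n (toChart c x V) ↔ 0 ≤ zerothCoord n (coordVec x V) := by
  have hx' := mem_extChartAt_source (I := 𝓡∂ (2 * n)) x
  rw [show coordVec x V = toChart x x V from (coordVec_eq x V).trans (toChart_self x V).symm]
  refine ⟨fun h1 => ?_, fun h1 => ?_⟩
  · have h2 := zerothCoord_coordChange_nonneg hx' hx hb h1
    rwa [fromChart_toChart hx] at h2
  · have h2 := zerothCoord_coordChange_nonneg hx hx' hb h1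
    rwa [fromChart_toChart hx'] at h2

theorem zerothCoord_toChart_eq_zero_iff {c x : M} (hx : x ∈ (extChartAt (𝓡∂ (2 * n)) c).source)
    (hb : x ∈ (𝓡∂ (2 * n)).boundary M) (V : TangentSpace (𝓡∂ (2 * n)) x) :
    zerothCoord n (toChart c x V) = 0 ↔ V ∈ boundaryTangent x := by
  have h1 := zerothCoord_toChart_nonneg_iff hx hb V
  have h2 := zerothCoord_toChart_nonneg_iff hx hb (-V)
  simp only [map_neg, Left.nonneg_neg_iff] at h2
  rw [le_antisymm_iff, h2, h1, ← le_antisymm_iff]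
  rfl

theorem zerothCoord_toChart_pos_iff {c x : M} (hx : x ∈ (extChartAt (𝓡∂ (2 * n)) c).source)
    (hb : x ∈ (𝓡∂ (2 * n)).boundary M) (V : TangentSpace (𝓡∂ (2 * n)) x) :
    0 < zerothCoord n (toChart c x V) ↔ 0 < (coordVec x V) 0 := by
  have h2 := zerothCoord_toChart_nonneg_iff hx hb (-V)
  simp only [map_neg, Left.nonneg_neg_iff] at h2
  rw [← not_le, h2, not_le]
  rfl

end Boundary

end HermitianTransfer

/-! ### The comparison principle -/

section Comparison

theorem IsHermitianPair.sq_le {E : Type*} [NormedAddCommGroup E] [InnerProductSpace ℝ E]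
    {J : E →L[ℝ] E} {g : E →L[ℝ] E →L[ℝ] ℝ} (hJ : IsHermitianPair J g) (a b : E) :
    g a b ^ 2 ≤ g a a * g b b := by
  rcases eq_or_ne b 0 with rfl | hb
  · simp
  have h1 := hJ.pos b hb
  have h2 := hJ.nonneg (g b b • a - g a b • b)
  simp only [map_sub, map_smul, sub_apply, smul_apply, smul_eq_mul, hJ.symm b a] at h2
  nlinarith [h2]

/-- The nondegeneracy `δ_{ψ,f} ≥ 1 / K` bounds `ψ` from below by a level of `f` above
`sup_{∂Γ} f`. -/
theorem exists_level {n : ℕ} {f : (Fin n → ℝ) → ℝ} {Γ : Set (Fin n → ℝ)} (K : ℝ)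
    (hb : supBoundary f Γ ≠ ⊤) :
    ∃ s : ℝ, supBoundary f Γ < s ∧ ∀ (M : Type*) (ψ : M → ℝ), (∀ x, |ψ x| ≤ K) →
      0 < nondegeneracy ψ f Γ → (nondegeneracy ψ f Γ)⁻¹ ≤ (K : EReal) → ∀ x, s ≤ ψ x := by
  induction h : supBoundary f Γ with
  | top => exact absurd h hb
  | bot => exact ⟨-K, EReal.bot_lt_coe _, fun M ψ hψ _ _ x => (abs_le.1 (hψ x)).1⟩
  | coe σ =>
    have hK1 : 0 < max K 1 := lt_max_of_lt_right one_pos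
    refine ⟨σ + (max K 1)⁻¹, by
      rw [EReal.coe_lt_coe_iff]; linarith [inv_pos.2 hK1], fun M ψ _ h0 h1 x => ?_⟩
    by_contra! hlt
    have h2 : nondegeneracy ψ f Γ ≤ ((ψ x - σ : ℝ) : EReal) := by
      rw [nondegeneracy, h, EReal.coe_sub]
      exact EReal.sub_le_sub (iInf_le _ x) le_rfl
    induction hd : nondegeneracy ψ f Γ with
    | top => rw [hd] at h2; exact absurd (top_le_iff.1 h2) (EReal.coe_ne_top _)
    | bot => rw [hd] at h0; exact absurd h0 (by simp)
    | coe d =>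
      rw [hd] at h0 h1 h2
      rw [← EReal.coe_inv, EReal.coe_le_coe_iff] at h1
      rw [EReal.coe_le_coe_iff] at h2
      have h3 : 0 < d := by exact_mod_cast h0
      have h4 : d < (max K 1)⁻¹ := by linarith
      have h5 : max K 1 < d⁻¹ := (lt_inv_comm₀ h3 hK1).1 h4
      linarith [le_max_left K 1]

variable {m : ℕ} [NeZero (m + 1)] {M : Type*} [TopologicalSpace M]
  [ChartedSpace (EuclideanHalfSpace (2 * (m + 1))) M] [IsManifold (𝓡∂ (2 * (m + 1))) ∞ M]
  (h : HermitianStructure (m + 1) M) (χ : RealOneOneForm h)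
  {f : (Fin (m + 1) → ℝ) → ℝ} {Γ : Set (Fin (m + 1) → ℝ)} {ψ φ u v : M → ℝ} {s K : ℝ}

theorem exists_eigenframe_subsolution (hv : ContMDiff (𝓡∂ (2 * (m + 1))) 𝓘(ℝ, ℝ) 2 v)
    (hsub : IsAdmissibleSubsolution h χ f Γ ψ φ v) (hψ : ∀ x, s ≤ ψ x) (c : M) {y : Coord (m + 1)}
    (hy : y ∈ (extChartAt (𝓡∂ (2 * (m + 1))) c).target) :
    ∃ e l, IsEigenframe ((chartPatch h χ c).J y) ((chartPatch h χ c).g y)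
      ((chartPatch h χ c).form (inChart c v) y) e l ∧ l ∈ Γ ∧ s ≤ f l := by
  have hx := (extChartAt (𝓡∂ (2 * (m + 1))) c).map_target hy
  obtain ⟨l, hl, hlΓ, hle⟩ := hsub.1 ((extChartAt (𝓡∂ (2 * (m + 1))) c).symm y)
  obtain ⟨e, he⟩ := hl.isEigenframe h χ hx hv
  rw [(extChartAt (𝓡∂ (2 * (m + 1))) c).right_inv hy] at he
  exact ⟨e, l, he, hlΓ, (hψ _).trans hle⟩

/-- At interior points the equation compares the eigenvalues of the solution with those of the
subsolution. -/
theorem exists_eigenframes_comparison (hu : ContMDiff (𝓡∂ (2 * (m + 1))) 𝓘(ℝ, ℝ) 2 u)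
    (hv : ContMDiff (𝓡∂ (2 * (m + 1))) 𝓘(ℝ, ℝ) 2 v)
    (hsol : IsAdmissibleSolution h χ f Γ ψ φ u)
    (hsub : IsAdmissibleSubsolution h χ f Γ ψ φ v) (hψ : ∀ x, s ≤ ψ x) (c : M) {y : Coord (m + 1)}
    (hy : y ∈ (extChartAt (𝓡∂ (2 * (m + 1))) c).target) (hpos : 0 < (chartPatch h χ c).h₀ y) :
    ∃ e l e' l', IsEigenframe ((chartPatch h χ c).J y) ((chartPatch h χ c).g y)
        ((chartPatch h χ c).form (inChart c v) y) e l ∧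
      IsEigenframe ((chartPatch h χ c).J y) ((chartPatch h χ c).g y)
        ((chartPatch h χ c).form (inChart c u) y) e' l' ∧
      l ∈ Γ ∧ l' ∈ Γ ∧ s ≤ f l' ∧ f l' ≤ f l := by
  have hx := (extChartAt (𝓡∂ (2 * (m + 1))) c).map_target hy
  have hxy := (extChartAt (𝓡∂ (2 * (m + 1))) c).right_inv hy
  obtain ⟨l, hl, hlΓ, hle⟩ := hsub.1 ((extChartAt (𝓡∂ (2 * (m + 1))) c).symm y)
  obtain ⟨e, he⟩ := hl.isEigenframe h χ hx hv
  obtain ⟨l', hl', hlΓ', hle'⟩ := hsol.1 ((extChartAt (𝓡∂ (2 * (m + 1))) c).symm y)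
    (mem_interior_of_pos hx (by rw [hxy]; exact hpos))
  obtain ⟨e', he'⟩ := hl'.isEigenframe h χ hx hu
  rw [hxy] at he he'
  exact ⟨e, l, e', l', he, he', hlΓ, hlΓ', (hψ _).trans hle'.ge, hle'.le.trans hle⟩

theorem finrank_coord (m : ℕ) : Module.finrank ℝ (Coord (m + 1)) = 2 * (m + 1) := by
  rw [finrank_euclideanSpace, Fintype.card_fin]

/-- The comparison principle: the subsolution lies below the solution on every connected component
which meets the boundary. -/
theorem le_on_connectedComponent [T2Space M] [CompactSpace M] (hp : IsAdmissiblePair f Γ)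
    (hs : supBoundary f Γ < (s : EReal)) (hu : ContMDiff (𝓡∂ (2 * (m + 1))) 𝓘(ℝ, ℝ) 2 u)
    (hv : ContMDiff (𝓡∂ (2 * (m + 1))) 𝓘(ℝ, ℝ) 2 v)
    (hsol : IsAdmissibleSolution h χ f Γ ψ φ u)
    (hsub : IsAdmissibleSubsolution h χ f Γ ψ φ v) (hψ : ∀ x, s ≤ ψ x) {c : M}
    (hc : c ∈ (𝓡∂ (2 * (m + 1))).boundary M) {p : M} (hpc : p ∈ connectedComponent c) :
    v p ≤ u p := by
  have hcont : Continuous fun p => v p - u p := hv.continuous.sub hu.continuous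
  obtain ⟨p₀, hp₀, hmax⟩ := (isClosed_connectedComponent (x := c)).isCompact.exists_isMaxOn
    ⟨p, hpc⟩ hcont.continuousOn
  by_contra! hlt
  have hbd : ∀ q ∈ (𝓡∂ (2 * (m + 1))).boundary M, v q - u q = 0 := fun q hq => by
    rw [hsol.2 q hq, hsub.2 q hq, sub_self]
  have hm0 : 0 < v p₀ - u p₀ := (sub_pos.2 hlt).trans_le (hmax hpc)
  set m₀ := v p₀ - u p₀ with hm₀
  -- the set where the maximum is attained is open by the strong maximum principle
  have hclopen : IsClopen (connectedComponent c ∩ {q | v q - u q = m₀}) := by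
    refine ⟨isClosed_connectedComponent.inter (isClosed_eq hcont continuous_const), ?_⟩
    rw [isOpen_iff_mem_nhds]
    rintro q ⟨hqc, hq⟩
    have hsrc := mem_extChartAt_source (I := 𝓡∂ (2 * (m + 1))) q
    have htgt := mem_extChartAt_target (I := 𝓡∂ (2 * (m + 1))) q
    have hpos : 0 < zerothCoord (m + 1) (extChartAt (𝓡∂ (2 * (m + 1))) q q) := by
      refine lt_of_le_of_ne (extChartAt_mem_halfSpace q q) fun h0 => ?_
      have h1 := hbd q ((mem_boundary_iff hsrc).2 h0.symm)
      exact hm0.ne' (hq.symm.trans h1)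
    obtain ⟨ρ, hρ, hball⟩ : ∃ ρ > 0, Metric.ball (extChartAt (𝓡∂ (2 * (m + 1))) q q) ρ ⊆
        (extChartAt (𝓡∂ (2 * (m + 1))) q).target ∩ {z | 0 < zerothCoord (m + 1) z} := by
      have hopen : IsOpen {z : Coord (m + 1) | 0 < zerothCoord (m + 1) z} :=
        isOpen_lt continuous_const (zerothCoord (m + 1)).continuous
      refine Metric.mem_nhds_iff.1 (inter_mem ?_ (hopen.mem_nhds hpos))
      have h2 := extChartAt_target_mem_nhdsWithin_halfSpace q htgt
      have h3 : halfSpace (zerothCoord (m + 1)) ∈ 𝓝 (extChartAt (𝓡∂ (2 * (m + 1))) q q) :=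
        mem_of_superset (hopen.mem_nhds hpos) fun z hz => (show 0 < zerothCoord (m + 1) z from
          hz).le
      rwa [nhdsWithin_eq_nhds.2 h3] at h2
    have hsymm : ContinuousOn (extChartAt (𝓡∂ (2 * (m + 1))) q).symm
        (Metric.ball (extChartAt (𝓡∂ (2 * (m + 1))) q q) ρ) :=
      (continuousOn_extChartAt_symm q).mono fun z hz => (hball hz).1
    have hconn : (extChartAt (𝓡∂ (2 * (m + 1))) q).symm ''
        Metric.ball (extChartAt (𝓡∂ (2 * (m + 1))) q q) ρ ⊆ connectedComponent c := by
      rw [connectedComponent_eq hqc]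
      refine IsPreconnected.subset_connectedComponent
        ((convex_ball _ _).isPreconnected.image _ hsymm) ⟨_, Metric.mem_ball_self hρ, ?_⟩
      exact extChartAt_to_inv q
    have hsm := HermitianPatch.sub_eq_of_isMax (P := chartPatch h χ q) (finrank_coord m) hp hs
      (contDiffOn_inChart q hu) (contDiffOn_inChart q hv)
      (fun y hy => isHermitianForm_chart h χ hv q hy)
      (fun y hy hy0 => by
        obtain ⟨e, l, e', l', h1, h2, h3, h4, h5, h6⟩ :=
          exists_eigenframes_comparison h χ hu hv hsol hsub hψ q hy hy0
        exact ⟨e, l, e', l', h1, h2, h3, h5.trans h6, h6⟩)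
      (x₀ := extChartAt (𝓡∂ (2 * (m + 1))) q q) (ρ := ρ) (M := m₀)
      (fun z hz => (hball hz).1) (fun z hz => (hball hz).2)
      (fun z hz => hmax (hconn ⟨z, hz, rfl⟩))
      (by simp only [inChart, Function.comp_apply, extChartAt_to_inv]; exact hq)
    have hnear : ∀ᶠ q' in 𝓝 q, q' ∈ (extChartAt (𝓡∂ (2 * (m + 1))) q).source ∧
        extChartAt (𝓡∂ (2 * (m + 1))) q q' ∈
          Metric.ball (extChartAt (𝓡∂ (2 * (m + 1))) q q) (ρ / 2) :=
      Filter.Eventually.and (extChartAt_source_mem_nhds q)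
        ((continuousAt_extChartAt q).eventually (Metric.ball_mem_nhds _ (half_pos hρ)))
    filter_upwards [hnear] with q' hq'
    have h1 := hsm _ hq'.2
    simp only [inChart, Function.comp_apply] at h1
    have h2 := hconn ⟨_, Metric.ball_subset_ball (half_le_self hρ.le) hq'.2, rfl⟩
    rw [(extChartAt (𝓡∂ (2 * (m + 1))) q).left_inv hq'.1] at h1 h2
    exact ⟨h2, h1⟩
  -- the positive maximum would then be attained at the boundary point `c` as well
  have hall := isPreconnected_connectedComponent.subset_isClopen hclopen ⟨p₀, hp₀, hp₀, rfl⟩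
  have h1 := (hall mem_connectedComponent).2
  exact hm0.ne' (h1.symm.trans (hbd c hc))

end Comparison

/-! ### The uniform estimate at the boundary -/

section Main

/-- The restriction of a coordinate patch to an open subset. -/
def HermitianPatch.restrict {E : Type*} [NormedAddCommGroup E] [InnerProductSpace ℝ E]
    (P : HermitianPatch E) (W : Set E) (hW : IsOpen W) : HermitianPatch E where
  h₀ := P.h₀
  exists_eq_one := P.exists_eq_one
  U := P.U ∩ W
  subset _ hy := P.subset hy.1
  mem_nhdsWithin y hy := inter_mem (P.mem_nhdsWithin y hy.1)
    (mem_nhdsWithin_of_mem_nhds (hW.mem_nhds hy.2))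
  J := P.J
  g := P.g
  χ := P.χ
  J_smooth := P.J_smooth.mono inter_subset_left
  g_smooth := P.g_smooth.mono inter_subset_left
  χ_smooth := P.χ_smooth.mono inter_subset_left
  pair y hy := P.pair y hy.1

section ComplexVectors

variable {n : ℕ} [NeZero n] {M : Type*} [TopologicalSpace M]
  [ChartedSpace (EuclideanHalfSpace (2 * n)) M] [IsManifold (𝓡∂ (2 * n)) ∞ M]
  (h : HermitianStructure n M) (χ : RealOneOneForm h)

theorem gForm_eq {c x : M} (hx : x ∈ (extChartAt (𝓡∂ (2 * n)) c).source) {u : M → ℝ}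
    (hu : ContMDiff (𝓡∂ (2 * n)) 𝓘(ℝ, ℝ) 2 u) (X Y : TangentSpace (𝓡∂ (2 * n)) x) :
    gForm h χ u x X Y = -(chartPatch h χ c).form (inChart c u)
      (extChartAt (𝓡∂ (2 * n)) c x) (toChart c x X)
      (chartJ h c (extChartAt (𝓡∂ (2 * n)) c x) (toChart c x Y)) := by
  have h1 := gForm_J_eq h χ hx hu X (-(h.J x Y))
  rw [map_neg, h.J_J, neg_neg, map_neg, map_neg, toChart_J h hx] at h1
  exact h1

theorem inv_sqrt_two_mul_self : (√2)⁻¹ * (√2)⁻¹ = (1 / 2 : ℝ) := by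
  rw [← mul_inv, Real.mul_self_sqrt zero_le_two, one_div]

theorem re_complexExt_xiNormal [T2Space M] {c x : M} (hx : x ∈ (extChartAt (𝓡∂ (2 * n)) c).source)
    {u : M → ℝ}
    (hu : ContMDiff (𝓡∂ (2 * n)) 𝓘(ℝ, ℝ) 2 u) (ν : TangentSpace (𝓡∂ (2 * n)) x) :
    (complexExt (gForm h χ u x) (xiNormal h ν) (complexJ h (xiNormal h ν).conj)).re
      = (chartPatch h χ c).form (inChart c u) (extChartAt (𝓡∂ (2 * n)) c x)
        (toChart c x ν) (toChart c x ν) := by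
  have hy := (extChartAt (𝓡∂ (2 * n)) c).map_source hx
  have hB := isHermitianForm_chart h χ hu c hy
  have hJ := (isHermitianPair_chart h hy).J_J
  have hinv := hB.inv (toChart c x ν) (toChart c x ν)
  change (chartPatch h χ c).form _ _ (chartJ h c _ _) (chartJ h c _ _) = _ at hinv
  simp only [complexExt, xiNormal, complexJ, CTangent.conj, gForm_eq h χ hx hu, map_neg, map_smul,
    toChart_J h hx, hJ, neg_neg, LinearMap.neg_apply, LinearMap.smul_apply, smul_eq_mul, hinv]
  linear_combination 2 * (chartPatch h χ c).form (inChart c u) (extChartAt (𝓡∂ (2 * n)) c x)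
        (toChart c x ν) (toChart c x ν) * inv_sqrt_two_mul_self

theorem norm_sq_complexExt_xiNormal [T2Space M] {c x : M}
    (hx : x ∈ (extChartAt (𝓡∂ (2 * n)) c).source) {u : M → ℝ}
    (hu : ContMDiff (𝓡∂ (2 * n)) 𝓘(ℝ, ℝ) 2 u) (ν : TangentSpace (𝓡∂ (2 * n)) x)
    {ξ : CTangent (n := n) x} (hξ : IsBoundaryHolomorphic h ξ) :
    ‖complexExt (gForm h χ u x) ξ (complexJ h (xiNormal h ν).conj)‖ ^ 2
      = (chartPatch h χ c).form (inChart c u) (extChartAt (𝓡∂ (2 * n)) c x)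
          (toChart c x ν) (toChart c x (√2 • ξ.re)) ^ 2
        + (chartPatch h χ c).form (inChart c u) (extChartAt (𝓡∂ (2 * n)) c x)
          (toChart c x ν) ((chartPatch h χ c).J (extChartAt (𝓡∂ (2 * n)) c x)
            (toChart c x (√2 • ξ.re))) ^ 2 := by
  have hy := (extChartAt (𝓡∂ (2 * n)) c).map_source hx
  have hB := isHermitianForm_chart h χ hu c hy
  have hJ := (isHermitianPair_chart h hy).J_J
  have him : ξ.im = -h.J x ξ.re := by rw [hξ.1, neg_neg]
  have hinv := fun a b => hB.inv a b
  have hsymm := hB.symm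
  change ∀ a b, (chartPatch h χ c).form _ _ (chartJ h c _ a) (chartJ h c _ b) = _ at hinv
  change _ = _ + (chartPatch h χ c).form _ _ _ (chartJ h c _ _) ^ 2
  have h2 := inv_sqrt_two_mul_self
  have h3 : (√2 : ℝ) * √2 = 2 := Real.mul_self_sqrt zero_le_two
  have hJl : ∀ a b, (chartPatch h χ c).form (inChart c u) (extChartAt (𝓡∂ (2 * n)) c x)
      (chartJ h c (extChartAt (𝓡∂ (2 * n)) c x) a) b
      = -(chartPatch h χ c).form (inChart c u) (extChartAt (𝓡∂ (2 * n)) c x) a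
        (chartJ h c (extChartAt (𝓡∂ (2 * n)) c x) b) := fun a b => by
    have h4 := hinv a (-(chartJ h c (extChartAt (𝓡∂ (2 * n)) c x) b))
    rwa [map_neg, hJ, neg_neg, map_neg] at h4
  rw [Complex.sq_norm, Complex.normSq_apply]
  simp only [complexExt, xiNormal, complexJ, CTangent.conj, him, gForm_eq h χ hx hu, map_neg,
    map_smul, toChart_J h hx, hJ, neg_neg, LinearMap.neg_apply, smul_eq_mul, hJl]
  rw [hsymm (toChart c x ν) (toChart c x ξ.re), hsymm (toChart c x ν), hJl]
  generalize (chartPatch h χ c).form (inChart c u) (extChartAt (𝓡∂ (2 * n)) c x)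
    (toChart c x ξ.re) (toChart c x ν) = p
  generalize (chartPatch h χ c).form (inChart c u) (extChartAt (𝓡∂ (2 * n)) c x)
    (toChart c x ξ.re) (chartJ h c (extChartAt (𝓡∂ (2 * n)) c x) (toChart c x ν)) = q
  linear_combination (4 * p ^ 2 + 4 * q ^ 2) * h2 - (p ^ 2 + q ^ 2) * h3

theorem unitary_of_complexExt {x : M} {k : ℕ} {ξ : Fin k → CTangent (n := n) x}
    (hξ : ∀ α, IsBoundaryHolomorphic h (ξ α))
    (hun : ∀ α β, complexExt (fun v w => h.metric.inner x v w) (ξ α) (ξ β).conj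
      = if α = β then 1 else 0) :
    (∀ α β, h.metric.inner x (√2 • (ξ α).re) (√2 • (ξ β).re) = if α = β then 1 else 0) ∧
      ∀ α β, h.metric.inner x (√2 • (ξ α).re) (h.J x (√2 • (ξ β).re)) = 0 := by
  have him : ∀ α, (ξ α).im = -h.J x (ξ α).re := fun α => by rw [(hξ α).1, neg_neg]
  have h3 : (√2 : ℝ) * √2 = 2 := Real.mul_self_sqrt zero_le_two
  have hJl : ∀ a b, h.metric.inner x (h.J x a) b = -h.metric.inner x a (h.J x b) := fun a b => by
    have h4 := h.metric_J x a (-(h.J x b))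
    rwa [map_neg, h.J_J, neg_neg, map_neg] at h4
  refine ⟨fun α β => ?_, fun α β => ?_⟩
  · have h1 := congrArg Complex.re (hun α β)
    simp only [complexExt, CTangent.conj, him, map_neg, neg_neg, neg_apply, h.metric_J] at h1
    simp only [map_smul, smul_apply, smul_eq_mul]
    rw [← mul_assoc, h3]
    split_ifs at h1 ⊢ with hαβ
    · simp only [Complex.one_re] at h1
      linarith
    · simp only [Complex.zero_re] at h1
      linarith
  · have h1 := congrArg Complex.im (hun α β)
    simp only [complexExt, CTangent.conj, him, map_neg, neg_neg, neg_apply, hJl] at h1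
    have h5 : (if α = β then (1 : ℂ) else 0).im = 0 := by split_ifs <;> simp
    rw [h5] at h1
    simp only [map_smul, smul_apply, smul_eq_mul]
    have h6 : h.metric.inner x (ξ α).re (h.J x (ξ β).re) = 0 := by linarith
    rw [h6]
    simp

end ComplexVectors

variable {m : ℕ} [NeZero (m + 1)] {M : Type*} [TopologicalSpace M]
  [ChartedSpace (EuclideanHalfSpace (2 * (m + 1))) M] [IsManifold (𝓡∂ (2 * (m + 1))) ∞ M]
  (h : HermitianStructure (m + 1) M) (χ : RealOneOneForm h)
  {f : (Fin (m + 1) → ℝ) → ℝ} {Γ : Set (Fin (m + 1) → ℝ)} {φ : M → ℝ} {s K : ℝ}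

/-- The assertion of the estimate at the boundary point `x₀` with the constant `C`, for solutions
whose right-hand side is at least `s`. -/
def HasNormalBound (f : (Fin (m + 1) → ℝ) → ℝ) (Γ : Set (Fin (m + 1) → ℝ)) (φ : M → ℝ)
    (s K C : ℝ) (x₀ : M) : Prop :=
  ∀ ψ u v : M → ℝ, (∀ x, s ≤ ψ x) →
    ContMDiff (𝓡∂ (2 * (m + 1))) 𝓘(ℝ, ℝ) 2 v → IsAdmissibleSubsolution h χ f Γ ψ φ v →
    C2NormLE h v K →
    ContMDiff (𝓡∂ (2 * (m + 1))) 𝓘(ℝ, ℝ) 2 u → IsAdmissibleSolution h χ f Γ ψ φ u →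
    (∀ x, |u x| ≤ K) →
    (∀ x ∈ (𝓡∂ (2 * (m + 1))).boundary M, gNorm h x (metricGradient h u x) ≤ K) →
    ∀ ν : TangentSpace (𝓡∂ (2 * (m + 1))) x₀, IsUnitInnerNormal h x₀ ν →
    ∀ ξ : Fin m → CTangent (n := m + 1) x₀,
      (∀ α, IsBoundaryHolomorphic h (ξ α)) →
      (∀ α β, complexExt (fun v w => h.metric.inner x₀ v w) (ξ α) (ξ β).conj
        = if α = β then 1 else 0) →
      (complexExt (gForm h χ u x₀) (xiNormal h ν) (complexJ h (xiNormal h ν).conj)).re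
        ≤ C * (1 + ∑ α, ‖complexExt (gForm h χ u x₀) (ξ α)
            (complexJ h (xiNormal h ν).conj)‖ ^ 2)

theorem HasNormalBound.mono {C C' : ℝ} {x₀ : M} (hC : HasNormalBound h χ f Γ φ s K C x₀)
    (hle : C ≤ C') : HasNormalBound h χ f Γ φ s K C' x₀ := by
  intro ψ u v h1 h2 h3 h4 h5 h6 h7 h8 ν hν ξ h9 h10
  refine (hC ψ u v h1 h2 h3 h4 h5 h6 h7 h8 ν hν ξ h9 h10).trans ?_
  exact mul_le_mul_of_nonneg_right hle (by positivity)

theorem abs_fderivWithin_inChart_le {c : M} {u : M → ℝ}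
    (hu : ContMDiff (𝓡∂ (2 * (m + 1))) 𝓘(ℝ, ℝ) 2 u) {y : Coord (m + 1)}
    (hy : y ∈ (extChartAt (𝓡∂ (2 * (m + 1))) c).target) (hK : gNorm h
      ((extChartAt (𝓡∂ (2 * (m + 1))) c).symm y) (metricGradient h u _) ≤ K) (a : Coord (m + 1)) :
    |fderivWithin ℝ (inChart c u) (halfSpace (zerothCoord (m + 1))) y a|
      ≤ K * √(chartBilin c h.metric.inner y a a) := by
  have hx := (extChartAt (𝓡∂ (2 * (m + 1))) c).map_target hy
  have hxy := (extChartAt (𝓡∂ (2 * (m + 1))) c).right_inv hy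
  have hp := isHermitianPair_chart h hy
  have hg := fun V W => chartBilin_toChart hx h.metric.inner V W
  have hd := differential_eq hx (hu.mdifferentiable (by simp))
    (fromChart c ((extChartAt (𝓡∂ (2 * (m + 1))) c).symm y) a)
  rw [← inner_metricGradient h, ← hg] at hd
  rw [gNorm, ← hg] at hK
  rw [toChart_fromChart hx, hxy] at hd
  rw [hxy] at hK
  rw [← hd, ← Real.sqrt_sq_eq_abs]
  refine (Real.sqrt_le_sqrt (hp.sq_le _ _)).trans ?_
  rw [Real.sqrt_mul (hp.nonneg _)]
  exact mul_le_mul_of_nonneg_right hK (Real.sqrt_nonneg _)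

/-- The estimate holds with a uniform constant near every boundary point. -/
theorem exists_hasNormalBound_near [T2Space M] [CompactSpace M] (hp : IsAdmissiblePair f Γ)
    (hs : supBoundary f Γ < (s : EReal)) (hφ : ContMDiff (𝓡∂ (2 * (m + 1))) 𝓘(ℝ, ℝ) ∞ φ)
    (hK : 0 ≤ K) {c : M} (hc : c ∈ (𝓡∂ (2 * (m + 1))).boundary M) :
    ∃ C > 0, ∀ᶠ x₀ in 𝓝 c, x₀ ∈ (𝓡∂ (2 * (m + 1))).boundary M →
      HasNormalBound h χ f Γ φ s K C x₀ := by
  have hcs := mem_extChartAt_source (I := 𝓡∂ (2 * (m + 1))) c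
  have hct := mem_extChartAt_target (I := 𝓡∂ (2 * (m + 1))) c
  -- a half-ball around `c`, which is connected
  obtain ⟨ρ, hρ, hball⟩ := Metric.mem_nhdsWithin_iff.1
    (extChartAt_target_mem_nhdsWithin_halfSpace c hct)
  let P := (chartPatch h χ c).restrict (Metric.ball (extChartAt (𝓡∂ (2 * (m + 1))) c c) ρ)
    Metric.isOpen_ball
  have hPt : ∀ {y}, y ∈ P.U → y ∈ (extChartAt (𝓡∂ (2 * (m + 1))) c).target := fun hy => hy.1
  have hcP : extChartAt (𝓡∂ (2 * (m + 1))) c c ∈ P.U := ⟨hct, Metric.mem_ball_self hρ⟩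
  have hconn : ∀ {y}, y ∈ P.U →
      (extChartAt (𝓡∂ (2 * (m + 1))) c).symm y ∈ connectedComponent c := by
    intro y hy
    have h1 : IsPreconnected (Metric.ball (extChartAt (𝓡∂ (2 * (m + 1))) c c) ρ ∩
      halfSpace (zerothCoord (m + 1))) := ((convex_ball _ _).inter convex_halfSpace).isPreconnected
    have h2 := h1.image (extChartAt (𝓡∂ (2 * (m + 1))) c).symm
      ((continuousOn_extChartAt_symm c).mono hball)
    refine h2.subset_connectedComponent
      ⟨_, ⟨Metric.mem_ball_self hρ, extChartAt_mem_halfSpace c c⟩, extChartAt_to_inv c⟩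
      ⟨y, ⟨hy.2, extChartAt_target_subset_halfSpace c hy.1⟩, rfl⟩
  obtain ⟨r, hr, C, hC, hmain⟩ := HermitianPatch.exists_double_normal_bound (P := P)
    (finrank_coord m) hp hs ((contDiffOn_inChart c hφ).mono inter_subset_left) hcP
    ((mem_boundary_iff hcs).1 hc) hK
  refine ⟨C, hC, ?_⟩
  have hnear : ∀ᶠ x₀ in 𝓝 c, x₀ ∈ (extChartAt (𝓡∂ (2 * (m + 1))) c).source ∧
      extChartAt (𝓡∂ (2 * (m + 1))) c x₀ ∈
        Metric.ball (extChartAt (𝓡∂ (2 * (m + 1))) c c) (min r ρ) :=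
    Filter.Eventually.and (extChartAt_source_mem_nhds c)
      ((continuousAt_extChartAt c).eventually (Metric.ball_mem_nhds _ (lt_min hr hρ)))
  filter_upwards [hnear] with x₀ hx₀ hb
  obtain ⟨hx₀, hx₀r⟩ := hx₀
  intro ψ u v hψ hv hsub hvK hu hsol huK hgrad ν hν ξ hξ hun
  have hyt := (extChartAt (𝓡∂ (2 * (m + 1))) c).map_source hx₀
  have hbdy : ∀ {y}, y ∈ P.U → P.h₀ y = 0 →
      (extChartAt (𝓡∂ (2 * (m + 1))) c).symm y ∈ (𝓡∂ (2 * (m + 1))).boundary M := by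
    intro y hy hy0
    rw [mem_boundary_iff ((extChartAt (𝓡∂ (2 * (m + 1))) c).map_target hy.1),
      (extChartAt (𝓡∂ (2 * (m + 1))) c).right_inv hy.1]
    exact hy0
  have hpair : P.IsBoundedPair f Γ s (inChart c φ) K (inChart c u) (inChart c v) :=
    { u_smooth := (contDiffOn_inChart c hu).mono inter_subset_left
      v_smooth := (contDiffOn_inChart c hv).mono inter_subset_left
      u_hermitian := fun y hy => isHermitianForm_chart h χ hu c (hPt hy)
      v_hermitian := fun y hy => isHermitianForm_chart h χ hv c (hPt hy)
      v_eigen := fun y hy => exists_eigenframe_subsolution h χ hv hsub hψ c (hPt hy)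
      comparison := fun y hy hy0 =>
        exists_eigenframes_comparison h χ hu hv hsol hsub hψ c (hPt hy) hy0
      u_boundary := fun y hy hy0 => hsol.2 _ (hbdy hy hy0)
      v_boundary := fun y hy hy0 => hsub.2 _ (hbdy hy hy0)
      le := fun y hy => le_on_connectedComponent h χ hp hs hu hv hsol hsub hψ hc (hconn hy)
      u_bound := fun y _ => huK _
      u_gradient := fun y hy hy0 a =>
        abs_fderivWithin_inChart_le h hu (hPt hy) (hgrad _ (hbdy hy hy0)) a
      v_C2 := fun y hy => c2BoundAt_of_C2NormLE h χ c hv hvK (hPt hy) }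
  have hframe := unitary_of_complexExt h hξ hun
  have hT : ∀ α, (√2 • (ξ α).re) ∈ boundaryTangent x₀ ∧
      h.J x₀ (√2 • (ξ α).re) ∈ boundaryTangent x₀ := by
    intro α
    have h1 : ∀ (t : ℝ) (V : TangentSpace (𝓡∂ (2 * (m + 1))) x₀), V ∈ boundaryTangent x₀ →
        t • V ∈ boundaryTangent x₀ := fun t V hV => by
      simp only [boundaryTangent, mem_ofPred_eq, map_smul] at hV ⊢
      rw [PiLp.smul_apply, hV, smul_zero]
    refine ⟨h1 _ _ (hξ α).2.2.1, ?_⟩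
    rw [map_smul, (hξ α).1, smul_neg, ← neg_smul]
    exact h1 _ _ (hξ α).2.2.2
  -- the real parts of the `ξ α`, rescaled, form a unitary frame of the complex tangent space
  have key := hmain _ (Metric.ball_subset_closedBall
      (Metric.ball_subset_ball (min_le_left _ _) hx₀r))
    ⟨hyt, Metric.ball_subset_ball (min_le_right _ _) hx₀r⟩ ((mem_boundary_iff hx₀).1 hb) _ _ hpair
    (toChart c x₀ ν) ((chartBilin_toChart hx₀ h.metric.inner ν ν).trans hν.unit)
    (fun a ha => by
      have h1 := (zerothCoord_toChart_eq_zero_iff hx₀ hb (fromChart c x₀ a)).1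
        (by rw [toChart_fromChart hx₀]; exact ha)
      have h2 := hν.normal _ h1
      rw [← chartBilin_toChart hx₀ h.metric.inner, toChart_fromChart hx₀] at h2
      exact h2)
    ((zerothCoord_toChart_pos_iff hx₀ hb ν).2 hν.inner)
    (fun α => toChart c x₀ (√2 • (ξ α).re)) (isUnitaryFrame_toChart h hx₀ hframe.1 hframe.2)
    (fun α => ⟨(zerothCoord_toChart_eq_zero_iff hx₀ hb _).2 (hT α).1, by
      have h1 := (zerothCoord_toChart_eq_zero_iff hx₀ hb _).2 (hT α).2
      rw [toChart_J h hx₀] at h1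
      exact h1⟩)
  rw [re_complexExt_xiNormal h χ hx₀ hu, Finset.sum_congr rfl fun α _ =>
    norm_sq_complexExt_xiNormal h χ hx₀ hu ν (hξ α)]
  exact key

/-- By compactness of the boundary the estimate holds with one constant. -/
theorem exists_hasNormalBound [T2Space M] [CompactSpace M] (hp : IsAdmissiblePair f Γ)
    (hs : supBoundary f Γ < (s : EReal)) (hφ : ContMDiff (𝓡∂ (2 * (m + 1))) 𝓘(ℝ, ℝ) ∞ φ)
    (hK : 0 ≤ K) :
    ∃ C > 0, ∀ x₀ ∈ (𝓡∂ (2 * (m + 1))).boundary M, HasNormalBound h χ f Γ φ s K C x₀ := by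
  have hcomp : IsCompact ((𝓡∂ (2 * (m + 1))).boundary M) :=
    ((𝓡∂ (2 * (m + 1))).isClosed_boundary (n := ∞) (by simp)).isCompact
  refine hcomp.induction_on (p := fun A => ∃ C > 0, ∀ x₀ ∈ A, HasNormalBound h χ f Γ φ s K C x₀)
    ⟨1, one_pos, fun x₀ hx₀ => absurd hx₀ (notMem_empty x₀)⟩ ?_ ?_ ?_
  · rintro A B hAB ⟨C, hC, hB⟩
    exact ⟨C, hC, fun x₀ hx₀ => hB x₀ (hAB hx₀)⟩
  · rintro A B ⟨C, hC, hA⟩ ⟨C', hC', hB⟩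
    refine ⟨max C C', lt_max_of_lt_left hC, fun x₀ hx₀ => ?_⟩
    rcases hx₀ with hx₀ | hx₀
    · exact (hA x₀ hx₀).mono h χ (le_max_left _ _)
    · exact (hB x₀ hx₀).mono h χ (le_max_right _ _)
  · intro c hc
    obtain ⟨C, hC, hev⟩ := exists_hasNormalBound_near h χ hp hs hφ hK hc
    exact ⟨_, eventually_nhdsWithin_iff.2 hev, C, hC, fun x₀ hx₀ => hx₀⟩

end Main

end

theorem proposition2p3 {n : ℕ} [NeZero n] (hn : 2 ≤ n)
    {M : Type*} [TopologicalSpace M] [T2Space M] [CompactSpace M]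
    [ChartedSpace (EuclideanHalfSpace (2 * n)) M] [IsManifold (𝓡∂ (2 * n)) ∞ M]
    (h : HermitianStructure n M) (χ : RealOneOneForm h)
    (Γ : Set (Fin n → ℝ)) (hΓ : IsSymmetricCone Γ)
    (f : (Fin n → ℝ) → ℝ) (hf : IsSmoothSymmetricOn f Γ)
    (hell : IsEllipticOn f Γ) (hconc : ConcaveOn ℝ Γ f)
    (hray : RayCondition f Γ) (hunb : UnboundedCondition f Γ)
    (φ : M → ℝ) (hφ : ContMDiff (𝓡∂ (2 * n)) 𝓘(ℝ, ℝ) ∞ φ) (K : ℝ) :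
    ∃ C : ℝ, 0 < C ∧
      ∀ ψ u v : M → ℝ,
        Continuous ψ → (∀ x, |ψ x| ≤ K) →
        0 < nondegeneracy ψ f Γ → (nondegeneracy ψ f Γ)⁻¹ ≤ (K : EReal) →
        ContMDiff (𝓡∂ (2 * n)) 𝓘(ℝ, ℝ) 2 v → IsAdmissibleSubsolution h χ f Γ ψ φ v →
        C2NormLE h v K →
        ContMDiff (𝓡∂ (2 * n)) 𝓘(ℝ, ℝ) 3 u → IsAdmissibleSolution h χ f Γ ψ φ u →
        (∀ x, |u x| ≤ K) →
        (∀ x ∈ (𝓡∂ (2 * n)).boundary M, gNorm h x (metricGradient h u x) ≤ K) →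
        ∀ x₀ ∈ (𝓡∂ (2 * n)).boundary M,
        ∀ ν : TangentSpace (𝓡∂ (2 * n)) x₀, IsUnitInnerNormal h x₀ ν →
        ∀ ξ : Fin (n - 1) → CTangent (n := n) x₀,
          (∀ α, IsBoundaryHolomorphic h (ξ α)) →
          (∀ α β, complexExt (fun v w => h.metric.inner x₀ v w) (ξ α) (ξ β).conj
            = if α = β then 1 else 0) →
          (complexExt (gForm h χ u x₀) (xiNormal h ν)
              (complexJ h (xiNormal h ν).conj)).re
            ≤ C * (1 + ∑ α, ‖complexExt (gForm h χ u x₀) (ξ α)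
                (complexJ h (xiNormal h ν).conj)‖ ^ 2) := by
  obtain ⟨m, rfl⟩ : ∃ m, n = m + 1 := ⟨n - 1, by omega⟩
  have hp : IsAdmissiblePair f Γ := ⟨hΓ, hf, hell, hconc, hunb⟩
  by_cases htop : supBoundary f Γ = ⊤
  · -- then the nondegeneracy is `-∞`, and there is nothing to prove
    refine ⟨1, one_pos, fun ψ u v _ _ h0 => ?_⟩
    rw [nondegeneracy, htop, sub_eq_add_neg, EReal.neg_top, EReal.add_bot] at h0
    exact absurd h0 (by simp)
  by_cases hK : 0 ≤ K
  · obtain ⟨s, hs, hlevel⟩ := exists_level K htop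
    obtain ⟨C, hC, hmain⟩ := exists_hasNormalBound h χ hp hs hφ hK
    refine ⟨C, hC, fun ψ u v _ hψK h0 h1 hv hsub hvK hu hsol huK hgrad x₀ hx₀ => ?_⟩
    exact hmain x₀ hx₀ ψ u v (hlevel M ψ hψK h0 h1) hv hsub hvK (hu.of_le (by norm_num)) hsol huK
      hgrad
  · refine ⟨1, one_pos, fun ψ u v _ hψK _ _ _ _ _ _ _ _ _ x₀ => ?_⟩
    exact absurd ((abs_nonneg _).trans (hψK x₀)) hK
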